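/- Let $X$ be a complex manifold of complex dimension $n$, let $E$ be a holomorphic vector bundle of finite rank on $X$, and let $M\subseteq X$ be a compact generic CR submanifold of class $C^\infty$ and of real codimension $k$. **Notation.** An $E$-valued $(n,r)$-form on $M$ is a form of degree $n+r$ on $M$ which is pointwise the restriction to $TM$ of an $E$-valued form of bidegree $(n,r)$ on $X$. The exterior derivative $d$ is well defined on $E$-valued $(n,r)$-forms (it is the tangential Cauchy–Riemann operator $\bar\partial_b$) and is understood in the sense of distributions. For $l\in\mathbb N\cup\{\infty\}$ let $C^l_{n,r}(M,E)$ be the space of $E$-valued $(n,r)$-forms of class $C^l$ with the $C^l$-topology, and $Z^l_{n,r}(M,E)$ its subspace of closed forms. For $U\subseteq M$ open, $l\in\mathbb N$ and $0<\alpha<1$ let $C^{l+\alpha}_{n,r}(\overline U,E)$ be the space of $(n,r)$-forms of class $C^l$ on $U$ whose derivatives up to order $l$ are Hölder continuous with exponent $\alpha$ up to $\overline U$, with the $C^{l+\alpha}$-topology; $C^{\infty+\alpha}:=C^\infty$ on $M$. For $r\ge1$ let $$B^{l+\alpha\to l}_{n,r}(M,E)=\{f\in C^l_{n,r}(M,E):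 f=du \text{ for some } u\in C^{l+\alpha}_{n,r-1}(M,E)\},$$ and let $B^{0\to l}_{n,r}(M,E)$ be defined in the same way with $u\in C^0_{n,r-1}(M,E)$. Let $\mathcal O$ be the trivial line bundle. **Condition $H(\alpha,q)$** ($0<\alpha<1$, $1\le q\le n-k$): each point of $M$ has an open neighborhood $U$ in $M$ and $\mathbb C$-linear operators $T_r:C^0_{n,r}(M,\mathcal O)\to C^0_{n,r-1}(U,\mathcal O)$, for $1\le r\le q$ and for $n-k-q+1\le r\le n-k$, such that (i) for all these $r$ and all $l\in\mathbb N$, $T_r$ maps $C^l_{n,r}(M,\mathcal O)$ into $C^{l+\alpha}_{n,r-1}(\overline U,\mathcal O)$, continuously for the $C^l$- and $C^{l+\alpha}$-topologies; (ii) if $f\in C^0_{n,r}(M,\mathcal O)$ has compact support in $U$ and $df$ is continuous on $M$, then on $U$: $f=T_1df$ if $r=0$, and $f=dT_rf+T_{r+1}df$ if $1\le r\le q-1$ or $n-k-q+1\le r\le n-k$ (with $T_{n-k+1}=0$). **Corollary.** Suppose that, for some $0<\alpha<1$ and some integer $q$ with $1\le q\le n-k$, condition $H(\alpha,q)$ is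 satisfied. (a) For all $r$ with $1\le r\le q$ or $n-k-q+1\le r\le n-k$, and all $l\in\mathbb N\cup\{\infty\}$, the space $B^{l+\alpha\to l}_{n,r}(M,E)$ is closed in $C^l_{n,r}(M,E)$, $$B^{l+\alpha\to l}_{n,r}(M,E)=B^{0\to l}_{n,r}(M,E),$$ and the natural map $$\frac{Z^\infty_{n,r}(M,E)}{d\,C^\infty_{n,r-1}(M,E)}\longrightarrow\frac{Z^l_{n,r}(M,E)}{B^{0\to l}_{n,r}(M,E)}\qquad(*)$$ is injective. (b) If $1\le r\le q-1$ or $n-k-q+1\le r\le n-k$, then moreover, for all $l\in\mathbb N\cup\{\infty\}$, there is a finite-dimensional subspace $\mathcal H_r$ of $Z^\infty_{n,r}(M,E)$ such that $$Z^l_{n,r}(M,E)=B^{l+\alpha\to l}_{n,r}(M,E)\oplus\mathcal H_r,$$ and hence $(*)$ is an isomorphism and the cohomology groups in $(*)$ are finite-dimensional. -/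

import Mathlib

open scoped Manifold ContDiff Topology
open TopologicalSpace (Opens)

namespace CRForms

noncomputable section

/-- `ℂⁿ`, the model space of complex manifolds of dimension `n`. -/
abbrev Cn (n : ℕ) : Type := EuclideanSpace ℂ (Fin n)

/-- `ℝᵐ`, the model space of real manifolds of dimension `m`. -/
abbrev Rm (m : ℕ) : Type := EuclideanSpace ℝ (Fin m)

/-- A generic CR submanifold of class `C^∞` and of real dimension `m` (so of real codimension
`2 n - m`) of the `n`-dimensional complex manifold `X`, given by a smooth embedding `ι : M → X`
of a real `m`-dimensional manifold. Generic means that the tangent spaces of `M` span those of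
`X` over `ℂ`, i.e. `T M + J T M = T X` along `M`. -/
structure GenericCR (n m : ℕ) (X : Type*) [TopologicalSpace X] [ChartedSpace (Cn n) X]
    (M : Type*) [TopologicalSpace M] [ChartedSpace (Rm m) M] where
  /-- the inclusion -/
  ι : M → X
  isSmoothEmbedding : Manifold.IsSmoothEmbedding (𝓡 m) 𝓘(ℝ, Cn n) ∞ ι
  generic : ∀ p : M, Submodule.span ℂ
    {w : Cn n | ∃ v : TangentSpace (𝓡 m) p, mfderiv (𝓡 m) 𝓘(ℝ, Cn n) ι p v = w} = ⊤

/-- A real-multilinear alternating form of degree `s + t` on `ℂⁿ` is of bidegree `(s, t)` if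
multiplication of all arguments by `c ∈ ℂ` multiplies the form by `c ^ s * conj c ^ t`. -/
def IsBidegree {n : ℕ} {W : Type*} [AddCommGroup W] [Module ℂ W] (s t : ℕ)
    (g : Cn n [⋀^Fin (s + t)]→ₗ[ℝ] W) : Prop :=
  ∀ (c : ℂ) (w : Fin (s + t) → Cn n),
    g (fun j => c • w j) = (c ^ s * (starRingEnd ℂ c) ^ t) • g w

section

variable {n m : ℕ} {X : Type*} [TopologicalSpace X] [ChartedSpace (Cn n) X]
  {M : Type*} [TopologicalSpace M] [ChartedSpace (Rm m) M]
  (S : GenericCR n m X M)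
  (F : Type*) [NormedAddCommGroup F] [NormedSpace ℂ F]
  (E : X → Type*) [∀ x, AddCommGroup (E x)] [∀ x, Module ℂ (E x)]

/-- `E`-valued differential forms of degree `N` on `M`, without regularity. -/
abbrev Form (N : ℕ) : Type _ :=
  ∀ p : M, (TangentSpace (𝓡 m) p) [⋀^Fin N]→ₗ[ℝ] (E (S.ι p))

/-- `f` is an `(n, r)`-form on `M`: at each point it is the restriction to the tangent space
of `M` of an alternating form of bidegree `(n, r)` on the tangent space of `X`. -/
def IsNRForm (r : ℕ) (f : Form S E (n + r)) : Prop :=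
  ∀ p : M, ∃ g : Cn n [⋀^Fin (n + r)]→ₗ[ℝ] (E (S.ι p)), IsBidegree n r g ∧
    ∀ v : Fin (n + r) → TangentSpace (𝓡 m) p,
      f p v = g fun j => (mfderiv (𝓡 m) 𝓘(ℝ, Cn n) S.ι p (v j) : Cn n)

variable [TopologicalSpace (Bundle.TotalSpace F E)] [∀ x, TopologicalSpace (E x)]
  [FiberBundle F E]

/-- The image, in the chart of `M` around `x`, of the part of `U` that lies in the domains of
that chart and of the trivialization of `E` around `ι x`. -/
def dom (x : M) (U : Opens M) : Set (Rm m) :=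
  (chartAt (Rm m) x).target ∩
    (chartAt (Rm m) x).symm ⁻¹' ((U : Set M) ∩ S.ι ⁻¹' (trivializationAt F E (S.ι x)).baseSet)

variable [VectorBundle ℂ F E]

/-- The coefficient of the form `f` on the constant vector fields `v 0, …, v (N - 1)`, in the
chart of `M` around `x` and the trivialization of `E` around `ι x`: an `F`-valued function of the
coordinates, meaningful on `dom S F E x ⊤`. -/
def coeff (x : M) {N : ℕ} (v : Fin N → Rm m) (f : Form S E N) (y : Rm m) : F :=
  (trivializationAt F E (S.ι x)).linearMapAt ℂ (S.ι ((chartAt (Rm m) x).symm y))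
    (f ((chartAt (Rm m) x).symm y)
      fun j => mfderiv 𝓘(ℝ, Rm m) (𝓡 m) (chartAt (Rm m) x).symm y (v j))

/-- `d f = g` on `U` in the sense of distributions: in all local coordinates,
`g (v 0, …, v N) = ∑ i, (-1) ^ i ∂_{v i} (f (v 0, …, v i omitted, …, v N))` weakly. -/
def IsWeakD (U : Opens M) {N : ℕ} (f : Form S E N) (g : Form S E (N + 1)) : Prop :=
  ∀ (x : M) (φ : Rm m → ℝ), ContDiff ℝ ∞ φ → HasCompactSupport φ → tsupport φ ⊆ dom S F E x U →
    ∀ v : Fin (N + 1) → Rm m,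
      ∫ y, φ y • coeff S F E x v g y =
        -∑ i : Fin (N + 1), (-1 : ℝ) ^ (i : ℕ) •
          ∫ y, (fderiv ℝ φ y (v i)) • coeff S F E x (fun j => v (i.succAbove j)) f y

lemma coeff_add (x : M) {N : ℕ} (v : Fin N → Rm m) (f g : Form S E N) :
    coeff S F E x v (f + g) = fun y => coeff S F E x v f y + coeff S F E x v g y := by
  funext y; simp [coeff]

lemma coeff_smul (x : M) {N : ℕ} (v : Fin N → Rm m) (c : ℂ) (f : Form S E N) :
    coeff S F E x v (c • f) = fun y => c • coeff S F E x v f y := by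
  funext y; simp [coeff]

lemma coeff_zero (x : M) {N : ℕ} (v : Fin N → Rm m) :
    coeff S F E x v (0 : Form S E N) = fun _ => 0 := by
  funext y; simp [coeff]

lemma isOpen_dom (x : M) (U : Opens M) : IsOpen (dom S F E x U) := by
  refine (chartAt (Rm m) x).isOpen_inter_preimage_symm (U.isOpen.inter ?_)
  exact (trivializationAt F E (S.ι x)).open_baseSet.preimage
    S.isSmoothEmbedding.isEmbedding.continuous

/-- `C^l_{n,r}(U, E)`, `l ∈ ℕ ∪ {∞}`: the `E`-valued `(n, r)`-forms on the open set `U ⊆ M`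
whose coefficients are of class `C^l`. A form on `U` is represented by its extension by zero. -/
def CForms (U : Opens M) (r : ℕ) (l : ℕ∞) : Submodule ℂ (Form S E (n + r)) where
  carrier := {f | IsNRForm S E r f ∧ (∀ p ∉ U, f p = 0) ∧
    ∀ (x : M) (v : Fin (n + r) → Rm m), ContDiffOn ℝ l (coeff S F E x v f) (dom S F E x U)}
  add_mem' := by
    rintro f g ⟨hf, hf0, hfc⟩ ⟨hg, hg0, hgc⟩
    refine ⟨fun p => ?_, fun p hp => by simp [hf0 p hp, hg0 p hp], fun x v => ?_⟩
    · obtain ⟨a, ha, haf⟩ := hf p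
      obtain ⟨b, hb, hbg⟩ := hg p
      exact ⟨a + b, fun c w => by simp [ha c w, hb c w], fun v =>
        (congrArg₂ (· + ·) (haf v) (hbg v) :)⟩
    · rw [coeff_add]
      exact (hfc x v).add (hgc x v)
  zero_mem' := by
    refine ⟨fun p => ⟨0, fun c w => by simp, fun v => rfl⟩, fun p _ => rfl, fun x v => ?_⟩
    rw [coeff_zero]
    exact contDiffOn_const
  smul_mem' := by
    rintro c f ⟨hf, hf0, hfc⟩
    refine ⟨fun p => ?_, fun p hp => by simp [hf0 p hp], fun x v => ?_⟩
    · obtain ⟨a, ha, haf⟩ := hf p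
      exact ⟨c • a, fun c' w => by simp [ha c' w, smul_comm c], fun v => (congrArg (c • ·) (haf v) :)⟩
    · rw [coeff_smul]
      exact (hfc x v).const_smul c

lemma CForms_mono (U : Opens M) (r : ℕ) {l l' : ℕ∞} (h : l ≤ l') :
    CForms S F E U r l' ≤ CForms S F E U r l :=
  fun _ hf => ⟨hf.1, hf.2.1, fun x v => (hf.2.2 x v).of_le (by exact_mod_cast h)⟩

/-- `C^{l+α}_{n,r}(Ū, E)`: the forms in `C^l_{n,r}(U, E)` all of whose coefficients have
derivatives of order `≤ l` that are Hölder continuous with exponent `α` on `U`, up to the boundary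
of `U` in `M` (that is, on the trace on `U` of each compact subset of a coordinate patch of `M`).
For `l = ∞` and `U = M` compact this is the space of `C^∞` forms. -/
def HForms (U : Opens M) (r : ℕ) (l : ℕ∞) (α : ℝ) : Submodule ℂ (Form S E (n + r)) where
  carrier := {f | f ∈ CForms S F E U r l ∧ ∀ (x : M) (v : Fin (n + r) → Rm m) (i : ℕ),
    (i : ℕ∞) ≤ l → ∀ K : Set (Rm m), IsCompact K → K ⊆ dom S F E x ⊤ →
      ∃ C : ℝ, ∀ y ∈ K ∩ dom S F E x U, ∀ z ∈ K ∩ dom S F E x U,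
        ‖iteratedFDeriv ℝ i (coeff S F E x v f) y - iteratedFDeriv ℝ i (coeff S F E x v f) z‖
          ≤ C * dist y z ^ α}
  add_mem' := by
    rintro f g ⟨hf, hfh⟩ ⟨hg, hgh⟩
    refine ⟨add_mem hf hg, fun x v i hi K hK hKd => ?_⟩
    obtain ⟨C, hC⟩ := hfh x v i hi K hK hKd
    obtain ⟨D, hD⟩ := hgh x v i hi K hK hKd
    refine ⟨C + D, fun y hy z hz => ?_⟩
    have key : ∀ y ∈ dom S F E x U, iteratedFDeriv ℝ i (coeff S F E x v (f + g)) y =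
        iteratedFDeriv ℝ i (coeff S F E x v f) y + iteratedFDeriv ℝ i (coeff S F E x v g) y := by
      intro y hy
      have hn := (isOpen_dom S F E x U).mem_nhds hy
      have hi' : ((i : ℕ) : WithTop ℕ∞) ≤ (l : WithTop ℕ∞) := by exact_mod_cast hi
      rw [coeff_add]
      exact iteratedFDeriv_add_apply (((hf.2.2 x v).contDiffAt hn).of_le hi')
        (((hg.2.2 x v).contDiffAt hn).of_le hi')
    rw [key y hy.2, key z hz.2, add_sub_add_comm, add_mul]
    exact (norm_add_le _ _).trans (add_le_add (hC y hy z hz) (hD y hy z hz))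
  zero_mem' := by
    refine ⟨zero_mem _, fun x v i _ K _ _ => ⟨0, fun y _ z _ => ?_⟩⟩
    rw [coeff_zero]
    simp
  smul_mem' := by
    rintro c f ⟨hf, hfh⟩
    refine ⟨Submodule.smul_mem _ c hf, fun x v i hi K hK hKd => ?_⟩
    obtain ⟨C, hC⟩ := hfh x v i hi K hK hKd
    refine ⟨‖c‖ * C, fun y hy z hz => ?_⟩
    have key : ∀ y ∈ dom S F E x U, iteratedFDeriv ℝ i (coeff S F E x v (c • f)) y =
        c • iteratedFDeriv ℝ i (coeff S F E x v f) y := by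
      intro y hy
      have hn := (isOpen_dom S F E x U).mem_nhds hy
      have hi' : ((i : ℕ) : WithTop ℕ∞) ≤ (l : WithTop ℕ∞) := by exact_mod_cast hi
      rw [coeff_smul]
      exact iteratedFDeriv_const_smul_apply (((hf.2.2 x v).contDiffAt hn).of_le hi')
    rw [key y hy.2, key z hz.2, ← smul_sub, norm_smul, mul_assoc]
    exact mul_le_mul_of_nonneg_left (hC y hy z hz) (norm_nonneg c)

/-- The `C^l`-topology on forms on `M`: uniform convergence, on compact subsets of the coordinate
patches, of all derivatives of order `≤ l` of all coefficients. It is used on `C^l` forms only. -/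
abbrev topC (N : ℕ) (l : ℕ∞) : TopologicalSpace (Form S E N) :=
  ⨅ (x : M) (v : Fin N → Rm m) (i : ℕ) (_ : (i : ℕ∞) ≤ l),
    TopologicalSpace.induced
      (fun f => UniformOnFun.ofFun {K : Set (Rm m) | IsCompact K ∧ K ⊆ dom S F E x ⊤}
        fun y => iteratedFDeriv ℝ i (coeff S F E x v f) y)
      inferInstance

/-- The `C^{l+α}`-topology on forms on `Ū`: uniform convergence, on the trace on `U` of each
compact subset of a coordinate patch of `M`, of all derivatives of order `≤ l` of all coefficients
and of their Hölder quotients of exponent `α`. It is used on `C^{l+α}` forms only. -/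
abbrev topH (U : Opens M) (N : ℕ) (l : ℕ∞) (α : ℝ) : TopologicalSpace (Form S E N) :=
  ⨅ (x : M) (v : Fin N → Rm m) (i : ℕ) (_ : (i : ℕ∞) ≤ l),
    TopologicalSpace.induced
      (fun f => UniformOnFun.ofFun
        {B : Set (Rm m) | ∃ K, IsCompact K ∧ K ⊆ dom S F E x ⊤ ∧ B = K ∩ dom S F E x U}
        fun y => iteratedFDeriv ℝ i (coeff S F E x v f) y)
      inferInstance ⊓
    TopologicalSpace.induced
      (fun f => UniformOnFun.ofFun
        {B : Set (Rm m × Rm m) | ∃ K, IsCompact K ∧ K ⊆ dom S F E x ⊤ ∧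
          B = (K ∩ dom S F E x U) ×ˢ (K ∩ dom S F E x U)}
        fun y => (dist y.1 y.2 ^ α)⁻¹ •
          (iteratedFDeriv ℝ i (coeff S F E x v f) y.1 -
            iteratedFDeriv ℝ i (coeff S F E x v f) y.2))
      inferInstance

/-- The `C^l`-topology of the space `C^l_{n,r}(M, E)`. -/
abbrev topCForms (r : ℕ) (l : ℕ∞) : TopologicalSpace (CForms S F E ⊤ r l) :=
  (topC S F E (n + r) l).induced Subtype.val

/-- The `C^{l+α}`-topology of the space `C^{l+α}_{n,r}(Ū, E)`. -/
abbrev topHForms (U : Opens M) (r : ℕ) (l : ℕ∞) (α : ℝ) :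
    TopologicalSpace (HForms S F E U r l α) :=
  (topH S F E U (n + r) l α).induced Subtype.val

lemma integrable_aux {D : Set (Rm m)} {φ : Rm m → ℝ} (hφ : Continuous φ)
    (hc : HasCompactSupport φ) (hD : tsupport φ ⊆ D) {h : Rm m → F} (hh : ContinuousOn h D) :
    MeasureTheory.Integrable fun y => φ y • h y := by
  rw [← MeasureTheory.integrableOn_iff_integrable_of_support_subset (f := fun y => φ y • h y)
    (s := tsupport φ) ((Function.support_smul_subset_left φ h).trans (subset_tsupport φ))]
  exact (hφ.continuousOn.smul (hh.mono hD)).integrableOn_compact hc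

variable {S F E} in
lemma IsWeakD.add {r : ℕ} {f f' : Form S E (n + r)} {g g' : Form S E (n + (r + 1))}
    (hf : f ∈ CForms S F E ⊤ r 0) (hf' : f' ∈ CForms S F E ⊤ r 0)
    (hg : g ∈ CForms S F E ⊤ (r + 1) 0) (hg' : g' ∈ CForms S F E ⊤ (r + 1) 0)
    (h : IsWeakD S F E ⊤ f g) (h' : IsWeakD S F E ⊤ f' g') :
    IsWeakD S F E ⊤ (f + f') (g + g') := by
  intro x φ hφ hc hs v
  have h1 := h x φ hφ hc hs v
  have h2 := h' x φ hφ hc hs v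
  have e1 := MeasureTheory.integral_add
    (integrable_aux F hφ.continuous hc hs (hg.2.2 x v).continuousOn)
    (integrable_aux F hφ.continuous hc hs (hg'.2.2 x v).continuousOn)
  have e2 : ∀ i : Fin (n + r + 1), _ := fun i => MeasureTheory.integral_add
    (integrable_aux F (φ := fun y => fderiv ℝ φ y (v i))
      ((hφ.continuous_fderiv (by simp)).clm_apply continuous_const) (hc.fderiv_apply ℝ (v i))
      ((tsupport_fderiv_apply_subset ℝ (v i)).trans hs)
      (hf.2.2 x fun j => v (i.succAbove j)).continuousOn)
    (integrable_aux F (φ := fun y => fderiv ℝ φ y (v i))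
      ((hφ.continuous_fderiv (by simp)).clm_apply continuous_const) (hc.fderiv_apply ℝ (v i))
      ((tsupport_fderiv_apply_subset ℝ (v i)).trans hs)
      (hf'.2.2 x fun j => v (i.succAbove j)).continuousOn)
  simp only [coeff_add, smul_add]
  rw [e1, h1, h2]
  simp only [e2, smul_add, Finset.sum_add_distrib, neg_add]

variable {S F E} in
lemma IsWeakD.smul {N : ℕ} {f : Form S E N} {g : Form S E (N + 1)} (c : ℂ)
    (h : IsWeakD S F E ⊤ f g) : IsWeakD S F E ⊤ (c • f) (c • g) := by
  intro x φ hφ hc hs v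
  have h1 := h x φ hφ hc hs v
  simp only [coeff_smul]
  simp only [smul_comm _ c, MeasureTheory.integral_smul, ← Finset.smul_sum, ← smul_neg, h1]

lemma IsWeakD.zero {N : ℕ} : IsWeakD S F E ⊤ (0 : Form S E N) 0 := by
  intro x φ hφ hc hs v
  simp [coeff_zero]

/-- `Z^l_{n,r}(M, E)`: the closed forms in `C^l_{n,r}(M, E)`. -/
def ZForms (r : ℕ) (l : ℕ∞) : Submodule ℂ (Form S E (n + r)) where
  carrier := {f | f ∈ CForms S F E ⊤ r l ∧ IsWeakD S F E ⊤ f 0}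
  add_mem' := by
    rintro f g ⟨hf, hf0⟩ ⟨hg, hg0⟩
    refine ⟨add_mem hf hg, ?_⟩
    have := hf0.add (CForms_mono S F E ⊤ r zero_le hf)
      (CForms_mono S F E ⊤ r zero_le hg) (zero_mem _) (zero_mem _) hg0
    rwa [add_zero] at this
  zero_mem' := ⟨zero_mem _, IsWeakD.zero S F E⟩
  smul_mem' := by
    rintro c f ⟨hf, hf0⟩
    refine ⟨Submodule.smul_mem _ c hf, ?_⟩
    have := hf0.smul c
    rwa [smul_zero] at this

/-- `B^{j → l}_{n,r+1}(M, E)`, `j, l ∈ ℕ ∪ {∞}`: the forms in `C^l_{n,r+1}(M, E)` that are `d u`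
for some `u ∈ C^j_{n,r}(M, E)`. -/
def BForms (r : ℕ) (j l : ℕ∞) : Submodule ℂ (Form S E (n + (r + 1))) where
  carrier := {f | f ∈ CForms S F E ⊤ (r + 1) l ∧ ∃ u ∈ CForms S F E ⊤ r j, IsWeakD S F E ⊤ u f}
  add_mem' := by
    rintro f g ⟨hf, u, hu, huf⟩ ⟨hg, w, hw, hwg⟩
    exact ⟨add_mem hf hg, u + w, add_mem hu hw,
      huf.add (CForms_mono S F E ⊤ r zero_le hu) (CForms_mono S F E ⊤ r zero_le hw)
        (CForms_mono S F E ⊤ _ zero_le hf) (CForms_mono S F E ⊤ _ zero_le hg) hwg⟩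
  zero_mem' := ⟨zero_mem _, 0, zero_mem _, IsWeakD.zero S F E⟩
  smul_mem' := by
    rintro c f ⟨hf, u, hu, huf⟩
    exact ⟨Submodule.smul_mem _ c hf, c • u, Submodule.smul_mem _ c hu, huf.smul c⟩

/-- `B^{l+α → l}_{n,r+1}(M, E)`: the forms in `C^l_{n,r+1}(M, E)` that are `d u` for some
`u ∈ C^{l+α}_{n,r}(M, E)`. -/
def BHForms (r : ℕ) (l : ℕ∞) (α : ℝ) : Submodule ℂ (Form S E (n + (r + 1))) where
  carrier := {f | f ∈ CForms S F E ⊤ (r + 1) l ∧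
    ∃ u ∈ HForms S F E ⊤ r l α, IsWeakD S F E ⊤ u f}
  add_mem' := by
    rintro f g ⟨hf, u, hu, huf⟩ ⟨hg, w, hw, hwg⟩
    exact ⟨add_mem hf hg, u + w, add_mem hu hw,
      huf.add (CForms_mono S F E ⊤ r zero_le hu.1) (CForms_mono S F E ⊤ r zero_le hw.1)
        (CForms_mono S F E ⊤ _ zero_le hf) (CForms_mono S F E ⊤ _ zero_le hg) hwg⟩
  zero_mem' := ⟨zero_mem _, 0, zero_mem _, IsWeakD.zero S F E⟩
  smul_mem' := by
    rintro c f ⟨hf, u, hu, huf⟩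
    exact ⟨Submodule.smul_mem _ c hf, c • u, Submodule.smul_mem _ c hu, huf.smul c⟩

/-- `Z^l_{n,r+1}(M, E) / B^{j → l}_{n,r+1}(M, E)`. (As `d ∘ d = 0`, exact forms are closed;
`submoduleOf` regards the exact ones among the closed forms as a subspace of the latter.) -/
abbrev Cohomology (r : ℕ) (j l : ℕ∞) : Type _ :=
  ZForms S F E (r + 1) l ⧸ (BForms S F E r j l).submoduleOf (ZForms S F E (r + 1) l)

lemma ZForms_le (r : ℕ) (l : ℕ∞) : ZForms S F E r ⊤ ≤ ZForms S F E r l :=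
  fun _ hf => ⟨CForms_mono S F E ⊤ r le_top hf.1, hf.2⟩

lemma BForms_le (r : ℕ) (l : ℕ∞) : BForms S F E r ⊤ ⊤ ≤ BForms S F E r 0 l :=
  fun _ hf => ⟨CForms_mono S F E ⊤ _ le_top hf.1,
    hf.2.choose, CForms_mono S F E ⊤ r zero_le hf.2.choose_spec.1, hf.2.choose_spec.2⟩

/-- The natural map
`Z^∞_{n,r+1}(M, E) / d C^∞_{n,r}(M, E) → Z^l_{n,r+1}(M, E) / B^{0 → l}_{n,r+1}(M, E)`. -/
def natMap (r : ℕ) (l : ℕ∞) : Cohomology S F E r ⊤ ⊤ →ₗ[ℂ] Cohomology S F E r 0 l :=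
  Submodule.mapQ _ _ (Submodule.inclusion (ZForms_le S F E (r + 1) l))
    (fun _ hf => BForms_le S F E r l hf)

end

/-- `n - k - q + 1 ≤ r ≤ n - k`. -/
def IsLargeDegree (n k q r : ℕ) : Prop := n + 1 ≤ r + k + q ∧ r + k ≤ n

section

variable {n m : ℕ} {X : Type*} [TopologicalSpace X] [ChartedSpace (Cn n) X]
  {M : Type*} [TopologicalSpace M] [ChartedSpace (Rm m) M]

/-- Condition `H(α, q)` for scalar forms on `M` (of codimension `k`): locally there are homotopy
operators in small and large degrees that gain `α` derivatives. The operator `T r` acts on forms of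
bidegree `(n, r + 1)`; it is only used for `1 ≤ r + 1 ≤ q` or `n - k - q + 1 ≤ r + 1 ≤ n - k`,
except that in top degree `r = n - k` it occurs on the space of `(n, n - k + 1)`-forms, which
is `0`. -/
def ConditionH (S : GenericCR n m X M) (k : ℕ) (α : ℝ) (q : ℕ) : Prop :=
  ∀ p : M, ∃ U : Opens M, p ∈ U ∧
    ∃ T : ∀ r : ℕ, CForms S ℂ (Bundle.Trivial X ℂ) ⊤ (r + 1) 0 →ₗ[ℂ]
        CForms S ℂ (Bundle.Trivial X ℂ) U r 0,
      (∀ (l r : ℕ), (r + 1 ≤ q ∨ IsLargeDegree n k q (r + 1)) →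
        ∃ hT : ∀ f : CForms S ℂ (Bundle.Trivial X ℂ) ⊤ (r + 1) l,
            (T r ⟨f, CForms_mono S ℂ _ ⊤ (r + 1) zero_le f.2⟩ : Form S _ (n + r)) ∈
              HForms S ℂ (Bundle.Trivial X ℂ) U r l α,
          Continuous[topCForms S ℂ (Bundle.Trivial X ℂ) (r + 1) l,
              topHForms S ℂ (Bundle.Trivial X ℂ) U r l α]
            fun f => ⟨_, hT f⟩) ∧
      (∀ (f : CForms S ℂ (Bundle.Trivial X ℂ) ⊤ 0 0) (g : CForms S ℂ (Bundle.Trivial X ℂ) ⊤ 1 0),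
        IsWeakD S ℂ (Bundle.Trivial X ℂ) ⊤ f.1 g.1 → closure {p | f.1 p ≠ 0} ⊆ U →
          ∀ p ∈ U, f.1 p = (T 0 g).1 p) ∧
      (∀ r : ℕ, (r + 1 ≤ q - 1 ∨ IsLargeDegree n k q (r + 1)) →
        ∀ (f : CForms S ℂ (Bundle.Trivial X ℂ) ⊤ (r + 1) 0)
          (g : CForms S ℂ (Bundle.Trivial X ℂ) ⊤ (r + 2) 0),
        IsWeakD S ℂ (Bundle.Trivial X ℂ) ⊤ f.1 g.1 → closure {p | f.1 p ≠ 0} ⊆ U →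
          IsWeakD S ℂ (Bundle.Trivial X ℂ) U (T r f).1 (f.1 - (T (r + 1) g).1))

end

end

end CRForms

open CRForms

/-! The proof builds a parametrix for d and applies Riesz theory to its error term.

Condition H is glued over M: with a partition of unity χ, cutoffs ψ equal to 1 on supp χ, and local
frames of E, the local operators T give global operators A and K with f = dAf + A df + Kf
(`ConditionH.exists_homotopy`). The error K contains only the terms in which d has hit a cutoff, so
it still maps C^l to C^{l+α} for every l. By Banach–Steinhaus and Arzelà–Ascoli it is compact on
each Banach space of C^l forms (`XC.isCompactOperator_of_holder`).

Riesz theory for 1 - K on continuous forms (`exists_isRieszPair`) gives a finite-rank projection P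
and an operator G with (1 - K)G = G(1 - K) = 1 - P. Both are determined algebraically by 1 - K,
hence are compatible with every map that intertwines two such operators. Comparison with C^l shows
that G preserves C^l. Comparison with the subspace of closed forms shows that P and G preserve
closedness. Since smooth forms are dense and P has finite rank, the range of P is smooth.

Degrees in which the homotopy formula holds (`solve_large`): for closed f, the formula at Gf reads f
= dAGf + Pf, so the cohomology is spanned by the finite-dimensional smooth space of all Pf. If f =
du with u merely continuous, Friedrichs' lemma (`exists_friedrichs`) approximates f uniformly by dw
with w smooth. For these, P(dw) = d(w - AG dw) has a smooth primitive, and the elements of the range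
of P with a smooth primitive form a finite-dimensional, hence closed, subspace. So Pf = dv with v
smooth, and v + AGf is a primitive of f of class C^{l+α} whenever f is C^l.

Degree q, where only the formula one degree lower is available (`hasRegularPrimitives_small`,
`isClosed_exactXC_small`): that formula says that u - Ku - Af is closed whenever du = f. Applying G
shows that w = Pu + GAf is another primitive, and then so is Kw + Af, which is C^{l+α}. Exactness of
f thus means that GAf becomes a primitive after adding an element of the finite-dimensional range of
P, which is a closed condition.

The primitive found serves all l at once. Therefore membership in the spaces B of order l reduces to
order 0, which yields closedness, the equality of the two spaces, injectivity of the natural map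
and, where the formula holds, the splitting.

The derivative d is defined weakly in each chart and trivialization separately. To pass from one
chart to all others, (n,s)-forms are expanded in smooth closed forms dc_J ∧ dz_1 ∧ … ∧ dz_n
(`exists_frame`, which uses genericity). Mollifying the coefficients gives smooth forms whose
derivative is known in every chart, and the graph of d is closed under uniform limits
(`isWeakD_of_chart`). Holomorphic changes of trivialization are harmless because the product of a
complex-linear covector with an (n,r)-form vanishes (`IsHomog.wedge_eq_zero`). -/

set_option linter.unusedSectionVars false

namespace CRForms
noncomputable section

/-! ### Riesz theory of 1 - K for compact K. -/

section Riesz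

open Filter

/-- `P` is the projection onto the generalized kernel of `T` along the stable range of `T`, and `G`
is the inverse of `T` on the stable range, extended by `0` to the generalized kernel. -/
structure IsRieszPair {B : Type*} [AddCommGroup B] [Module ℂ B] (T P G : Module.End ℂ B) :
    Prop where
  proj_mem : ∀ b, ∃ k, (T ^ k) (P b) = 0
  sub_proj_mem : ∀ b k, ∃ y, (T ^ k) y = b - P b
  inv_mem : ∀ b k, ∃ y, (T ^ k) y = G b
  map_inv : ∀ b, T (G b) = b - P b
  inv_map : ∀ b, G (T b) = b - P b
  disjoint : ∀ b, (∃ k, (T ^ k) b = 0) → (∀ k, ∃ y, (T ^ k) y = b) → b = 0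

lemma pow_intertwine {B B' : Type*} [AddCommGroup B] [Module ℂ B] [AddCommGroup B'] [Module ℂ B']
    {T : Module.End ℂ B} {T' : Module.End ℂ B'} {j : B' →ₗ[ℂ] B} (h : ∀ b, j (T' b) = T (j b))
    (k : ℕ) (b : B') : j ((T' ^ k) b) = (T ^ k) (j b) := by
  induction k generalizing b with
  | zero => simp
  | succ k ih => rw [pow_succ, pow_succ, Module.End.mul_apply, ih, h, Module.End.mul_apply]

lemma exists_pow_sub_eq_zero {B : Type*} [AddCommGroup B] [Module ℂ B] {T : Module.End ℂ B}
    {a b : B} (ha : ∃ k, (T ^ k) a = 0) (hb : ∃ k, (T ^ k) b = 0) : ∃ k, (T ^ k) (a - b) = 0 := by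
  obtain ⟨k, hk⟩ := ha
  obtain ⟨l, hl⟩ := hb
  refine ⟨k + l, ?_⟩
  rw [map_sub, pow_add, Module.End.mul_apply, Module.End.mul_apply, hl, ← Module.End.mul_apply,
    ← pow_add, add_comm, pow_add, Module.End.mul_apply, hk]
  simp

namespace IsRieszPair

variable {B B' : Type*} [AddCommGroup B] [Module ℂ B] [AddCommGroup B'] [Module ℂ B']
  {T P G : Module.End ℂ B} {T' P' G' : Module.End ℂ B'}

/-- `P` is determined by `T` alone: the two sides differ by an element lying both in the generalized
kernel and in every range of `T ^ k`. This is applied to the inclusion of C^l into C^0 and to that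
of the closed forms into all forms. -/
lemma proj_intertwine (h : IsRieszPair T P G) (h' : IsRieszPair T' P' G') {j : B' →ₗ[ℂ] B}
    (hj : ∀ b, j (T' b) = T (j b)) (b : B') : P (j b) = j (P' b) := by
  rw [← sub_eq_zero]
  refine h.disjoint _ (exists_pow_sub_eq_zero (h.proj_mem _) ?_) fun k => ?_
  · obtain ⟨k, hk⟩ := h'.proj_mem b
    exact ⟨k, by rw [← pow_intertwine hj, hk, map_zero]⟩
  · obtain ⟨y, hy⟩ := h.sub_proj_mem (j b) k
    obtain ⟨z, hz⟩ := h'.sub_proj_mem b k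
    refine ⟨j z - y, ?_⟩
    rw [map_sub, ← pow_intertwine hj, hz, hy, map_sub]
    abel

lemma inv_intertwine (h : IsRieszPair T P G) (h' : IsRieszPair T' P' G') {j : B' →ₗ[ℂ] B}
    (hj : ∀ b, j (T' b) = T (j b)) (b : B') : G (j b) = j (G' b) := by
  rw [← sub_eq_zero]
  refine h.disjoint _ ⟨1, ?_⟩ fun k => ?_
  · rw [pow_one, map_sub, h.map_inv, ← hj, h'.map_inv, h.proj_intertwine h' hj, map_sub, sub_self]
  · obtain ⟨y, hy⟩ := h.inv_mem (j b) k
    obtain ⟨z, hz⟩ := h'.inv_mem b k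
    exact ⟨y - j z, by rw [map_sub, ← pow_intertwine hj, hz, hy]⟩

end IsRieszPair

variable {B : Type*} [NormedAddCommGroup B] [NormedSpace ℂ B]

lemma toLinearMap_pow (A : B →L[ℂ] B) (k : ℕ) :
    (A : Module.End ℂ B) ^ k = ((A ^ k : B →L[ℂ] B) : Module.End ℂ B) := by
  induction k with
  | zero => rfl
  | succ k ih => rw [pow_succ, pow_succ, ih]; rfl

lemma exists_pow_one_sub_compact {K : B →L[ℂ] B} (hK : IsCompactOperator K) (k : ℕ) :
    ∃ L : B →L[ℂ] B, IsCompactOperator L ∧ (1 - K) ^ k = 1 - L := by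
  induction k with
  | zero => exact ⟨0, isCompactOperator_zero, by simp⟩
  | succ k ih =>
    obtain ⟨L, hL, h⟩ := ih
    refine ⟨K + L - K * L, (hK.add hL).sub (hK.comp_clm L), ?_⟩
    rw [pow_succ', h]
    noncomm_ring

lemma exists_subseq_tendsto_compact {B' : Type*} [NormedAddCommGroup B'] [NormedSpace ℂ B']
    {K : B' →L[ℂ] B} (hK : IsCompactOperator K) {R : ℝ} (x : ℕ → B') (hx : ∀ k, ‖x k‖ ≤ R) :
    ∃ y, ∃ φ : ℕ → ℕ, StrictMono φ ∧ Tendsto (fun k => K (x (φ k))) atTop (𝓝 y) := by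
  obtain ⟨C, hC, hs⟩ := IsCompactOperator.image_closedBall_subset_compact (f := (K : B' →ₗ[ℂ] B)) hK R
  obtain ⟨y, -, φ, hφ, hy⟩ := hC.tendsto_subseq (x := fun k => K (x k))
    fun k => hs ⟨x k, by simpa using hx k, rfl⟩
  exact ⟨y, φ, hφ, hy⟩

/-- On this kernel `K` is the identity, and a space whose identity is compact is finite-dimensional.
-/
lemma finiteDimensional_ker_one_sub {K : B →L[ℂ] B} (hK : IsCompactOperator K) :
    FiniteDimensional ℂ (LinearMap.ker (1 - K : B →L[ℂ] B).toLinearMap) := by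
  set N := LinearMap.ker (1 - K : B →L[ℂ] B).toLinearMap
  have hN : IsClosed (N : Set B) := (1 - K : B →L[ℂ] B).isClosed_ker
  have hKN : ∀ v ∈ N, K v = v := fun v hv => by
    have : v - K v = 0 := hv
    exact (sub_eq_zero.1 this).symm
  have hmap : ∀ v ∈ N, (K : B →ₗ[ℂ] B) v ∈ N := fun v hv => by
    rw [ContinuousLinearMap.coe_coe, hKN v hv]; exact hv
  have := IsCompactOperator.restrict (f := (K : B →ₗ[ℂ] B)) hK hmap hN
  have hid : (id : N → N) = (K : B →ₗ[ℂ] B).restrict hmap := by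
    funext v
    exact Subtype.ext (hKN v v.2).symm
  exact FiniteDimensional.of_isCompactOperator_id (𝕜 := ℂ) (hid ▸ this)

/-- On a closed complement of the kernel, `1 - K` is bounded below. Otherwise unit vectors `x k`
with `(1 - K) (x k) → 0` would, by compactness of `K`, converge along a subsequence to a unit vector
lying both in the kernel and in its complement. -/
lemma isClosed_range_one_sub [CompleteSpace B] {K : B →L[ℂ] B} (hK : IsCompactOperator K) :
    IsClosed (LinearMap.range (1 - K : B →L[ℂ] B).toLinearMap : Set B) := by
  set T : B →L[ℂ] B := 1 - K with hT
  set N := LinearMap.ker T.toLinearMap with hNdef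
  have : FiniteDimensional ℂ N := finiteDimensional_ker_one_sub hK
  obtain ⟨V, hVc, hV⟩ := (Submodule.ClosedComplemented.of_finiteDimensional N).exists_isClosed_isCompl
  have : CompleteSpace V := hVc.completeSpace_coe
  have hanti : ∃ c > 0, ∀ v : V, c * ‖v‖ ≤ ‖T v‖ := by
    by_contra! hcon
    have hx : ∀ k : ℕ, ∃ v : V, ‖v‖ = 1 ∧ ‖T v‖ < 1 / ((k : ℝ) + 1) := fun k => by
      obtain ⟨v, hv⟩ := hcon (1 / ((k : ℝ) + 1)) (by positivity)
      have hv0 : v ≠ 0 := by rintro rfl; simp at hv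
      refine ⟨((‖v‖⁻¹ : ℝ) : ℂ) • v, ?_, ?_⟩
      · rw [norm_smul]; simp [hv0]
      · rw [Submodule.coe_smul, map_smul, norm_smul]
        have : 0 < ‖v‖ := norm_pos_iff.2 hv0
        simp only [Complex.norm_real, norm_inv, norm_norm]
        rw [inv_mul_lt_iff₀ this, mul_comm]
        exact hv
    choose x hx1 hx2 using hx
    obtain ⟨y, φ, hφ, hy⟩ := exists_subseq_tendsto_compact hK (R := 1) (fun k => (x k : B))
      fun k => (hx1 k).le
    have hTx : Tendsto (fun k => T (x k)) atTop (𝓝 0) :=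
      squeeze_zero_norm (fun k => (hx2 k).le) tendsto_one_div_add_atTop_nhds_zero_nat
    have hxy : Tendsto (fun k => (x (φ k) : B)) atTop (𝓝 y) := by
      have := (hTx.comp hφ.tendsto_atTop).add hy
      rw [zero_add] at this
      refine this.congr fun k => ?_
      simp [hT]
    have hyV : y ∈ V := hVc.mem_of_tendsto hxy (Eventually.of_forall fun k => (x (φ k)).2)
    have hyn : ‖y‖ = 1 := tendsto_nhds_unique hxy.norm
      (tendsto_const_nhds.congr fun k => (hx1 (φ k)).symm)
    have hTy : T y = 0 := tendsto_nhds_unique ((T.continuous.tendsto y).comp hxy)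
      (hTx.comp hφ.tendsto_atTop)
    have := Submodule.disjoint_def.1 hV.disjoint y hTy hyV
    rw [this] at hyn
    simp at hyn
  obtain ⟨c, hc, hcV⟩ := hanti
  have hr : (LinearMap.range T.toLinearMap : Set B) = Set.range (T ∘L V.subtypeL) := by
    ext b
    constructor
    · rintro ⟨a, rfl⟩
      obtain ⟨n, hn, v, hv, rfl⟩ := Submodule.mem_sup.1 (hV.sup_eq_top ▸ Submodule.mem_top : a ∈ N ⊔ V)
      refine ⟨⟨v, hv⟩, ?_⟩
      have : T n = 0 := hn
      simp [this]
    · rintro ⟨v, rfl⟩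
      exact ⟨v, rfl⟩
  rw [hr]
  have hal : AntilipschitzWith (Real.toNNReal c⁻¹) (T ∘L V.subtypeL) := by
    refine AddMonoidHomClass.antilipschitz_of_bound _ fun v => ?_
    rw [Real.coe_toNNReal _ (by positivity), inv_mul_eq_div, le_div_iff₀ hc, mul_comm]
    exact hcV v
  exact hal.isClosed_range (ContinuousLinearMap.uniformContinuous _)

/-- If the kernels grew strictly, Riesz's lemma would provide bounded vectors, each at distance at
least 1 from the preceding kernel. Their images under `K` would be 1-separated, against compactness.
-/
lemma exists_ker_pow_eq {K : B →L[ℂ] B} (hK : IsCompactOperator K) :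
    ∃ k, LinearMap.ker (((1 - K : B →L[ℂ] B) : Module.End ℂ B) ^ k) =
      LinearMap.ker (((1 - K : B →L[ℂ] B) : Module.End ℂ B) ^ (k + 1)) := by
  by_contra! hne
  set T : Module.End ℂ B := ((1 - K : B →L[ℂ] B) : Module.End ℂ B) with hT
  have hTK : ∀ b, T b = b - K b := fun b => rfl
  have hle : ∀ k l, k ≤ l → LinearMap.ker (T ^ k) ≤ LinearMap.ker (T ^ l) := by
    intro k l hkl b hb
    rw [LinearMap.mem_ker] at hb ⊢
    obtain ⟨i, rfl⟩ := Nat.exists_eq_add_of_le' hkl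
    rw [pow_add, Module.End.mul_apply, hb, map_zero]
  have hcl : ∀ k, IsClosed (LinearMap.ker (T ^ k) : Set B) := fun k => by
    rw [hT, toLinearMap_pow]
    exact ((1 - K : B →L[ℂ] B) ^ k).isClosed_ker
  have hx : ∀ k, ∃ x ∈ LinearMap.ker (T ^ (k + 1)), ‖x‖ ≤ 3 ∧
      ∀ y ∈ LinearMap.ker (T ^ k), 1 ≤ ‖x - y‖ := by
    intro k
    obtain ⟨x, hx, hx'⟩ := SetLike.exists_of_lt (lt_of_le_of_ne (hle k (k + 1) (by omega)) (hne k))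
    obtain ⟨z, hz, hz'⟩ := riesz_lemma_of_norm_lt (c := (2 : ℂ)) (R := 3) (by simp) (by norm_num)
      (F := (LinearMap.ker (T ^ k)).submoduleOf (LinearMap.ker (T ^ (k + 1))))
      ((hcl k).preimage continuous_subtype_val) ⟨⟨x, hx⟩, hx'⟩
    exact ⟨z, z.2, hz, fun y hy => hz' ⟨y, hle k _ (by omega) hy⟩ hy⟩
  choose x hxk hxn hxd using hx
  obtain ⟨y, φ, hφ, hy⟩ := exists_subseq_tendsto_compact hK x hxn
  have hdist : ∀ i j, i < j → 1 ≤ ‖K (x j) - K (x i)‖ := by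
    intro i j hij
    -- `K (x j) - K (x i)` equals `x j - y` with `y = T (x j) + x i - T (x i)`, and `y` lies in the
    -- kernel of `T ^ j` because `i < j`.
    have := hxd j (T (x j) + x i - T (x i)) ?_
    · convert this using 2
      rw [hTK, hTK]; abel
    · have h1 : T (x j) ∈ LinearMap.ker (T ^ j) := by
        have := hxk j
        rwa [LinearMap.mem_ker, pow_succ, Module.End.mul_apply] at this
      have h2 : x i ∈ LinearMap.ker (T ^ j) := hle _ _ hij (hxk i)
      have h3 : T (x i) ∈ LinearMap.ker (T ^ j) := by
        refine hle i j hij.le ?_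
        have := hxk i
        rwa [LinearMap.mem_ker, pow_succ, Module.End.mul_apply] at this
      exact sub_mem (add_mem h1 h2) h3
  obtain ⟨N, hN⟩ := Metric.cauchySeq_iff'.1 hy.cauchySeq 1 one_pos
  have h1 := hN (N + 1) (by omega)
  rw [dist_eq_norm] at h1
  exact absurd (hdist _ _ (hφ (Nat.lt_succ_self N))) (not_le.2 h1)

/-- The Riesz decomposition of a Banach space with respect to `1 - K`, `K` compact. -/
theorem exists_isRieszPair [CompleteSpace B] {K : B →L[ℂ] B} (hK : IsCompactOperator K) :
    ∃ P G : B →L[ℂ] B, IsRieszPair ((1 - K : B →L[ℂ] B) : Module.End ℂ B) P G ∧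
      FiniteDimensional ℂ (LinearMap.range (P : B →ₗ[ℂ] B)) := by
  set T : Module.End ℂ B := ((1 - K : B →L[ℂ] B) : Module.End ℂ B) with hT
  have hTc : ∀ k, (T ^ k) = (((1 - K : B →L[ℂ] B) ^ k : B →L[ℂ] B) : Module.End ℂ B) :=
    toLinearMap_pow _
  obtain ⟨ν₀, hν₀⟩ := exists_ker_pow_eq hK
  rw [← hT] at hν₀
  have hcomm : ∀ i j b, (T ^ i) ((T ^ j) b) = (T ^ (i + j)) b := fun i j b => by
    rw [pow_add, Module.End.mul_apply]
  have hstab0 : ∀ k b, (T ^ (ν₀ + k)) b = 0 → (T ^ ν₀) b = 0 := by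
    intro k
    induction k with
    | zero => exact fun b hb => hb
    | succ k ih =>
      intro b hb
      have h1 : T ^ k * T ^ (ν₀ + 1) = T ^ (ν₀ + (k + 1)) := by rw [← pow_add]; congr 1; omega
      have h2 : (T ^ k) b ∈ LinearMap.ker (T ^ (ν₀ + 1)) := by
        rw [LinearMap.mem_ker, hcomm, ← hb]; congr 2; omega
      rw [← hν₀, LinearMap.mem_ker, hcomm] at h2
      exact ih b h2
  -- One more than the index of stabilization, so that `S = T ^ ν` factors through `T` even if `ν₀ =
  -- 0`; this is what makes `T` surjective on `R`.
  set ν := ν₀ + 1 with hν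
  have hstab : ∀ k b, (T ^ k) b = 0 → (T ^ ν) b = 0 := by
    intro k b hb
    have : (T ^ ν₀) b = 0 := hstab0 k b (by rw [← hcomm, hb, map_zero])
    rw [hν, add_comm, ← hcomm, this, map_zero]
  obtain ⟨L, hL, hLT⟩ := exists_pow_one_sub_compact hK ν
  set S : B →L[ℂ] B := (1 - K) ^ ν with hS
  have hST : ∀ b, S b = (T ^ ν) b := fun b => by rw [hTc]; rfl
  set N := LinearMap.ker S.toLinearMap with hN
  set R := LinearMap.range S.toLinearMap with hR
  have hRc : IsClosed (R : Set B) := by rw [hR, hLT]; exact isClosed_range_one_sub hL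
  have : CompleteSpace R := hRc.completeSpace_coe
  have : FiniteDimensional ℂ N := by rw [hN, hLT]; exact finiteDimensional_ker_one_sub hL
  have hNR : ∀ b ∈ R, S b = 0 → b = 0 := by
    rintro _ ⟨c, rfl⟩ hb
    have : (T ^ (ν + ν)) c = 0 := by rw [← hcomm, ← hST, ← hST]; exact hb
    have := hstab _ _ this
    rwa [← hST] at this
  have hLR : ∀ v ∈ R, (L : B →ₗ[ℂ] B) v ∈ R := by
    rintro _ ⟨c, rfl⟩
    have h1 : S c - S (S c) = L (S c) := by
      have h2 : ∀ x, S x = x - L x := fun x => by rw [hLT]; simp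
      rw [h2 (S c), sub_sub_cancel]
    rw [ContinuousLinearMap.coe_coe, ContinuousLinearMap.coe_coe, ← h1, ← map_sub]
    exact ⟨_, rfl⟩
  let LR : R →L[ℂ] R := L.restrict hLR
  have hLRc : IsCompactOperator LR := IsCompactOperator.restrict (f := (L : B →ₗ[ℂ] B)) hL hLR hRc
  -- Fredholm alternative on `R`: an eigenvector of `L` for the eigenvalue 1 would be killed by `S =
  -- 1 - L`, which is injective on `R`. Hence `S` maps `R` onto `R`.
  have hres : (1 : ℂ) ∈ resolventSet ℂ LR := by
    refine (hLRc.hasEigenvalue_or_mem_resolventSet one_ne_zero).resolve_left fun hev => ?_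
    obtain ⟨v, hv⟩ := hev.exists_hasEigenvector
    refine hv.2 (Subtype.ext (hNR v v.2 ?_))
    have h1 : L v = v := by
      have := hv.apply_eq_smul
      rw [one_smul] at this
      exact congrArg Subtype.val this
    rw [hLT]; simp [h1]
  have hsurj : ∀ r ∈ R, ∃ r' ∈ R, S r' = r := by
    intro r hr
    rw [spectrum.mem_resolventSet_iff, ContinuousLinearMap.isUnit_iff_bijective] at hres
    obtain ⟨r', hr'⟩ := hres.2 ⟨r, hr⟩
    refine ⟨r', r'.2, ?_⟩
    have := congrArg Subtype.val hr'
    rw [hLT]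
    simpa [LR] using this
  have hcompl : IsCompl N R := by
    refine ⟨Submodule.disjoint_def.2 fun b hb hb' => hNR b hb' hb, codisjoint_iff.2 ?_⟩
    rw [eq_top_iff]
    intro b _
    obtain ⟨r, hr, hrb⟩ := hsurj (S b) ⟨b, rfl⟩
    refine Submodule.mem_sup.2 ⟨b - r, ?_, r, hr, by abel⟩
    rw [hN, LinearMap.mem_ker, ContinuousLinearMap.coe_coe, map_sub, hrb, sub_self]
  have hTR : ∀ b, b ∈ R → T b ∈ R := by
    rintro _ ⟨c, rfl⟩
    refine ⟨T c, ?_⟩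
    have h1 := hST (T c)
    rw [← Module.End.mul_apply, ← pow_succ, pow_succ', Module.End.mul_apply, ← hST] at h1
    exact h1
  have hTinj : ∀ b ∈ R, T b = 0 → b = 0 := fun b hb h => hNR b hb (by
    rw [hST]; exact hstab 1 b (by rwa [pow_one]))
  have hTsurj : ∀ r ∈ R, ∃ r' ∈ R, T r' = r := by
    intro r hr
    obtain ⟨r', hr', h⟩ := hsurj r hr
    have : ∀ k, (T ^ k) r' ∈ R := by
      intro k
      induction k with
      | zero => exact hr'
      | succ k ih => rw [pow_succ']; exact hTR _ ih
    refine ⟨(T ^ ν₀) r', this _, ?_⟩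
    rw [← h, hST, ← Module.End.mul_apply, ← pow_succ']
  have hTsurjk : ∀ k, ∀ r ∈ R, ∃ r' ∈ R, (T ^ k) r' = r := by
    intro k
    induction k with
    | zero => exact fun r hr => ⟨r, hr, rfl⟩
    | succ k ih =>
      intro r hr
      obtain ⟨a, ha, hab⟩ := ih r hr
      obtain ⟨c, hc, hca⟩ := hTsurj a ha
      exact ⟨c, hc, by rw [pow_succ, Module.End.mul_apply, hca, hab]⟩
  let P₀ : B →L[ℂ] N := N.projectionOntoL R
    (Submodule.IsCompl.isTopCompl_of_isClosed hcompl (Submodule.closed_of_finiteDimensional N) hRc)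
  let P : B →L[ℂ] B := N.subtypeL ∘L P₀
  have hPN : ∀ b, P b ∈ N := fun b => (P₀ b).2
  have hPR : ∀ b, b - P b ∈ R := by
    intro b
    exact Submodule.sub_projection_mem hcompl b
  let TR : R →L[ℂ] R := (1 - K : B →L[ℂ] B).restrict hTR
  let e : R ≃L[ℂ] R := ContinuousLinearEquiv.ofBijective TR
    (LinearMap.ker_eq_bot'.2 fun v hv => Subtype.ext (hTinj v v.2 (congrArg Subtype.val hv)))
    (LinearMap.range_eq_top.2 fun r => by
      obtain ⟨r', hr', h⟩ := hTsurj r r.2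
      exact ⟨⟨r', hr'⟩, Subtype.ext h⟩)
  have he : ∀ r : R, ((e r : R) : B) = T r := fun r => rfl
  let Q : B →L[ℂ] R := (ContinuousLinearMap.id ℂ B - P).codRestrict R hPR
  let G : B →L[ℂ] B := R.subtypeL ∘L (e.symm : R →L[ℂ] R) ∘L Q
  have hGR : ∀ b, G b ∈ R := fun b => (e.symm (Q b)).2
  have hTG : ∀ b, T (G b) = b - P b := fun b => by
    have := he (e.symm (Q b))
    rw [e.apply_symm_apply] at this
    exact this.symm
  have hNRu : ∀ b ∈ N, b ∈ R → b = 0 := fun b hb hb' => hNR b hb' hb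
  have hNT : ∀ b ∈ N, T b ∈ N := fun b hb => by
    have hb' : S b = 0 := hb
    change S (T b) = 0
    rw [hST, ← Module.End.mul_apply, ← pow_succ, pow_succ', Module.End.mul_apply, ← hST, hb',
      map_zero]
  refine ⟨P, G, ⟨fun b => ⟨ν, ?_⟩, fun b k => ?_, fun b k => ?_, hTG, fun b => ?_, ?_⟩, ?_⟩
  · have : S (P b) = 0 := hPN b
    rw [← hST]; exact this
  · obtain ⟨y, -, hy⟩ := hTsurjk k _ (hPR b)
    exact ⟨y, hy⟩
  · obtain ⟨y, -, hy⟩ := hTsurjk k _ (hGR b)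
    exact ⟨y, hy⟩
  · have h1 : P (T b) = T (P b) := by
      rw [← sub_eq_zero]
      refine hNRu _ (sub_mem (hPN _) (hNT _ (hPN b))) ?_
      have h2 := sub_mem (hTR _ (hPR b)) (hPR (T b))
      rw [map_sub] at h2
      convert h2 using 1
      abel
    change G (T b) = b - P b
    rw [← sub_eq_zero]
    refine hTinj _ (sub_mem (hGR _) (hPR b)) ?_
    rw [map_sub, hTG, h1, map_sub, sub_self]
  · rintro b ⟨k, hk⟩ hb
    obtain ⟨y, hy⟩ := hb ν
    refine hNR b ⟨y, by rw [← hy]; exact hST y⟩ ?_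
    rw [hST]; exact hstab k b hk
  · refine Submodule.finiteDimensional_of_le (S₂ := N) ?_
    rintro _ ⟨b, rfl⟩
    exact hPN b

/-- A continuous operator of finite rank maps a dense subspace onto its whole range, since the image
is finite-dimensional and therefore closed. With `j` the inclusion of C^l into C^0, this puts the
range of `P` into C^l. -/
lemma range_proj_le_range {B' : Type*} [NormedAddCommGroup B'] [NormedSpace ℂ B']
    {T P G : Module.End ℂ B} {T' P' G' : Module.End ℂ B'} (h : IsRieszPair T P G)
    (h' : IsRieszPair T' P' G') (hP : Continuous P) [FiniteDimensional ℂ (LinearMap.range P)]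
    {j : B' →ₗ[ℂ] B} (hj : ∀ b, j (T' b) = T (j b)) (hd : DenseRange j) (b : B) :
    ∃ b', P b = j b' := by
  have hle : LinearMap.range (P ∘ₗ j) ≤ LinearMap.range P := by
    rintro _ ⟨c, rfl⟩
    exact ⟨j c, rfl⟩
  have : FiniteDimensional ℂ (LinearMap.range (P ∘ₗ j)) := Submodule.finiteDimensional_of_le hle
  have hc : IsClosed (LinearMap.range (P ∘ₗ j) : Set B) := Submodule.closed_of_finiteDimensional _
  have : P b ∈ LinearMap.range (P ∘ₗ j) := by
    refine (hc.preimage hP).closure_subset_iff.2 ?_ (hd b)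
    rintro _ ⟨c, rfl⟩
    exact ⟨c, rfl⟩
  obtain ⟨c, hc⟩ := this
  exact ⟨P' c, by rw [← hc, LinearMap.comp_apply, h.proj_intertwine h' hj]⟩

end Riesz

end
end CRForms

namespace CRForms
noncomputable section

/-! ### Exterior and interior products of alternating forms. -/

section Wedge

open AlternatingMap

variable {V V' W W' : Type*} [AddCommGroup V] [Module ℝ V] [AddCommGroup V'] [Module ℝ V']
  [AddCommGroup W] [Module ℂ W] [AddCommGroup W'] [Module ℂ W'] {N : ℕ}

/-- The exterior product of a complex covector and an alternating form. -/
def wedge (τ : V →ₗ[ℝ] ℂ) (u : V [⋀^Fin N]→ₗ[ℝ] W) : V [⋀^Fin (N + 1)]→ₗ[ℝ] W :=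
  alternatizeUncurryFin
    { toFun := fun v => τ v • u
      map_add' := fun v w => by rw [map_add, add_smul]
      map_smul' := fun c v => by
        rw [map_smul, RingHom.id_apply, Complex.real_smul, mul_smul]
        ext w
        simp }

lemma wedge_apply (τ : V →ₗ[ℝ] ℂ) (u : V [⋀^Fin N]→ₗ[ℝ] W) (v : Fin (N + 1) → V) :
    wedge τ u v = ∑ i : Fin (N + 1), (-1 : ℝ) ^ (i : ℕ) • τ (v i) •
      u (fun j => v (i.succAbove j)) := by
  rw [wedge, alternatizeUncurryFin_apply]
  refine Finset.sum_congr rfl fun i _ => ?_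
  rcases Nat.even_or_odd (i : ℕ) with h | h <;> simp [h.neg_one_pow] <;> rfl

lemma wedge_add_right (τ : V →ₗ[ℝ] ℂ) (u w : V [⋀^Fin N]→ₗ[ℝ] W) :
    wedge τ (u + w) = wedge τ u + wedge τ w := by
  ext v; simp [wedge_apply, Finset.sum_add_distrib]

lemma wedge_add_left (τ σ : V →ₗ[ℝ] ℂ) (u : V [⋀^Fin N]→ₗ[ℝ] W) :
    wedge (τ + σ) u = wedge τ u + wedge σ u := by
  ext v; simp [wedge_apply, Finset.sum_add_distrib, add_smul]

lemma wedge_smul_right (τ : V →ₗ[ℝ] ℂ) (c : ℂ) (u : V [⋀^Fin N]→ₗ[ℝ] W) :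
    wedge τ (c • u) = c • wedge τ u := by
  ext v; simp [wedge_apply, Finset.smul_sum, smul_comm c]

lemma wedge_smul_left (c : ℂ) (τ : V →ₗ[ℝ] ℂ) (u : V [⋀^Fin N]→ₗ[ℝ] W) :
    wedge (c • τ) u = c • wedge τ u := by
  ext v; simp [wedge_apply, Finset.smul_sum, smul_comm c, mul_smul]

lemma wedge_zero_right (τ : V →ₗ[ℝ] ℂ) : wedge τ (0 : V [⋀^Fin N]→ₗ[ℝ] W) = 0 := by
  ext v; simp [wedge_apply]

lemma wedge_zero_left (u : V [⋀^Fin N]→ₗ[ℝ] W) : wedge 0 u = 0 := by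
  ext v; simp [wedge_apply]

lemma wedge_neg_right (τ : V →ₗ[ℝ] ℂ) (u : V [⋀^Fin N]→ₗ[ℝ] W) : wedge τ (-u) = -wedge τ u := by
  rw [← neg_one_smul ℂ u, wedge_smul_right, neg_one_smul]

lemma wedge_sub_right (τ : V →ₗ[ℝ] ℂ) (u w : V [⋀^Fin N]→ₗ[ℝ] W) :
    wedge τ (u - w) = wedge τ u - wedge τ w := by
  rw [sub_eq_add_neg, wedge_add_right, wedge_neg_right, sub_eq_add_neg]

lemma wedge_sum_right {κ : Type*} (s : Finset κ) (τ : V →ₗ[ℝ] ℂ) (u : κ → V [⋀^Fin N]→ₗ[ℝ] W) :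
    wedge τ (∑ i ∈ s, u i) = ∑ i ∈ s, wedge τ (u i) := by
  classical
  induction s using Finset.induction_on with
  | empty => simp [wedge_zero_right]
  | insert i s hi ih => rw [Finset.sum_insert hi, Finset.sum_insert hi, wedge_add_right, ih]

lemma wedge_sum_left {κ : Type*} (s : Finset κ) (τ : κ → V →ₗ[ℝ] ℂ) (u : V [⋀^Fin N]→ₗ[ℝ] W) :
    wedge (∑ i ∈ s, τ i) u = ∑ i ∈ s, wedge (τ i) u := by
  classical
  induction s using Finset.induction_on with
  | empty => simp [wedge_zero_left]
  | insert i s hi ih => rw [Finset.sum_insert hi, Finset.sum_insert hi, wedge_add_left, ih]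

/-- The sum of the two sides' products is the double alternatization of a symmetric bilinear map,
which vanishes. -/
lemma wedge_wedge (τ σ : V →ₗ[ℝ] ℂ) (u : V [⋀^Fin N]→ₗ[ℝ] W) :
    wedge τ (wedge σ u) = -wedge σ (wedge τ u) := by
  rw [← add_eq_zero_iff_eq_neg]
  let f₁ : (τ σ : V →ₗ[ℝ] ℂ) → (V →ₗ[ℝ] V →ₗ[ℝ] V [⋀^Fin N]→ₗ[ℝ] W) := fun τ σ =>
    LinearMap.mk₂ ℝ (fun x y => τ x • σ y • u) (fun x y z => by simp [add_smul])
      (fun c x y => by simp [mul_smul]) (fun x y z => by simp [add_smul])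
      (fun c x y => by
        rw [map_smul, Complex.real_smul, mul_smul, smul_comm]
        ext w; simp)
  have h := alternatizeUncurryFin_alternatizeUncurryFinLM_comp_of_symmetric (f := f₁ τ σ + f₁ σ τ)
    (fun x y => by
      simp only [f₁, LinearMap.add_apply, LinearMap.mk₂_apply]
      rw [smul_comm (τ x), smul_comm (σ x)]
      exact add_comm _ _)
  have e : ∀ τ σ, alternatizeUncurryFin (alternatizeUncurryFinLM ∘ₗ f₁ τ σ) =
      wedge τ (wedge σ u) := by
    intro τ σ
    simp only [wedge]
    congr 1
    ext x v
    simp only [f₁, LinearMap.comp_apply, alternatizeUncurryFinLM_apply, alternatizeUncurryFin_apply,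
      LinearMap.mk₂_apply, LinearMap.coe_mk, AddHom.coe_mk, AlternatingMap.smul_apply,
      Finset.smul_sum]
    exact Finset.sum_congr rfl fun i _ => smul_comm _ _ _
  rw [LinearMap.comp_add, alternatizeUncurryFin_add, e, e] at h
  exact h

lemma wedge_self (τ : V →ₗ[ℝ] ℂ) (u : V [⋀^Fin N]→ₗ[ℝ] W) : wedge τ (wedge τ u) = 0 := by
  have h := add_eq_zero_iff_eq_neg.2 (wedge_wedge τ τ u)
  rw [← two_smul ℂ] at h
  exact (smul_eq_zero.1 h).resolve_left two_ne_zero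

/-- Interior product with the complexified vector `a + i b`. -/
def cint (a b : V) (u : V [⋀^Fin (N + 1)]→ₗ[ℝ] W) : V [⋀^Fin N]→ₗ[ℝ] W :=
  u.curryLeft a + Complex.I • u.curryLeft b

/-- Interior multiplication is an antiderivation: the term in which `τ` takes the argument `x`
splits off, and in the others the index shifts by one, which changes the sign. -/
lemma curryLeft_wedge (τ : V →ₗ[ℝ] ℂ) (u : V [⋀^Fin (N + 1)]→ₗ[ℝ] W) (x : V) :
    (wedge τ u).curryLeft x = τ x • u - wedge τ (u.curryLeft x) := by
  ext v
  simp only [curryLeft_apply_apply, wedge_apply, AlternatingMap.sub_apply, AlternatingMap.smul_apply]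
  rw [Fin.sum_univ_succ, sub_eq_add_neg, ← Finset.sum_neg_distrib]
  congr 1
  · simp
  · refine Finset.sum_congr rfl fun i _ => ?_
    rw [Fin.val_succ, pow_succ, mul_neg_one, neg_smul]
    congr 3
    congr 1
    funext j
    refine Fin.cases ?_ (fun j => ?_) j <;> simp

lemma curryLeft_wedge_zero (τ : V →ₗ[ℝ] ℂ) (u : V [⋀^Fin 0]→ₗ[ℝ] W) (x : V) :
    (wedge τ u).curryLeft x = τ x • u := by
  ext v
  simp only [curryLeft_apply_apply, wedge_apply, AlternatingMap.smul_apply]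
  rw [Fin.sum_univ_succ]
  simp only [Finset.univ_eq_empty, Finset.sum_empty, add_zero, Fin.val_zero, pow_zero, one_smul]
  congr 2

lemma cint_wedge (a b : V) (τ : V →ₗ[ℝ] ℂ) (u : V [⋀^Fin (N + 1)]→ₗ[ℝ] W) :
    cint a b (wedge τ u) = (τ a + Complex.I * τ b) • u - wedge τ (cint a b u) := by
  rw [cint, cint, curryLeft_wedge, curryLeft_wedge, wedge_add_right, wedge_smul_right, smul_sub,
    add_smul, mul_smul]
  abel

lemma cint_wedge_zero (a b : V) (τ : V →ₗ[ℝ] ℂ) (u : V [⋀^Fin 0]→ₗ[ℝ] W) :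
    cint a b (wedge τ u) = (τ a + Complex.I * τ b) • u := by
  rw [cint, curryLeft_wedge_zero, curryLeft_wedge_zero, add_smul, mul_smul]

lemma cint_add (a b : V) (u w : V [⋀^Fin (N + 1)]→ₗ[ℝ] W) :
    cint a b (u + w) = cint a b u + cint a b w := by
  ext v; simp [cint]; abel

lemma cint_smul (a b : V) (c : ℂ) (u : V [⋀^Fin (N + 1)]→ₗ[ℝ] W) :
    cint a b (c • u) = c • cint a b u := by
  ext v; simp [cint, smul_comm c]

lemma cint_zero (a b : V) : cint a b (0 : V [⋀^Fin (N + 1)]→ₗ[ℝ] W) = 0 := by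
  ext v; simp [cint]

lemma curryLeft_curryLeft (u : V [⋀^Fin (N + 2)]→ₗ[ℝ] W) (x y : V) :
    (u.curryLeft x).curryLeft y = -(u.curryLeft y).curryLeft x := by
  have h := curryLeft_same u (x + y)
  have h1 := curryLeft_same u x
  have h2 := curryLeft_same u y
  simp only [map_add, curryLeft_add, LinearMap.add_apply] at h
  rw [h1, h2, zero_add, add_zero] at h
  exact eq_neg_of_add_eq_zero_right (by rw [add_comm] at h ⊢; exact h)

lemma cint_cint (a b c d : V) (u : V [⋀^Fin (N + 2)]→ₗ[ℝ] W) :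
    cint a b (cint c d u) = -cint c d (cint a b u) := by
  have hs : ∀ (z : ℂ) (w : V [⋀^Fin (N + 1)]→ₗ[ℝ] W) (x : V),
      (z • w).curryLeft x = z • w.curryLeft x := fun z w x => rfl
  simp only [cint, curryLeft_add, LinearMap.add_apply, hs, smul_add]
  rw [curryLeft_curryLeft u c a, curryLeft_curryLeft u d a, curryLeft_curryLeft u c b,
    curryLeft_curryLeft u d b]
  simp only [smul_neg]
  abel

end Wedge

lemma alternatingMap_sum_apply {V W κ : Type*} [AddCommGroup V] [Module ℝ V] [AddCommGroup W]
    [Module ℂ W] {N : ℕ} (s : Finset κ) (u : κ → V [⋀^Fin N]→ₗ[ℝ] W) (v : Fin N → V) :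
    (∑ i ∈ s, u i) v = ∑ i ∈ s, u i v := by
  classical
  induction s using Finset.induction_on with
  | empty => simp
  | insert i s hi ih => rw [Finset.sum_insert hi, Finset.sum_insert hi, AlternatingMap.add_apply, ih]

/-! ### Eigenvalues of sums of commuting projections. -/

section CommutingProjections

variable {B κ : Type*} [AddCommGroup B] [Module ℂ B]

/-- Commuting projections diagonalize simultaneously with eigenvalues 0 and 1, so their sum has only
natural numbers as eigenvalues. The induction replaces the diagonalization: `Q b v` satisfies the
same relation for the shorter sum, with `c - 1` in place of `c`. -/
lemma eq_zero_of_sum_projections (Q : κ → Module.End ℂ B) (hQ : ∀ a v, Q a (Q a v) = Q a v)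
    (hc : ∀ a b v, Q a (Q b v) = Q b (Q a v)) (s : Finset κ) (c : ℂ) (hcs : ∀ k : ℕ, c ≠ k) (v : B)
    (hv : ∑ a ∈ s, Q a v = c • v) : v = 0 := by
  classical
  induction s using Finset.induction_on generalizing c v with
  | empty =>
    rw [Finset.sum_empty] at hv
    exact (smul_eq_zero.1 hv.symm).resolve_left (by simpa using hcs 0)
  | insert b s hb ih =>
    rw [Finset.sum_insert hb] at hv
    have hbv : Q b v = 0 := by
      refine ih (c - 1) (fun k hk => hcs (k + 1) ?_) _ ?_
      · rw [sub_eq_iff_eq_add] at hk; rw [hk]; push_cast; ring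
      · have := congrArg (Q b) hv
        rw [map_add, hQ, map_sum, map_smul] at this
        rw [sub_smul, one_smul, ← this, add_sub_cancel_left]
        exact Finset.sum_congr rfl fun a _ => hc a b v
    rw [hbv, zero_add] at hv
    exact ih c hcs v hv

/-- Applying `Q b` to the relation shows that on `Q b v` the remaining projections sum to -1, which
is not a natural number. -/
lemma apply_eq_zero_of_sum_projections (Q : κ → Module.End ℂ B)
    (hQ : ∀ a v, Q a (Q a v) = Q a v) (hc : ∀ a b v, Q a (Q b v) = Q b (Q a v)) (s : Finset κ)
    (v : B) (hv : ∑ a ∈ s, Q a v = 0) {b : κ} (hb : b ∈ s) : Q b v = 0 := by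
  classical
  refine eq_zero_of_sum_projections Q hQ hc (s.erase b) (-1) (fun k hk => ?_) _ ?_
  · have : (0 : ℂ) = ((k + 1 : ℕ) : ℂ) := by push_cast; rw [← hk]; ring
    exact absurd (by exact_mod_cast this : (0 : ℕ) = k + 1) (by omega)
  · have := congrArg (Q b) hv
    rw [map_sum, map_zero, ← Finset.add_sum_erase _ _ hb, hQ] at this
    rw [neg_one_smul, ← add_eq_zero_iff_eq_neg, add_comm, ← this]
    congr 1
    exact Finset.sum_congr rfl fun a _ => hc a b v

end CommutingProjections

/-! ### Forms of bidegree (n,q) on ℂⁿ and their products with covectors. -/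

section Bidegree

open AlternatingMap

variable {W : Type*} [AddCommGroup W] [Module ℂ W] {N : ℕ}

/-- Homogeneity of bidegree `(p, q)` under multiplication of all arguments by complex scalars. -/
def IsHomog {V : Type*} [AddCommGroup V] [Module ℂ V] (p q : ℕ) (g : V [⋀^Fin N]→ₗ[ℝ] W) : Prop :=
  ∀ (c : ℂ) (w : Fin N → V), g (fun j => c • w j) = (c ^ p * (starRingEnd ℂ c) ^ q) • g w

/-- This is the derivative at `t = 0` of `∑ t ^ card s * x s`, to which only the singletons
contribute. -/
lemma sum_card_mul_zero_pow (x : Finset (Fin N) → ℂ) :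
    ∑ s : Finset (Fin N), ((s.card : ℂ) * 0 ^ (s.card - 1)) * x s = ∑ i : Fin N, x {i} := by
  have h1 : ∑ i : Fin N, x {i} = ∑ s ∈ Finset.powersetCard 1 Finset.univ, x s := by
    rw [Finset.powersetCard_one, Finset.sum_map]; rfl
  rw [h1, ← Finset.sum_subset (Finset.subset_univ (Finset.powersetCard 1 Finset.univ))]
  · refine Finset.sum_congr rfl fun s hs => ?_
    rw [(Finset.mem_powersetCard.1 hs).2]; simp
  · intro s _ hs
    rw [Finset.mem_powersetCard] at hs
    have : s.card ≠ 1 := fun h => hs ⟨Finset.subset_univ _, h⟩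
    rcases Nat.eq_zero_or_pos s.card with h | h
    · simp [h]
    · rw [zero_pow (by omega)]; simp

/-- Put `c = 1 + t i` in the homogeneity relation, expand the left side over subsets by
multilinearity, and differentiate at `t = 0`. Since `W` carries no topology, this is done after
applying linear functionals. -/
lemma IsHomog.sum_update {V : Type*} [AddCommGroup V] [Module ℂ V] {p q : ℕ}
    {g : V [⋀^Fin N]→ₗ[ℝ] W} (hg : IsHomog p q g) (w : Fin N → V) :
    ∑ i, g (Function.update w i (Complex.I • w i)) = (Complex.I * ((p : ℂ) - q)) • g w := by
  rw [← sub_eq_zero, ← Module.forall_dual_apply_eq_zero_iff ℂ]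
  intro ℓ
  have key : ∀ t : ℝ, ∑ s : Finset (Fin N),
      (t : ℂ) ^ s.card * ℓ (g (s.piecewise (fun j => Complex.I • w j) w)) =
        ((1 + t * Complex.I) ^ p * (1 - t * Complex.I) ^ q) * ℓ (g w) := by
    intro t
    have h1 := hg (1 + t * Complex.I) w
    have h2 : (fun j => (1 + (t : ℂ) * Complex.I) • w j) =
        (fun j => t • Complex.I • w j) + w := by
      funext j
      rw [add_smul, one_smul, mul_smul, add_comm]
      rfl
    have h3 := MultilinearMap.map_add_univ g.toMultilinearMap (fun j => t • Complex.I • w j) w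
    rw [h2] at h1
    have h4 := h3.symm.trans h1
    have h5 := congrArg ℓ h4
    rw [map_sum, map_smul, smul_eq_mul] at h5
    have hconj : (starRingEnd ℂ) (1 + t * Complex.I) = 1 - t * Complex.I := by
      simp [sub_eq_add_neg]
    rw [hconj] at h5
    rw [← h5]
    refine Finset.sum_congr rfl fun s _ => ?_
    have h6 := MultilinearMap.map_piecewise_smul g.toMultilinearMap (fun _ => t)
      (s.piecewise (fun j => Complex.I • w j) w) s
    have h7 : s.piecewise (fun i => t • s.piecewise (fun j => Complex.I • w j) w i)
        (s.piecewise (fun j => Complex.I • w j) w) =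
        s.piecewise (fun j => t • Complex.I • w j) w := by
      funext j
      by_cases hj : j ∈ s <;> simp [hj]
    rw [h7, Finset.prod_const] at h6
    rw [h6]
    have : ∀ (r : ℝ) (x : W), ℓ (r • x) = (r : ℂ) * ℓ x := fun r x => by
      rw [← Complex.coe_smul, map_smul, smul_eq_mul]
    rw [this]
    push_cast
    rfl
  have d1 : HasDerivAt (fun t : ℝ => ∑ s : Finset (Fin N),
      (t : ℂ) ^ s.card * ℓ (g (s.piecewise (fun j => Complex.I • w j) w)))
      (∑ s : Finset (Fin N), ((s.card : ℂ) * 0 ^ (s.card - 1)) *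
        ℓ (g (s.piecewise (fun j => Complex.I • w j) w))) 0 := by
    refine HasDerivAt.fun_sum fun s _ => HasDerivAt.mul_const ?_ _
    have := (Complex.ofRealCLM.hasDerivAt (x := (0 : ℝ))).fun_pow s.card
    simpa using this
  have d2 : HasDerivAt (fun t : ℝ => ((1 + t * Complex.I) ^ p * (1 - t * Complex.I) ^ q) * ℓ (g w))
      ((Complex.I * ((p : ℂ) - q)) * ℓ (g w)) 0 := by
    have a := ((Complex.ofRealCLM.hasDerivAt (x := (0 : ℝ))).mul_const Complex.I)
    have h1 := (a.const_add 1).pow p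
    have h2 := (a.const_sub 1).pow q
    have h := (h1.mul h2).mul_const (ℓ (g w))
    refine (h.congr_deriv ?_)
    simp only [Pi.pow_apply, _root_.map_zero, Complex.ofRealCLM_apply, Complex.ofReal_zero,
      Complex.ofReal_one, zero_mul, add_zero, sub_zero, one_pow]
    ring
  have d := d1.unique (d2.congr_of_eventuallyEq (Filter.Eventually.of_forall key))
  rw [sum_card_mul_zero_pow] at d
  rw [map_sub, map_sum, map_smul, smul_eq_mul, ← d, sub_eq_zero]
  refine Finset.sum_congr rfl fun i _ => ?_
  rw [Finset.piecewise_singleton]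

/-- The complex coordinate functions of `ℂⁿ`. -/
def coordC (n : ℕ) (a : Fin n) : Cn n →ₗ[ℂ] ℂ := (EuclideanSpace.proj a : Cn n →L[ℂ] ℂ)

lemma sum_coordC_smul {n : ℕ} (w : Cn n) :
    ∑ a, coordC n a w • EuclideanSpace.single a (1 : ℂ) = w := by
  ext b
  simp [coordC, Pi.single_apply]

lemma linearMap_eq_sum_coordC {n : ℕ} (L : Cn n →ₗ[ℂ] ℂ) :
    L = ∑ a, L (EuclideanSpace.single a (1 : ℂ)) • coordC n a := by
  ext w
  conv_lhs => rw [← sum_coordC_smul w]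
  simp [map_sum, mul_comm]

/-- The coordinate vector field `∂ / ∂ z_a` followed by exterior multiplication by `d z_a`. -/
def dzProj {n : ℕ} (a : Fin n) (g : Cn n [⋀^Fin (N + 1)]→ₗ[ℝ] W) : Cn n [⋀^Fin (N + 1)]→ₗ[ℝ] W :=
  wedge ((coordC n a).restrictScalars ℝ)
    (cint ((1 / 2 : ℝ) • EuclideanSpace.single a (1 : ℂ))
      (-(1 / 2 : ℝ) • Complex.I • EuclideanSpace.single a (1 : ℂ)) g)

lemma coordC_pairing {n : ℕ} (a b : Fin n) :
    (coordC n a).restrictScalars ℝ ((1 / 2 : ℝ) • EuclideanSpace.single b (1 : ℂ)) + Complex.I *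
      (coordC n a).restrictScalars ℝ (-(1 / 2 : ℝ) • Complex.I • EuclideanSpace.single b (1 : ℂ)) =
      if a = b then 1 else 0 := by
  by_cases h : a = b
  · subst h
    simp only [coordC, LinearMap.coe_restrictScalars, if_true]
    simp
    rw [← mul_assoc, mul_comm Complex.I, mul_assoc, Complex.I_mul_I]
    norm_num
  · simp [coordC, h]

lemma half_sub_smul (c : ℂ) (A B : W) :
    (1 / 2 : ℝ) • (c.re • A + c.im • B) - Complex.I • (1 / 2 : ℝ) • (c.re • B + c.im • -A) =
      c • ((1 / 2 : ℝ) • A - Complex.I • (1 / 2 : ℝ) • B) := by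
  simp only [← Complex.coe_smul]
  conv_rhs => rw [← Complex.re_add_im c]
  match_scalars
  · ring
  · linear_combination (1 / 2 * (c.im : ℂ)) * Complex.I_mul_I

/-- The sum of the operators dz_a ∧ (∂/∂z_a ⌟ ·) counts the holomorphic degree. Evaluated on
vectors, it replaces the arguments one at a time by their (1,0)-parts, which gives ½(p + q)g -
(i/2)·i(p - q)g = p g by `IsHomog.sum_update`. -/
lemma dzProj_sum {n : ℕ} {p q : ℕ} (hN : N + 1 = p + q) {g : Cn n [⋀^Fin (N + 1)]→ₗ[ℝ] W}
    (hg : IsHomog p q g) : ∑ a, dzProj a g = (p : ℂ) • g := by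
  ext v
  have h0 : ∀ (w : Cn n) (x : Fin N → Cn n),
      ∑ a, coordC n a w • (cint ((1 / 2 : ℝ) • EuclideanSpace.single a (1 : ℂ))
        (-(1 / 2 : ℝ) • Complex.I • EuclideanSpace.single a (1 : ℂ)) g x) =
        (1 / 2 : ℝ) • g (Matrix.vecCons w x) -
          Complex.I • (1 / 2 : ℝ) • g (Matrix.vecCons (Complex.I • w) x) := by
    intro w x
    -- The (1,0)-part of `g` in its first argument; being complex-linear, it is determined by its
    -- values on the standard basis.
    let L : Cn n →ₗ[ℂ] W :=
      { toFun := fun w => (1 / 2 : ℝ) • g (Matrix.vecCons w x) -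
          Complex.I • (1 / 2 : ℝ) • g (Matrix.vecCons (Complex.I • w) x)
        map_add' := fun a b => by
          simp only [smul_add, AlternatingMap.map_vecCons_add]
          abel
        map_smul' := fun c a => by
          have e1 : ∀ a : Cn n, g (Matrix.vecCons (c • a) x) =
              c.re • g (Matrix.vecCons a x) + c.im • g (Matrix.vecCons (Complex.I • a) x) := by
            intro a
            rw [← AlternatingMap.map_vecCons_smul, ← AlternatingMap.map_vecCons_smul,
              ← AlternatingMap.map_vecCons_add]
            congr 2
            conv_lhs => rw [← Complex.re_add_im c, add_smul, mul_smul]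
            rfl
          have e2 : g (Matrix.vecCons (Complex.I • Complex.I • a) x) = -g (Matrix.vecCons a x) := by
            rw [smul_smul, Complex.I_mul_I, ← neg_one_smul ℝ (g _),
              ← AlternatingMap.map_vecCons_smul]
            simp
          rw [smul_comm Complex.I c a, e1, e1, e2, RingHom.id_apply]
          exact half_sub_smul _ _ _ }
    have hL : L w = ∑ a, coordC n a w • L (EuclideanSpace.single a 1) := by
      conv_lhs => rw [← sum_coordC_smul w]
      rw [map_sum]; simp
    change _ = L w
    rw [hL]
    refine Finset.sum_congr rfl fun a _ => ?_
    congr 1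
    simp only [cint, AlternatingMap.add_apply, AlternatingMap.smul_apply, curryLeft_apply_apply,
      AlternatingMap.map_vecCons_smul]
    rw [neg_smul, smul_neg, ← sub_eq_add_neg]
    rfl
  have h1 : (∑ a, dzProj a g) v = ∑ i : Fin (N + 1), (-1 : ℝ) ^ (i : ℕ) •
      ((1 / 2 : ℝ) • g (Matrix.vecCons (v i) (fun j => v (i.succAbove j))) -
      Complex.I • (1 / 2 : ℝ) •
        g (Matrix.vecCons (Complex.I • v i) (fun j => v (i.succAbove j)))) := by
    simp only [alternatingMap_sum_apply, dzProj, wedge_apply]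
    rw [Finset.sum_comm]
    refine Finset.sum_congr rfl fun i _ => ?_
    rw [← h0, Finset.smul_sum]
    rfl
  have h2 : ∀ (i : Fin (N + 1)) (x : Cn n),
      (-1 : ℝ) ^ (i : ℕ) • g (Matrix.vecCons x (fun j => v (i.succAbove j))) =
        g (Function.update v i x) := by
    intro i x
    have := neg_one_pow_smul_map_insertNth g i x (fun j => v (i.succAbove j))
    have h5 : (-1 : ℤ) ^ (i : ℕ) • g (i.insertNth x (fun j => v (i.succAbove j))) =
      (-1 : ℝ) ^ (i : ℕ) • g (i.insertNth x (fun j => v (i.succAbove j))) := by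
      rcases Nat.even_or_odd (i : ℕ) with h | h <;> simp [h.neg_one_pow]
    rw [← this, h5, smul_smul, ← mul_pow, neg_one_mul, neg_neg, one_pow, one_smul]
    congr 1
    exact Fin.insertNth_removeNth i x v
  rw [h1]
  have h3 : ∀ i : Fin (N + 1), (-1 : ℝ) ^ (i : ℕ) •
      ((1 / 2 : ℝ) • g (Matrix.vecCons (v i) (fun j => v (i.succAbove j))) -
      Complex.I • (1 / 2 : ℝ) •
        g (Matrix.vecCons (Complex.I • v i) (fun j => v (i.succAbove j)))) =
      (1 / 2 : ℝ) • g v - (Complex.I * (1 / 2 : ℝ)) • g (Function.update v i (Complex.I • v i)) := by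
    intro i
    rw [smul_sub, smul_comm _ (1 / 2 : ℝ), h2, Function.update_eq_self, smul_comm _ Complex.I,
      smul_comm _ (1 / 2 : ℝ), h2, mul_smul, Complex.coe_smul]
  rw [Finset.sum_congr rfl fun i _ => h3 i, Finset.sum_sub_distrib,
    ← Finset.smul_sum (r := Complex.I * ((1 / 2 : ℝ) : ℂ)),
    hg.sum_update, Finset.sum_const, Finset.card_univ, Fintype.card_fin, smul_smul,
    AlternatingMap.smul_apply, ← Complex.coe_smul, ← Nat.cast_smul_eq_nsmul ℂ, smul_smul, ← sub_smul]
  congr 1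
  have : ((N + 1 : ℕ) : ℂ) = p + q := by rw [hN]; push_cast; rfl
  rw [this]
  push_cast
  linear_combination (-(1 / 2 : ℂ) * (p - q)) * Complex.I_mul_I

lemma dzProj_dzProj_self {n : ℕ} (a : Fin n) (g : Cn n [⋀^Fin (N + 1)]→ₗ[ℝ] W) :
    dzProj a (dzProj a g) = dzProj a g := by
  rcases N with _ | N
  · simp only [dzProj]
    rw [cint_wedge_zero, coordC_pairing, if_pos rfl, one_smul]
  · simp only [dzProj]
    rw [cint_wedge, coordC_pairing, if_pos rfl, one_smul]
    set i := cint ((1 / 2 : ℝ) • EuclideanSpace.single a (1 : ℂ))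
      (-(1 / 2 : ℝ) • Complex.I • EuclideanSpace.single a (1 : ℂ)) g
    have h : wedge ((coordC n a).restrictScalars ℝ) (wedge ((coordC n a).restrictScalars ℝ)
        (cint ((1 / 2 : ℝ) • EuclideanSpace.single a (1 : ℂ))
          (-(1 / 2 : ℝ) • Complex.I • EuclideanSpace.single a (1 : ℂ)) i)) = 0 := by
      have := wedge_self ((coordC n a).restrictScalars ℝ)
        (cint ((1 / 2 : ℝ) • EuclideanSpace.single a (1 : ℂ))
          (-(1 / 2 : ℝ) • Complex.I • EuclideanSpace.single a (1 : ℂ)) i)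
      exact this
    rw [wedge_sub_right, h, sub_zero]

lemma dzProj_comm {n : ℕ} (a b : Fin n) (g : Cn n [⋀^Fin (N + 1)]→ₗ[ℝ] W) :
    dzProj a (dzProj b g) = dzProj b (dzProj a g) := by
  by_cases hab : a = b
  · subst hab; rfl
  rcases N with _ | N
  · simp only [dzProj]
    rw [cint_wedge_zero, coordC_pairing, if_neg (Ne.symm hab), cint_wedge_zero, coordC_pairing,
      if_neg hab, zero_smul, zero_smul, wedge_zero_right, wedge_zero_right]
  · simp only [dzProj]
    rw [cint_wedge, coordC_pairing, if_neg (Ne.symm hab), cint_wedge, coordC_pairing,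
      if_neg hab, zero_smul, zero_smul, zero_sub, zero_sub, wedge_neg_right, wedge_neg_right,
      wedge_wedge, cint_cint, wedge_neg_right, wedge_neg_right, neg_neg]

/-- The exterior product of a complex linear form and a form of bidegree `(n, q)` vanishes. -/
theorem IsHomog.wedge_eq_zero {n q : ℕ} (hN : N = n + q) {g : Cn n [⋀^Fin N]→ₗ[ℝ] W}
    (hg : IsHomog n q g) (L : Cn n →ₗ[ℂ] ℂ) : wedge (L.restrictScalars ℝ) g = 0 := by
  have hθ : ∀ a, wedge ((coordC n a).restrictScalars ℝ) g = 0 := by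
    intro a
    rcases N with _ | N
    · exact absurd a.2 (by omega)
    let P : Fin n → Module.End ℂ (Cn n [⋀^Fin (N + 1)]→ₗ[ℝ] W) := fun a =>
      { toFun := dzProj a
        map_add' := fun u w => by simp only [dzProj, cint_add, wedge_add_right]
        map_smul' := fun c u => by simp only [dzProj, cint_smul, wedge_smul_right, RingHom.id_apply] }
    have hP : ∀ a u, P a u = dzProj a u := fun _ _ => rfl
    -- For holomorphic degree `n` the `n` commuting projections `1 - P a` sum to zero on `g`, so
    -- each of them kills `g`. Hence `g` is divisible by every dz_a.
    have h := apply_eq_zero_of_sum_projections (fun a => 1 - P a)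
      (fun a v => by
        simp only [LinearMap.sub_apply, Module.End.one_apply, map_sub, hP, dzProj_dzProj_self]
        abel)
      (fun a b v => by
        simp only [LinearMap.sub_apply, Module.End.one_apply, map_sub, hP, dzProj_comm a b]
        abel) Finset.univ g
      (by
        simp only [LinearMap.sub_apply, Module.End.one_apply, Finset.sum_sub_distrib, hP]
        rw [dzProj_sum hN hg, Finset.sum_const, Finset.card_univ, Fintype.card_fin,
          Nat.cast_smul_eq_nsmul, sub_self]) (Finset.mem_univ a)
    have h' : dzProj a g = g := (sub_eq_zero.1 h).symm
    rw [← h', dzProj]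
    exact wedge_self _ _
  have hL : L.restrictScalars ℝ =
      ∑ a, L (EuclideanSpace.single a (1 : ℂ)) • (coordC n a).restrictScalars ℝ := by
    ext w
    conv_lhs => rw [linearMap_eq_sum_coordC L]
    simp
  rw [hL, wedge_sum_left]
  exact Finset.sum_eq_zero fun a _ => by rw [wedge_smul_left, hθ, smul_zero]

lemma IsHomog.wedge_linear {V : Type*} [AddCommGroup V] [Module ℂ V] {p q : ℕ}
    {g : V [⋀^Fin N]→ₗ[ℝ] W} (hg : IsHomog p q g) (L : V →ₗ[ℂ] ℂ) :
    IsHomog (p + 1) q (wedge (L.restrictScalars ℝ) g) := by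
  intro c w
  rw [wedge_apply, wedge_apply, Finset.smul_sum]
  refine Finset.sum_congr rfl fun i _ => ?_
  rw [hg c, smul_comm _ ((-1 : ℝ) ^ (i : ℕ)), LinearMap.coe_restrictScalars, map_smul, smul_smul,
    smul_smul, smul_eq_mul]
  congr 2
  ring

/-- The exterior product of a real linear form and a form of bidegree `(n, q)` has bidegree
`(n, q + 1)`. -/
theorem IsHomog.wedge_real {n q : ℕ} (hN : N = n + q) {g : Cn n [⋀^Fin N]→ₗ[ℝ] W}
    (hg : IsHomog n q g) (τ : Cn n →ₗ[ℝ] ℂ) : IsHomog n (q + 1) (wedge τ g) := by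
  have hc : ∀ (c : ℂ) (w : Cn n), τ (c • w) = c.re * τ w + c.im * τ (Complex.I • w) := by
    intro c w
    conv_lhs => rw [← Complex.re_add_im c, add_smul, mul_smul, map_add]
    rw [Complex.coe_smul, Complex.coe_smul, map_smul, map_smul, Complex.real_smul,
      Complex.real_smul]
  have hI : ∀ w : Cn n, τ (Complex.I • Complex.I • w) = -τ w := fun w => by
    rw [smul_smul, Complex.I_mul_I, neg_one_smul, map_neg]
  -- The complex-linear part of `τ`. Its product with `g` vanishes by `IsHomog.wedge_eq_zero`, so
  -- only the antilinear part `τ₂` contributes, and it adds one conjugate factor.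
  let τ₁ : Cn n →ₗ[ℂ] ℂ :=
    { toFun := fun w => (τ w - Complex.I * τ (Complex.I • w)) / 2
      map_add' := fun v w => by rw [smul_add, map_add, map_add]; ring
      map_smul' := fun c w => by
        rw [smul_comm Complex.I c w, hc c, hc c, hI, RingHom.id_apply, smul_eq_mul]
        conv_rhs => enter [1]; rw [← Complex.re_add_im c]
        linear_combination ((c.im : ℂ) * τ (Complex.I • w) / 2 ) * Complex.I_mul_I }
  let τ₂ : Cn n →ₗ[ℝ] ℂ := τ - τ₁.restrictScalars ℝ
  have hτ₂ : ∀ w, τ₂ w = (τ w + Complex.I * τ (Complex.I • w)) / 2 := fun w => by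
    change τ w - (τ w - Complex.I * τ (Complex.I • w)) / 2 = _
    ring
  have hconj : ∀ (c : ℂ) (w : Cn n), τ₂ (c • w) = (starRingEnd ℂ c) * τ₂ w := by
    intro c w
    have : (starRingEnd ℂ) c = c.re - c.im * Complex.I := by
      apply Complex.ext <;> simp
    rw [hτ₂, hτ₂, smul_comm Complex.I c w, hc c, hc c, hI, this]
    linear_combination ((c.im : ℂ) * τ (Complex.I • w) / 2) * Complex.I_mul_I
  have hsplit : wedge τ g = wedge τ₂ g := by
    have : τ = τ₁.restrictScalars ℝ + τ₂ := by simp [τ₂]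
    conv_lhs => rw [this]
    rw [wedge_add_left, hg.wedge_eq_zero hN, zero_add]
  rw [hsplit]
  intro c w
  rw [wedge_apply, wedge_apply, Finset.smul_sum]
  refine Finset.sum_congr rfl fun i _ => ?_
  rw [hg c, smul_comm _ ((-1 : ℝ) ^ (i : ℕ)), hconj, smul_smul, smul_smul]
  congr 2
  ring

end Bidegree

/-! ### Forms annihilated by n independent complex covectors, with continuous coefficients. -/

section Representation

open AlternatingMap

variable {m : ℕ}

/-- The exterior product of a finite family of complex covectors. -/
def wedgeList {V : Type*} [AddCommGroup V] [Module ℝ V] :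
    (t : ℕ) → (Fin t → V →ₗ[ℝ] ℂ) → V [⋀^Fin t]→ₗ[ℝ] ℂ
  | 0, _ => AlternatingMap.constOfIsEmpty ℝ V (Fin 0) 1
  | t + 1, θ => wedge (θ 0) (wedgeList t (Fin.tail θ))

/-- Evaluation of a form of degree `t` on the complexified vectors `a j + i b j`. -/
def cevalList {V : Type*} [AddCommGroup V] [Module ℝ V] :
    (t : ℕ) → (a b : Fin t → V) → V [⋀^Fin t]→ₗ[ℝ] ℂ → ℂ
  | 0, _, _, u => u ![]
  | t + 1, a, b, u => cevalList t (Fin.tail a) (Fin.tail b) (cint (a 0) (b 0) u)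

lemma cevalList_zero_right {V : Type*} [AddCommGroup V] [Module ℝ V] (t : ℕ) (a b : Fin t → V) :
    cevalList t a b 0 = 0 := by
  induction t with
  | zero => rfl
  | succ t ih => rw [cevalList, cint_zero, ih]

/-- The covectors `θ` are dual to the complexified vectors `a + i b`. -/
def IsDualFamily {V : Type*} [AddCommGroup V] [Module ℝ V] {t : ℕ} (θ : Fin t → V →ₗ[ℝ] ℂ)
    (a b : Fin t → V) : Prop :=
  ∀ i j, θ i (a j) + Complex.I * θ i (b j) = if i = j then 1 else 0

/-- Contracting `θ 0 ∧ u = 0` with the first dual vector gives `u = θ 0 ∧ (contraction)`. By duality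
the contraction is again annihilated by the remaining covectors, so the argument repeats. -/
lemma eq_ceval_smul_wedgeList {V : Type*} [AddCommGroup V] [Module ℝ V] (t : ℕ)
    (θ : Fin t → V →ₗ[ℝ] ℂ) (a b : Fin t → V) (h : IsDualFamily θ a b)
    (u : V [⋀^Fin t]→ₗ[ℝ] ℂ) (hu : ∀ i, wedge (θ i) u = 0) :
    u = cevalList t a b u • wedgeList t θ := by
  induction t with
  | zero =>
    ext v
    simp [cevalList, wedgeList, Subsingleton.elim v ![]]
  | succ t ih =>
    have h0 := cint_wedge (a 0) (b 0) (θ 0) u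
    rw [hu, cint_zero, h, if_pos rfl, one_smul, eq_comm, sub_eq_zero] at h0
    have h1 := ih (Fin.tail θ) (Fin.tail a) (Fin.tail b)
      (fun i j => by simpa [Fin.tail] using h i.succ j.succ) (cint (a 0) (b 0) u) (fun i => by
        have := cint_wedge (a 0) (b 0) (θ i.succ) u
        rw [hu, cint_zero, h, if_neg (Fin.succ_ne_zero i), zero_smul, zero_sub, eq_comm,
          neg_eq_zero] at this
        exact this)
    rw [wedgeList, cevalList, ← wedge_smul_right, ← h1]
    exact h0

/-- The real coordinate functions of `ℝᵐ`, with complex values. -/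
def coordR (k : Fin m) : Rm m →ₗ[ℝ] ℂ :=
  (Complex.ofRealCLM ∘L (EuclideanSpace.proj k : Rm m →L[ℝ] ℝ) : Rm m →L[ℝ] ℂ)

lemma sum_coordR_smul {W : Type*} [AddCommGroup W] [Module ℂ W] (L : Rm m →ₗ[ℝ] W) (w : Rm m) :
    ∑ k, coordR k w • L (EuclideanSpace.single k 1) = L w := by
  have hw : w = ∑ k, w k • EuclideanSpace.single k (1 : ℝ) := by
    ext b
    simp [Pi.single_apply]
  conv_rhs => rw [hw, map_sum]
  refine Finset.sum_congr rfl fun k _ => ?_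
  rw [map_smul, ← Complex.coe_smul]
  rfl

lemma sum_wedge_coordR {W : Type*} [AddCommGroup W] [Module ℂ W] {N : ℕ}
    (u : Rm m [⋀^Fin (N + 1)]→ₗ[ℝ] W) :
    ∑ k, wedge (coordR k) (u.curryLeft (EuclideanSpace.single k 1)) = ((N + 1 : ℕ) : ℂ) • u := by
  have h := alternatizeUncurryFin_curryLeft u
  rw [Nat.cast_smul_eq_nsmul, ← h]
  ext v
  rw [alternatingMap_sum_apply, alternatizeUncurryFin_apply]
  simp only [wedge_apply]
  rw [Finset.sum_comm]
  refine Finset.sum_congr rfl fun i _ => ?_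
  rw [← Finset.smul_sum]
  have h2 := congrArg (fun w : Rm m [⋀^Fin N]→ₗ[ℝ] W => w (fun j => v (i.succAbove j)))
    (sum_coordR_smul u.curryLeft (v i))
  rw [alternatingMap_sum_apply] at h2
  simp only [AlternatingMap.smul_apply] at h2
  rw [h2]
  rcases Nat.even_or_odd (i : ℕ) with h | h <;> simp [h.neg_one_pow] <;> rfl

lemma sum_smul_wedge_coordR {W : Type*} [AddCommGroup W] [Module ℂ W] {N : ℕ}
    (τ : Rm m →ₗ[ℝ] ℂ) (u : Rm m [⋀^Fin N]→ₗ[ℝ] W) :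
    ∑ k, wedge (coordR k) (τ (EuclideanSpace.single k 1) • u) = wedge τ u := by
  have : τ = ∑ k, τ (EuclideanSpace.single k 1) • coordR k := by
    ext w
    have := sum_coordR_smul τ w
    rw [← this]
    simp [mul_comm]
  conv_rhs => rw [this]
  rw [wedge_sum_left]
  exact Finset.sum_congr rfl fun k _ => by rw [wedge_smul_right, wedge_smul_left]

variable {n : ℕ} (θ : Fin n → Rm m →ₗ[ℝ] ℂ) (a b : Fin n → Rm m)

/-- Interior product with the `k`-th coordinate vector, projected to the common kernel of the
covectors `θ` along the complexified vectors `a + i b`. -/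
def projInt {N : ℕ} (k : Fin m) (u : Rm m [⋀^Fin (N + 1)]→ₗ[ℝ] ℂ) : Rm m [⋀^Fin N]→ₗ[ℝ] ℂ :=
  u.curryLeft (EuclideanSpace.single k 1) -
    ∑ j, θ j (EuclideanSpace.single k 1) • cint (a j) (b j) u

/-- The coefficients of a form of bidegree `(n, s)` with respect to the forms `stdForm θ s J`. -/
def stdCoeff : (s : ℕ) → (Fin s → Fin m) → Rm m [⋀^Fin (n + s)]→ₗ[ℝ] ℂ → ℂ
  | 0, _, u => cevalList n a b u
  | s + 1, J, u => ((s + 1 : ℕ) : ℂ)⁻¹ * stdCoeff s (Fin.tail J) (projInt θ a b (J 0) u)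

/-- The forms `dx_{J 0} ∧ … ∧ dx_{J (s - 1)} ∧ θ_0 ∧ … ∧ θ_{n - 1}`. -/
def stdForm : (s : ℕ) → (Fin s → Fin m) → Rm m [⋀^Fin (n + s)]→ₗ[ℝ] ℂ
  | 0, _ => wedgeList n θ
  | s + 1, J => wedge (coordR (J 0)) (stdForm s (Fin.tail J))

lemma stdCoeff_zero_right (s : ℕ) (J : Fin s → Fin m) : stdCoeff θ a b s J 0 = 0 := by
  induction s with
  | zero => exact cevalList_zero_right _ _ _
  | succ s ih =>
    have : projInt θ a b (J 0) (0 : Rm m [⋀^Fin (n + s + 1)]→ₗ[ℝ] ℂ) = 0 := by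
      simp [projInt, cint_zero]
    rw [stdCoeff]
    exact mul_eq_zero_of_right _ ((congrArg _ this).trans (ih _))

/-- Contract `u` with the k-th coordinate vector, projected along the dual vectors into the common
kernel of the `θ j`. The result is still annihilated by all `θ i`, and summing dx_k ∧ (contraction)
over k gives (n + s + 1)u - n u = (s + 1)u. This is the source of the factor (s + 1)⁻¹ in
`stdCoeff`. The multi-indices `J` are unrestricted, so the forms `stdForm` are a spanning family and
not a basis. -/
theorem eq_sum_stdCoeff_smul_stdForm (h : IsDualFamily θ a b) (s : ℕ)
    (u : Rm m [⋀^Fin (n + s)]→ₗ[ℝ] ℂ) (hu : ∀ i, wedge (θ i) u = 0) :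
    u = ∑ J : Fin s → Fin m, stdCoeff θ a b s J u • stdForm θ s J := by
  induction s with
  | zero =>
    rw [Fintype.sum_unique]
    exact eq_ceval_smul_wedgeList n θ a b h u hu
  | succ s ih =>
    have hann : ∀ k i, wedge (θ i) (projInt θ a b k (N := n + s) u) = 0 := by
      intro k i
      have h1 := curryLeft_wedge (θ i) (N := n + s) u (EuclideanSpace.single k 1)
      have hui : wedge (θ i) (N := n + s + 1) u = 0 := hu i
      rw [hui] at h1
      have h1' : wedge (θ i) (AlternatingMap.curryLeft (n := n + s) u (EuclideanSpace.single k 1)) =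
          θ i (EuclideanSpace.single k 1) • u := (sub_eq_zero.1 h1.symm).symm
      have h2 : ∀ j, wedge (θ i) (cint (N := n + s) (a j) (b j) u) = (if i = j then 1 else 0 : ℂ) • u := by
        intro j
        have := cint_wedge (N := n + s) (a j) (b j) (θ i) u
        rw [hui, cint_zero, h] at this
        exact (sub_eq_zero.1 this.symm).symm
      rw [projInt, wedge_sub_right, wedge_sum_right, h1', sub_eq_zero]
      simp only [wedge_smul_right, h2]
      simp
    have hsum : ∑ k, wedge (coordR k) (projInt θ a b k (N := n + s) u) = ((s + 1 : ℕ) : ℂ) • u := by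
      have h1 : ∀ j, wedge (θ j) (cint (N := n + s) (a j) (b j) u) = u := by
        intro j
        have := cint_wedge (N := n + s) (a j) (b j) (θ j) u
        have hui : wedge (θ j) (N := n + s + 1) u = 0 := hu j
        rw [hui, cint_zero, h, if_pos rfl, one_smul] at this
        exact (sub_eq_zero.1 this.symm).symm
      simp only [projInt, wedge_sub_right, wedge_sum_right, Finset.sum_sub_distrib]
      rw [sum_wedge_coordR, Finset.sum_comm]
      simp only [sum_smul_wedge_coordR, h1]
      rw [Finset.sum_const, Finset.card_univ, Fintype.card_fin, ← Nat.cast_smul_eq_nsmul ℂ, ← sub_smul]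
      congr 1
      push_cast
      ring
    have h3 : u = ∑ k, ((s + 1 : ℕ) : ℂ)⁻¹ • wedge (coordR k) (projInt θ a b k (N := n + s) u) := by
      rw [← Finset.smul_sum, hsum, smul_smul, inv_mul_cancel₀ (Nat.cast_ne_zero.2 (Nat.succ_ne_zero s)), one_smul]
    conv_lhs => rw [h3]
    rw [Fintype.sum_equiv (Fin.consEquiv (fun _ => Fin m)).symm _
      (fun p : Fin m × (Fin s → Fin m) => stdCoeff θ a b (s + 1) (Fin.cons p.1 p.2) u •
        stdForm θ (s + 1) (Fin.cons p.1 p.2)) (fun J => by simp), Fintype.sum_prod_type]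
    refine Finset.sum_congr rfl fun k _ => ?_
    conv_lhs => rw [ih _ (hann k), wedge_sum_right, Finset.smul_sum]
    refine Finset.sum_congr rfl fun J _ => ?_
    rw [wedge_smul_right, smul_smul]
    rfl

lemma alternating_expand {W : Type*} [AddCommGroup W] [Module ℂ W] {N : ℕ}
    (u : Rm m [⋀^Fin N]→ₗ[ℝ] W) (v : Fin N → Rm m) :
    u v = ∑ I : Fin N → Fin m, (∏ j, v j (I j)) • u (fun j => EuclideanSpace.single (I j) 1) := by
  have hv : v = fun j => ∑ k, v j k • EuclideanSpace.single k (1 : ℝ) := by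
    funext j
    ext b
    simp [Pi.single_apply]
  conv_lhs => rw [hv]
  have := u.toMultilinearMap.map_sum (fun j k => v j k • EuclideanSpace.single k (1 : ℝ))
  refine this.trans (Finset.sum_congr rfl fun I _ => ?_)
  exact u.toMultilinearMap.map_smul_univ (fun j => v j (I j)) _

variable {θ a b}
variable {Y : Type*} [TopologicalSpace Y] {D : Set Y}

lemma continuousOn_alternating {N : ℕ} {u : Y → Rm m [⋀^Fin N]→ₗ[ℝ] ℂ}
    (hu : ∀ v, ContinuousOn (fun y => u y v) D) {v : Y → Fin N → Rm m} (hv : ContinuousOn v D) :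
    ContinuousOn (fun y => u y (v y)) D := by
  simp only [alternating_expand (u _) (v _)]
  refine continuousOn_finsetSum _ fun I _ =>
    ContinuousOn.smul (f := fun y => ∏ j, v y j (I j)) ?_ (hu _)
  have h : ∀ j, ContinuousOn (fun y => v y j (I j)) D := fun j =>
    (EuclideanSpace.proj (I j) : Rm m →L[ℝ] ℝ).continuous.comp_continuousOn
      (continuousOn_pi.1 hv j)
  fun_prop

lemma continuousOn_cint {N : ℕ} {u : Y → Rm m [⋀^Fin (N + 1)]→ₗ[ℝ] ℂ}
    (hu : ∀ v, ContinuousOn (fun y => u y v) D) {a b : Y → Rm m} (ha : ContinuousOn a D)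
    (hb : ContinuousOn b D) (v : Fin N → Rm m) :
    ContinuousOn (fun y => cint (a y) (b y) (u y) v) D := by
  have hc : ∀ {a : Y → Rm m}, ContinuousOn a D →
      ContinuousOn (fun y => (Matrix.vecCons (a y) v : Fin (N + 1) → Rm m)) D := fun ha =>
    continuousOn_pi.2 fun j => by
      refine Fin.cases ?_ (fun j => ?_) j
      · simpa using ha
      · simpa using continuousOn_const
  exact (continuousOn_alternating hu (hc ha)).add
    ((continuousOn_alternating hu (hc hb)).const_smul Complex.I)

lemma continuousOn_cevalList (t : ℕ) {u : Y → Rm m [⋀^Fin t]→ₗ[ℝ] ℂ}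
    (hu : ∀ v, ContinuousOn (fun y => u y v) D) {a b : Fin t → Y → Rm m}
    (ha : ∀ j, ContinuousOn (a j) D) (hb : ∀ j, ContinuousOn (b j) D) :
    ContinuousOn (fun y => cevalList t (fun j => a j y) (fun j => b j y) (u y)) D := by
  induction t with
  | zero => exact hu ![]
  | succ t ih =>
    exact ih (u := fun y => cint (a 0 y) (b 0 y) (u y))
      (fun v => continuousOn_cint hu (ha 0) (hb 0) v) (a := fun j => a j.succ)
      (b := fun j => b j.succ) (fun j => ha j.succ) (fun j => hb j.succ)

/-- An explicit choice of coefficients is needed for this: they are built from `u`, the covectors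
and the dual vectors by contractions and products only, so continuity is inherited. -/
theorem continuousOn_stdCoeff {θ : Fin n → Y → Rm m →ₗ[ℝ] ℂ} {a b : Fin n → Y → Rm m}
    (hθ : ∀ j k, ContinuousOn (fun y => θ j y (EuclideanSpace.single k 1)) D)
    (ha : ∀ j, ContinuousOn (a j) D) (hb : ∀ j, ContinuousOn (b j) D) (s : ℕ)
    (J : Fin s → Fin m) {u : Y → Rm m [⋀^Fin (n + s)]→ₗ[ℝ] ℂ}
    (hu : ∀ v, ContinuousOn (fun y => u y v) D) :
    ContinuousOn
      (fun y => stdCoeff (fun j => θ j y) (fun j => a j y) (fun j => b j y) s J (u y)) D := by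
  induction s with
  | zero => exact continuousOn_cevalList n hu ha hb
  | succ s ih =>
    refine continuousOn_const.mul (ih (Fin.tail J)
      (u := fun y => projInt (fun j => θ j y) (fun j => a j y) (fun j => b j y) (J 0) (u y)) ?_)
    intro v
    simp only [projInt, AlternatingMap.sub_apply, alternatingMap_sum_apply, AlternatingMap.smul_apply]
    exact (hu _).sub (continuousOn_finsetSum _ fun j _ =>
      (hθ j (J 0)).smul (continuousOn_cint hu (ha j) (hb j) v))

end Representation

end
end CRForms

namespace CRForms
noncomputable section

/-! ### Calculus of germs of class C^{l+α}. -/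

section Germs

open Filter

variable {V V' : Type} [NormedAddCommGroup V] [NormedSpace ℝ V] [NormedAddCommGroup V']
  [NormedSpace ℝ V'] {G G' : Type*} [NormedAddCommGroup G] [NormedSpace ℝ G]
  [NormedAddCommGroup G'] [NormedSpace ℝ G'] {α : ℝ} {y : V}

/-- `w` is Hölder continuous with exponent `α` on a neighborhood of `y`. -/
def LocHolder (α : ℝ) (w : V → G) (y : V) : Prop :=
  ∃ C : ℝ, 0 ≤ C ∧ ∃ t ∈ 𝓝 y, ∀ a ∈ t, ∀ b ∈ t, ‖w a - w b‖ ≤ C * dist a b ^ α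

/-- The germ of `w` at `y` is of class `C^{l + α}`. -/
def RegAt (l : ℕ∞) (α : ℝ) (w : V → G) (y : V) : Prop :=
  ContDiffAt ℝ l w y ∧ ∀ i : ℕ, (i : ℕ∞) ≤ l → LocHolder α (iteratedFDeriv ℝ i w) y

lemma LocHolder.congr {w w' : V → G} (h : LocHolder α w y) (he : w' =ᶠ[𝓝 y] w) :
    LocHolder α w' y := by
  obtain ⟨C, hC, t, ht, h⟩ := h
  refine ⟨C, hC, _, inter_mem ht he, fun a ha b hb => ?_⟩
  rw [ha.2, hb.2]
  exact h a ha.1 b hb.1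

lemma LocHolder.add {w w' : V → G} (h : LocHolder α w y) (h' : LocHolder α w' y) :
    LocHolder α (fun z => w z + w' z) y := by
  obtain ⟨C, hC, t, ht, h⟩ := h
  obtain ⟨C', hC', t', ht', h'⟩ := h'
  refine ⟨C + C', add_nonneg hC hC', _, inter_mem ht ht', fun a ha b hb => ?_⟩
  rw [add_sub_add_comm, add_mul]
  exact (norm_add_le _ _).trans (add_le_add (h a ha.1 b hb.1) (h' a ha.2 b hb.2))

lemma locHolder_of_contDiffAt_one (_hα0 : 0 ≤ α) (hα1 : α ≤ 1) {w : V → G}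
    (hw : ContDiffAt ℝ 1 w y) : LocHolder α w y := by
  obtain ⟨K, t, ht, hK⟩ := hw.exists_lipschitzOnWith
  -- Radius 1/2 keeps all distances at most 1, where `d ≤ d ^ α`.
  refine ⟨K, K.2, _, inter_mem ht (Metric.ball_mem_nhds y (by norm_num : (0 : ℝ) < 1 / 2)),
    fun a ha b hb => ?_⟩
  rw [← dist_eq_norm]
  refine (hK.dist_le_mul a ha.1 b hb.1).trans (mul_le_mul_of_nonneg_left ?_ K.2)
  have h1 : dist a b ≤ 1 := by
    have h2 := Metric.mem_ball.1 ha.2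
    have h3 := Metric.mem_ball'.1 hb.2
    linarith [dist_triangle a y b]
  rcases eq_or_lt_of_le (dist_nonneg (x := a) (y := b)) with h0 | h0
  · rw [← h0]; exact Real.rpow_nonneg le_rfl _
  · conv_lhs => rw [← Real.rpow_one (dist a b)]
    exact Real.rpow_le_rpow_of_exponent_ge h0 h1 hα1

/-- With exponent 0 the Hölder condition only bounds the local oscillation. Thus `RegAt l 0` means
class C^l, and one calculus serves both C^l and C^{l+α}. -/
lemma locHolder_zero_of_continuousAt {w : V → G} (hw : ContinuousAt w y) : LocHolder 0 w y := by
  refine ⟨2, by norm_num, _, hw.preimage_mem_nhds (Metric.ball_mem_nhds _ one_pos),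
    fun a ha b hb => ?_⟩
  rw [Real.rpow_zero, mul_one, ← dist_eq_norm]
  have h2 := Metric.mem_ball.1 ha
  have h3 := Metric.mem_ball'.1 hb
  linarith [dist_triangle (w a) (w y) (w b)]

lemma exists_bound_of_continuousAt {w : V → G} (hw : ContinuousAt w y) :
    ∃ C, 0 ≤ C ∧ ∀ᶠ z in 𝓝 y, ‖w z‖ ≤ C := by
  refine ⟨‖w y‖ + 1, by positivity, ?_⟩
  filter_upwards [hw.norm.eventually (gt_mem_nhds (lt_add_one ‖w y‖))] with z hz using hz.le

lemma LocHolder.clm_apply {M : V → G →L[ℝ] G'} {w : V → G} (hM : LocHolder α M y)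
    (hMc : ContinuousAt M y) (hw : LocHolder α w y) (hwc : ContinuousAt w y) :
    LocHolder α (fun z => M z (w z)) y := by
  obtain ⟨C, hC, t, ht, h⟩ := hM
  obtain ⟨C', hC', t', ht', h'⟩ := hw
  obtain ⟨D, hD, hMD⟩ := exists_bound_of_continuousAt hMc
  obtain ⟨D', hD', hwD⟩ := exists_bound_of_continuousAt hwc
  refine ⟨D * C' + C * D', by positivity, _,
    inter_mem (inter_mem ht ht') (inter_mem hMD hwD), fun a ha b hb => ?_⟩
  have e : M a (w a) - M b (w b) = M a (w a - w b) + (M a - M b) (w b) := by simp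
  rw [e]
  refine (norm_add_le _ _).trans ?_
  have h1 : ‖M a (w a - w b)‖ ≤ D * (C' * dist a b ^ α) :=
    ((M a).le_opNorm _).trans (mul_le_mul ha.2.1 (h' a ha.1.2 b hb.1.2) (norm_nonneg _) hD)
  have h2 : ‖(M a - M b) (w b)‖ ≤ C * dist a b ^ α * D' :=
    ((M a - M b).le_opNorm _).trans (mul_le_mul (h a ha.1.1 b hb.1.1) hb.2.2 (norm_nonneg _)
      (mul_nonneg hC (Real.rpow_nonneg dist_nonneg _)))
  linarith

lemma LocHolder.comp (hα0 : 0 ≤ α) {τ : V' → V} {x : V'} {w : V → G} (hw : LocHolder α w (τ x))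
    (hτ : ContDiffAt ℝ 1 τ x) : LocHolder α (w ∘ τ) x := by
  obtain ⟨K, t, ht, hK⟩ := hτ.exists_lipschitzOnWith
  obtain ⟨C, hC, s, hs, h⟩ := hw
  refine ⟨C * (K : ℝ) ^ α, mul_nonneg hC (Real.rpow_nonneg K.2 _), _,
    inter_mem ht (hτ.continuousAt.preimage_mem_nhds hs), fun a ha b hb => ?_⟩
  refine (h _ ha.2 _ hb.2).trans ?_
  have e : (K : ℝ) ^ α * dist a b ^ α = (K * dist a b) ^ α :=
    (Real.mul_rpow K.2 dist_nonneg).symm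
  rw [mul_assoc, e]
  exact mul_le_mul_of_nonneg_left
    (Real.rpow_le_rpow dist_nonneg (hK.dist_le_mul a ha.1 b hb.1) hα0) hC

lemma locHolder_iteratedFDeriv_succ {i : ℕ} {w : V → G} :
    LocHolder α (iteratedFDeriv ℝ (i + 1) w) y ↔
      LocHolder α (iteratedFDeriv ℝ i (fderiv ℝ w)) y := by
  have h : ∀ a b, ‖iteratedFDeriv ℝ (i + 1) w a - iteratedFDeriv ℝ (i + 1) w b‖ =
      ‖iteratedFDeriv ℝ i (fderiv ℝ w) a - iteratedFDeriv ℝ i (fderiv ℝ w) b‖ := by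
    intro a b
    have e : ∀ a, iteratedFDeriv ℝ (i + 1) w a =
        (continuousMultilinearCurryRightEquiv' ℝ i V G).symm (iteratedFDeriv ℝ i (fderiv ℝ w) a) :=
      fun a => by rw [iteratedFDeriv_succ_eq_comp_right]; rfl
    rw [e, e, ← dist_eq_norm, ← dist_eq_norm]
    exact LinearIsometryEquiv.dist_map _ _ _
  simp only [LocHolder, h]

lemma locHolder_iteratedFDeriv_zero {w : V → G} :
    LocHolder α (iteratedFDeriv ℝ 0 w) y ↔ LocHolder α w y := by
  have h : ∀ a b, ‖iteratedFDeriv ℝ 0 w a - iteratedFDeriv ℝ 0 w b‖ = ‖w a - w b‖ := by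
    intro a b
    rw [iteratedFDeriv_zero_eq_comp, Function.comp_apply, Function.comp_apply, ← map_sub,
      LinearIsometryEquiv.norm_map]
  simp only [LocHolder, h]

lemma RegAt.of_le {l l' : ℕ∞} {w : V → G} (h : RegAt l α w y) (hl : l' ≤ l) : RegAt l' α w y :=
  ⟨h.1.of_le (by exact_mod_cast hl), fun i hi => h.2 i (hi.trans hl)⟩

lemma RegAt.locHolder {l : ℕ∞} {w : V → G} (h : RegAt l α w y) : LocHolder α w y :=
  locHolder_iteratedFDeriv_zero.1 (h.2 0 (by simp))

lemma RegAt.continuousAt {l : ℕ∞} {w : V → G} (h : RegAt l α w y) : ContinuousAt w y :=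
  h.1.continuousAt

lemma regAt_iff_forall_nat {l : ℕ∞} {w : V → G} :
    RegAt l α w y ↔ ∀ k : ℕ, (k : ℕ∞) ≤ l → RegAt k α w y := by
  refine ⟨fun h k hk => h.of_le hk, fun h => ⟨?_, fun i hi => (h i hi).2 i le_rfl⟩⟩
  induction l using ENat.recTopCoe with
  | top => exact contDiffAt_infty.2 fun k => (h k le_top).1
  | coe k => exact (h k le_rfl).1

lemma regAt_zero_iff {w : V → G} :
    RegAt 0 α w y ↔ ContDiffAt ℝ 0 w y ∧ LocHolder α w y := by
  refine ⟨fun h => ⟨by simpa using h.1, h.locHolder⟩, fun h => ⟨by simpa using h.1, fun i hi => ?_⟩⟩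
  have : i = 0 := by exact_mod_cast nonpos_iff_eq_zero.1 hi
  subst this
  exact locHolder_iteratedFDeriv_zero.2 h.2

lemma regAt_succ_iff {l : ℕ} {w : V → G} :
    RegAt (l + 1 : ℕ) α w y ↔ (∀ᶠ z in 𝓝 y, DifferentiableAt ℝ w z) ∧ LocHolder α w y ∧
      RegAt l α (fderiv ℝ w) y := by
  constructor
  · intro h
    have h1 : ContDiffAt ℝ ((l : ℕ) + 1 : WithTop ℕ∞) w y := by simpa using h.1
    refine ⟨?_, h.locHolder, ?_, fun i hi => ?_⟩
    · obtain ⟨f', ⟨u, hu, hf⟩, -⟩ := contDiffAt_succ_iff_hasFDerivAt.1 h1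
      filter_upwards [hu] with z hz using (hf z hz).differentiableAt
    · exact h1.fderiv_right le_rfl
    · refine locHolder_iteratedFDeriv_succ.1 (h.2 (i + 1) ?_)
      exact_mod_cast Nat.succ_le_succ (by exact_mod_cast hi)
  · rintro ⟨hd, h0, h1⟩
    refine ⟨?_, fun i hi => ?_⟩
    · have : ContDiffAt ℝ ((l : ℕ) + 1 : WithTop ℕ∞) w y :=
        contDiffAt_succ_iff_hasFDerivAt.2 ⟨fderiv ℝ w, ⟨_, hd, fun z hz => hz.hasFDerivAt⟩, h1.1⟩
      simpa using this
    · rcases i with _ | i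
      · exact locHolder_iteratedFDeriv_zero.2 h0
      · refine locHolder_iteratedFDeriv_succ.2 (h1.2 i ?_)
        have : i + 1 ≤ l + 1 := by exact_mod_cast hi
        exact_mod_cast Nat.le_of_succ_le_succ this

lemma RegAt.congr {l : ℕ∞} {w w' : V → G} (h : RegAt l α w y) (he : w' =ᶠ[𝓝 y] w) :
    RegAt l α w' y :=
  ⟨h.1.congr_of_eventuallyEq he, fun i hi => (h.2 i hi).congr (he.iteratedFDeriv ℝ i)⟩

lemma regAt_of_contDiffAt_infty (hα0 : 0 ≤ α) (hα1 : α ≤ 1) {w : V → G}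
    (hw : ContDiffAt ℝ ∞ w y) (l : ℕ∞) : RegAt l α w y :=
  ⟨hw.of_le (by exact_mod_cast le_top), fun i _ => locHolder_of_contDiffAt_one hα0 hα1
    (hw.iteratedFDeriv_right (m := 1) (i := i) (by exact_mod_cast le_top))⟩

lemma regAt_zero_of_contDiffAt {l : ℕ∞} {w : V → G} (hw : ContDiffAt ℝ l w y) : RegAt l 0 w y :=
  ⟨hw, fun i hi => locHolder_zero_of_continuousAt
    (hw.iteratedFDeriv_right (m := 0) (i := i) (by
      rw [zero_add]; exact_mod_cast hi)).continuousAt⟩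

lemma RegAt.add {l : ℕ∞} {w w' : V → G} (h : RegAt l α w y) (h' : RegAt l α w' y) :
    RegAt l α (fun z => w z + w' z) y := by
  refine ⟨h.1.add h'.1, fun i hi => ((h.2 i hi).add (h'.2 i hi)).congr ?_⟩
  have hi' : (i : WithTop ℕ∞) ≤ (l : WithTop ℕ∞) := by exact_mod_cast hi
  have h1 := (h.1.of_le hi').eventually (by simp)
  have h2 := (h'.1.of_le hi').eventually (by simp)
  filter_upwards [h1, h2] with z hz hz' using iteratedFDeriv_add_apply hz hz'

lemma regAt_const (c : G) (l : ℕ∞) : RegAt l α (fun _ : V => c) y := by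
  refine ⟨contDiffAt_const, fun i _ => ⟨0, le_rfl, Set.univ, univ_mem, fun a _ b _ => ?_⟩⟩
  rcases i with _ | i
  · have e : ∀ z : V, iteratedFDeriv ℝ 0 (fun _ : V => c) z = iteratedFDeriv ℝ 0 (fun _ : V => c) a :=
      fun z => by ext v; simp
    rw [e b, sub_self]; simp
  · rw [iteratedFDeriv_const_of_ne (Nat.succ_ne_zero i)]; simp

lemma RegAt.sum {l : ℕ∞} {κ : Type*} (s : Finset κ) {w : κ → V → G}
    (h : ∀ i ∈ s, RegAt l α (w i) y) : RegAt l α (fun z => ∑ i ∈ s, w i z) y := by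
  classical
  induction s using Finset.induction_on with
  | empty => simpa using regAt_const (0 : G) l
  | insert i s hi ih =>
    simp only [Finset.sum_insert hi]
    exact (h i (Finset.mem_insert_self i s)).add
      (ih fun j hj => h j (Finset.mem_insert_of_mem hj))

lemma RegAt.locHolder_clm_apply (hα0 : 0 ≤ α) (hα1 : α ≤ 1) {l : ℕ∞} {M : V → G →L[ℝ] G'}
    (hM : ContDiffAt ℝ ∞ M y) {w : V → G} (hw : RegAt l α w y) :
    LocHolder α (fun z => M z (w z)) y :=
  (locHolder_of_contDiffAt_one hα0 hα1 (hM.of_le (by exact_mod_cast le_top))).clm_apply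
    hM.continuousAt hw.locHolder hw.continuousAt

/-- Induction on `l` with the product rule: both terms of the derivative are again a smooth family
of operators applied to a germ, but between other spaces, whence the generalization over `G` and
`G'`. That `V` lies in `Type` keeps `V →L[ℝ] G` in the universe of `G`. -/
lemma RegAt.clm_apply_nat (hα0 : 0 ≤ α) (hα1 : α ≤ 1) (l : ℕ) {M : V → G →L[ℝ] G'}
    (hM : ContDiffAt ℝ ∞ M y) {w : V → G} (hw : RegAt l α w y) :
    RegAt l α (fun z => M z (w z)) y := by
  induction l generalizing G G' with
  | zero =>
    have h := regAt_zero_iff.1 hw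
    exact regAt_zero_iff.2 ⟨(hM.of_le (by exact_mod_cast le_top)).clm_apply h.1,
      hw.locHolder_clm_apply hα0 hα1 hM⟩
  | succ l ih =>
    obtain ⟨hd, -, h1⟩ := regAt_succ_iff.1 hw
    have hMd : ∀ᶠ z in 𝓝 y, DifferentiableAt ℝ M z := by
      have := (hM.of_le (m := 1) (by exact_mod_cast le_top)).eventually (by simp)
      filter_upwards [this] with z hz using hz.differentiableAt (by simp)
    refine regAt_succ_iff.2 ⟨?_, hw.locHolder_clm_apply hα0 hα1 hM, ?_⟩
    · filter_upwards [hd, hMd] with z hz hz' using hz'.clm_apply hz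
    · have hM' : ContDiffAt ℝ ∞ (fderiv ℝ M) y := hM.fderiv_right (by simp)
      have hL : ContDiffAt ℝ ∞ (fun z => ContinuousLinearMap.compL ℝ V G G' (M z)) y := by
        fun_prop
      have hL' : ContDiffAt ℝ ∞
          (fun z => ContinuousLinearMap.flipₗᵢ ℝ V G G' (fderiv ℝ M z)) y := by
        have h : ContDiff ℝ ∞ (fun A : V →L[ℝ] G →L[ℝ] G' => ContinuousLinearMap.flipₗᵢ ℝ V G G' A) :=
          LinearIsometryEquiv.contDiff (𝕜 := ℝ) (E := V →L[ℝ] G →L[ℝ] G')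
            (F := G →L[ℝ] V →L[ℝ] G') _
        exact h.contDiffAt.comp y hM'
      have e1 : RegAt l α (fun z => (ContinuousLinearMap.compL ℝ V G G' (M z)) (fderiv ℝ w z)) y :=
        ih hL h1
      have e2 : RegAt l α (fun z => (ContinuousLinearMap.flipₗᵢ ℝ V G G' (fderiv ℝ M z)) (w z)) y :=
        ih hL' (hw.of_le (by exact_mod_cast Nat.le_succ l))
      refine (e1.add e2).congr ?_
      filter_upwards [hd, hMd] with z hz hz'
      rw [fderiv_clm_apply hz' hz]
      rfl

theorem RegAt.clm_apply (hα0 : 0 ≤ α) (hα1 : α ≤ 1) {l : ℕ∞} {M : V → G →L[ℝ] G'}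
    (hM : ContDiffAt ℝ ∞ M y) {w : V → G} (hw : RegAt l α w y) :
    RegAt l α (fun z => M z (w z)) y :=
  regAt_iff_forall_nat.2 fun k hk => RegAt.clm_apply_nat hα0 hα1 k hM (hw.of_le hk)

/-- Induction on `l` with the chain rule; the derivative is a smooth operator, precomposition with
`fderiv ℝ τ`, applied to `fderiv ℝ w ∘ τ`. -/
lemma RegAt.comp_nat (hα0 : 0 ≤ α) (hα1 : α ≤ 1) (l : ℕ) {τ : V' → V} {x : V'}
    (hτ : ContDiffAt ℝ ∞ τ x) {w : V → G} (hw : RegAt l α w (τ x)) : RegAt l α (w ∘ τ) x := by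
  have hτ1 : ContDiffAt ℝ 1 τ x := hτ.of_le (by exact_mod_cast le_top)
  induction l generalizing G with
  | zero =>
    have h := regAt_zero_iff.1 hw
    exact regAt_zero_iff.2 ⟨h.1.comp x (hτ.of_le (by exact_mod_cast le_top)), h.2.comp hα0 hτ1⟩
  | succ l ih =>
    obtain ⟨hd, h0, h1⟩ := regAt_succ_iff.1 hw
    have hτd : ∀ᶠ z in 𝓝 x, DifferentiableAt ℝ τ z := by
      filter_upwards [hτ1.eventually (by simp)] with z hz using hz.differentiableAt (by simp)
    have hd' : ∀ᶠ z in 𝓝 x, DifferentiableAt ℝ w (τ z) := hτ.continuousAt.eventually hd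
    refine regAt_succ_iff.2 ⟨?_, h0.comp hα0 hτ1, ?_⟩
    · filter_upwards [hd', hτd] with z hz hz' using hz.comp z hz'
    · have hL : ContDiffAt ℝ ∞
          (fun z => (ContinuousLinearMap.compL ℝ V' V G).flip (fderiv ℝ τ z)) x := by
        have h : ContDiffAt ℝ ∞ (fderiv ℝ τ) x := hτ.fderiv_right (m := ∞) (by simp)
        fun_prop
      have e := RegAt.clm_apply_nat hα0 hα1 l hL (ih h1)
      refine e.congr ?_
      filter_upwards [hd', hτd] with z hz hz'
      rw [fderiv_comp z hz hz']
      rfl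

theorem RegAt.comp (hα0 : 0 ≤ α) (hα1 : α ≤ 1) {l : ℕ∞} {τ : V' → V} {x : V'}
    (hτ : ContDiffAt ℝ ∞ τ x) {w : V → G} (hw : RegAt l α w (τ x)) : RegAt l α (w ∘ τ) x :=
  regAt_iff_forall_nat.2 fun k hk => RegAt.comp_nat hα0 hα1 k hτ (hw.of_le hk)

theorem RegAt.const_clm_apply (hα0 : 0 ≤ α) (hα1 : α ≤ 1) {l : ℕ∞} (L : G →L[ℝ] G') {w : V → G}
    (hw : RegAt l α w y) : RegAt l α (fun z => L (w z)) y :=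
  RegAt.clm_apply hα0 hα1 (M := fun _ => L) contDiffAt_const hw

theorem RegAt.smul [NormedSpace ℂ G] (hα0 : 0 ≤ α) (hα1 : α ≤ 1) {l : ℕ∞} {c : V → ℂ}
    (hc : ContDiffAt ℝ ∞ c y) {w : V → G} (hw : RegAt l α w y) :
    RegAt l α (fun z => c z • w z) y :=
  RegAt.clm_apply hα0 hα1 (M := fun z => (ContinuousLinearMap.lsmul ℝ ℂ : ℂ →L[ℝ] G →L[ℝ] G) (c z))
    ((ContinuousLinearMap.lsmul ℝ ℂ : ℂ →L[ℝ] G →L[ℝ] G).contDiff.contDiffAt.comp y hc) hw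

end Germs

end
end CRForms

namespace CRForms
noncomputable section

/-! ### The underlying real structure, coordinate changes and immersions. -/

section Real

variable {n : ℕ} {X : Type*} [TopologicalSpace X] [ChartedSpace (Cn n) X]

lemma contMDiffAt_real {W : Type*} [NormedAddCommGroup W] [NormedSpace ℂ W] {h : X → W} {q : X}
    (hh : ContMDiffAt 𝓘(ℂ, Cn n) 𝓘(ℂ, W) ω h q) : ContMDiffAt 𝓘(ℝ, Cn n) 𝓘(ℝ, W) ∞ h q := by
  rw [contMDiffAt_iff] at hh ⊢
  refine ⟨hh.1, ?_⟩
  have h2 := hh.2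
  exact (h2.of_le (m := ∞) le_top).restrict_scalars ℝ

lemma isManifold_real [IsManifold 𝓘(ℂ, Cn n) ω X] : IsManifold 𝓘(ℝ, Cn n) ∞ X := by
  refine isManifold_of_contDiffOn _ _ _ fun e e' he he' => ?_
  have h := (contDiffGroupoid ω 𝓘(ℂ, Cn n)).compatible he he'
  rw [contDiffGroupoid, mem_groupoid_of_pregroupoid] at h
  have h' : ContDiffOn ℂ ω (𝓘(ℂ, Cn n) ∘ (e.symm ≫ₕ e') ∘ 𝓘(ℂ, Cn n).symm)
    (𝓘(ℂ, Cn n).symm ⁻¹' (e.symm ≫ₕ e').source ∩ Set.range 𝓘(ℂ, Cn n)) := h.1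
  exact (h'.of_le (m := ∞) le_top).restrict_scalars ℝ

end Real

section Chart

variable {m : ℕ} {M : Type*} [TopologicalSpace M] [ChartedSpace (Rm m) M] [IsManifold (𝓡 m) ∞ M]

lemma contMDiffAt_chart_symm {x : M} {y : Rm m} (hy : y ∈ (chartAt (Rm m) x).target) :
    ContMDiffAt 𝓘(ℝ, Rm m) (𝓡 m) ∞ (chartAt (Rm m) x).symm y :=
  (contMDiffOn_chart_symm (I := 𝓡 m) (n := ∞)).contMDiffAt
    ((chartAt (Rm m) x).open_target.mem_nhds hy)

lemma contMDiffAt_chart {x p : M} (hp : p ∈ (chartAt (Rm m) x).source) :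
    ContMDiffAt (𝓡 m) 𝓘(ℝ, Rm m) ∞ (chartAt (Rm m) x) p :=
  (contMDiffOn_chart (I := 𝓡 m) (n := ∞)).contMDiffAt
    ((chartAt (Rm m) x).open_source.mem_nhds hp)

lemma contDiffAt_comp_chart_symm {G : Type*} [NormedAddCommGroup G] [NormedSpace ℝ G] {c : M → G}
    {x p : M} (hp : p ∈ (chartAt (Rm m) x).source) (hc : ContMDiffAt (𝓡 m) 𝓘(ℝ, G) ∞ c p) :
    ContDiffAt ℝ ∞ (fun y => c ((chartAt (Rm m) x).symm y)) (chartAt (Rm m) x p) := by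
  rw [← contMDiffAt_iff_contDiffAt]
  refine ContMDiffAt.comp (g := c) _ ?_
    (contMDiffAt_chart_symm ((chartAt (Rm m) x).map_source hp))
  rwa [(chartAt (Rm m) x).left_inv hp]

/-- The coordinate change from the chart at `x'` to the chart at `x`. -/
def trans (x x' : M) (y : Rm m) : Rm m := chartAt (Rm m) x ((chartAt (Rm m) x').symm y)

lemma contDiffAt_trans {x x' p : M} (hp : p ∈ (chartAt (Rm m) x).source)
    (hp' : p ∈ (chartAt (Rm m) x').source) :
    ContDiffAt ℝ ∞ (trans x x') (chartAt (Rm m) x' p) :=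
  contDiffAt_comp_chart_symm hp' (contMDiffAt_chart hp)

lemma mfderiv_symm_trans {x x' p : M} (hp : p ∈ (chartAt (Rm m) x).source)
    (hp' : p ∈ (chartAt (Rm m) x').source) (v : Rm m) :
    mfderiv 𝓘(ℝ, Rm m) (𝓡 m) (chartAt (Rm m) x').symm (chartAt (Rm m) x' p) v =
      mfderiv 𝓘(ℝ, Rm m) (𝓡 m) (chartAt (Rm m) x).symm (chartAt (Rm m) x p)
        (fderiv ℝ (trans x x') (chartAt (Rm m) x' p) v) := by
  have e0 : trans x x' (chartAt (Rm m) x' p) = chartAt (Rm m) x p := by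
    rw [trans, (chartAt (Rm m) x').left_inv hp']
  have hev : (chartAt (Rm m) x').symm =ᶠ[𝓝 (chartAt (Rm m) x' p)]
      (chartAt (Rm m) x).symm ∘ trans x x' := by
    have h1 := (chartAt (Rm m) x').isOpen_inter_preimage_symm (chartAt (Rm m) x).open_source
    filter_upwards [h1.mem_nhds ⟨(chartAt (Rm m) x').map_source hp', by
      rw [Set.mem_preimage, (chartAt (Rm m) x').left_inv hp']; exact hp⟩] with y hy
    exact ((chartAt (Rm m) x).left_inv hy.2).symm
  have h2 : MDifferentiableAt 𝓘(ℝ, Rm m) (𝓡 m) (chartAt (Rm m) x).symm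
      (trans x x' (chartAt (Rm m) x' p)) := by
    rw [e0]
    exact (contMDiffAt_chart_symm ((chartAt (Rm m) x).map_source hp)).mdifferentiableAt (by simp)
  have h3 : DifferentiableAt ℝ (trans x x') (chartAt (Rm m) x' p) :=
    (contDiffAt_trans hp hp').differentiableAt (by simp)
  have h4 := mfderiv_comp_apply (I := 𝓘(ℝ, Rm m)) (I' := 𝓘(ℝ, Rm m)) (I'' := 𝓡 m)
    (chartAt (Rm m) x' p) h2 h3.mdifferentiableAt v
  rw [← e0, ← mfderiv_eq_fderiv]
  refine Eq.trans ?_ h4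
  have h5 := hev.mfderiv_eq (I := 𝓘(ℝ, Rm m)) (I' := 𝓡 m)
  exact DFunLike.congr_fun h5 v

end Chart

section Immersion

variable {n m : ℕ} {X : Type*} [TopologicalSpace X] [ChartedSpace (Cn n) X]
  [IsManifold 𝓘(ℂ, Cn n) ω X]
  {M : Type*} [TopologicalSpace M] [ChartedSpace (Rm m) M] [IsManifold (𝓡 m) ∞ M]

/-- In adapted charts `ι` is the inclusion of a factor, so the projection to that factor gives a
smooth local left inverse; differentiate its composition with `ι`. -/
lemma mfderiv_injective_of_isImmersionAt {ι : M → X} {p : M}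
    (h : Manifold.IsImmersionAt (𝓡 m) 𝓘(ℝ, Cn n) ∞ ι p) :
    Function.Injective (mfderiv (𝓡 m) 𝓘(ℝ, Cn n) ι p) := by
  have hX : IsManifold 𝓘(ℝ, Cn n) ∞ X := isManifold_real
  let g : X → M := fun z => h.domChart.symm (h.equiv.symm (h.codChart z)).1
  have hcod : ContMDiffAt 𝓘(ℝ, Cn n) 𝓘(ℝ, Cn n) ∞ h.codChart (ι p) :=
    contMDiffAt_of_mem_maximalAtlas h.codChart_mem_maximalAtlas h.mem_codChart_source
  have hw : ∀ p' ∈ h.domChart.source, h.codChart (ι p') = h.equiv (h.domChart p', 0) := by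
    intro p' hp'
    have := h.writtenInCharts
    have h2 := this (x := h.domChart p') (by simpa using h.domChart.map_source hp')
    simpa [h.domChart.left_inv hp'] using h2
  have hgι : ∀ p' ∈ h.domChart.source, g (ι p') = p' := by
    intro p' hp'
    simp [g, hw p' hp', h.domChart.left_inv hp']
  have hL : ContMDiffAt 𝓘(ℝ, Cn n) 𝓘(ℝ, Rm m) ∞
      (fun z => (h.equiv.symm (h.codChart z)).1) (ι p) := by
    have : ContDiff ℝ ∞ (fun w : Cn n => (h.equiv.symm w).1) :=
      contDiff_fst.comp h.equiv.symm.contDiff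
    exact this.contMDiff.contMDiffAt.comp (ι p) hcod
  have hp := h.mem_domChart_source
  have hg : ContMDiffAt 𝓘(ℝ, Cn n) (𝓡 m) ∞ g (ι p) := by
    refine ContMDiffAt.comp (g := h.domChart.symm) (ι p) ?_ hL
    refine contMDiffAt_symm_of_mem_maximalAtlas h.domChart_mem_maximalAtlas ?_
    simpa [hw p hp] using h.domChart.map_source hp
  have hid : g ∘ ι =ᶠ[𝓝 p] id := by
    filter_upwards [h.domChart.open_source.mem_nhds hp] with p' hp' using hgι p' hp'
  have hc := mfderiv_comp p (hg.mdifferentiableAt (by simp)) (h.contMDiffAt.mdifferentiableAt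
    (by simp))
  have h5 := hid.mfderiv_eq (I := 𝓡 m) (I' := 𝓡 m)
  intro v w hvw
  have e : ∀ v : TangentSpace (𝓡 m) p, mfderiv 𝓘(ℝ, Cn n) (𝓡 m) g (ι p)
      (mfderiv (𝓡 m) 𝓘(ℝ, Cn n) ι p v) = v := by
    intro v
    have h6 := DFunLike.congr_fun hc v
    have h7 := DFunLike.congr_fun h5 v
    refine h6.symm.trans (h7.trans ?_)
    rw [mfderiv_id]; rfl
  rw [← e v, ← e w, hvw]

end Immersion

/-! ### Coefficients of forms and their transformation. -/

section Coeff

variable {n m : ℕ} {X : Type*} [TopologicalSpace X] [ChartedSpace (Cn n) X]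
  {M : Type*} [TopologicalSpace M] [ChartedSpace (Rm m) M]
  (S : GenericCR n m X M)
  (F : Type*) [NormedAddCommGroup F] [NormedSpace ℂ F]
  (E : X → Type*) [∀ x, AddCommGroup (E x)] [∀ x, Module ℂ (E x)]
  [TopologicalSpace (Bundle.TotalSpace F E)] [∀ x, TopologicalSpace (E x)]
  [FiberBundle F E]

/-- The points where both the chart at `x` and the trivialization at `ι x` are defined. -/
def patch (x : M) : Set M :=
  (chartAt (Rm m) x).source ∩ S.ι ⁻¹' (trivializationAt F E (S.ι x)).baseSet

lemma mem_patch_self (x : M) : x ∈ patch S F E x :=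
  ⟨mem_chart_source _ x, FiberBundle.mem_baseSet_trivializationAt' _⟩

lemma continuous_ι : Continuous S.ι := S.isSmoothEmbedding.isEmbedding.continuous

lemma isOpen_patch (x : M) : IsOpen (patch S F E x) :=
  (chartAt (Rm m) x).open_source.inter
    ((trivializationAt F E (S.ι x)).open_baseSet.preimage (continuous_ι S))

variable {S F E}

lemma chart_mem_dom {x p : M} {U : Opens M} (hp : p ∈ patch S F E x) (hU : p ∈ U) :
    chartAt (Rm m) x p ∈ dom S F E x U :=
  ⟨(chartAt (Rm m) x).map_source hp.1, by
    rw [Set.mem_preimage, (chartAt (Rm m) x).left_inv hp.1]; exact ⟨hU, hp.2⟩⟩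

lemma symm_mem_patch {x : M} {U : Opens M} {y : Rm m} (hy : y ∈ dom S F E x U) :
    (chartAt (Rm m) x).symm y ∈ patch S F E x :=
  ⟨(chartAt (Rm m) x).map_target hy.1, hy.2.2⟩

lemma chart_symm_of_mem_dom {x : M} {U : Opens M} {y : Rm m} (hy : y ∈ dom S F E x U) :
    chartAt (Rm m) x ((chartAt (Rm m) x).symm y) = y :=
  (chartAt (Rm m) x).right_inv hy.1

lemma dom_mono (x : M) {U U' : Opens M} (h : U ≤ U') : dom S F E x U ⊆ dom S F E x U' :=
  fun _ hy => ⟨hy.1, h hy.2.1, hy.2.2⟩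

variable [VectorBundle ℂ F E]

variable (S F E) in
/-- The form `f` in the coordinates of the chart at `x` and the trivialization at `ι x`. -/
def coeffAlt (x : M) {N : ℕ} (f : Form S E N) (y : Rm m) : Rm m [⋀^Fin N]→ₗ[ℝ] F :=
  (((trivializationAt F E (S.ι x)).linearMapAt ℂ
    (S.ι ((chartAt (Rm m) x).symm y))).restrictScalars ℝ).compAlternatingMap
      ((f ((chartAt (Rm m) x).symm y)).compLinearMap
        (mfderiv 𝓘(ℝ, Rm m) (𝓡 m) (chartAt (Rm m) x).symm y).toLinearMap)

lemma coeff_change [IsManifold (𝓡 m) ∞ M] {x x' p : M} (hp : p ∈ patch S F E x)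
    (hp' : p ∈ patch S F E x') {N : ℕ} (v : Fin N → Rm m) (f : Form S E N) :
    coeff S F E x' v f (chartAt (Rm m) x' p) =
      (trivializationAt F E (S.ι x)).coordChangeL ℂ (trivializationAt F E (S.ι x')) (S.ι p)
        (coeff S F E x (fun j => fderiv ℝ (trans x x') (chartAt (Rm m) x' p) (v j)) f
          (chartAt (Rm m) x p)) := by
  simp only [coeff]
  rw [Bundle.Trivialization.coordChangeL_apply _ _ ⟨hp.2, hp'.2⟩]
  simp only [mfderiv_symm_trans hp.1 hp'.1]
  -- The two base points equal `p` only propositionally, while the fibres depend on them, so they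
  -- are generalized before being replaced by `p`.
  generalize hq : (chartAt (Rm m) x').symm (chartAt (Rm m) x' p) = q
  generalize hq' : (chartAt (Rm m) x).symm (chartAt (Rm m) x p) = q'
  rw [(chartAt (Rm m) x').left_inv hp'.1] at hq
  rw [(chartAt (Rm m) x).left_inv hp.1] at hq'
  subst hq; subst hq'
  rw [Bundle.Trivialization.coe_linearMapAt_of_mem _ hp.2,
    Bundle.Trivialization.coe_linearMapAt_of_mem _ hp'.2]
  simp only
  rw [Bundle.Trivialization.symm_apply_apply_mk _ hp.2]

end Coeff

end
end CRForms

namespace CRForms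
noncomputable section

/-! ### Regularity of forms near a point. -/

section Reg

variable {n m : ℕ} {X : Type*} [TopologicalSpace X] [ChartedSpace (Cn n) X]
  {M : Type*} [TopologicalSpace M] [ChartedSpace (Rm m) M] [IsManifold (𝓡 m) ∞ M]
  {S : GenericCR n m X M}
  {F : Type*} [NormedAddCommGroup F] [NormedSpace ℂ F]
  {E : X → Type*} [∀ x, AddCommGroup (E x)] [∀ x, Module ℂ (E x)]
  [TopologicalSpace (Bundle.TotalSpace F E)] [∀ x, TopologicalSpace (E x)]
  [FiberBundle F E] [VectorBundle ℂ F E]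

variable (S F E) in
/-- `f` is of class `C^{l + α}` near `p`. -/
def Reg {N : ℕ} (l : ℕ∞) (α : ℝ) (f : Form S E N) (p : M) : Prop :=
  ∀ v, RegAt l α (coeff S F E p v f) (chartAt (Rm m) p p)

lemma contMDiffAt_coordChangeL_ι [IsManifold 𝓘(ℂ, Cn n) ω X]
    [ContMDiffVectorBundle ω F E 𝓘(ℂ, Cn n)] {x x' p : M}
    (hp : p ∈ patch S F E x) (hp' : p ∈ patch S F E x') :
    ContMDiffAt (𝓡 m) 𝓘(ℝ, F →L[ℝ] F) ∞ (fun q => ((trivializationAt F E (S.ι x)).coordChangeL ℂ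
      (trivializationAt F E (S.ι x')) (S.ι q) : F →L[ℂ] F).restrictScalars ℝ) p := by
  have h := contMDiffAt_real (contMDiffAt_coordChangeL (n := ω) (IB := 𝓘(ℂ, Cn n))
    (e := trivializationAt F E (S.ι x)) (e' := trivializationAt F E (S.ι x')) hp.2 hp'.2)
  have h2 : ContMDiffAt (𝓡 m) 𝓘(ℝ, F →L[ℂ] F) ∞ (fun q =>
      ((trivializationAt F E (S.ι x)).coordChangeL ℂ
      (trivializationAt F E (S.ι x')) (S.ι q) : F →L[ℂ] F)) p :=
    ContMDiffAt.comp p h (S.isSmoothEmbedding.contMDiff p)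
  have h3 : ContDiff ℝ ∞ (fun L : F →L[ℂ] F => L.restrictScalars ℝ) :=
    (ContinuousLinearMap.restrictScalarsL ℂ F F ℝ ℝ).contDiff
  exact h3.contMDiff.contMDiffAt.comp p h2

/-- By multilinearity, the coefficients in one chart and trivialization are smooth combinations of
those in another, composed with a smooth coordinate change. Regularity at a point may therefore be
tested in any single patch. -/
lemma regAt_coeff_change [IsManifold 𝓘(ℂ, Cn n) ω X] [ContMDiffVectorBundle ω F E 𝓘(ℂ, Cn n)]
    {α : ℝ} (hα0 : 0 ≤ α) (hα1 : α ≤ 1) {l : ℕ∞} {N : ℕ} {f : Form S E N} {x x' p : M}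
    (hp : p ∈ patch S F E x) (hp' : p ∈ patch S F E x')
    (h : ∀ v, RegAt l α (coeff S F E x v f) (chartAt (Rm m) x p)) (v : Fin N → Rm m) :
    RegAt l α (coeff S F E x' v f) (chartAt (Rm m) x' p) := by
  have hτ := contDiffAt_trans hp.1 hp'.1
  have e0 : trans x x' (chartAt (Rm m) x' p) = chartAt (Rm m) x p := by
    rw [trans, (chartAt (Rm m) x').left_inv hp'.1]
  let G : Rm m → F →L[ℝ] F := fun y => ((trivializationAt F E (S.ι x)).coordChangeL ℂ
      (trivializationAt F E (S.ι x')) (S.ι ((chartAt (Rm m) x').symm y)) :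
      F →L[ℂ] F).restrictScalars ℝ
  have hG : ContDiffAt ℝ ∞ G (chartAt (Rm m) x' p) :=
    contDiffAt_comp_chart_symm hp'.1 (contMDiffAt_coordChangeL_ι hp hp')
  have hc : ∀ I : Fin N → Fin m, ContDiffAt ℝ ∞
      (fun y => ∏ j, (fderiv ℝ (trans x x') y (v j)) (I j)) (chartAt (Rm m) x' p) := by
    intro I
    refine contDiffAt_prod fun j _ => ?_
    have h1 : ContDiffAt ℝ ∞ (fderiv ℝ (trans x x')) (chartAt (Rm m) x' p) :=
      hτ.fderiv_right (by simp)
    exact ((EuclideanSpace.proj (I j) : Rm m →L[ℝ] ℝ).contDiff.contDiffAt).comp _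
      (h1.clm_apply contDiffAt_const)
  have key : RegAt l α (fun y => ∑ I : Fin N → Fin m,
      ((∏ j, (fderiv ℝ (trans x x') y (v j)) (I j)) • G y)
        ((coeff S F E x (fun j => EuclideanSpace.single (I j) 1) f ∘ trans x x') y))
      (chartAt (Rm m) x' p) := by
    refine RegAt.sum _ fun I _ => RegAt.clm_apply hα0 hα1 ((hc I).smul hG)
      (RegAt.comp hα0 hα1 hτ ?_)
    rw [e0]
    exact h _
  refine key.congr ?_
  have hW : {y | y ∈ dom S F E x' ⊤ ∧ (chartAt (Rm m) x').symm y ∈ patch S F E x} ∈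
      𝓝 (chartAt (Rm m) x' p) := by
    have h1 := (isOpen_dom S F E x' ⊤).mem_nhds (chart_mem_dom hp' (U := ⊤) trivial)
    have h2 := ((chartAt (Rm m) x').continuousAt_symm
      ((chartAt (Rm m) x').map_source hp'.1)).preimage_mem_nhds
        ((isOpen_patch S F E x).mem_nhds (by rwa [(chartAt (Rm m) x').left_inv hp'.1]))
    exact Filter.inter_mem h1 h2
  filter_upwards [hW] with y hy
  have h3 := coeff_change hy.2 (symm_mem_patch hy.1) v f
  rw [chart_symm_of_mem_dom hy.1] at h3
  rw [h3]
  have h4 := alternating_expand (coeffAlt S F E x f (trans x x' y))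
    (fun j => fderiv ℝ (trans x x') y (v j))
  simp only [show ∀ (f : Form S E N) y v, coeffAlt S F E x f y v = coeff S F E x v f y from
    fun _ _ _ => rfl] at h4
  have h5 : chartAt (Rm m) x ((chartAt (Rm m) x').symm y) = trans x x' y := rfl
  rw [h5, h4, map_sum]
  refine Finset.sum_congr rfl fun I _ => ?_
  simp only [Function.comp_apply, _root_.smul_apply, G]
  exact ((G y).map_smul _ _)

section

variable [IsManifold 𝓘(ℂ, Cn n) ω X] [ContMDiffVectorBundle ω F E 𝓘(ℂ, Cn n)]
  {α : ℝ} {l : ℕ∞} {N r : ℕ} {p x : M} {U : Opens M}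

lemma Reg.regAt (hα0 : 0 ≤ α) (hα1 : α ≤ 1) {f : Form S E N} (h : Reg S F E l α f p)
    (hp : p ∈ patch S F E x) (v : Fin N → Rm m) :
    RegAt l α (coeff S F E x v f) (chartAt (Rm m) x p) :=
  regAt_coeff_change hα0 hα1 (mem_patch_self S F E p) hp h v

lemma reg_of_regAt (hα0 : 0 ≤ α) (hα1 : α ≤ 1) {f : Form S E N} (hp : p ∈ patch S F E x)
    (h : ∀ v, RegAt l α (coeff S F E x v f) (chartAt (Rm m) x p)) : Reg S F E l α f p :=
  regAt_coeff_change hα0 hα1 hp (mem_patch_self S F E p) h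

/-- Turns a condition on all coordinate patches into a pointwise one, which is tested only in the
patch centred at the point; `regAt_coeff_change` gives the other patches. -/
theorem mem_CForms_iff {f : Form S E (n + r)} :
    f ∈ CForms S F E U r l ↔
      IsNRForm S E r f ∧ (∀ p ∉ U, f p = 0) ∧ ∀ p ∈ U, Reg S F E l 0 f p := by
  refine ⟨fun h => ⟨h.1, h.2.1, fun p hp v => regAt_zero_of_contDiffAt ?_⟩,
    fun h => ⟨h.1, h.2.1, fun x v y hy => ?_⟩⟩
  · exact (h.2.2 p v).contDiffAt
      ((isOpen_dom S F E p U).mem_nhds (chart_mem_dom (mem_patch_self S F E p) hp))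
  · have h1 := (h.2.2 _ hy.2.1).regAt le_rfl zero_le_one (symm_mem_patch hy) v
    rw [chart_symm_of_mem_dom hy] at h1
    exact h1.1.contDiffWithinAt

/-- Two points closer than a Lebesgue number lie in one neighbourhood with a local Hölder bound. For
points at distance at least δ the bound 2|D| on the difference is absorbed by the factor `dist ^ α /
δ ^ α`. -/
lemma exists_holder_of_isCompact {V G : Type*} [NormedAddCommGroup V] [NormedSpace ℝ V]
    [NormedAddCommGroup G] [NormedSpace ℝ G] {α : ℝ} (hα0 : 0 ≤ α) {w : V → G} {K : Set V}
    (hK : IsCompact K) (hc : ContinuousOn w K)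
    (h : ∀ y ∈ K, ∃ C : ℝ, 0 ≤ C ∧ ∃ t ∈ 𝓝 y, ∀ a ∈ t, ∀ b ∈ t, ‖w a - w b‖ ≤ C * dist a b ^ α) :
    ∃ C : ℝ, 0 ≤ C ∧ ∀ a ∈ K, ∀ b ∈ K, ‖w a - w b‖ ≤ C * dist a b ^ α := by
  obtain ⟨D, hD⟩ := (hK.image_of_continuousOn hc).isBounded.exists_norm_le
  choose! C hC t ht hCt using h
  obtain ⟨s, hs⟩ := hK.elim_nhds_subcover' (fun y hy => interior (t y))
    (fun y hy => interior_mem_nhds.2 (ht y hy))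
  obtain ⟨δ, hδ, hL⟩ := lebesgue_number_lemma_of_metric (c := fun y : s => interior (t y.1))
    hK (fun _ => isOpen_interior) (by
      refine hs.trans fun z hz => ?_
      simp only [Set.mem_iUnion] at hz ⊢
      obtain ⟨y, hy, hz⟩ := hz
      exact ⟨⟨y, hy⟩, hz⟩)
  have hsum : 0 ≤ ∑ y ∈ s, C y := Finset.sum_nonneg fun y _ => hC _ y.2
  refine ⟨(∑ y ∈ s, C y) + 2 * |D| / δ ^ α, by positivity, fun a ha b hb => ?_⟩
  have hd := Real.rpow_nonneg (dist_nonneg (x := a) (y := b)) α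
  rcases lt_or_ge (dist b a) δ with hab | hab
  · obtain ⟨y, hy⟩ := hL a ha
    have h1 := hCt _ y.1.2 a (interior_subset (hy (Metric.mem_ball_self hδ))) b
      (interior_subset (hy hab))
    refine h1.trans (mul_le_mul_of_nonneg_right ?_ hd)
    have h2 := Finset.single_le_sum (f := fun y : K => C y) (fun y _ => hC _ y.2) y.2
    have h3 : 0 ≤ 2 * |D| / δ ^ α := by positivity
    linarith
  · have h1 : ‖w a - w b‖ ≤ 2 * |D| := by
      have h2 := (hD _ ⟨a, ha, rfl⟩).trans (le_abs_self D)
      have h3 := (hD _ ⟨b, hb, rfl⟩).trans (le_abs_self D)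
      linarith [norm_sub_le (w a) (w b)]
    have h2 : δ ^ α ≤ dist a b ^ α := by
      rw [dist_comm]; exact Real.rpow_le_rpow hδ.le hab hα0
    have h3 : 2 * |D| ≤ 2 * |D| / δ ^ α * dist a b ^ α := by
      rw [div_mul_eq_mul_div, le_div_iff₀ (by positivity)]
      exact mul_le_mul_of_nonneg_left h2 (by positivity)
    rw [add_mul]
    have := mul_nonneg hsum hd
    linarith

theorem mem_HForms_of_reg (hα0 : 0 ≤ α) (hα1 : α ≤ 1) {f : Form S E (n + r)}
    (hf : IsNRForm S E r f) (h : ∀ p, Reg S F E l α f p) : f ∈ HForms S F E ⊤ r l α := by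
  have hr : ∀ (x : M) (v : Fin (n + r) → Rm m), ∀ y ∈ dom S F E x ⊤,
      RegAt l α (coeff S F E x v f) y := by
    intro x v y hy
    have h1 := (h ((chartAt (Rm m) x).symm y)).regAt hα0 hα1 (symm_mem_patch hy) v
    rwa [chart_symm_of_mem_dom hy] at h1
  refine ⟨⟨hf, fun p hp => absurd trivial hp, fun x v y hy => (hr x v y hy).1.contDiffWithinAt⟩,
    fun x v i hi K hK hKd => ?_⟩
  have hcont : ContinuousOn (iteratedFDeriv ℝ i (coeff S F E x v f)) K := fun y hy =>
    ((hr x v y (hKd hy)).1.iteratedFDeriv_right (m := 0) (i := i) (by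
      rw [zero_add]; exact_mod_cast hi)).continuousAt.continuousWithinAt
  obtain ⟨C, -, hC⟩ := exists_holder_of_isCompact hα0 hK hcont
    (fun y hy => (hr x v y (hKd hy)).2 i hi)
  exact ⟨C, fun y hy z hz => hC y hy.1 z hz.1⟩

theorem reg_of_mem_HForms {f : Form S E (n + r)} (h : f ∈ HForms S F E U r l α) (hp : p ∈ U) :
    Reg S F E l α f p := by
  intro v
  have hd := chart_mem_dom (mem_patch_self S F E p) hp
  have ho := (isOpen_dom S F E p U).mem_nhds hd
  refine ⟨(h.1.2.2 p v).contDiffAt ho, fun i hi => ?_⟩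
  obtain ⟨ρ, hρ, hsub⟩ := Metric.nhds_basis_closedBall.mem_iff.1 ho
  obtain ⟨C, hC⟩ := h.2 p v i hi _ (isCompact_closedBall _ ρ)
    (hsub.trans (dom_mono p le_top))
  refine ⟨|C|, abs_nonneg C, _, Metric.closedBall_mem_nhds _ hρ, fun a ha b hb => ?_⟩
  exact (hC a ⟨ha, hsub ha⟩ b ⟨hb, hsub hb⟩).trans
    (mul_le_mul_of_nonneg_right (le_abs_self C) (Real.rpow_nonneg dist_nonneg _))

lemma Reg.add {f g : Form S E N} (hf : Reg S F E l α f p) (hg : Reg S F E l α g p) :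
    Reg S F E l α (f + g) p := fun v => by
  rw [coeff_add]; exact (hf v).add (hg v)

lemma reg_zero : Reg S F E l α (0 : Form S E N) p := fun v => by
  rw [coeff_zero]; exact regAt_const 0 l

lemma Reg.congr {f g : Form S E N} (hf : Reg S F E l α f p) (h : ∀ᶠ q in 𝓝 p, g q = f q) :
    Reg S F E l α g p := fun v => by
  refine (hf v).congr ?_
  have h1 := ((chartAt (Rm m) p).continuousAt_symm (mem_chart_target _ p)).tendsto
  rw [(chartAt (Rm m) p).left_inv (mem_chart_source _ p)] at h1
  filter_upwards [h1.eventually h] with y hy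
  simp only [coeff, hy]

end

end Reg

end
end CRForms

namespace CRForms
noncomputable section

/-! ### Multiplication of forms by functions and by differentials of functions. -/

section Operations

variable {n m : ℕ} {X : Type*} [TopologicalSpace X] [ChartedSpace (Cn n) X]
  [IsManifold 𝓘(ℂ, Cn n) ω X]
  {M : Type*} [TopologicalSpace M] [ChartedSpace (Rm m) M] [IsManifold (𝓡 m) ∞ M]
  {S : GenericCR n m X M}
  {F : Type*} [NormedAddCommGroup F] [NormedSpace ℂ F]
  {E : X → Type*} [∀ x, AddCommGroup (E x)] [∀ x, Module ℂ (E x)]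
  {N r : ℕ} {l : ℕ∞} {α : ℝ} {x p : M}

lemma mfderiv_ι_injective (S : GenericCR n m X M) (p : M) :
    Function.Injective (mfderiv (𝓡 m) 𝓘(ℝ, Cn n) S.ι p) :=
  mfderiv_injective_of_isImmersionAt (S.isSmoothEmbedding.isImmersion.isImmersionAt p)

/-- Multiplication of a form by a function. -/
def smulForm (c : M → ℂ) (f : Form S E N) : Form S E N := fun p => c p • f p

/-- The differential of a function. -/
def dfun (c : M → ℂ) (p : M) : TangentSpace (𝓡 m) p →ₗ[ℝ] ℂ :=
  (mfderiv (𝓡 m) 𝓘(ℝ, ℂ) c p : TangentSpace (𝓡 m) p →L[ℝ] ℂ).toLinearMap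

/-- The exterior product of the differential of a function and a form. -/
def dwedge (c : M → ℂ) (f : Form S E N) : Form S E (N + 1) := fun p => wedge (dfun c p) (f p)

lemma IsNRForm.smulForm {f : Form S E (n + r)} (h : IsNRForm S E r f) (c : M → ℂ) :
    IsNRForm S E r (smulForm c f) := by
  intro p
  obtain ⟨g, hg, hgf⟩ := h p
  exact ⟨c p • g, fun c' w => by simp [hg c' w, smul_comm (c p)],
    fun v => (congrArg (c p • ·) (hgf v) :)⟩

/-- The alternating form `a` at `p` is the restriction of a form of bidegree `(n, r)`. -/
def IsNRAt (S : GenericCR n m X M) (E : X → Type*) [∀ x, AddCommGroup (E x)]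
    [∀ x, Module ℂ (E x)] (r : ℕ) (p : M)
    (a : (TangentSpace (𝓡 m) p) [⋀^Fin (n + r)]→ₗ[ℝ] (E (S.ι p))) : Prop :=
  ∃ g : Cn n [⋀^Fin (n + r)]→ₗ[ℝ] (E (S.ι p)), IsBidegree n r g ∧
    ∀ v : Fin (n + r) → TangentSpace (𝓡 m) p,
      a v = g fun j => (mfderiv (𝓡 m) 𝓘(ℝ, Cn n) S.ι p (v j) : Cn n)

/-- As dι is injective at `p`, the covector `σ` extends to a real covector on ℂⁿ, and
`IsHomog.wedge_real` applies there. -/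
lemma IsNRAt.wedge {a : (TangentSpace (𝓡 m) p) [⋀^Fin (n + r)]→ₗ[ℝ] (E (S.ι p))}
    (h : IsNRAt S E r p a) (σ : TangentSpace (𝓡 m) p →ₗ[ℝ] ℂ) :
    IsNRAt S E (r + 1) p (wedge σ a) := by
  obtain ⟨g, hg, hgf⟩ := h
  obtain ⟨L, hL⟩ := LinearMap.exists_leftInverse_of_injective
    (mfderiv (𝓡 m) 𝓘(ℝ, Cn n) S.ι p).toLinearMap
    (LinearMap.ker_eq_bot.2 (mfderiv_ι_injective S p))
  let τ : Cn n →ₗ[ℝ] ℂ := σ ∘ₗ L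
  have hτ : ∀ v : TangentSpace (𝓡 m) p, τ (mfderiv (𝓡 m) 𝓘(ℝ, Cn n) S.ι p v) = σ v :=
    fun v => congrArg σ (DFunLike.congr_fun hL v)
  refine ⟨CRForms.wedge τ g, IsHomog.wedge_real rfl hg τ, fun v => ?_⟩
  refine (wedge_apply _ _ v).trans (Eq.trans ?_ (wedge_apply τ g _).symm)
  refine Finset.sum_congr rfl fun i _ => ?_
  rw [hτ, hgf]

/-- Used for differentials of holomorphic functions restricted to M: the coordinates of X in the
construction of frames, and the transition functions of E in `isWeakD_pack`. -/
lemma IsNRAt.wedge_eq_zero {a : (TangentSpace (𝓡 m) p) [⋀^Fin (n + r)]→ₗ[ℝ] (E (S.ι p))}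
    (h : IsNRAt S E r p a) (L : Cn n →ₗ[ℂ] ℂ) {σ : TangentSpace (𝓡 m) p →ₗ[ℝ] ℂ}
    (hσ : ∀ v, σ v = L (mfderiv (𝓡 m) 𝓘(ℝ, Cn n) S.ι p v)) : CRForms.wedge σ a = 0 := by
  obtain ⟨g, hg, hgf⟩ := h
  have h0 := IsHomog.wedge_eq_zero rfl hg L
  ext v
  have h1 := DFunLike.congr_fun h0
    (fun j => (mfderiv (𝓡 m) 𝓘(ℝ, Cn n) S.ι p (v j) : Cn n))
  refine Eq.trans ?_ h1
  refine (wedge_apply _ _ v).trans (Eq.trans ?_ (wedge_apply _ g _).symm)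
  refine Finset.sum_congr rfl fun i _ => ?_
  rw [hσ, hgf]
  rfl

lemma IsNRForm.dwedge {f : Form S E (n + r)} (h : IsNRForm S E r f) (c : M → ℂ) :
    IsNRForm S E (r + 1) (dwedge c f) := fun p => IsNRAt.wedge (h p) (dfun c p)

variable [TopologicalSpace (Bundle.TotalSpace F E)] [∀ x, TopologicalSpace (E x)]
  [FiberBundle F E] [VectorBundle ℂ F E]

lemma coeff_smulForm (x : M) (v : Fin N → Rm m) (c : M → ℂ) (f : Form S E N) (y : Rm m) :
    coeff S F E x v (smulForm c f) y =
      c ((chartAt (Rm m) x).symm y) • coeff S F E x v f y := by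
  simp [coeff, smulForm]

lemma coeffAlt_smulForm (x : M) (c : M → ℂ) (f : Form S E N) (y : Rm m) :
    coeffAlt S F E x (smulForm c f) y =
      c ((chartAt (Rm m) x).symm y) • coeffAlt S F E x f y := by
  ext v
  exact coeff_smulForm x v c f y

lemma dfun_mfderiv_symm {c : M → ℂ} {y : Rm m}
    (hc : MDifferentiableAt (𝓡 m) 𝓘(ℝ, ℂ) c ((chartAt (Rm m) x).symm y))
    (hy : y ∈ (chartAt (Rm m) x).target) (v : Rm m) :
    dfun c ((chartAt (Rm m) x).symm y)
      (mfderiv 𝓘(ℝ, Rm m) (𝓡 m) (chartAt (Rm m) x).symm y v) =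
      fderiv ℝ (fun z => c ((chartAt (Rm m) x).symm z)) y v := by
  have h := mfderiv_comp_apply (I := 𝓘(ℝ, Rm m)) (I' := 𝓡 m) (I'' := 𝓘(ℝ, ℂ)) y
    hc
    ((contMDiffAt_chart_symm hy).mdifferentiableAt (by simp)) v
  rw [← mfderiv_eq_fderiv]
  exact h.symm

lemma coeff_dwedge {c : M → ℂ} {y : Rm m}
    (hc : MDifferentiableAt (𝓡 m) 𝓘(ℝ, ℂ) c ((chartAt (Rm m) x).symm y)) (f : Form S E N)
    (hy : y ∈ (chartAt (Rm m) x).target) (v : Fin (N + 1) → Rm m) :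
    coeff S F E x v (dwedge c f) y = ∑ i : Fin (N + 1), (-1 : ℝ) ^ (i : ℕ) •
      fderiv ℝ (fun z => c ((chartAt (Rm m) x).symm z)) y (v i) •
        coeff S F E x (fun j => v (i.succAbove j)) f y := by
  let L := (trivializationAt F E (S.ι x)).linearMapAt ℂ (S.ι ((chartAt (Rm m) x).symm y))
  let q := (chartAt (Rm m) x).symm y
  have h := congrArg L (wedge_apply (dfun c q) (f q)
    fun j => mfderiv 𝓘(ℝ, Rm m) (𝓡 m) (chartAt (Rm m) x).symm y (v j))
  refine h.trans ((map_sum L _ _).trans (Finset.sum_congr rfl fun i _ => ?_))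
  refine ((L.restrictScalars ℝ).map_smul _ _).trans (congrArg ((-1 : ℝ) ^ (i : ℕ) • ·) ?_)
  refine (L.map_smul _ _).trans ?_
  rw [← dfun_mfderiv_symm hc hy]
  rfl

lemma coeffAlt_dwedge {c : M → ℂ} {y : Rm m}
    (hc : MDifferentiableAt (𝓡 m) 𝓘(ℝ, ℂ) c ((chartAt (Rm m) x).symm y)) (f : Form S E N)
    (hy : y ∈ (chartAt (Rm m) x).target) :
    coeffAlt S F E x (dwedge c f) y =
      wedge (fderiv ℝ (fun z => c ((chartAt (Rm m) x).symm z)) y : Rm m →ₗ[ℝ] ℂ)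
        (coeffAlt S F E x f y) := by
  ext v
  rw [wedge_apply]
  exact coeff_dwedge hc f hy v

section

variable [ContMDiffVectorBundle ω F E 𝓘(ℂ, Cn n)]

lemma Reg.smulForm (hα0 : 0 ≤ α) (hα1 : α ≤ 1) {f : Form S E N} (h : Reg S F E l α f p)
    {c : M → ℂ} (hc : ContMDiff (𝓡 m) 𝓘(ℝ, ℂ) ∞ c) : Reg S F E l α (smulForm c f) p := fun v => by
  simp only [funext (coeff_smulForm (F := F) p v c f)]
  exact RegAt.smul hα0 hα1 (contDiffAt_comp_chart_symm (mem_chart_source _ p) (hc p)) (h v)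

lemma Reg.dwedge (hα0 : 0 ≤ α) (hα1 : α ≤ 1) {f : Form S E N} (h : Reg S F E l α f p)
    {c : M → ℂ} (hc : ContMDiff (𝓡 m) 𝓘(ℝ, ℂ) ∞ c) : Reg S F E l α (dwedge c f) p := fun v => by
  have hc' := contDiffAt_comp_chart_symm (mem_chart_source (Rm m) p) (hc p)
  have h1 : ContDiffAt ℝ ∞ (fderiv ℝ (fun z => c ((chartAt (Rm m) p).symm z)))
      (chartAt (Rm m) p p) := hc'.fderiv_right (by simp)
  have key : RegAt l α (fun y => ∑ i : Fin (N + 1), ((-1 : ℝ) ^ (i : ℕ) •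
      fderiv ℝ (fun z => c ((chartAt (Rm m) p).symm z)) y (v i)) •
        coeff S F E p (fun j => v (i.succAbove j)) f y) (chartAt (Rm m) p p) :=
    RegAt.sum _ fun i _ => RegAt.smul hα0 hα1
      ((h1.clm_apply contDiffAt_const).const_smul _) (h _)
  refine key.congr ?_
  filter_upwards [(chartAt (Rm m) p).open_target.mem_nhds (mem_chart_target _ p)] with y hy
  rw [coeff_dwedge ((hc _).mdifferentiableAt (by simp)) f hy]
  simp only [smul_assoc]

lemma Reg.smulForm_of_tsupport (hα0 : 0 ≤ α) (hα1 : α ≤ 1) {f : Form S E N} {c : M → ℂ}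
    (hc : ContMDiff (𝓡 m) 𝓘(ℝ, ℂ) ∞ c) (h : p ∈ tsupport c → Reg S F E l α f p) :
    Reg S F E l α (CRForms.smulForm c f) p := by
  by_cases hp : p ∈ tsupport c
  · exact (h hp).smulForm hα0 hα1 hc
  · refine reg_zero.congr ?_
    filter_upwards [(isClosed_tsupport c).isOpen_compl.mem_nhds hp] with q hq
    simp [CRForms.smulForm, image_eq_zero_of_notMem_tsupport hq]

lemma dfun_eq_zero_of_notMem_tsupport {c : M → ℂ} (hp : p ∉ tsupport c) :
    dfun (m := m) c p = 0 := by
  have h : c =ᶠ[𝓝 p] fun _ => 0 := by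
    filter_upwards [(isClosed_tsupport c).isOpen_compl.mem_nhds hp] with q hq
    exact image_eq_zero_of_notMem_tsupport hq
  have h2 := h.mfderiv_eq (I := 𝓡 m) (I' := 𝓘(ℝ, ℂ))
  ext v
  refine (DFunLike.congr_fun h2 v).trans ?_
  rw [mfderiv_const]; rfl

lemma Reg.dwedge_of_tsupport (hα0 : 0 ≤ α) (hα1 : α ≤ 1) {f : Form S E N} {c : M → ℂ}
    (hc : ContMDiff (𝓡 m) 𝓘(ℝ, ℂ) ∞ c) (h : p ∈ tsupport c → Reg S F E l α f p) :
    Reg S F E l α (CRForms.dwedge c f) p := by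
  by_cases hp : p ∈ tsupport c
  · exact (h hp).dwedge hα0 hα1 hc
  · refine reg_zero.congr ?_
    filter_upwards [(isClosed_tsupport c).isOpen_compl.mem_nhds hp] with q hq
    simp [CRForms.dwedge, dfun_eq_zero_of_notMem_tsupport hq, wedge_zero_left]

lemma smulForm_mem_CForms {f : Form S E (n + r)} (hf : f ∈ CForms S F E ⊤ r l) {c : M → ℂ}
    (hc : ContMDiff (𝓡 m) 𝓘(ℝ, ℂ) ∞ c) : smulForm c f ∈ CForms S F E ⊤ r l := by
  have h := mem_CForms_iff.1 hf
  exact mem_CForms_iff.2 ⟨h.1.smulForm c, fun p hp => absurd trivial hp,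
    fun p hp => (h.2.2 p hp).smulForm le_rfl zero_le_one hc⟩

lemma dwedge_mem_CForms {f : Form S E (n + r)} (hf : f ∈ CForms S F E ⊤ r l) {c : M → ℂ}
    (hc : ContMDiff (𝓡 m) 𝓘(ℝ, ℂ) ∞ c) : dwedge c f ∈ CForms S F E ⊤ (r + 1) l := by
  have h := mem_CForms_iff.1 hf
  exact mem_CForms_iff.2 ⟨h.1.dwedge c, fun p hp => absurd trivial hp,
    fun p hp => (h.2.2 p hp).dwedge le_rfl zero_le_one hc⟩

end

/-! ### Passage between E-valued and scalar forms in a trivialization. -/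

section Frame

/-- The component of an `E`-valued form along the functional `L`, in the trivialization at `ι x`. -/
def unpack (x : M) (L : F →L[ℂ] ℂ) : Form S E N →ₗ[ℂ] Form S (Bundle.Trivial X ℂ) N where
  toFun f p := (((L : F →ₗ[ℂ] ℂ) ∘ₗ
    (trivializationAt F E (S.ι x)).linearMapAt ℂ (S.ι p)).restrictScalars ℝ).compAlternatingMap
      (f p)
  map_add' f g := by funext p; ext v; simp
  map_smul' c f := by funext p; ext v; simp

/-- The `E`-valued form `u ⊗ e`, where `e` is constant in the trivialization at `ι x`. -/
def pack (x : M) (e : F) : Form S (Bundle.Trivial X ℂ) N →ₗ[ℂ] Form S E N where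
  toFun u p := ((((trivializationAt F E (S.ι x)).symmₗ ℂ (S.ι p)) ∘ₗ
    LinearMap.toSpanSingleton ℂ F e).restrictScalars ℝ).compAlternatingMap (u p)
  map_add' f g := by
    funext p; ext v
    exact map_add ((((trivializationAt F E (S.ι x)).symmₗ ℂ (S.ι p)) ∘ₗ
      LinearMap.toSpanSingleton ℂ F e)) (f p v) (g p v)
  map_smul' c f := by
    funext p; ext v
    exact map_smul ((((trivializationAt F E (S.ι x)).symmₗ ℂ (S.ι p)) ∘ₗ
      LinearMap.toSpanSingleton ℂ F e)) c (f p v)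

lemma IsNRForm.comp {E' : X → Type*} [∀ x, AddCommGroup (E' x)] [∀ x, Module ℂ (E' x)]
    {f : Form S E (n + r)} (h : IsNRForm S E r f) (L : ∀ p : M, E (S.ι p) →ₗ[ℂ] E' (S.ι p)) :
    IsNRForm S E' r (fun p => ((L p).restrictScalars ℝ).compAlternatingMap (f p)) := by
  intro p
  obtain ⟨g, hg, hgf⟩ := h p
  refine ⟨((L p).restrictScalars ℝ).compAlternatingMap g, fun c w => ?_,
    fun v => congrArg (L p) (hgf v)⟩
  exact (congrArg (L p) (hg c w)).trans (map_smul _ _ _)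

lemma IsNRForm.unpack {f : Form S E (n + r)} (h : IsNRForm S E r f) (x : M) (L : F →L[ℂ] ℂ) :
    IsNRForm S (Bundle.Trivial X ℂ) r (unpack x L f) :=
  h.comp (E' := Bundle.Trivial X ℂ) fun p =>
    (L : F →ₗ[ℂ] ℂ) ∘ₗ (trivializationAt F E (S.ι x)).linearMapAt ℂ (S.ι p)

lemma IsNRForm.pack {u : Form S (Bundle.Trivial X ℂ) (n + r)}
    (h : IsNRForm S (Bundle.Trivial X ℂ) r u) (x : M) (e : F) : IsNRForm S E r (pack x e u) :=
  h.comp (E := Bundle.Trivial X ℂ) (E' := E) fun p =>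
    ((trivializationAt F E (S.ι x)).symmₗ ℂ (S.ι p)) ∘ₗ LinearMap.toSpanSingleton ℂ F e

lemma coeff_trivial (x : M) (v : Fin N → Rm m) (u : Form S (Bundle.Trivial X ℂ) N) (y : Rm m) :
    coeff S ℂ (Bundle.Trivial X ℂ) x v u y = u ((chartAt (Rm m) x).symm y)
      fun j => mfderiv 𝓘(ℝ, Rm m) (𝓡 m) (chartAt (Rm m) x).symm y (v j) := by
  have h : (trivializationAt ℂ (Bundle.Trivial X ℂ) (S.ι x)).linearMapAt ℂ
      (S.ι ((chartAt (Rm m) x).symm y)) = LinearMap.id :=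
    Bundle.Trivial.linearMapAt_trivialization ℂ X ℂ _
  rw [coeff, h]
  rfl

lemma coeff_unpack (x : M) (L : F →L[ℂ] ℂ) (v : Fin N → Rm m) (f : Form S E N) (y : Rm m) :
    coeff S ℂ (Bundle.Trivial X ℂ) x v (unpack x L f) y = L (coeff S F E x v f y) := by
  rw [coeff_trivial]
  rfl

lemma patch_subset_trivial (x : M) : patch S F E x ⊆ patch S ℂ (Bundle.Trivial X ℂ) x :=
  fun _ hp => ⟨hp.1, trivial⟩

lemma coeff_pack {x : M} {U : Opens M} (e : F) (v : Fin N → Rm m)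
    (u : Form S (Bundle.Trivial X ℂ) N) {y : Rm m} (hy : y ∈ dom S F E x U) :
    coeff S F E x v (pack x e u) y = coeff S ℂ (Bundle.Trivial X ℂ) x v u y • e := by
  rw [coeff_trivial]
  exact Bundle.Trivialization.linearMapAt_symmₗ (R := ℂ) (trivializationAt F E (S.ι x))
    (symm_mem_patch hy).2 _

section

variable [ContMDiffVectorBundle ω F E 𝓘(ℂ, Cn n)]

lemma Reg.unpack (hα0 : 0 ≤ α) (hα1 : α ≤ 1) {f : Form S E N} (h : Reg S F E l α f p)
    (hp : p ∈ patch S F E x) (L : F →L[ℂ] ℂ) :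
    Reg S ℂ (Bundle.Trivial X ℂ) l α (unpack x L f) p := by
  refine reg_of_regAt hα0 hα1 (patch_subset_trivial x hp) fun v => ?_
  simp only [funext (coeff_unpack x L v f)]
  exact RegAt.const_clm_apply hα0 hα1 (L.restrictScalars ℝ) (h.regAt hα0 hα1 hp v)

lemma Reg.pack (hα0 : 0 ≤ α) (hα1 : α ≤ 1) {u : Form S (Bundle.Trivial X ℂ) N}
    (h : Reg S ℂ (Bundle.Trivial X ℂ) l α u p) (hp : p ∈ patch S F E x) (e : F) :
    Reg S F E l α (pack x e u) p := by
  refine reg_of_regAt hα0 hα1 hp fun v => ?_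
  refine (RegAt.const_clm_apply hα0 hα1
    ((ContinuousLinearMap.toSpanSingleton ℂ e).restrictScalars ℝ)
    (h.regAt hα0 hα1 (patch_subset_trivial x hp) v)).congr ?_
  filter_upwards [(isOpen_dom S F E x ⊤).mem_nhds (chart_mem_dom hp trivial)] with y hy
  rw [coeff_pack e v u hy]
  rfl

end

end Frame

end Operations

end
end CRForms

namespace CRForms
noncomputable section

/-! ### The weak exterior derivative on open subsets of ℝᵐ. -/

section Euclidean

open MeasureTheory

variable {m : ℕ} {W W' : Type*} [NormedAddCommGroup W] [NormedSpace ℂ W] [NormedAddCommGroup W']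
  [NormedSpace ℂ W'] {N : ℕ} {D D' : Set (Rm m)} {u : Rm m → Rm m [⋀^Fin N]→ₗ[ℝ] W}
  {g : Rm m → Rm m [⋀^Fin (N + 1)]→ₗ[ℝ] W}

/-- The coefficients of the form `u` are continuous on `D`. -/
def CtsOn (D : Set (Rm m)) (u : Rm m → Rm m [⋀^Fin N]→ₗ[ℝ] W) : Prop :=
  ∀ v, ContinuousOn (fun y => u y v) D

/-- `d u = g` on `D` in the sense of distributions, for forms on an open subset of `ℝᵐ`. -/
def WkD (D : Set (Rm m)) (u : Rm m → Rm m [⋀^Fin N]→ₗ[ℝ] W)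
    (g : Rm m → Rm m [⋀^Fin (N + 1)]→ₗ[ℝ] W) : Prop :=
  ∀ φ : Rm m → ℝ, ContDiff ℝ ∞ φ → HasCompactSupport φ → tsupport φ ⊆ D →
    ∀ v : Fin (N + 1) → Rm m, ∫ y, φ y • g y v =
      -∑ i : Fin (N + 1), (-1 : ℝ) ^ (i : ℕ) •
        ∫ y, (fderiv ℝ φ y (v i)) • u y (fun j => v (i.succAbove j))

lemma integrable_smul_of_tsupport {𝕜 : Type*} [RCLike 𝕜] [NormedSpace 𝕜 W] {φ : Rm m → 𝕜}
    (hφ : Continuous φ) (hc : HasCompactSupport φ) (hD : tsupport φ ⊆ D) {h : Rm m → W}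
    (hh : ContinuousOn h D) : Integrable fun y => φ y • h y := by
  rw [← integrableOn_iff_integrable_of_support_subset (f := fun y => φ y • h y)
    (s := tsupport φ) ((Function.support_smul_subset_left φ h).trans (subset_tsupport φ))]
  exact (hφ.continuousOn.smul (hh.mono hD)).integrableOn_compact hc

lemma WkD.mono (h : WkD D u g) (hD : D' ⊆ D) : WkD D' u g :=
  fun φ h1 h2 h3 => h φ h1 h2 (h3.trans hD)

lemma CtsOn.mono (h : CtsOn D u) (hD : D' ⊆ D) : CtsOn D' u := fun v => (h v).mono hD

lemma integral_smul_congr {φ : Rm m → ℝ}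
    (hφ : tsupport φ ⊆ D) {h h' : Rm m → W} (hh : ∀ y ∈ D, h y = h' y) :
    ∫ y, φ y • h y = ∫ y, φ y • h' y := by
  refine integral_congr_ae (Filter.Eventually.of_forall fun y => ?_)
  by_cases hy : y ∈ tsupport φ
  · simp only [hh y (hφ hy)]
  · simp only [image_eq_zero_of_notMem_tsupport hy, zero_smul]

lemma WkD.congr {u' : Rm m → Rm m [⋀^Fin N]→ₗ[ℝ] W} {g' : Rm m → Rm m [⋀^Fin (N + 1)]→ₗ[ℝ] W}
    (h : WkD D u g) (hu : ∀ y ∈ D, u' y = u y) (hg : ∀ y ∈ D, g' y = g y) : WkD D u' g' := by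
  intro φ h1 h2 h3 v
  rw [integral_smul_congr h3 (h' := fun y => g y v) fun y hy => by rw [hg y hy], h φ h1 h2 h3 v]
  congr 1
  refine Finset.sum_congr rfl fun i _ => ?_
  rw [integral_smul_congr ((tsupport_fderiv_apply_subset ℝ (v i)).trans h3)
    (h' := fun y => u' y (fun j => v (i.succAbove j))) fun y hy => by rw [hu y hy]]

lemma continuous_fderiv_apply {𝕜 : Type*} [RCLike 𝕜] {φ : Rm m → 𝕜} (hφ : ContDiff ℝ ∞ φ)
    (v : Rm m) : Continuous fun y => fderiv ℝ φ y v :=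
  (hφ.continuous_fderiv (by simp)).clm_apply continuous_const

lemma WkD.map [CompleteSpace W] [CompleteSpace W'] (hu : CtsOn D u) (hg : CtsOn D g)
    (h : WkD D u g) (L : W →L[ℂ] W') :
    WkD D (fun y => ((L : W →ₗ[ℂ] W').restrictScalars ℝ).compAlternatingMap (u y))
      (fun y => ((L : W →ₗ[ℂ] W').restrictScalars ℝ).compAlternatingMap (g y)) := by
  intro φ h1 h2 h3 v
  have e : ∀ {ψ : Rm m → ℝ} {w : Rm m → W}, Continuous ψ → HasCompactSupport ψ →
      tsupport ψ ⊆ D → ContinuousOn w D → ∫ y, ψ y • L (w y) = L (∫ y, ψ y • w y) := by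
    intro ψ w k1 k2 k3 k4
    rw [← ContinuousLinearMap.integral_comp_comm L (integrable_smul_of_tsupport k1 k2 k3 k4)]
    exact integral_congr_ae (Filter.Eventually.of_forall fun y =>
      ((L.restrictScalars ℝ).map_smul (ψ y) (w y)).symm)
  refine (e h1.continuous h2 h3 (hg v)).trans ?_
  rw [h φ h1 h2 h3, map_neg, map_sum]
  congr 1
  refine Finset.sum_congr rfl fun i _ => ?_
  refine ((L.restrictScalars ℝ).map_smul _ _).trans (congrArg ((-1 : ℝ) ^ (i : ℕ) • ·) ?_)
  exact (e (continuous_fderiv_apply h1 _) (h2.fderiv_apply ℝ _)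
    ((tsupport_fderiv_apply_subset ℝ (v i)).trans h3) (hu _)).symm

/-- Complex test functions, treated through their real and imaginary parts, are needed for the
Leibniz rule, where a real test function is multiplied by the complex function `c`. -/
lemma WkD.integral_complex (hu : CtsOn D u) (hg : CtsOn D g) (h : WkD D u g) {φ : Rm m → ℂ}
    (h1 : ContDiff ℝ ∞ φ) (h2 : HasCompactSupport φ) (h3 : tsupport φ ⊆ D)
    (v : Fin (N + 1) → Rm m) : ∫ y, φ y • g y v =
      -∑ i : Fin (N + 1), (-1 : ℝ) ^ (i : ℕ) •
        ∫ y, (fderiv ℝ φ y (v i)) • u y (fun j => v (i.succAbove j)) := by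
  let A : Rm m → ℝ := fun y => (φ y).re
  let B : Rm m → ℝ := fun y => (φ y).im
  have hA : ContDiff ℝ ∞ A := Complex.reCLM.contDiff.comp h1
  have hB : ContDiff ℝ ∞ B := Complex.imCLM.contDiff.comp h1
  have hA2 : HasCompactSupport A := h2.comp_left (g := Complex.re) rfl
  have hB2 : HasCompactSupport B := h2.comp_left (g := Complex.im) rfl
  have hA3 : tsupport A ⊆ D := (tsupport_comp_subset (g := Complex.re) rfl φ).trans h3
  have hB3 : tsupport B ⊆ D := (tsupport_comp_subset (g := Complex.im) rfl φ).trans h3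
  have key : ∀ (a b : Rm m → ℝ) (w : Rm m → W), Continuous a → Continuous b →
      HasCompactSupport a → HasCompactSupport b → tsupport a ⊆ D → tsupport b ⊆ D →
      ContinuousOn w D → ∫ y, ((a y : ℂ) + Complex.I * b y) • w y =
        (∫ y, a y • w y) + Complex.I • ∫ y, b y • w y := by
    intro a b w k1 k2 k3 k4 k5 k6 k7
    have hi : Integrable fun y => Complex.I • b y • w y :=
      (integrable_smul_of_tsupport k2 k4 k6 k7).smul Complex.I
    rw [← integral_smul, ← integral_add (integrable_smul_of_tsupport k1 k3 k5 k7) hi]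
    refine integral_congr_ae (Filter.Eventually.of_forall fun y => ?_)
    simp only [add_smul, mul_smul, Complex.coe_smul]
  have eφ : ∀ y, φ y = (A y : ℂ) + Complex.I * B y := fun y => by
    rw [mul_comm]; exact (Complex.re_add_im (φ y)).symm
  have eD : ∀ y w, fderiv ℝ φ y w = (fderiv ℝ A y w : ℂ) + Complex.I * fderiv ℝ B y w := by
    intro y w
    have hd : DifferentiableAt ℝ φ y := (h1.differentiable (by simp)) y
    have e1 : fderiv ℝ A y = Complex.reCLM ∘L fderiv ℝ φ y :=
      (Complex.reCLM.hasFDerivAt.comp y hd.hasFDerivAt).fderiv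
    have e2 : fderiv ℝ B y = Complex.imCLM ∘L fderiv ℝ φ y :=
      (Complex.imCLM.hasFDerivAt.comp y hd.hasFDerivAt).fderiv
    rw [e1, e2, mul_comm]
    exact (Complex.re_add_im _).symm
  simp only [eD]
  simp only [eφ]
  rw [key A B _ hA.continuous hB.continuous hA2 hB2 hA3 hB3 (hg v), h A hA hA2 hA3,
    h B hB hB2 hB3, smul_neg, ← neg_add, Finset.smul_sum, ← Finset.sum_add_distrib]
  congr 1
  refine Finset.sum_congr rfl fun i _ => ?_
  rw [key _ _ _ (continuous_fderiv_apply hA _) (continuous_fderiv_apply hB _)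
    (hA2.fderiv_apply ℝ _) (hB2.fderiv_apply ℝ _)
    ((tsupport_fderiv_apply_subset ℝ (v i)).trans hA3)
    ((tsupport_fderiv_apply_subset ℝ (v i)).trans hB3) (hu _), smul_add, smul_comm Complex.I]

/-- The Leibniz rule, obtained by testing `d u = g` with `φ c`. Because `φ c` is supported in
`tsupport c`, the result holds on all of `D'`, although `u` is controlled only on `D`; this allows a
form to be cut off and extended by zero. -/
theorem WkD.smul (hu : CtsOn D u) (hg : CtsOn D g) (h : WkD D u g) (hD' : IsOpen D')
    {c : Rm m → ℂ} (hc : ContDiffOn ℝ ∞ c D') (hs : D' ∩ tsupport c ⊆ D) :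
    WkD D' (fun y => c y • u y)
      (fun y => wedge (fderiv ℝ c y : Rm m →ₗ[ℝ] ℂ) (u y) + c y • g y) := by
  intro φ h1 h2 h3 v
  have hcat : ∀ y ∈ tsupport φ, ContDiffAt ℝ ∞ c y := fun y hy =>
    hc.contDiffAt (hD'.mem_nhds (h3 hy))
  -- `c` is smooth only on `D'`, but its product with a function supported in `tsupport φ` is smooth
  -- everywhere.
  have hext : ∀ {ψ : Rm m → ℂ} {b : Rm m → ℂ}, ContDiff ℝ ∞ ψ → tsupport ψ ⊆ tsupport φ →
      (∀ y ∈ tsupport φ, ContDiffAt ℝ ∞ b y) → ContDiff ℝ ∞ (fun y => ψ y * b y) := by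
    intro ψ b k1 k2 k3
    rw [contDiff_iff_contDiffAt]
    intro y
    by_cases hy : y ∈ tsupport φ
    · exact k1.contDiffAt.mul (k3 y hy)
    · refine (contDiffAt_const (c := (0 : ℂ))).congr_of_eventuallyEq ?_
      filter_upwards [(isClosed_tsupport φ).isOpen_compl.mem_nhds hy] with z hz
      rw [image_eq_zero_of_notMem_tsupport fun h => hz (k2 h), zero_mul]
  let Φ : Rm m → ℂ := fun y => (φ y : ℂ)
  have hΦ : ContDiff ℝ ∞ Φ := Complex.ofRealCLM.contDiff.comp h1
  have hΦs : tsupport Φ ⊆ tsupport φ := tsupport_comp_subset (g := Complex.ofReal) rfl φ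
  have hΦd : ∀ y w, fderiv ℝ Φ y w = (fderiv ℝ φ y w : ℂ) := fun y w => by
    have hd : DifferentiableAt ℝ φ y := (h1.differentiable (by simp)) y
    rw [(Complex.ofRealCLM.hasFDerivAt.comp y hd.hasFDerivAt).fderiv (f := Φ)]
    rfl
  let θ : Rm m → ℂ := fun y => Φ y * c y
  have hθ : ContDiff ℝ ∞ θ := hext hΦ hΦs hcat
  have hθc : tsupport θ ⊆ tsupport c := tsupport_mul_subset_right
  have hθφ : tsupport θ ⊆ tsupport φ := tsupport_mul_subset_left.trans hΦs
  have hcomp : ∀ {ψ : Rm m → ℂ}, tsupport ψ ⊆ tsupport φ → HasCompactSupport ψ := fun k =>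
    h2.of_isClosed_subset (isClosed_tsupport _) k
  have hsub : tsupport θ ⊆ D := fun y hy => hs ⟨h3 (hθφ hy), hθc hy⟩
  have key := h.integral_complex hu hg hθ (hcomp hθφ) hsub v
  have hθd : ∀ y w, fderiv ℝ θ y w = fderiv ℝ Φ y w * c y + Φ y * fderiv ℝ c y w := by
    intro y w
    by_cases hy : y ∈ tsupport φ
    · have e' : fderiv ℝ θ y = _ := ((hΦ.differentiable (by simp) y).hasFDerivAt.mul
        ((hcat y hy).differentiableAt (by simp)).hasFDerivAt).fderiv
      rw [e']
      simp [mul_comm]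
      ring
    · have hz : ∀ {ψ : Rm m → ℂ}, tsupport ψ ⊆ tsupport φ → fderiv ℝ ψ y = 0 := fun k =>
        image_eq_zero_of_notMem_tsupport
          (f := fderiv ℝ _) fun h => hy (k (tsupport_fderiv_subset ℝ h))
      rw [hz hθφ, hz hΦs, image_eq_zero_of_notMem_tsupport fun h => hy (hΦs h)]
      simp
  let a : Fin (N + 1) → Rm m → ℂ := fun i y => fderiv ℝ Φ y (v i) * c y
  let b : Fin (N + 1) → Rm m → ℂ := fun i y => Φ y * fderiv ℝ c y (v i)
  let U : Fin (N + 1) → Rm m → W := fun i y => u y (fun j => v (i.succAbove j))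
  have ha : ∀ i, ContDiff ℝ ∞ (a i) := fun i =>
    hext ((hΦ.fderiv_right (m := ∞) (by simp)).clm_apply contDiff_const)
      ((tsupport_fderiv_apply_subset ℝ (v i)).trans hΦs) hcat
  have hb : ∀ i, ContDiff ℝ ∞ (b i) := fun i => hext hΦ hΦs fun y hy =>
    ((hcat y hy).fderiv_right (m := ∞) (by simp)).clm_apply contDiffAt_const
  have haφ : ∀ i, tsupport (a i) ⊆ tsupport φ := fun i =>
    tsupport_mul_subset_left.trans ((tsupport_fderiv_apply_subset ℝ (v i)).trans hΦs)
  have hbφ : ∀ i, tsupport (b i) ⊆ tsupport φ := fun i => tsupport_mul_subset_left.trans hΦs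
  have haD : ∀ i, tsupport (a i) ⊆ D := fun i y hy =>
    hs ⟨h3 (haφ i hy), tsupport_mul_subset_right hy⟩
  have hbD : ∀ i, tsupport (b i) ⊆ D := fun i y hy =>
    hs ⟨h3 (hbφ i hy), tsupport_fderiv_apply_subset ℝ (v i) (tsupport_mul_subset_right hy)⟩
  have hai : ∀ i, Integrable fun y => a i y • U i y := fun i =>
    integrable_smul_of_tsupport (ha i).continuous (hcomp (haφ i)) (haD i) (hu _)
  have hbi : ∀ i, Integrable fun y => b i y • U i y := fun i =>
    integrable_smul_of_tsupport (hb i).continuous (hcomp (hbφ i)) (hbD i) (hu _)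
  have hbi' : ∀ i : Fin (N + 1), Integrable fun y => (-1 : ℝ) ^ (i : ℕ) • b i y • U i y :=
    fun i => (hbi i).smul ((-1 : ℝ) ^ (i : ℕ))
  have hθi : Integrable fun y => θ y • g y v :=
    integrable_smul_of_tsupport hθ.continuous (hcomp hθφ) hsub (hg v)
  have e1 : ∀ y, φ y • (wedge (fderiv ℝ c y : Rm m →ₗ[ℝ] ℂ) (u y) + c y • g y) v =
      (∑ i : Fin (N + 1), (-1 : ℝ) ^ (i : ℕ) • b i y • U i y) + θ y • g y v := by
    intro y
    rw [AlternatingMap.add_apply, AlternatingMap.smul_apply, wedge_apply, ← Complex.coe_smul,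
      smul_add, Finset.smul_sum, smul_smul]
    congr 1
    refine Finset.sum_congr rfl fun i _ => ?_
    rw [smul_comm, smul_smul]
    rfl
  have e2 : ∀ i y, fderiv ℝ θ y (v i) • U i y = a i y • U i y + b i y • U i y := by
    intro i y
    rw [hθd, add_smul]
  have e3 : ∀ i y, fderiv ℝ φ y (v i) • c y • U i y = a i y • U i y := by
    intro i y
    rw [← Complex.coe_smul, smul_smul, ← hΦd]
  simp only [e1]
  rw [integral_add (integrable_finsetSum _ fun i _ => hbi' i) hθi,
    integral_finsetSum _ fun i _ => hbi' i, key]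
  simp only [AlternatingMap.smul_apply]
  rw [← sub_eq_add_neg, sub_eq_iff_eq_add, ← sub_eq_neg_add, ← Finset.sum_sub_distrib]
  refine Finset.sum_congr rfl fun i _ => ?_
  have e4 : (∫ y, fderiv ℝ θ y (v i) • u y (fun j => v (i.succAbove j))) =
      (∫ y, a i y • U i y) + ∫ y, b i y • U i y := by
    rw [← integral_add (hai i) (hbi i)]
    exact integral_congr_ae (Filter.Eventually.of_forall fun y => e2 i y)
  have e5 : (∫ y, fderiv ℝ φ y (v i) • c y • u y (fun j => v (i.succAbove j))) =
      ∫ y, a i y • U i y :=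
    integral_congr_ae (Filter.Eventually.of_forall fun y => e3 i y)
  rw [e4, e5, integral_smul, smul_add]
  abel

lemma WkD.const_zero {c : ℂ} : WkD (N := 0) D
    (fun _ => AlternatingMap.constOfIsEmpty ℝ (Rm m) (Fin 0) c) 0 := by
  intro φ h1 h2 h3 v
  have h := integral_smul_fderiv_eq_neg_fderiv_smul_of_integrable (μ := volume) (v := v 0) (f := φ)
    (g := fun _ : Rm m => c) (by
      exact integrable_smul_of_tsupport (D := Set.univ) (continuous_fderiv_apply h1 _)
        (h2.fderiv_apply ℝ _) (Set.subset_univ _) continuousOn_const) (by simp)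
    (integrable_smul_of_tsupport (D := Set.univ) h1.continuous h2 (Set.subset_univ _)
      continuousOn_const) (fun y _ => h1.differentiable (by simp) y)
    (fun y _ => differentiableAt_const _)
  simp at h ⊢
  exact h

/-- This is d ∘ d = 0: the double sum is an alternatization of the second derivative of the test
function, which is symmetric. -/
theorem WkD.closed (hu : CtsOn D u) (h : WkD D u g) : WkD D g 0 := by
  intro φ h1 h2 h3 v
  have hφ' : ContDiff ℝ ∞ (fderiv ℝ φ) := h1.fderiv_right (by simp)
  have hd : ∀ w, ContDiff ℝ ∞ (fun y => fderiv ℝ φ y w) := fun w =>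
    hφ'.clm_apply contDiff_const
  have hdd : ∀ y w z, fderiv ℝ (fun y => fderiv ℝ φ y w) y z = fderiv ℝ (fderiv ℝ φ) y z w := by
    intro y w z
    rw [fderiv_clm_apply (hφ'.differentiable (by simp) y) (differentiableAt_const _)]
    simp
  have hs : ∀ w, tsupport (fun y => fderiv ℝ φ y w) ⊆ D := fun w =>
    (tsupport_fderiv_apply_subset ℝ w).trans h3
  have hc : ∀ w, HasCompactSupport fun y => fderiv ℝ φ y w := fun w => h2.fderiv_apply ℝ w
  have hi : ∀ (i : Fin (N + 1 + 1)) (j : Fin (N + 1)), Integrable fun y =>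
      (-1 : ℝ) ^ (i : ℕ) • (-1 : ℝ) ^ (j : ℕ) •
        (fderiv ℝ (fderiv ℝ φ) y (v (i.succAbove j)) (v i) •
          u y fun k => v (i.succAbove (j.succAbove k))) := by
    intro i j
    have := integrable_smul_of_tsupport (continuous_fderiv_apply (hd (v i)) (v (i.succAbove j)))
      ((hc (v i)).fderiv_apply ℝ _) ((tsupport_fderiv_apply_subset ℝ _).trans (hs (v i)))
      (hu fun k => v (i.succAbove (j.succAbove k)))
    simp only [hdd] at this
    exact (this.smul ((-1 : ℝ) ^ (j : ℕ))).smul ((-1 : ℝ) ^ (i : ℕ))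
  have e : ∑ i : Fin (N + 1 + 1), (-1 : ℝ) ^ (i : ℕ) •
      ∫ y, (fderiv ℝ φ y (v i)) • g y (fun j => v (i.succAbove j)) =
      -∫ y, ∑ i : Fin (N + 1 + 1), ∑ j : Fin (N + 1), (-1 : ℝ) ^ (i : ℕ) • (-1 : ℝ) ^ (j : ℕ) •
        (fderiv ℝ (fderiv ℝ φ) y (v (i.succAbove j)) (v i) •
          u y fun k => v (i.succAbove (j.succAbove k))) := by
    rw [integral_finsetSum _ fun i _ => integrable_finsetSum _ fun j _ => hi i j,
      ← Finset.sum_neg_distrib]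
    refine Finset.sum_congr rfl fun i _ => ?_
    rw [integral_finsetSum _ fun j _ => hi i j, h _ (hd (v i)) (hc (v i)) (hs (v i)), smul_neg,
      Finset.smul_sum]
    congr 1
    refine Finset.sum_congr rfl fun j _ => ?_
    rw [integral_smul, integral_smul]
    simp only [hdd]
  have e0 : ∀ y, ∑ i : Fin (N + 1 + 1), ∑ j : Fin (N + 1), (-1 : ℝ) ^ (i : ℕ) •
      (-1 : ℝ) ^ (j : ℕ) • (fderiv ℝ (fderiv ℝ φ) y (v (i.succAbove j)) (v i) •
          u y fun k => v (i.succAbove (j.succAbove k))) = 0 := by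
    intro y
    let B : Rm m →ₗ[ℝ] Rm m →ₗ[ℝ] Rm m [⋀^Fin N]→ₗ[ℝ] W :=
      LinearMap.mk₂ ℝ (fun a b => fderiv ℝ (fderiv ℝ φ) y a b • u y)
        (fun a b c => by simp [add_smul]) (fun c a b => by simp [mul_smul])
        (fun a b c => by simp [add_smul]) (fun c a b => by simp [mul_smul])
    have hsym := (h1.contDiffAt (x := y)).isSymmSndFDerivAt (by
      rw [minSmoothness_of_isRCLikeNormedField]; exact WithTop.coe_le_coe.2 (le_top : (2 : ℕ∞) ≤ ⊤))
    have h0 := AlternatingMap.alternatizeUncurryFin_alternatizeUncurryFinLM_comp_of_symmetric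
      (f := B) (fun a b => by
        simp only [B, LinearMap.mk₂_apply]
        rw [hsym a b])
    have h4 := DFunLike.congr_fun h0 v
    simp only [AlternatingMap.alternatizeUncurryFin_apply, LinearMap.comp_apply,
      AlternatingMap.alternatizeUncurryFinLM_apply, B, LinearMap.mk₂_apply,
      AlternatingMap.smul_apply, AlternatingMap.zero_apply, Finset.smul_sum] at h4
    refine Eq.trans ?_ h4
    refine Finset.sum_congr rfl fun i _ => Finset.sum_congr rfl fun j _ => ?_
    rw [hsym]
    rcases Nat.even_or_odd (i : ℕ) with hi | hi <;> rcases Nat.even_or_odd (j : ℕ) with hj | hj <;>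
      simp [hi.neg_one_pow, hj.neg_one_pow] <;> rfl
  rw [e]
  simp only [e0]
  simp

end Euclidean

/-! ### The weak exterior derivative on M. -/

section Manifold

variable {n m : ℕ} {X : Type*} [TopologicalSpace X] [ChartedSpace (Cn n) X]
  [IsManifold 𝓘(ℂ, Cn n) ω X]
  {M : Type*} [TopologicalSpace M] [ChartedSpace (Rm m) M] [IsManifold (𝓡 m) ∞ M]
  {S : GenericCR n m X M}
  {F : Type*} [NormedAddCommGroup F] [NormedSpace ℂ F]
  {E : X → Type*} [∀ x, AddCommGroup (E x)] [∀ x, Module ℂ (E x)]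
  [TopologicalSpace (Bundle.TotalSpace F E)] [∀ x, TopologicalSpace (E x)]
  [FiberBundle F E] [VectorBundle ℂ F E]
  {N r : ℕ} {l : ℕ∞} {x : M} {U : Opens M}

lemma isWeakD_iff {f : Form S E N} {g : Form S E (N + 1)} : IsWeakD S F E U f g ↔
    ∀ x, WkD (dom S F E x U) (coeffAlt S F E x f) (coeffAlt S F E x g) := Iff.rfl

lemma ctsOn_coeffAlt {f : Form S E (n + r)} (hf : f ∈ CForms S F E U r l) (x : M) :
    CtsOn (dom S F E x U) (coeffAlt S F E x f) := fun v => (hf.2.2 x v).continuousOn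

lemma coeffAlt_add (x : M) (f g : Form S E N) (y : Rm m) :
    coeffAlt S F E x (f + g) y = coeffAlt S F E x f y + coeffAlt S F E x g y := by
  ext v
  exact congrFun (coeff_add S F E x v f g) y

lemma coeffAlt_zero (x : M) : coeffAlt S F E x (0 : Form S E N) = 0 := by
  funext y; ext v
  exact congrFun (coeff_zero S F E x v) y

lemma contDiffOn_comp_symm {c : M → ℂ} (hc : ContMDiff (𝓡 m) 𝓘(ℝ, ℂ) ∞ c) (x : M) :
    ContDiffOn ℝ ∞ (fun y => c ((chartAt (Rm m) x).symm y)) (chartAt (Rm m) x).target := by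
  intro y hy
  have h := contDiffAt_comp_chart_symm ((chartAt (Rm m) x).map_target hy) (hc _)
  rw [(chartAt (Rm m) x).right_inv hy] at h
  exact h.contDiffWithinAt

lemma symm_mem_tsupport {c : M → ℂ} {y : Rm m} (hy : y ∈ (chartAt (Rm m) x).target)
    (h : y ∈ tsupport fun y => c ((chartAt (Rm m) x).symm y)) :
    (chartAt (Rm m) x).symm y ∈ tsupport c := by
  refine mem_closure_of_frequently_of_tendsto ?_ ((chartAt (Rm m) x).continuousAt_symm hy)
  exact mem_closure_iff_frequently.1 h

theorem WkD.smulForm {f : Form S E N} {g : Form S E (N + 1)}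
    (hf : CtsOn (dom S F E x U) (coeffAlt S F E x f))
    (hg : CtsOn (dom S F E x U) (coeffAlt S F E x g))
    (h : WkD (dom S F E x U) (coeffAlt S F E x f) (coeffAlt S F E x g)) {c : M → ℂ}
    (hc : ContMDiff (𝓡 m) 𝓘(ℝ, ℂ) ∞ c) (hs : tsupport c ⊆ U) :
    WkD (dom S F E x ⊤) (coeffAlt S F E x (smulForm c f))
      (coeffAlt S F E x (dwedge c f + CRForms.smulForm c g)) := by
  refine (h.smul hf hg (isOpen_dom S F E x ⊤) ((contDiffOn_comp_symm hc x).mono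
    fun y hy => hy.1) ?_).congr (fun y hy => coeffAlt_smulForm x c f y) fun y hy => ?_
  · rintro y ⟨hy, hy'⟩
    exact ⟨hy.1, hs (symm_mem_tsupport hy.1 hy'), hy.2.2⟩
  · rw [coeffAlt_add, coeffAlt_smulForm, coeffAlt_dwedge ((hc _).mdifferentiableAt (by simp)) f hy.1]

lemma WkD.unpack [CompleteSpace F] {f : Form S E N} {g : Form S E (N + 1)}
    (hf : CtsOn (dom S F E x U) (coeffAlt S F E x f))
    (hg : CtsOn (dom S F E x U) (coeffAlt S F E x g))
    (h : WkD (dom S F E x U) (coeffAlt S F E x f) (coeffAlt S F E x g)) (L : F →L[ℂ] ℂ) :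
    WkD (dom S F E x U) (coeffAlt S ℂ (Bundle.Trivial X ℂ) x (unpack x L f))
      (coeffAlt S ℂ (Bundle.Trivial X ℂ) x (CRForms.unpack x L g)) :=
  (h.map hf hg L).congr (fun y _ => AlternatingMap.ext fun v => coeff_unpack x L v f y)
    (fun y _ => AlternatingMap.ext fun v => coeff_unpack x L v g y)

lemma IsWeakD.closed {f : Form S E (n + r)} {g : Form S E (n + (r + 1))}
    (hf : f ∈ CForms S F E U r l) (h : IsWeakD S F E U f g) : IsWeakD S F E U g 0 := fun x => by
  have := (isWeakD_iff.1 h x).closed (ctsOn_coeffAlt hf x)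
  rw [← coeffAlt_zero (S := S) (E := E) x] at this
  exact this

lemma IsWeakD.neg {f : Form S E N} {g : Form S E (N + 1)} (h : IsWeakD S F E ⊤ f g) :
    IsWeakD S F E ⊤ (-f) (-g) := by
  have := h.smul (-1)
  rwa [neg_one_smul, neg_one_smul] at this

lemma IsWeakD.sub {f f' : Form S E (n + r)} {g g' : Form S E (n + (r + 1))}
    (hf : f ∈ CForms S F E ⊤ r 0) (hf' : f' ∈ CForms S F E ⊤ r 0)
    (hg : g ∈ CForms S F E ⊤ (r + 1) 0) (hg' : g' ∈ CForms S F E ⊤ (r + 1) 0)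
    (h : IsWeakD S F E ⊤ f g) (h' : IsWeakD S F E ⊤ f' g') :
    IsWeakD S F E ⊤ (f - f') (g - g') := by
  rw [sub_eq_add_neg, sub_eq_add_neg]
  exact h.add hf (neg_mem hf') hg (neg_mem hg') h'.neg

lemma IsWeakD.sum {κ : Type*} (s : Finset κ) {f : κ → Form S E (n + r)}
    {g : κ → Form S E (n + (r + 1))} (hf : ∀ i, f i ∈ CForms S F E ⊤ r 0)
    (hg : ∀ i, g i ∈ CForms S F E ⊤ (r + 1) 0) (h : ∀ i, IsWeakD S F E ⊤ (f i) (g i)) :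
    IsWeakD S F E ⊤ (∑ i ∈ s, f i) (∑ i ∈ s, g i) := by
  classical
  induction s using Finset.induction_on with
  | empty => simpa using IsWeakD.zero S F E
  | insert i s hi ih =>
    rw [Finset.sum_insert hi, Finset.sum_insert hi]
    exact (h i).add (hf i) (sum_mem fun j _ => hf j) (hg i) (sum_mem fun j _ => hg j) ih

end Manifold

end
end CRForms

namespace CRForms
noncomputable section

/-! ### Local frames of closed smooth (n,s)-forms. -/

section Frames

variable {n m : ℕ} {X : Type*} [TopologicalSpace X] [ChartedSpace (Cn n) X]
  [IsManifold 𝓘(ℂ, Cn n) ω X]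
  {M : Type*} [TopologicalSpace M] [ChartedSpace (Rm m) M] [IsManifold (𝓡 m) ∞ M]
  {S : GenericCR n m X M} {x p : M} {s t : ℕ}

lemma t2Space_of_genericCR [T2Space X] (S : GenericCR n m X M) : T2Space M :=
  S.isSmoothEmbedding.isEmbedding.t2Space

lemma exists_contMDiff_eventuallyEq [T2Space M] {O : Set M} (hO : O ∈ 𝓝 x) {h : M → ℂ}
    (hh : ∀ p ∈ O, ContMDiffAt (𝓡 m) 𝓘(ℝ, ℂ) ∞ h p) :
    ∃ h' : M → ℂ, ContMDiff (𝓡 m) 𝓘(ℝ, ℂ) ∞ h' ∧ h' =ᶠ[𝓝 x] h := by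
  obtain ⟨f, -, hf⟩ := (SmoothBumpFunction.nhds_basis_tsupport (I := 𝓡 m) x).mem_iff.1 hO
  refine ⟨fun p => f p • h p, contMDiff_of_tsupport fun p hp => ?_, ?_⟩
  · have hp' : p ∈ tsupport f := tsupport_smul_subset_left (f : M → ℝ) h hp
    exact (f.contMDiff p).smul (hh p (hf hp'))
  · filter_upwards [f.eventuallyEq_one] with p hp
    simp [hp]

lemma dfun_comp_ι {h : X → ℂ} (hh : MDifferentiableAt 𝓘(ℂ, Cn n) 𝓘(ℂ, ℂ) h (S.ι p))
    (v : TangentSpace (𝓡 m) p) : dfun (fun q => h (S.ι q)) p v =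
      mfderiv 𝓘(ℂ, Cn n) 𝓘(ℂ, ℂ) h (S.ι p) (mfderiv (𝓡 m) 𝓘(ℝ, Cn n) S.ι p v) := by
  have h1 := hh.hasMFDerivAt
  have h2 : HasMFDerivAt 𝓘(ℝ, Cn n) 𝓘(ℝ, ℂ) h (S.ι p)
      ((mfderiv 𝓘(ℂ, Cn n) 𝓘(ℂ, ℂ) h (S.ι p) : Cn n →L[ℂ] ℂ).restrictScalars ℝ) := by
    refine ⟨h1.1, ?_⟩
    exact HasFDerivWithinAt.restrictScalars ℝ h1.2
  have h3 := HasMFDerivAt.comp p h2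
    ((S.isSmoothEmbedding.contMDiff p).mdifferentiableAt (by simp)).hasMFDerivAt
  exact DFunLike.congr_fun h3.mfderiv v

lemma exists_complex_combination {R : Rm m →ₗ[ℝ] Cn n}
    (h : Submodule.span ℂ (Set.range R) = ⊤) (w : Cn n) :
    ∃ a b, R a + Complex.I • R b = w := by
  have hw : w ∈ Submodule.span ℂ (Set.range R) := h ▸ trivial
  induction hw using Submodule.span_induction with
  | mem w hw =>
    obtain ⟨a, rfl⟩ := hw
    exact ⟨a, 0, by simp⟩
  | zero => exact ⟨0, 0, by simp⟩
  | add w w' _ _ ih ih' =>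
    obtain ⟨a, b, rfl⟩ := ih
    obtain ⟨a', b', rfl⟩ := ih'
    exact ⟨a + a', b + b', by simp only [map_add, smul_add]; abel⟩
  | smul c w _ ih =>
    obtain ⟨a, b, rfl⟩ := ih
    refine ⟨c.re • a - c.im • b, c.im • a + c.re • b, ?_⟩
    simp only [map_add, map_sub, map_smul, smul_add, ← Complex.coe_smul]
    conv_rhs => rw [← Complex.re_add_im c]
    match_scalars
    · ring
    · ring_nf
      rw [Complex.I_sq]
      ring

/-- The exterior product of the differentials of finitely many functions. -/
def dList (S : GenericCR n m X M) : (t : ℕ) → (Fin t → M → ℂ) → Form S (Bundle.Trivial X ℂ) t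
  | 0, _ => fun p => AlternatingMap.constOfIsEmpty ℝ (TangentSpace (𝓡 m) p) (Fin 0) (1 : ℂ)
  | t + 1, h => dwedge (h 0) (dList S t (Fin.tail h))

/-- The forms `dc_{J 0} ∧ … ∧ dc_{J (s - 1)} ∧ dz_0 ∧ … ∧ dz_{n - 1}`. -/
def frameForm (S : GenericCR n m X M) (z : Fin n → M → ℂ) (c : Fin m → M → ℂ) :
    (s : ℕ) → (Fin s → Fin m) → Form S (Bundle.Trivial X ℂ) (n + s)
  | 0, _ => dList S n z
  | s + 1, J => dwedge (c (J 0)) (frameForm S z c s (Fin.tail J))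

lemma reg_dList {h : Fin t → M → ℂ} (hh : ∀ j, ContMDiff (𝓡 m) 𝓘(ℝ, ℂ) ∞ (h j)) (p : M) :
    Reg S ℂ (Bundle.Trivial X ℂ) ⊤ 0 (dList S t h) p := by
  induction t with
  | zero =>
    intro v
    have e : coeff S ℂ (Bundle.Trivial X ℂ) p v (dList S 0 h) = fun _ => 1 := by
      funext y
      rw [coeff_trivial]; rfl
    rw [e]
    exact regAt_const _ _
  | succ t ih => exact (ih fun j => hh j.succ).dwedge le_rfl zero_le_one (hh 0)

lemma reg_frameForm {z : Fin n → M → ℂ} {c : Fin m → M → ℂ}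
    (hz : ∀ j, ContMDiff (𝓡 m) 𝓘(ℝ, ℂ) ∞ (z j)) (hc : ∀ k, ContMDiff (𝓡 m) 𝓘(ℝ, ℂ) ∞ (c k))
    (s : ℕ) (J : Fin s → Fin m) (p : M) :
    Reg S ℂ (Bundle.Trivial X ℂ) ⊤ 0 (frameForm S z c s J) p := by
  induction s with
  | zero => exact reg_dList hz p
  | succ s ih => exact (ih (Fin.tail J)).dwedge le_rfl zero_le_one (hc _)

lemma ctsOn_of_reg {F : Type*} [NormedAddCommGroup F] [NormedSpace ℂ F]
    {E : X → Type*} [∀ x, AddCommGroup (E x)] [∀ x, Module ℂ (E x)]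
    [TopologicalSpace (Bundle.TotalSpace F E)] [∀ x, TopologicalSpace (E x)]
    [FiberBundle F E] [VectorBundle ℂ F E] [ContMDiffVectorBundle ω F E 𝓘(ℂ, Cn n)]
    {N : ℕ} {f : Form S E N} {U : Opens M} {l : ℕ∞} (h : ∀ p ∈ U, Reg S F E l 0 f p) (x : M) :
    CtsOn (dom S F E x U) (coeffAlt S F E x f) := by
  intro v y hy
  have h1 := (h _ hy.2.1).regAt le_rfl zero_le_one (symm_mem_patch hy) v
  rw [chart_symm_of_mem_dom hy] at h1
  exact h1.1.continuousAt.continuousWithinAt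

/-- Since `d f = 0`, the Leibniz rule gives `d (c f) = dc ∧ f`, and `WkD.closed` applies to it. -/
lemma isWeakD_dwedge_zero {N : ℕ} {f : Form S (Bundle.Trivial X ℂ) N}
    (hr : ∀ p, Reg S ℂ (Bundle.Trivial X ℂ) ⊤ 0 f p)
    (h : IsWeakD S ℂ (Bundle.Trivial X ℂ) ⊤ f 0) {c : M → ℂ}
    (hc : ContMDiff (𝓡 m) 𝓘(ℝ, ℂ) ∞ c) :
    IsWeakD S ℂ (Bundle.Trivial X ℂ) ⊤ (dwedge c f) 0 := by
  refine isWeakD_iff.2 fun x => ?_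
  have h0 : CtsOn (dom S ℂ (Bundle.Trivial X ℂ) x ⊤)
      (coeffAlt S ℂ (Bundle.Trivial X ℂ) x (0 : Form S (Bundle.Trivial X ℂ) (N + 1))) := by
    rw [coeffAlt_zero]; exact fun v => continuousOn_const
  have h1 := (isWeakD_iff.1 h x).smulForm (ctsOn_of_reg (fun p _ => hr p) x) h0 hc
    (Set.subset_univ _)
  have e : smulForm c (0 : Form S (Bundle.Trivial X ℂ) (N + 1)) = 0 := by
    funext p; simp [smulForm]
  rw [e, add_zero] at h1
  have h2 := h1.closed (ctsOn_of_reg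
    (fun p _ => (hr p).smulForm le_rfl zero_le_one hc) x)
  exact h2.congr (fun _ _ => rfl) fun y _ => by rw [coeffAlt_zero]

lemma isWeakD_dList {h : Fin t → M → ℂ} (hh : ∀ j, ContMDiff (𝓡 m) 𝓘(ℝ, ℂ) ∞ (h j)) :
    IsWeakD S ℂ (Bundle.Trivial X ℂ) ⊤ (dList S t h) 0 := by
  induction t with
  | zero =>
    refine isWeakD_iff.2 fun x => ?_
    refine (WkD.const_zero (c := (1 : ℂ))).congr (fun y _ => ?_) fun y _ => by
      rw [coeffAlt_zero]
    ext v
    exact coeff_trivial (S := S) x v (dList S 0 h) y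
  | succ t ih =>
    exact isWeakD_dwedge_zero (fun p => reg_dList (fun j => hh j.succ) p)
      (ih fun j => hh j.succ) (hh 0)

lemma isWeakD_frameForm {z : Fin n → M → ℂ} {c : Fin m → M → ℂ}
    (hz : ∀ j, ContMDiff (𝓡 m) 𝓘(ℝ, ℂ) ∞ (z j)) (hc : ∀ k, ContMDiff (𝓡 m) 𝓘(ℝ, ℂ) ∞ (c k))
    (s : ℕ) (J : Fin s → Fin m) :
    IsWeakD S ℂ (Bundle.Trivial X ℂ) ⊤ (frameForm S z c s J) 0 := by
  induction s with
  | zero => exact isWeakD_dList hz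
  | succ s ih =>
    exact isWeakD_dwedge_zero (fun p => reg_frameForm hz hc s _ p) (ih (Fin.tail J)) (hc _)

lemma dList_eq_comp {h : Fin t → M → ℂ} {L : Fin t → Cn n →ₗ[ℂ] ℂ}
    (hL : ∀ j v, dfun (h j) p v = L j (mfderiv (𝓡 m) 𝓘(ℝ, Cn n) S.ι p v)) :
    ∃ g : Cn n [⋀^Fin t]→ₗ[ℝ] ℂ, IsHomog t 0 g ∧ ∀ v : Fin t → TangentSpace (𝓡 m) p,
      dList S t h p v = g fun j => (mfderiv (𝓡 m) 𝓘(ℝ, Cn n) S.ι p (v j) : Cn n) := by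
  induction t with
  | zero => exact ⟨AlternatingMap.constOfIsEmpty ℝ _ (Fin 0) 1, fun c w => by simp, fun v => rfl⟩
  | succ t ih =>
    obtain ⟨g, hg, hgf⟩ := ih (h := Fin.tail h) (L := Fin.tail L) fun j v => hL j.succ v
    refine ⟨wedge ((L 0).restrictScalars ℝ) g, hg.wedge_linear (L 0), fun v => ?_⟩
    refine (wedge_apply _ _ v).trans (Eq.trans ?_ (wedge_apply _ g _).symm)
    refine Finset.sum_congr rfl fun i _ => ?_
    rw [hL, hgf]
    rfl

lemma isNRAt_frameForm {z : Fin n → M → ℂ} {c : Fin m → M → ℂ} {L : Fin n → Cn n →ₗ[ℂ] ℂ}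
    (hL : ∀ j v, dfun (z j) p v = L j (mfderiv (𝓡 m) 𝓘(ℝ, Cn n) S.ι p v))
    (s : ℕ) (J : Fin s → Fin m) : IsNRAt S (Bundle.Trivial X ℂ) s p (frameForm S z c s J p) := by
  induction s with
  | zero => exact dList_eq_comp hL
  | succ s ih => exact (ih (Fin.tail J)).wedge _

lemma coeffAlt_dList {h : Fin t → M → ℂ} (hh : ∀ j, ContMDiff (𝓡 m) 𝓘(ℝ, ℂ) ∞ (h j)) {y : Rm m}
    (hy : y ∈ (chartAt (Rm m) x).target) :
    coeffAlt S ℂ (Bundle.Trivial X ℂ) x (dList S t h) y = wedgeList t fun j =>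
      (fderiv ℝ (fun z => h j ((chartAt (Rm m) x).symm z)) y : Rm m →ₗ[ℝ] ℂ) := by
  induction t with
  | zero => ext v; exact coeff_trivial (S := S) x v (dList S 0 h) y
  | succ t ih =>
    have h1 := coeffAlt_dwedge (S := S) (E := Bundle.Trivial X ℂ) (F := ℂ) (x := x) ((hh 0 _).mdifferentiableAt (by simp)) (dList S t (Fin.tail h)) hy
    rw [ih (h := Fin.tail h) fun j => hh j.succ] at h1
    exact h1

lemma coeffAlt_frameForm {z : Fin n → M → ℂ} {c : Fin m → M → ℂ}
    (hz : ∀ j, ContMDiff (𝓡 m) 𝓘(ℝ, ℂ) ∞ (z j)) (hc : ∀ k, ContMDiff (𝓡 m) 𝓘(ℝ, ℂ) ∞ (c k))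
    {y : Rm m} (hy : y ∈ (chartAt (Rm m) x).target)
    (hcy : ∀ k, (fderiv ℝ (fun z => c k ((chartAt (Rm m) x).symm z)) y : Rm m →ₗ[ℝ] ℂ) = coordR k)
    (s : ℕ) (J : Fin s → Fin m) :
    coeffAlt S ℂ (Bundle.Trivial X ℂ) x (frameForm S z c s J) y = stdForm (fun j =>
      (fderiv ℝ (fun w => z j ((chartAt (Rm m) x).symm w)) y : Rm m →ₗ[ℝ] ℂ)) s J := by
  induction s with
  | zero => exact coeffAlt_dList hz hy
  | succ s ih =>
    have h1 := coeffAlt_dwedge (S := S) (E := Bundle.Trivial X ℂ) (F := ℂ) (x := x) ((hc (J 0) _).mdifferentiableAt (by simp))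
      (frameForm S z c s (Fin.tail J)) hy
    rw [ih (Fin.tail J), hcy] at h1
    exact h1

lemma contMDiffAt_coord (S : GenericCR n m X M) {x p : M}
    (hp : S.ι p ∈ (chartAt (Cn n) (S.ι x)).source) (j : Fin n) :
    ContMDiffAt 𝓘(ℂ, Cn n) 𝓘(ℂ, ℂ) ω (fun q => chartAt (Cn n) (S.ι x) q j) (S.ι p) := by
  have h1 : ContMDiffAt 𝓘(ℂ, Cn n) 𝓘(ℂ, Cn n) ω (chartAt (Cn n) (S.ι x)) (S.ι p) :=
    (contMDiffOn_chart (I := 𝓘(ℂ, Cn n)) (n := ω)).contMDiffAt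
      ((chartAt (Cn n) (S.ι x)).open_source.mem_nhds hp)
  have h2 : ContDiff ℂ ω fun w : Cn n => w j := (EuclideanSpace.proj j : Cn n →L[ℂ] ℂ).contDiff
  exact h2.contMDiff.contMDiffAt.comp (S.ι p) h1

/-- Holomorphic coordinates on `X` span, along the generic submanifold, the complexified
tangent space. -/
lemma exists_dual_vectors (S : GenericCR n m X M) (x : M) : ∃ a b : Fin n → Rm m, ∀ i j,
    dfun (m := m) (fun p => chartAt (Cn n) (S.ι x) (S.ι p) i) x (a j) +
      Complex.I * dfun (m := m) (fun p => chartAt (Cn n) (S.ι x) (S.ι p) i) x (b j) =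
        if i = j then 1 else 0 := by
  let e := chartAt (Cn n) (S.ι x)
  let D : Cn n →L[ℂ] Cn n := mfderiv 𝓘(ℂ, Cn n) 𝓘(ℂ, Cn n) e (S.ι x)
  have hD : Function.Surjective D :=
    (mdifferentiable_chart (I := 𝓘(ℂ, Cn n)) (S.ι x)).mfderiv_surjective
      (mem_chart_source _ (S.ι x))
  have hc : ∀ i v, mfderiv 𝓘(ℂ, Cn n) 𝓘(ℂ, ℂ) (fun q => e q i) (S.ι x) v = (D v) i := by
    intro i v
    have h1 := (mdifferentiableAt_atlas (I := 𝓘(ℂ, Cn n)) (chart_mem_atlas (Cn n) (S.ι x))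
      (mem_chart_source _ (S.ι x))).hasMFDerivAt
    have h2 : HasMFDerivAt 𝓘(ℂ, Cn n) 𝓘(ℂ, ℂ) (fun w : Cn n => w i) (e (S.ι x))
        (EuclideanSpace.proj i : Cn n →L[ℂ] ℂ) :=
      (EuclideanSpace.proj i : Cn n →L[ℂ] ℂ).hasFDerivAt.hasMFDerivAt
    exact DFunLike.congr_fun (HasMFDerivAt.comp (S.ι x) h2 h1).mfderiv v
  let R : Rm m →ₗ[ℝ] Cn n := (D.restrictScalars ℝ).toLinearMap ∘ₗ
    (mfderiv (𝓡 m) 𝓘(ℝ, Cn n) S.ι x).toLinearMap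
  have hR : Submodule.span ℂ (Set.range R) = ⊤ := by
    have h1 : Set.range R = (D : Cn n →ₗ[ℂ] Cn n) '' {w : Cn n | ∃ v : TangentSpace (𝓡 m) x,
        mfderiv (𝓡 m) 𝓘(ℝ, Cn n) S.ι x v = w} := by
      ext w
      constructor
      · rintro ⟨v, rfl⟩
        exact ⟨_, ⟨v, rfl⟩, rfl⟩
      · rintro ⟨_, ⟨v, rfl⟩, rfl⟩
        exact ⟨v, rfl⟩
    rw [h1, Submodule.span_image, S.generic x, Submodule.map_top]
    exact LinearMap.range_eq_top.2 hD
  choose a b hab using fun j : Fin n =>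
    exists_complex_combination hR (EuclideanSpace.single j (1 : ℂ))
  refine ⟨a, b, fun i j => ?_⟩
  have hd : ∀ v : Rm m, dfun (m := m) (fun p => e (S.ι p) i) x v = (R v) i := fun v =>
    (dfun_comp_ι (S := S) (h := fun q => e q i) ((contMDiffAt_coord S
      (mem_chart_source _ _) i).mdifferentiableAt (by simp)) v).trans (hc i _)
  rw [hd, hd]
  have h1 := congrArg (fun w : Cn n => w i) (hab j)
  simp only [PiLp.add_apply, PiLp.smul_apply, smul_eq_mul] at h1
  rw [h1]
  simp

/-- The Euclidean coordinates of a chart domain, where `z` are complex functions. -/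
def coordCovector (x : M) (h : M → ℂ) (y : Rm m) : Rm m →ₗ[ℝ] ℂ :=
  (fderiv ℝ (fun w => h ((chartAt (Rm m) x).symm w)) y : Rm m →ₗ[ℝ] ℂ)

lemma continuousOn_coordCovector {h : M → ℂ} (hh : ContMDiff (𝓡 m) 𝓘(ℝ, ℂ) ∞ h) (x : M)
    (v : Rm m) :
    ContinuousOn (fun y => coordCovector x h y v) (chartAt (Rm m) x).target := by
  have h1 := (contDiffOn_comp_symm hh x).continuousOn_fderiv_of_isOpen
    (chartAt (Rm m) x).open_target (by simp)
  exact h1.clm_apply continuousOn_const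

/-- Fixed vectors `a + i b` do not stay dual to the covectors `θ j y` as `y` varies. Multiplication
by the inverse of the pairing matrix, which is continuous where the determinant is nonzero, restores
duality; real and imaginary parts are then separated. -/
lemma exists_dual_family {D : Set (Rm m)} {θ : Fin n → Rm m → Rm m →ₗ[ℝ] ℂ} {a b : Fin n → Rm m}
    (hθ : ∀ j v, ContinuousOn (fun y => θ j y v) D)
    (hA : ∀ y ∈ D, (Matrix.of fun i j => θ i y (a j) + Complex.I * θ i y (b j)).det ≠ 0) :
    ∃ a' b' : Fin n → Rm m → Rm m, (∀ j, ContinuousOn (a' j) D) ∧ (∀ j, ContinuousOn (b' j) D) ∧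
      ∀ y ∈ D, IsDualFamily (fun j => θ j y) (fun j => a' j y) (fun j => b' j y) := by
  let A : Rm m → Matrix (Fin n) (Fin n) ℂ := fun y =>
    Matrix.of fun i j => θ i y (a j) + Complex.I * θ i y (b j)
  have hAc : ContinuousOn A D := by
    refine continuousOn_pi.2 fun i => continuousOn_pi.2 fun j => ?_
    exact (hθ i (a j)).add (continuousOn_const.mul (hθ i (b j)))
  have hB : ContinuousOn (fun y => (A y)⁻¹) D := by
    rw [continuousOn_iff_continuous_domRestrict] at hAc ⊢
    have e : D.domRestrict (fun y => (A y)⁻¹) = fun y => (D.domRestrict A y).det⁻¹ •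
        (D.domRestrict A y).adjugate := by
      funext y
      simp [Matrix.inv_def, Ring.inverse_eq_inv']
    rw [e]
    exact (hAc.matrix_det.inv₀ fun y => hA y y.2).smul hAc.matrix_adjugate
  have hBc : ∀ k j, ContinuousOn (fun y => (A y)⁻¹ k j) D := fun k j =>
    continuousOn_pi.1 (continuousOn_pi.1 hB k) j
  refine ⟨fun j y => ∑ k, (((A y)⁻¹ k j).re • a k - ((A y)⁻¹ k j).im • b k),
    fun j y => ∑ k, (((A y)⁻¹ k j).im • a k + ((A y)⁻¹ k j).re • b k), fun j => ?_, fun j => ?_,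
    fun y hy i j => ?_⟩
  · exact continuousOn_finsetSum _ fun k _ =>
      ((Complex.continuous_re.comp_continuousOn (hBc k j)).smul continuousOn_const).sub
      ((Complex.continuous_im.comp_continuousOn (hBc k j)).smul continuousOn_const)
  · exact continuousOn_finsetSum _ fun k _ =>
      ((Complex.continuous_im.comp_continuousOn (hBc k j)).smul continuousOn_const).add
      ((Complex.continuous_re.comp_continuousOn (hBc k j)).smul continuousOn_const)
  · have h1 : (A y * (A y)⁻¹) i j = if i = j then 1 else 0 := by
      rw [Matrix.mul_nonsing_inv _ (isUnit_iff_ne_zero.2 (hA y hy)), Matrix.one_apply]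
    rw [← h1, Matrix.mul_apply]
    simp only [map_sum, map_add, map_sub, map_smul, Finset.mul_sum, ← Finset.sum_add_distrib]
    refine Finset.sum_congr rfl fun k _ => ?_
    simp only [A, Matrix.of_apply, Complex.real_smul]
    generalize (Matrix.of fun i j => θ i y (a j) + Complex.I * θ i y (b j))⁻¹ k j = c
    conv_rhs => rw [← Complex.re_add_im c]
    linear_combination (-(c.im : ℂ) * θ i y (b k)) * Complex.I_sq

/-- Take for `z` the holomorphic coordinates of X restricted to M and for `c` the real coordinates
of M, both cut off to smooth functions on M. By genericity the dz_i have dual complexified tangent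
vectors at `x`, hence also nearby. An (n,s)-form is annihilated by every dz_i, so
`eq_sum_stdCoeff_smul_stdForm` expands it in the forms dc_J ∧ dz with continuous coefficients. The
last clause, that the coefficients vanish where the form does, serves to extend them by zero. -/
theorem exists_frame [T2Space M] (S : GenericCR n m X M) (x : M) :
    ∃ (z : Fin n → M → ℂ) (c : Fin m → M → ℂ) (V : Opens M), x ∈ V ∧
      (V : Set M) ⊆ (chartAt (Rm m) x).source ∧ (∀ j, ContMDiff (𝓡 m) 𝓘(ℝ, ℂ) ∞ (z j)) ∧
      (∀ k, ContMDiff (𝓡 m) 𝓘(ℝ, ℂ) ∞ (c k)) ∧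
      (∀ p ∈ V, ∀ s J, IsNRAt S (Bundle.Trivial X ℂ) s p (frameForm S z c s J p)) ∧
      ∀ (s : ℕ) (u : Form S (Bundle.Trivial X ℂ) (n + s)),
        (∀ p ∈ V, IsNRAt S (Bundle.Trivial X ℂ) s p (u p)) →
        CtsOn (dom S ℂ (Bundle.Trivial X ℂ) x V) (coeffAlt S ℂ (Bundle.Trivial X ℂ) x u) →
        ∃ C : (Fin s → Fin m) → Rm m → ℂ,
          (∀ J, ContinuousOn (C J) (dom S ℂ (Bundle.Trivial X ℂ) x V)) ∧
          (∀ y ∈ dom S ℂ (Bundle.Trivial X ℂ) x V, coeffAlt S ℂ (Bundle.Trivial X ℂ) x u y =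
            ∑ J, C J y • coeffAlt S ℂ (Bundle.Trivial X ℂ) x (frameForm S z c s J) y) ∧
          ∀ J y, coeffAlt S ℂ (Bundle.Trivial X ℂ) x u y = 0 → C J y = 0 := by
  let e := chartAt (Rm m) x
  let hz : Fin n → M → ℂ := fun j p => chartAt (Cn n) (S.ι x) (S.ι p) j
  let O : Set M := S.ι ⁻¹' (chartAt (Cn n) (S.ι x)).source
  have hO : IsOpen O := (chartAt (Cn n) (S.ι x)).open_source.preimage (continuous_ι S)
  have hxO : x ∈ O := mem_chart_source _ (S.ι x)
  have hzs : ∀ j, ∀ p ∈ O, ContMDiffAt (𝓡 m) 𝓘(ℝ, ℂ) ∞ (hz j) p := fun j p hp =>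
    (contMDiffAt_real (contMDiffAt_coord S hp j)).comp p (S.isSmoothEmbedding.contMDiff p)
  have hcs : ∀ k : Fin m, ∀ p ∈ e.source,
      ContMDiffAt (𝓡 m) 𝓘(ℝ, ℂ) ∞ (fun p => ((e p k : ℝ) : ℂ)) p := fun k p hp => by
    have h2 : ContDiff ℝ ∞ fun w : Rm m => ((w k : ℝ) : ℂ) :=
      Complex.ofRealCLM.contDiff.comp (EuclideanSpace.proj k : Rm m →L[ℝ] ℝ).contDiff
    exact h2.contMDiff.contMDiffAt.comp p (contMDiffAt_chart hp)
  choose z hzc hze using fun j => exists_contMDiff_eventuallyEq (hO.mem_nhds hxO) (hzs j)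
  choose c hcc hce using fun k =>
    exists_contMDiff_eventuallyEq (e.open_source.mem_nhds (mem_chart_source _ x)) (hcs k)
  obtain ⟨a₀, b₀, hab⟩ := exists_dual_vectors S x
  have hsurj : Function.Surjective
      (mfderiv 𝓘(ℝ, Rm m) (𝓡 m) e.symm (e x) : Rm m → TangentSpace (𝓡 m) (e.symm (e x))) :=
    ((mdifferentiable_chart (I := 𝓡 m) x).symm).mfderiv_surjective (mem_chart_target _ x)
  choose a ha using fun j => hsurj (a₀ j)
  choose b hb using fun j => hsurj (b₀ j)
  let A : Rm m → Matrix (Fin n) (Fin n) ℂ := fun y => Matrix.of fun i j =>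
    coordCovector x (z i) y (a j) + Complex.I * coordCovector x (z i) y (b j)
  have hA0 : A (e x) = 1 := by
    ext i j
    have h1 : ∀ v w, mfderiv 𝓘(ℝ, Rm m) (𝓡 m) e.symm (e x) v = w →
        coordCovector x (z i) (e x) v = dfun (m := m) (hz i) x w := by
      intro v w hvw
      have h2 := dfun_mfderiv_symm (x := x) (y := e x) (((hzc i) _).mdifferentiableAt (by simp))
        (mem_chart_target _ x) v
      refine h2.symm.trans ?_
      have h3 : dfun (m := m) (z i) x = dfun (m := m) (hz i) x := by
        have := (hze i).mfderiv_eq (I := 𝓡 m) (I' := 𝓘(ℝ, ℂ))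
        ext v
        exact DFunLike.congr_fun this v
      rw [← h3, hvw]
      generalize hq : e.symm (e x) = q
      have hq' : x = q := (e.left_inv (mem_chart_source _ x)).symm.trans hq
      subst hq'
      rfl
    have h4 := hab i j
    rw [Matrix.one_apply, ← h4, ← h1 _ _ (ha j), ← h1 _ _ (hb j)]
    rfl
  have hAc : ContinuousOn A e.target :=
    continuousOn_pi.2 fun i => continuousOn_pi.2 fun j =>
      (continuousOn_coordCovector (hzc i) x _).add
        (continuousOn_const.mul (continuousOn_coordCovector (hzc i) x _))
  have hdet : ∀ᶠ p in 𝓝 x, (A (e p)).det ≠ 0 := by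
    have h1 : ContinuousAt (fun y => (A y).det) (e x) :=
      (Continuous.matrix_det continuous_id).continuousAt.comp
        (hAc.continuousAt (e.open_target.mem_nhds (mem_chart_target _ x)))
    have h2 : ContinuousAt (fun p => (A (e p)).det) x :=
      ContinuousAt.comp (g := fun y => (A y).det) h1 (e.continuousAt (mem_chart_source _ x))
    refine h2.eventually_ne ?_
    simp only [hA0, Matrix.det_one]
    exact one_ne_zero
  -- The frame neighbourhood consists of points near which the cut-off functions still agree with
  -- the coordinates and at which the pairing matrix is invertible.
  have hev : ∀ᶠ p in 𝓝 x, p ∈ e.source ∧ p ∈ O ∧ (∀ j, z j =ᶠ[𝓝 p] hz j) ∧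
      (∀ k, c k =ᶠ[𝓝 p] fun p => ((e p k : ℝ) : ℂ)) ∧ (A (e p)).det ≠ 0 := by
    filter_upwards [e.open_source.mem_nhds (mem_chart_source _ x), hO.mem_nhds hxO,
      Filter.eventually_all.2 fun j => (hze j).eventually_nhds,
      Filter.eventually_all.2 fun k => (hce k).eventually_nhds, hdet] with p h1 h2 h3 h4 h5
      using ⟨h1, h2, h3, h4, h5⟩
  obtain ⟨V, hV, hVo, hxV⟩ := mem_nhds_iff.1 hev
  have hL : ∀ p ∈ V, ∀ j v, dfun (m := m) (z j) p v =
      (mfderiv 𝓘(ℂ, Cn n) 𝓘(ℂ, ℂ) (fun q => chartAt (Cn n) (S.ι x) q j) (S.ι p) :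
        Cn n →L[ℂ] ℂ).toLinearMap (mfderiv (𝓡 m) 𝓘(ℝ, Cn n) S.ι p v) := by
    intro p hp j v
    have h3 : dfun (m := m) (z j) p v = dfun (m := m) (hz j) p v :=
      DFunLike.congr_fun (((hV hp).2.2.1 j).mfderiv_eq (I := 𝓡 m) (I' := 𝓘(ℝ, ℂ))) v
    rw [h3]
    exact dfun_comp_ι (S := S) (h := fun q => chartAt (Cn n) (S.ι x) q j)
      ((contMDiffAt_coord S (hV hp).2.1 j).mdifferentiableAt (by simp)) v
  refine ⟨z, c, ⟨V, hVo⟩, hxV, fun p hp => (hV hp).1, hzc, hcc,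
    fun p hp s J => isNRAt_frameForm (hL p hp) s J, fun s u hu huc => ?_⟩
  let D := dom S ℂ (Bundle.Trivial X ℂ) x ⟨V, hVo⟩
  have hDt : D ⊆ e.target := fun y hy => hy.1
  have hDV : ∀ y ∈ D, e.symm y ∈ V := fun y hy => hy.2.1
  have hθ : ∀ j v, ContinuousOn (fun y => coordCovector x (z j) y v) D := fun j v =>
    (continuousOn_coordCovector (hzc j) x v).mono hDt
  obtain ⟨a', b', ha', hb', hdual⟩ := exists_dual_family (a := a) (b := b) hθ fun y hy => by
    have := (hV (hDV y hy)).2.2.2.2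
    rwa [e.right_inv hy.1] at this
  refine ⟨fun J y => stdCoeff (fun j => coordCovector x (z j) y) (fun j => a' j y)
      (fun j => b' j y) s J (coeffAlt S ℂ (Bundle.Trivial X ℂ) x u y), fun J => ?_,
    fun y hy => ?_, fun J y hy => ?_⟩
  · exact continuousOn_stdCoeff (fun j k => hθ j _) ha' hb' s J huc
  · have hw : ∀ i, wedge (coordCovector x (z i) y) (coeffAlt S ℂ (Bundle.Trivial X ℂ) x u y) =
        0 := by
      intro i
      have h1 := coeffAlt_dwedge (S := S) (E := Bundle.Trivial X ℂ) (F := ℂ) (x := x)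
        (((hzc i) _).mdifferentiableAt (by simp)) u hy.1
      refine h1.symm.trans ?_
      have h2 : dwedge (z i) u (e.symm y) = 0 :=
        (hu _ (hDV y hy)).wedge_eq_zero _ (hL _ (hDV y hy) i)
      simp only [coeffAlt]
      rw [h2]
      ext v
      simp only [LinearMap.compAlternatingMap_apply]
      exact map_zero _
    have h1 := eq_sum_stdCoeff_smul_stdForm _ _ _ (hdual y hy) s
      (coeffAlt S ℂ (Bundle.Trivial X ℂ) x u y) hw
    refine h1.trans (Finset.sum_congr rfl fun J _ => ?_)
    rw [coeffAlt_frameForm hzc hcc hy.1 (fun k => ?_) s J]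
    · rfl
    · have h2 : (fun w => c k (e.symm w)) =ᶠ[𝓝 y] fun w => ((w k : ℝ) : ℂ) := by
        have h3 := (e.continuousAt_symm hy.1).eventually ((hV (hDV y hy)).2.2.2.1 k)
        filter_upwards [h3, e.open_target.mem_nhds hy.1] with w hw hw'
        rw [hw, e.right_inv hw']
      rw [h2.fderiv_eq]
      have h4 : HasFDerivAt (fun w : Rm m => ((w k : ℝ) : ℂ))
          (Complex.ofRealCLM ∘L (EuclideanSpace.proj k : Rm m →L[ℝ] ℝ)) y :=
        (Complex.ofRealCLM ∘L (EuclideanSpace.proj k : Rm m →L[ℝ] ℝ)).hasFDerivAt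
      rw [h4.fderiv]
      rfl
  · simp only [hy]
    exact stdCoeff_zero_right _ _ _ s J

end Frames

end
end CRForms

namespace CRForms
noncomputable section

/-! ### Coefficients at a point, and bounds under change of patch. -/

section Evaluation

variable {n m : ℕ} {X : Type*} [TopologicalSpace X] [ChartedSpace (Cn n) X]
  [IsManifold 𝓘(ℂ, Cn n) ω X]
  {M : Type*} [TopologicalSpace M] [ChartedSpace (Rm m) M] [IsManifold (𝓡 m) ∞ M]
  {S : GenericCR n m X M}
  {F : Type*} [NormedAddCommGroup F] [NormedSpace ℂ F]
  {E : X → Type*} [∀ x, AddCommGroup (E x)] [∀ x, Module ℂ (E x)]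
  [TopologicalSpace (Bundle.TotalSpace F E)] [∀ x, TopologicalSpace (E x)]
  [FiberBundle F E] [VectorBundle ℂ F E]
  {N r : ℕ} {l : ℕ∞} {x p : M} {U : Opens M}

/-- The coordinate multivectors. -/
def basisVec (I : Fin N → Fin m) (j : Fin N) : Rm m := EuclideanSpace.single (I j) 1

variable (S F E) in
/-- The coefficients of an alternating form at `p` in the coordinates at `x`. -/
def evAt (x p : M) : ((TangentSpace (𝓡 m) p) [⋀^Fin N]→ₗ[ℝ] (E (S.ι p))) →ₗ[ℂ]
    ((Fin N → Fin m) → F) where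
  toFun a I := (trivializationAt F E (S.ι x)).linearMapAt ℂ (S.ι p) (a fun j =>
    (mfderiv 𝓘(ℝ, Rm m) (𝓡 m) (chartAt (Rm m) x).symm (chartAt (Rm m) x p) (basisVec I j) : Rm m))
  map_add' a b := by
    funext I
    exact map_add ((trivializationAt F E (S.ι x)).linearMapAt ℂ (S.ι p)) (a _) (b _)
  map_smul' c a := by
    funext I
    exact map_smul ((trivializationAt F E (S.ι x)).linearMapAt ℂ (S.ι p)) c (a _)

lemma coeff_eq_evAt (hp : p ∈ (chartAt (Rm m) x).source) (I : Fin N → Fin m) (f : Form S E N) :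
    coeff S F E x (basisVec I) f (chartAt (Rm m) x p) = evAt S F E x p (f p) I := by
  simp only [coeff, evAt, LinearMap.coe_mk, AddHom.coe_mk]
  generalize hq : (chartAt (Rm m) x).symm (chartAt (Rm m) x p) = q
  rw [(chartAt (Rm m) x).left_inv hp] at hq
  subst hq
  rfl

lemma coeff_expand (x : M) (v : Fin N → Rm m) (f : Form S E N) (y : Rm m) :
    coeff S F E x v f y = ∑ I : Fin N → Fin m, (∏ j, v j (I j)) • coeff S F E x (basisVec I) f y :=
  alternating_expand (coeffAlt S F E x f y) v

lemma evAt_injective (hp : p ∈ patch S F E x) :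
    Function.Injective (evAt (N := N) S F E x p) := by
  rw [← LinearMap.ker_eq_bot, LinearMap.ker_eq_bot']
  intro a ha
  let D : Rm m →ₗ[ℝ] TangentSpace (𝓡 m) p := (mfderiv 𝓘(ℝ, Rm m) (𝓡 m) (chartAt (Rm m) x).symm
    (chartAt (Rm m) x p)).toLinearMap
  have hD : Function.Surjective D :=
    ((mdifferentiable_chart (I := 𝓡 m) x).symm).mfderiv_surjective
      ((chartAt (Rm m) x).map_source hp.1)
  have h0 : ∀ I : Fin N → Fin m, a (fun j => D (basisVec I j)) = 0 := by
    intro I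
    have h1 := congrFun ha I
    have h2 := Bundle.Trivialization.symmₗ_linearMapAt (R := ℂ) (trivializationAt F E (S.ι x)) hp.2
      (a fun j => D (basisVec I j))
    rw [← h2]
    exact (congrArg ((trivializationAt F E (S.ι x)).symmₗ ℂ (S.ι p)) h1).trans (map_zero _)
  refine AlternatingMap.ext fun v => ?_
  choose w hw using fun j => hD (v j)
  have h3 := alternating_expand (a.compLinearMap D) w
  have h4 : a.compLinearMap D w = a v := congrArg a (funext hw)
  rw [← h4, h3]
  refine Finset.sum_eq_zero fun I _ => ?_
  have h5 : a.compLinearMap D (fun j => EuclideanSpace.single (I j) 1) = 0 := h0 I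
  rw [h5, smul_zero]

variable (S E) in
/-- The restrictions to the tangent space of `M` at `p` of the forms of bidegree `(n, r)`. -/
def nrSubmodule (r : ℕ) (p : M) :
    Submodule ℂ ((TangentSpace (𝓡 m) p) [⋀^Fin (n + r)]→ₗ[ℝ] (E (S.ι p))) where
  carrier := {a | IsNRAt S E r p a}
  add_mem' := by
    rintro a b ⟨g, hg, hga⟩ ⟨g', hg', hgb⟩
    exact ⟨g + g', fun c w => by simp [hg c w, hg' c w], fun v =>
        (congrArg₂ (· + ·) (hga v) (hgb v) :)⟩
  zero_mem' := ⟨0, fun c w => by simp, fun v => rfl⟩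
  smul_mem' := by
    rintro c a ⟨g, hg, hga⟩
    exact ⟨c • g, fun c' w => by simp [hg c' w, smul_comm c], fun v => (congrArg (c • ·) (hga v) :)⟩

/-- The coefficient vectors of (n,r)-forms at `p` form a subspace of a finite-dimensional space, and
such a subspace is closed. -/
lemma exists_limit_form [FiniteDimensional ℂ F]
    {a : ℕ → (TangentSpace (𝓡 m) p) [⋀^Fin (n + r)]→ₗ[ℝ] (E (S.ι p))}
    (ha : ∀ k, IsNRAt S E r p (a k)) {h : (Fin (n + r) → Fin m) → F}
    (hlim : ∀ I, Filter.Tendsto (fun k => evAt S F E x p (a k) I) Filter.atTop (𝓝 (h I))) :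
    ∃ b, IsNRAt S E r p b ∧ evAt S F E x p b = h := by
  have hc : IsClosed (((nrSubmodule S E r p).map (evAt S F E x p) :
      Submodule ℂ ((Fin (n + r) → Fin m) → F)) : Set ((Fin (n + r) → Fin m) → F)) :=
    Submodule.closed_of_finiteDimensional _
  have h1 : h ∈ ((nrSubmodule S E r p).map (evAt S F E x p) :
      Submodule ℂ ((Fin (n + r) → Fin m) → F)) :=
    hc.mem_of_tendsto (tendsto_pi_nhds.2 hlim)
      (Filter.Eventually.of_forall fun k => ⟨a k, ha k, rfl⟩)
  obtain ⟨b, hb, hbh⟩ := h1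
  exact ⟨b, hb, hbh⟩

lemma tendsto_evAt_change [FiniteDimensional ℂ F] {x' : M} (hp : p ∈ patch S F E x)
    {a : ℕ → (TangentSpace (𝓡 m) p) [⋀^Fin N]→ₗ[ℝ] (E (S.ι p))}
    {b : (TangentSpace (𝓡 m) p) [⋀^Fin N]→ₗ[ℝ] (E (S.ι p))}
    (h : Filter.Tendsto (fun k => evAt S F E x p (a k)) Filter.atTop (𝓝 (evAt S F E x p b))) :
    Filter.Tendsto (fun k => evAt S F E x' p (a k)) Filter.atTop (𝓝 (evAt S F E x' p b)) := by
  obtain ⟨L, hL⟩ := LinearMap.exists_leftInverse_of_injective (evAt (N := N) S F E x p)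
    (LinearMap.ker_eq_bot.2 (evAt_injective hp))
  have h1 := ((evAt S F E x' p ∘ₗ L).continuous_of_finiteDimensional.tendsto _).comp h
  have h2 : ∀ a, evAt S F E x' p (L (evAt S F E x p a)) = evAt S F E x' p a := fun a =>
    congrArg _ (DFunLike.congr_fun hL a)
  simpa only [Function.comp_def, LinearMap.comp_apply, h2] using h1

lemma exists_coeff_bound [ContMDiffVectorBundle ω F E 𝓘(ℂ, Cn n)] {x' : M} {K : Set M}
    (hK : IsCompact K) (hKx : K ⊆ patch S F E x) (hKx' : K ⊆ patch S F E x') (v : Fin N → Rm m) :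
    ∃ C : ℝ, 0 ≤ C ∧ ∀ (f : Form S E N), ∀ p ∈ K,
      ‖coeff S F E x' v f (chartAt (Rm m) x' p)‖ ≤
        C * ∑ I, ‖coeff S F E x (basisVec I) f (chartAt (Rm m) x p)‖ := by
  let G : M → F →L[ℝ] F := fun q => ((trivializationAt F E (S.ι x)).coordChangeL ℂ
      (trivializationAt F E (S.ι x')) (S.ι q) : F →L[ℂ] F).restrictScalars ℝ
  have hG : ContinuousOn G K := fun q hq =>
    (contMDiffAt_coordChangeL_ι (hKx hq) (hKx' hq)).continuousAt.continuousWithinAt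
  let b : (Fin N → Fin m) → M → ℝ := fun I q =>
    ∏ j, (fderiv ℝ (trans x x') (chartAt (Rm m) x' q) (v j)) (I j)
  have hb : ∀ I, ContinuousOn (b I) K := by
    intro I
    refine continuousOn_finsetProd _ fun j _ => ?_
    refine (EuclideanSpace.proj (I j) : Rm m →L[ℝ] ℝ).continuous.comp_continuousOn ?_
    refine ContinuousOn.clm_apply (fun q hq => ?_) continuousOn_const
    have h1 : ContDiffAt ℝ ∞ (fderiv ℝ (trans x x')) (chartAt (Rm m) x' q) :=
      (contDiffAt_trans (hKx hq).1 (hKx' hq).1).fderiv_right (by simp)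
    exact (ContinuousAt.comp (g := fderiv ℝ (trans x x')) h1.continuousAt
      ((chartAt (Rm m) x').continuousAt (hKx' hq).1)).continuousWithinAt
  choose B hB using fun I => (hK.image_of_continuousOn ((hb I).smul hG)).isBounded.exists_norm_le
  refine ⟨∑ I, |B I|, Finset.sum_nonneg fun I _ => abs_nonneg _, fun f p hp => ?_⟩
  rw [coeff_change (hKx hp) (hKx' hp), coeff_expand, map_sum, Finset.mul_sum]
  refine (norm_sum_le _ _).trans (Finset.sum_le_sum fun I _ => ?_)
  have h1 := (((b I p • G p)).le_opNorm (coeff S F E x (basisVec I) f (chartAt (Rm m) x p)))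
  have h2 : (b I p • G p) (coeff S F E x (basisVec I) f (chartAt (Rm m) x p)) =
      (trivializationAt F E (S.ι x)).coordChangeL ℂ (trivializationAt F E (S.ι x')) (S.ι p)
        (b I p • coeff S F E x (basisVec I) f (chartAt (Rm m) x p)) := ((G p).map_smul _ _).symm
  rw [h2] at h1
  refine h1.trans (mul_le_mul_of_nonneg_right ?_ (norm_nonneg _))
  exact ((hB I _ ⟨p, hp, rfl⟩).trans (le_abs_self _)).trans
    (Finset.single_le_sum (f := fun I => |B I|) (fun I _ => abs_nonneg _) (Finset.mem_univ I))

end Evaluation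

end
end CRForms

/-! ### The Banach space of forms of class C^l. -/

namespace CRForms
noncomputable section

/-- Termwise differentiation, applied once at each order below `l`. -/
lemma hasFTaylorSeriesUpToOn_of_tendstoUniformlyOn {V W : Type*} [NormedAddCommGroup V]
    [NormedSpace ℝ V] [NormedAddCommGroup W] [NormedSpace ℝ W] {U : Set V} (hU : IsOpen U) {l : ℕ}
    {f : ℕ → V → W} (hf : ∀ k, ContDiffOn ℝ l (f k) U)
    {h : V → W} {g : V → FormalMultilinearSeries ℝ V W}
    (h0 : ∀ y ∈ U, (g y 0).curry0 = h y)
    (hg : ∀ i ≤ l, TendstoUniformlyOn (fun k => iteratedFDeriv ℝ i (f k)) (fun y => g y i)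
      Filter.atTop U) :
    HasFTaylorSeriesUpToOn l h g U := by
  have hn : ∀ k, ∀ y ∈ U, ContDiffAt ℝ l (f k) y := fun k y hy =>
    (hf k).contDiffAt (hU.mem_nhds hy)
  refine ⟨h0, fun i hi y hy => ?_, fun i hi => ?_⟩
  · have hi' : i < l := by exact_mod_cast hi
    refine HasFDerivAt.hasFDerivWithinAt ?_
    refine hasFDerivAt_of_tendstoUniformlyOn (l := Filter.atTop) hU
      (f := fun k => iteratedFDeriv ℝ i (f k))
      (f' := fun k y => fderiv ℝ (iteratedFDeriv ℝ i (f k)) y)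
      (g' := fun y => (g y i.succ).curryLeft) ?_ (fun k z hz => ?_) (fun z hz => ?_) hy
    · have := (continuousMultilinearCurryLeftEquiv ℝ (fun _ : Fin (i + 1) => V) W).isometry.uniformContinuous.comp_tendstoUniformlyOn (hg (i + 1) hi')
      exact this
    · exact ((hn k z hz).differentiableAt_iteratedFDeriv (by exact_mod_cast hi')).hasFDerivAt
    · exact (hg i hi'.le).tendsto_at hz
  · have hi' : i ≤ l := by exact_mod_cast hi
    refine (hg i hi').continuousOn (Filter.Frequently.of_forall fun k y hy => ?_)
    exact (((hn k y hy).iteratedFDeriv_right (m := 0) (i := i)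
      (by simpa using hi)).continuousAt).continuousWithinAt

section Space

variable {n m : ℕ} {X : Type*} [TopologicalSpace X] [ChartedSpace (Cn n) X]
  [IsManifold 𝓘(ℂ, Cn n) ω X]
  {M : Type*} [TopologicalSpace M] [ChartedSpace (Rm m) M] [IsManifold (𝓡 m) ∞ M]
  (S : GenericCR n m X M)
  (F : Type*) [NormedAddCommGroup F] [NormedSpace ℂ F]
  (E : X → Type*) [∀ x, AddCommGroup (E x)] [∀ x, Module ℂ (E x)]
  [TopologicalSpace (Bundle.TotalSpace F E)] [∀ x, TopologicalSpace (E x)]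
  [FiberBundle F E] [VectorBundle ℂ F E]

lemma exists_closedBall_subset_dom (x : M) :
    ∃ ρ : ℝ, 0 < ρ ∧ Metric.closedBall (chartAt (Rm m) x x) ρ ⊆ dom S F E x ⊤ :=
  Metric.nhds_basis_closedBall.mem_iff.1
    ((isOpen_dom S F E x ⊤).mem_nhds (chart_mem_dom (mem_patch_self S F E x) trivial))

/-- The radius of a closed coordinate ball around `x` contained in the patch at `x`. -/
def rad (x : M) : ℝ := (exists_closedBall_subset_dom S F E x).choose

lemma rad_pos (x : M) : 0 < rad S F E x := (exists_closedBall_subset_dom S F E x).choose_spec.1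

/-- A closed coordinate ball around `x`. -/
def cball (x : M) : Set (Rm m) := Metric.closedBall (chartAt (Rm m) x x) (rad S F E x)

/-- An open coordinate ball around `x`. -/
def oball (x : M) : Set (Rm m) := Metric.ball (chartAt (Rm m) x x) (rad S F E x)

lemma cball_subset_dom (x : M) : cball S F E x ⊆ dom S F E x ⊤ :=
  (exists_closedBall_subset_dom S F E x).choose_spec.2

lemma isCompact_cball (x : M) : IsCompact (cball S F E x) := isCompact_closedBall _ _

lemma isOpen_oball (x : M) : IsOpen (oball S F E x) := Metric.isOpen_ball

lemma oball_subset_cball (x : M) : oball S F E x ⊆ cball S F E x := Metric.ball_subset_closedBall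

lemma closure_oball (x : M) : closure (oball S F E x) = cball S F E x :=
  closure_ball _ (rad_pos S F E x).ne'

instance (x : M) : CompactSpace (cball S F E x) :=
  isCompact_iff_compactSpace.1 (isCompact_cball S F E x)

lemma exists_centers [CompactSpace M] : ∃ t : Finset M, ∀ p : M, ∃ x ∈ t,
    p ∈ (chartAt (Rm m) x).source ∧ chartAt (Rm m) x p ∈ oball S F E x := by
  obtain ⟨t, -, ht⟩ := isCompact_univ.elim_nhds_subcover
    (fun x => (chartAt (Rm m) x).source ∩ chartAt (Rm m) x ⁻¹' oball S F E x) fun x _ =>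
      Filter.inter_mem ((chartAt (Rm m) x).open_source.mem_nhds (mem_chart_source _ x))
        (((chartAt (Rm m) x).continuousAt (mem_chart_source _ x)).preimage_mem_nhds
          (Metric.ball_mem_nhds _ (rad_pos S F E x)))
  refine ⟨t, fun p => ?_⟩
  have := ht (Set.mem_univ p)
  simp only [Set.mem_iUnion] at this
  obtain ⟨x, hx, h⟩ := this
  exact ⟨x, hx, h⟩

/-- The centres of finitely many coordinate balls that cover `M`. -/
def centers [CompactSpace M] : Finset M := (exists_centers S F E).choose

lemma exists_mem_centers [CompactSpace M] (p : M) : ∃ x ∈ centers S F E,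
    p ∈ (chartAt (Rm m) x).source ∧ chartAt (Rm m) x p ∈ oball S F E x :=
  (exists_centers S F E).choose_spec p

variable {S F E} in
lemma mem_patch_of_mem_cball {x p : M} (hp : p ∈ (chartAt (Rm m) x).source)
    (h : chartAt (Rm m) x p ∈ cball S F E x) : p ∈ patch S F E x := by
  have := symm_mem_patch (cball_subset_dom S F E x h)
  rwa [(chartAt (Rm m) x).left_inv hp] at this

/-- The Banach space of `(n, r)`-forms of class `C^l`. -/
def XC (r l : ℕ) : Type _ := CForms S F E ⊤ r (l : ℕ∞)

instance (r l : ℕ) : AddCommGroup (XC S F E r l) :=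
  inferInstanceAs (AddCommGroup (CForms S F E ⊤ r (l : ℕ∞)))

instance (r l : ℕ) : Module ℂ (XC S F E r l) :=
  inferInstanceAs (Module ℂ (CForms S F E ⊤ r (l : ℕ∞)))

variable {S F E} {r l : ℕ}

/-- The underlying form. -/
def XC.form : XC S F E r l →ₗ[ℂ] Form S E (n + r) := (CForms S F E ⊤ r (l : ℕ∞)).subtype

lemma XC.form_mem (f : XC S F E r l) : f.form ∈ CForms S F E ⊤ r (l : ℕ∞) := f.2

/-- A form of class `C^l` as an element of the Banach space. -/
def XC.mk (f : Form S E (n + r)) (hf : f ∈ CForms S F E ⊤ r (l : ℕ∞)) : XC S F E r l := ⟨f, hf⟩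

@[simp] lemma XC.form_mk (f : Form S E (n + r)) (hf : f ∈ CForms S F E ⊤ r (l : ℕ∞)) :
    (XC.mk f hf).form = f := rfl

lemma XC.form_injective : Function.Injective (XC.form : XC S F E r l → Form S E (n + r)) :=
  Subtype.val_injective

lemma XC.contDiffAt (f : XC S F E r l) {x : M} {y : Rm m} (hy : y ∈ dom S F E x ⊤)
    (v : Fin (n + r) → Rm m) : ContDiffAt ℝ l (coeff S F E x v f.form) y :=
  (f.form_mem.2.2 x v).contDiffAt ((isOpen_dom S F E x ⊤).mem_nhds hy)

lemma XC.continuousOn_iteratedFDeriv (f : XC S F E r l) {x : M} (v : Fin (n + r) → Rm m) {i : ℕ}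
    (hi : i ≤ l) : ContinuousOn (iteratedFDeriv ℝ i (coeff S F E x v f.form)) (dom S F E x ⊤) :=
  fun _ hy => (((f.contDiffAt hy v).iteratedFDeriv_right (m := 0) (i := i)
      (by simpa using hi)).continuousAt).continuousWithinAt

variable [CompactSpace M]

variable (S F E r l) in
/-- The target of the jets of forms. -/
abbrev JetSpace : Type _ := ∀ (x : centers S F E) (_ : Fin (n + r) → Fin m) (i : Fin (l + 1)),
  C(cball S F E x.1, Rm m [×i]→L[ℝ] F)

/-- The derivatives of order `≤ l` of the coefficients on the coordinate balls. -/
def XC.jet : XC S F E r l →ₗ[ℂ] JetSpace S F E r l where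
  toFun f x I i := ⟨fun y => iteratedFDeriv ℝ i (coeff S F E x.1 (basisVec I) f.form) y,
    ((f.continuousOn_iteratedFDeriv _ (Nat.lt_succ_iff.1 i.2)).mono
      (cball_subset_dom S F E x.1)).domRestrict⟩
  map_add' f g := by
    funext x I i
    ext1 y
    have hi : ((i : ℕ) : WithTop ℕ∞) ≤ (l : ℕ) := by exact_mod_cast Nat.lt_succ_iff.1 i.2
    simp only [ContinuousMap.coe_mk, Pi.add_apply, ContinuousMap.add_apply, map_add, coeff_add]
    exact iteratedFDeriv_add_apply ((f.contDiffAt (cball_subset_dom S F E x.1 y.2) _).of_le hi)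
      ((g.contDiffAt (cball_subset_dom S F E x.1 y.2) _).of_le hi)
  map_smul' c f := by
    funext x I i
    ext1 y
    have hi : ((i : ℕ) : WithTop ℕ∞) ≤ (l : ℕ) := by exact_mod_cast Nat.lt_succ_iff.1 i.2
    simp only [ContinuousMap.coe_mk, Pi.smul_apply, ContinuousMap.smul_apply, map_smul, coeff_smul,
      RingHom.id_apply]
    exact iteratedFDeriv_const_smul_apply
      ((f.contDiffAt (cball_subset_dom S F E x.1 y.2) _).of_le hi)

lemma XC.jet_apply (f : XC S F E r l) (x : centers S F E) (I : Fin (n + r) → Fin m)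
    (i : Fin (l + 1)) (y : cball S F E x.1) :
    f.jet x I i y = iteratedFDeriv ℝ i (coeff S F E x.1 (basisVec I) f.form) y := rfl

lemma XC.jet_zero_apply (f : XC S F E r l) (x : centers S F E) (I : Fin (n + r) → Fin m)
    (y : cball S F E x.1) :
    (f.jet x I 0 y).curry0 = coeff S F E x.1 (basisVec I) f.form y := by
  rw [XC.jet_apply]; rfl

lemma XC.jet_injective : Function.Injective (XC.jet : XC S F E r l → JetSpace S F E r l) := by
  rw [← LinearMap.coe_coe, injective_iff_map_eq_zero]
  intro f hf
  refine XC.form_injective (funext fun p => ?_)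
  obtain ⟨x, hx, hp, hpx⟩ := exists_mem_centers S F E p
  have hc := oball_subset_cball S F E x hpx
  refine evAt_injective (mem_patch_of_mem_cball hp hc) (funext fun I => ?_)
  rw [← coeff_eq_evAt hp, map_zero]
  change _ = evAt S F E x p 0 I
  rw [map_zero]
  have h1 := f.jet_zero_apply ⟨x, hx⟩ I ⟨_, hc⟩
  rw [← h1]
  have h2 : f.jet = 0 := hf
  rw [h2]
  rfl

instance : NormedAddCommGroup (XC S F E r l) :=
  NormedAddCommGroup.induced _ _ (XC.jet : XC S F E r l →ₗ[ℂ] JetSpace S F E r l) XC.jet_injective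

instance : NormedSpace ℂ (XC S F E r l) :=
  NormedSpace.induced ℂ _ _ (XC.jet : XC S F E r l →ₗ[ℂ] JetSpace S F E r l)

lemma XC.norm_def (f : XC S F E r l) : ‖f‖ = ‖f.jet‖ := rfl

lemma XC.isometry_jet : Isometry (XC.jet : XC S F E r l → JetSpace S F E r l) :=
  AddMonoidHomClass.isometry_of_norm (XC.jet : XC S F E r l →ₗ[ℂ] JetSpace S F E r l) fun _ => rfl

lemma XC.norm_iteratedFDeriv_le (f : XC S F E r l) {x : M} (hx : x ∈ centers S F E)
    (I : Fin (n + r) → Fin m) {i : ℕ} (hi : i ≤ l) {y : Rm m} (hy : y ∈ cball S F E x) :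
    ‖iteratedFDeriv ℝ i (coeff S F E x (basisVec I) f.form) y‖ ≤ ‖f‖ := by
  have h1 := (f.jet ⟨x, hx⟩ I ⟨i, Nat.lt_succ_iff.2 hi⟩).norm_coe_le_norm ⟨y, hy⟩
  refine h1.trans ?_
  rw [XC.norm_def]
  exact ((norm_le_pi_norm (f.jet ⟨x, hx⟩ I) _).trans (norm_le_pi_norm (f.jet ⟨x, hx⟩) _)).trans
    (norm_le_pi_norm f.jet _)

lemma XC.norm_coeff_le (f : XC S F E r l) {x : M} (hx : x ∈ centers S F E)
    (I : Fin (n + r) → Fin m) {y : Rm m} (hy : y ∈ cball S F E x) :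
    ‖coeff S F E x (basisVec I) f.form y‖ ≤ ‖f‖ := by
  simpa using f.norm_iteratedFDeriv_le hx I (Nat.zero_le l) hy

lemma XC.norm_le {f : XC S F E r l} {C : ℝ} (hC : 0 ≤ C)
    (h : ∀ x ∈ centers S F E, ∀ (I : Fin (n + r) → Fin m), ∀ i ≤ l, ∀ y ∈ cball S F E x,
      ‖iteratedFDeriv ℝ i (coeff S F E x (basisVec I) f.form) y‖ ≤ C) : ‖f‖ ≤ C := by
  rw [XC.norm_def]
  refine (pi_norm_le_iff_of_nonneg hC).2 fun x => (pi_norm_le_iff_of_nonneg hC).2 fun I =>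
    (pi_norm_le_iff_of_nonneg hC).2 fun i => (ContinuousMap.norm_le _ hC).2 fun y => ?_
  exact h x.1 x.2 I i (Nat.lt_succ_iff.1 i.2) y y.2

lemma XC.norm_le_zero {f : XC S F E r 0} {C : ℝ} (hC : 0 ≤ C)
    (h : ∀ x ∈ centers S F E, ∀ (I : Fin (n + r) → Fin m), ∀ y ∈ cball S F E x,
      ‖coeff S F E x (basisVec I) f.form y‖ ≤ C) : ‖f‖ ≤ C := by
  refine XC.norm_le hC fun x hx I i hi y hy => ?_
  obtain rfl : i = 0 := Nat.le_zero.1 hi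
  simpa using h x hx I y hy

lemma XC.tendsto_evAt {u : ℕ → XC S F E r l} {g : JetSpace S F E r l}
    (h : Filter.Tendsto (fun k => (u k).jet) Filter.atTop (𝓝 g)) {x p : M} (hx : x ∈ centers S F E)
    (hp : p ∈ (chartAt (Rm m) x).source) (hc : chartAt (Rm m) x p ∈ cball S F E x) :
    Filter.Tendsto (fun k => evAt S F E x p ((u k).form p)) Filter.atTop
      (𝓝 fun I => (g ⟨x, hx⟩ I 0 ⟨_, hc⟩).curry0) := by
  refine tendsto_pi_nhds.2 fun I => ?_
  simp only [← coeff_eq_evAt hp]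
  have h1 : Filter.Tendsto (fun k => (u k).jet ⟨x, hx⟩ I 0 ⟨_, hc⟩) Filter.atTop
      (𝓝 (g ⟨x, hx⟩ I 0 ⟨_, hc⟩)) :=
    ((continuous_eval_const (F := C(cball S F E x, Rm m [×0]→L[ℝ] F)) _).tendsto _).comp
      (tendsto_pi_nhds.1 (tendsto_pi_nhds.1 (tendsto_pi_nhds.1 h ⟨x, hx⟩) I) 0)
  exact ((continuousMultilinearCurryFin0 ℝ (Rm m) F).continuous.tendsto _).comp h1

/-- Pointwise limits of the values define an (n,r)-form, whose coefficients on each ball are the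
limits of order zero, whichever ball was used to define the value. Termwise differentiation
identifies the higher derivatives on the open balls. -/
lemma XC.mem_range_jet [FiniteDimensional ℂ F] [ContMDiffVectorBundle ω F E 𝓘(ℂ, Cn n)]
    {u : ℕ → XC S F E r l} {g : JetSpace S F E r l}
    (h : Filter.Tendsto (fun k => (u k).jet) Filter.atTop (𝓝 g)) :
    g ∈ Set.range (XC.jet : XC S F E r l → JetSpace S F E r l) := by
  choose c hc hpc hco using exists_mem_centers S F E
  have hcc : ∀ p, chartAt (Rm m) (c p) p ∈ cball S F E (c p) := fun p =>
    oball_subset_cball S F E _ (hco p)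
  have hlim : ∀ p, ∃ b, IsNRAt S E r p b ∧ evAt S F E (c p) p b =
      fun I => (g ⟨c p, hc p⟩ I 0 ⟨_, hcc p⟩).curry0 := fun p =>
    exists_limit_form (fun k => (u k).form_mem.1 p)
      (tendsto_pi_nhds.1 (XC.tendsto_evAt h (hc p) (hpc p) (hcc p)))
  choose f hfn hfe using hlim
  have hev : ∀ (x : M) (hx : x ∈ centers S F E) (I : Fin (n + r) → Fin m) (y : cball S F E x),
      coeff S F E x (basisVec I) f y = (g ⟨x, hx⟩ I 0 y).curry0 := by
    intro x hx I ⟨y, hy⟩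
    have hd := cball_subset_dom S F E x hy
    set p := (chartAt (Rm m) x).symm y with hpdef
    have hpy : chartAt (Rm m) x p = y := chart_symm_of_mem_dom hd
    have hp : p ∈ (chartAt (Rm m) x).source := (symm_mem_patch hd).1
    have hy' : chartAt (Rm m) x p ∈ cball S F E x := by rwa [hpy]
    have h1 := XC.tendsto_evAt h (hc p) (hpc p) (hcc p)
    rw [← hfe p] at h1
    have h2 := tendsto_evAt_change (x' := x) (mem_patch_of_mem_cball (hpc p) (hcc p)) h1
    have h3 := tendsto_nhds_unique h2 (XC.tendsto_evAt h hx hp hy')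
    have h4 := congrFun h3 I
    rw [← coeff_eq_evAt hp] at h4
    have h5 : (⟨chartAt (Rm m) x p, hy'⟩ : cball S F E x) = ⟨y, hy⟩ := Subtype.ext hpy
    rw [h5, hpy] at h4
    exact h4
  classical
  -- A formal multilinear series needs a value at every point and in every order; outside the ball
  -- and above order `l` the value is 0.
  let g' : ∀ (x : M) (_ : x ∈ centers S F E) (_ : Fin (n + r) → Fin m),
      Rm m → FormalMultilinearSeries ℝ (Rm m) F := fun x hx I y i =>
    if hi : i < l + 1 then (if hy : y ∈ cball S F E x then g ⟨x, hx⟩ I ⟨i, hi⟩ ⟨y, hy⟩ else 0) else 0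
  have hT : ∀ (x : M) (hx : x ∈ centers S F E) (I : Fin (n + r) → Fin m),
      HasFTaylorSeriesUpToOn l (coeff S F E x (basisVec I) f) (g' x hx I) (oball S F E x) := by
    intro x hx I
    refine hasFTaylorSeriesUpToOn_of_tendstoUniformlyOn (isOpen_oball S F E x)
      (f := fun k => coeff S F E x (basisVec I) (u k).form) (fun k => ?_) (fun y hy => ?_)
      fun i hi => ?_
    · exact ((u k).form_mem.2.2 x _).mono
        ((oball_subset_cball S F E x).trans (cball_subset_dom S F E x))
    · have hy' := oball_subset_cball S F E x hy
      rw [hev x hx I ⟨y, hy'⟩]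
      simp only [g', Nat.zero_lt_succ, dif_pos hy']
      rfl
    · have h1 := tendsto_pi_nhds.1 (tendsto_pi_nhds.1 (tendsto_pi_nhds.1 h ⟨x, hx⟩) I)
        ⟨i, Nat.lt_succ_iff.2 hi⟩
      have h2 := ContinuousMap.tendsto_iff_tendstoUniformly.1 h1
      rw [Metric.tendstoUniformly_iff] at h2
      rw [Metric.tendstoUniformlyOn_iff]
      intro ε hε
      filter_upwards [h2 ε hε] with k hk y hy
      have hy' := oball_subset_cball S F E x hy
      have h3 := hk ⟨y, hy'⟩
      simp only [g', dif_pos (Nat.lt_succ_iff.2 hi), dif_pos hy']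
      exact h3
  have hf : f ∈ CForms S F E ⊤ r (l : ℕ∞) := by
    rw [mem_CForms_iff]
    refine ⟨hfn, fun p hp => (hp trivial).elim, fun p _ => ?_⟩
    refine reg_of_regAt le_rfl zero_le_one (mem_patch_of_mem_cball (hpc p) (hcc p)) fun v => ?_
    refine regAt_zero_of_contDiffAt ?_
    have h1 : coeff S F E (c p) v f = fun y => ∑ I : Fin (n + r) → Fin m,
        (∏ j, v j (I j)) • coeff S F E (c p) (basisVec I) f y :=
      funext fun y => coeff_expand (c p) v f y
    rw [h1]
    refine ContDiffAt.sum fun I _ => ContDiffAt.const_smul _ ?_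
    exact ((hT (c p) (hc p) I).contDiffOn).contDiffAt ((isOpen_oball S F E _).mem_nhds (hco p))
  refine ⟨XC.mk f hf, ?_⟩
  funext x I i
  ext1 y
  have hi : (i : ℕ) ≤ l := Nat.lt_succ_iff.1 i.2
  have hEq : Set.EqOn (iteratedFDeriv ℝ i (coeff S F E x.1 (basisVec I) f))
      (fun y => g' x.1 x.2 I y i) (oball S F E x.1) := by
    intro y hy
    have h1 := (hT x.1 x.2 I).eq_iteratedFDerivWithin_of_uniqueDiffOn (m := i)
      (by exact_mod_cast hi) (isOpen_oball S F E x.1).uniqueDiffOn hy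
    rw [iteratedFDerivWithin_of_isOpen _ (isOpen_oball S F E x.1) hy] at h1
    exact h1.symm
  -- Both sides are continuous on the closed ball, in which the open ball is dense.
  have hEq2 := hEq.of_subset_closure (t := cball S F E x.1)
    (((XC.mk f hf).continuousOn_iteratedFDeriv _ hi).mono (cball_subset_dom S F E x.1)) (by
      rw [continuousOn_iff_continuous_domRestrict]
      refine (g x I i).continuous.congr fun y => ?_
      simp only [g', dif_pos i.2, Set.domRestrict_apply, dif_pos y.2])
    (oball_subset_cball S F E x.1) (closure_oball S F E x.1).ge y.2
  rw [XC.jet_apply, XC.form_mk, hEq2]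
  simp only [g', dif_pos i.2, dif_pos y.2]

instance [FiniteDimensional ℂ F] [ContMDiffVectorBundle ω F E 𝓘(ℂ, Cn n)] :
    CompleteSpace (XC S F E r l) := by
  have : CompleteSpace F := FiniteDimensional.complete ℂ F
  have h1 : ∀ i : ℕ, CompleteSpace (Rm m [×i]→L[ℝ] F) := fun i => inferInstance
  have h2 : CompleteSpace (JetSpace S F E r l) := inferInstance
  rw [completeSpace_iff_isComplete_range XC.isometry_jet.isUniformInducing]
  refine IsClosed.isComplete (isClosed_of_closure_subset fun g hg => ?_)
  obtain ⟨a, ha, hag⟩ := mem_closure_iff_seq_limit.1 hg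
  choose u hu using ha
  refine XC.mem_range_jet (u := u) ?_
  simpa only [hu] using hag

/-- The image of `K` is covered by the finitely many coordinate balls that define the norm, and
`exists_coeff_bound` compares coefficients on each overlap. Only order zero enters, so the constant
does not depend on `l`. -/
lemma exists_coeff_le_norm [T2Space M] [ContMDiffVectorBundle ω F E 𝓘(ℂ, Cn n)] {x : M}
    {K : Set (Rm m)} (hK : IsCompact K) (hKd : K ⊆ dom S F E x ⊤) (v : Fin (n + r) → Rm m) :
    ∃ C : ℝ, 0 ≤ C ∧ ∀ (l : ℕ) (f : XC S F E r l), ∀ y ∈ K,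
      ‖coeff S F E x v f.form y‖ ≤ C * ‖f‖ := by
  have hcomp : ∀ (x : M) (K : Set (Rm m)), IsCompact K → K ⊆ dom S F E x ⊤ →
      IsCompact ((chartAt (Rm m) x).symm '' K) := fun x K hK hKd =>
    hK.image_of_continuousOn ((chartAt (Rm m) x).continuousOn_symm.mono fun y hy => (hKd hy).1)
  have hb : ∀ c : M, ∃ C : ℝ, 0 ≤ C ∧ ∀ (f : Form S E (n + r)),
      ∀ p ∈ (chartAt (Rm m) x).symm '' K ∩ (chartAt (Rm m) c).symm '' cball S F E c,
      ‖coeff S F E x v f (chartAt (Rm m) x p)‖ ≤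
        C * ∑ I, ‖coeff S F E c (basisVec I) f (chartAt (Rm m) c p)‖ := fun c =>
    exists_coeff_bound ((hcomp x K hK hKd).inter (hcomp c _ (isCompact_cball S F E c)
        (cball_subset_dom S F E c)))
      (fun p hp => by
        obtain ⟨y, hy, rfl⟩ := hp.2
        exact symm_mem_patch (cball_subset_dom S F E c hy))
      (fun p hp => by
        obtain ⟨y, hy, rfl⟩ := hp.1
        exact symm_mem_patch (hKd hy)) v
  choose C hC hCf using hb
  refine ⟨(∑ c ∈ centers S F E, C c) * Fintype.card (Fin (n + r) → Fin m),
    mul_nonneg (Finset.sum_nonneg fun c _ => hC c) (Nat.cast_nonneg _), fun l f y hy => ?_⟩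
  obtain ⟨c, hc, hp, hpc⟩ := exists_mem_centers S F E ((chartAt (Rm m) x).symm y)
  have hcc := oball_subset_cball S F E c hpc
  have h1 := hCf c f.form ((chartAt (Rm m) x).symm y) ⟨⟨y, hy, rfl⟩, ⟨_, hcc,
    (chartAt (Rm m) c).left_inv hp⟩⟩
  rw [chart_symm_of_mem_dom (hKd hy)] at h1
  refine h1.trans ?_
  have h2 : ∑ I, ‖coeff S F E c (basisVec I) f.form
      (chartAt (Rm m) c ((chartAt (Rm m) x).symm y))‖ ≤
        Fintype.card (Fin (n + r) → Fin m) * ‖f‖ := by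
    refine (Finset.sum_le_sum fun I _ => f.norm_coeff_le hc I hcc).trans ?_
    simp
  rw [mul_assoc]
  exact mul_le_mul (Finset.single_le_sum (fun c _ => hC c) hc) h2
    (Finset.sum_nonneg fun _ _ => norm_nonneg _) (Finset.sum_nonneg fun c _ => hC c)

end Space

end
end CRForms

namespace CRForms
noncomputable section

/-! ### Friedrichs' commutator lemma on ℝᵐ. -/

section Mollifier

open MeasureTheory

/-- A rescaled bump function. What matters is that `A` does not depend on `ε`: the factor 1/ε in the
L¹ norm of the derivative will be compensated by a Lipschitz bound of order ε. -/
lemma exists_mollifier (m : ℕ) : ∃ A : Rm m → ℝ, (∀ w, 0 ≤ A w) ∧ ∀ ε : ℝ, 0 < ε →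
    ∃ φ : Rm m → ℝ, ContDiff ℝ ∞ φ ∧ HasCompactSupport φ ∧ tsupport φ ⊆ Metric.closedBall 0 ε ∧
      (∀ t, 0 ≤ φ t) ∧ ∫ t, φ t = 1 ∧ ∀ w, ∫ t, |fderiv ℝ φ t w| ≤ A w / ε := by
  let b : ContDiffBump (0 : Rm m) := ⟨1 / 2, 1, by norm_num, by norm_num⟩
  let ρ : Rm m → ℝ := b.normed volume
  have hρ : ContDiff ℝ ∞ ρ := b.contDiff_normed
  refine ⟨fun w => ∫ t, |fderiv ℝ ρ t w|, fun w => integral_nonneg fun t => abs_nonneg _,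
    fun ε hε => ?_⟩
  let φ : Rm m → ℝ := fun t => (ε ^ m)⁻¹ * ρ (ε⁻¹ • t)
  have hsub : tsupport φ ⊆ Metric.closedBall 0 ε := by
    refine closure_minimal (fun t ht => ?_) Metric.isClosed_closedBall
    have h1 : ε⁻¹ • t ∈ Function.support ρ := fun h => ht (by simp [φ, h])
    rw [b.support_normed_eq] at h1
    rw [mem_ball_zero_iff, norm_smul, norm_inv, Real.norm_of_nonneg hε.le] at h1
    rw [mem_closedBall_zero_iff]
    have h2 : ε⁻¹ * ‖t‖ < 1 := h1
    rw [inv_mul_lt_iff₀ hε] at h2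
    linarith
  have hfd : ∀ t w, fderiv ℝ φ t w = (ε ^ m)⁻¹ * (ε⁻¹ * fderiv ℝ ρ (ε⁻¹ • t) w) := by
    intro t w
    have h1 : HasFDerivAt (fun t : Rm m => ε⁻¹ • t) (ε⁻¹ • ContinuousLinearMap.id ℝ (Rm m)) t :=
      (hasFDerivAt_id t).const_smul ε⁻¹
    have h2 := ((hρ.differentiable (by simp) (ε⁻¹ • t)).hasFDerivAt.comp t h1).const_mul (ε ^ m)⁻¹
    have h3 : fderiv ℝ φ t = _ := h2.fderiv
    rw [h3]
    simp
  have hint : ∀ f : Rm m → ℝ, ∫ t, f (ε⁻¹ • t) = ε ^ m * ∫ t, f t := by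
    intro f
    rw [Measure.integral_comp_inv_smul_of_nonneg volume f hε.le]
    simp
  have hεm : ε ^ m ≠ 0 := (pow_pos hε m).ne'
  refine ⟨φ, contDiff_const.mul (hρ.comp (contDiff_const_smul _)),
    HasCompactSupport.of_support_subset_isCompact (isCompact_closedBall 0 ε)
      ((subset_tsupport φ).trans hsub), hsub,
    fun t => mul_nonneg (inv_nonneg.2 (pow_pos hε m).le) (b.nonneg_normed _), ?_, fun w => ?_⟩
  · rw [integral_const_mul, hint ρ, b.integral_normed, mul_one, inv_mul_cancel₀ hεm]
  · simp only [hfd, abs_mul, abs_inv, abs_of_pos hε, abs_of_pos (pow_pos hε m)]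
    rw [integral_const_mul, integral_const_mul, hint fun t => |fderiv ℝ ρ t w|]
    refine le_of_eq ?_
    field_simp

variable {m : ℕ} {W : Type*} [NormedAddCommGroup W] [NormedSpace ℂ W] {N : ℕ} {D : Set (Rm m)}
  {φ : Rm m → ℝ} {ε : ℝ} {x : Rm m}

lemma sub_mem_of_mem_tsupport {ψ : Rm m → ℝ} (hx : Metric.closedBall x ε ⊆ D)
    (hs : tsupport ψ ⊆ Metric.closedBall 0 ε) {t : Rm m} (ht : t ∈ tsupport ψ) : x - t ∈ D := by
  refine hx ?_
  have := hs ht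
  rw [mem_closedBall_zero_iff] at this
  rw [Metric.mem_closedBall, dist_eq_norm]
  simpa using this

lemma integrable_smul_reflect {ψ : Rm m → ℝ} (hψ : Continuous ψ)
    (hc : HasCompactSupport ψ) (hs : tsupport ψ ⊆ Metric.closedBall 0 ε)
    (hx : Metric.closedBall x ε ⊆ D) {h : Rm m → W} (hh : ContinuousOn h D) :
    Integrable fun t => ψ t • h (x - t) := by
  refine integrable_smul_of_tsupport (D := {t | x - t ∈ D}) hψ hc
    (fun t ht => sub_mem_of_mem_tsupport hx hs ht)
    (hh.comp (by fun_prop) fun t ht => ht)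

lemma WkD.reflect {u : Rm m → Rm m [⋀^Fin N]→ₗ[ℝ] W} {g : Rm m → Rm m [⋀^Fin (N + 1)]→ₗ[ℝ] W}
    (h : WkD D u g) (hφ : ContDiff ℝ ∞ φ) (hc : HasCompactSupport φ)
    (hs : tsupport φ ⊆ Metric.closedBall 0 ε) (hx : Metric.closedBall x ε ⊆ D)
    (v : Fin (N + 1) → Rm m) :
    ∫ t, φ t • g (x - t) v = ∑ i : Fin (N + 1), (-1 : ℝ) ^ (i : ℕ) •
      ∫ t, (fderiv ℝ φ t (v i)) • u (x - t) (fun j => v (i.succAbove j)) := by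
  let ψ : Rm m → ℝ := fun y => φ (x - y)
  have hψs : tsupport ψ ⊆ (fun y => x - y) ⁻¹' tsupport φ :=
    tsupport_comp_subset_preimage φ (continuous_const.sub continuous_id)
  have hψD : tsupport ψ ⊆ D := fun y hy => by
    have := sub_mem_of_mem_tsupport hx hs (hψs hy)
    rwa [sub_sub_cancel] at this
  have hψc : HasCompactSupport ψ := hc.comp_homeomorph (Homeomorph.subLeft x)
  have hfd : ∀ y w, fderiv ℝ ψ y w = -fderiv ℝ φ (x - y) w := by
    intro y w
    have h1 : HasFDerivAt (fun y : Rm m => x - y) (-ContinuousLinearMap.id ℝ (Rm m)) y :=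
      (hasFDerivAt_id y).const_sub x
    have h2 : fderiv ℝ ψ y = _ :=
      ((hφ.differentiable (by simp) (x - y)).hasFDerivAt.comp y h1).fderiv
    rw [h2]
    simp
  have h1 := h ψ (hφ.comp (contDiff_const.sub contDiff_id)) hψc hψD v
  have e1 : ∫ t, φ t • g (x - t) v = ∫ y, ψ y • g y v := by
    rw [← integral_sub_left_eq_self (fun t => φ t • g (x - t) v) volume x]
    simp only [sub_sub_cancel, ψ]
  rw [e1, h1, ← Finset.sum_neg_distrib]
  refine Finset.sum_congr rfl fun i _ => ?_
  rw [← smul_neg]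
  congr 1
  rw [← integral_sub_left_eq_self (fun t => fderiv ℝ φ t (v i) • u (x - t) _) volume x,
    ← integral_neg]
  simp only [sub_sub_cancel, hfd, neg_smul, neg_neg]

/-- The convolution of `c` with `φ`. -/
def mollify (φ : Rm m → ℝ) (c : Rm m → ℂ) (x : Rm m) : ℂ := ∫ t, φ t • c (x - t)

lemma hasFDerivAt_mollify (hφ : ContDiff ℝ ∞ φ) (hc : HasCompactSupport φ) {c : Rm m → ℂ}
    (hcc : Continuous c) (x w : Rm m) :
    fderiv ℝ (mollify φ c) x w = ∫ t, (fderiv ℝ φ t w) • c (x - t) := by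
  have h1 := hc.hasFDerivAt_convolution_left (ContinuousLinearMap.lsmul ℝ ℝ : ℝ →L[ℝ] ℂ →L[ℝ] ℂ)
    (hφ.of_le (by simp)) (hcc.locallyIntegrable (μ := volume)) x
  have h2 : fderiv ℝ (mollify φ c) x = _ := h1.fderiv
  rw [h2, convolution_def, ContinuousLinearMap.integral_apply]
  · rfl
  · exact HasCompactSupport.convolutionExists_left _ (hc.fderiv ℝ)
      (hφ.continuous_fderiv (by simp)) (hcc.locallyIntegrable) x

lemma contDiff_mollify (hφ : ContDiff ℝ ∞ φ) (hc : HasCompactSupport φ) {c : Rm m → ℂ}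
    (hcc : Continuous c) : ContDiff ℝ ∞ (mollify φ c) :=
  hc.contDiff_convolution_left (ContinuousLinearMap.lsmul ℝ ℝ : ℝ →L[ℝ] ℂ →L[ℝ] ℂ) hφ
    (hcc.locallyIntegrable (μ := volume))

lemma norm_integral_smul_le {ψ : Rm m → ℝ} (hψ : Continuous ψ) (hc : HasCompactSupport ψ)
    {H : Rm m → W} {B : ℝ} (hB : ∀ t ∈ tsupport ψ, ‖H t‖ ≤ B) :
    ‖∫ t, ψ t • H t‖ ≤ (∫ t, |ψ t|) * B := by
  rw [← integral_mul_const]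
  refine norm_integral_le_of_norm_le ((hψ.integrable_of_hasCompactSupport hc).norm.mul_const B)
    (Filter.Eventually.of_forall fun t => ?_)
  rw [norm_smul]
  by_cases ht : t ∈ tsupport ψ
  · exact mul_le_mul_of_nonneg_left (hB t ht) (norm_nonneg _)
  · simp [image_eq_zero_of_notMem_tsupport ht]

lemma integral_fderiv_eq_zero (hφ : ContDiff ℝ ∞ φ) (hc : HasCompactSupport φ) (w : Rm m) :
    ∫ t, fderiv ℝ φ t w = 0 := by
  have h := integral_smul_fderiv_eq_neg_fderiv_smul_of_integrable (μ := volume) (v := w) (f := φ)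
    (g := fun _ : Rm m => (1 : ℝ)) (by
      simpa using (continuous_fderiv_apply hφ w).integrable_of_hasCompactSupport
        (μ := volume) (hc.fderiv_apply ℝ w)) (by simp)
    (by simpa using hφ.continuous.integrable_of_hasCompactSupport (μ := volume) hc)
    (fun y _ => hφ.differentiable (by simp) y) (fun y _ => differentiableAt_const _)
  simpa using h.symm

lemma norm_mollify_sub_le (hφ : Continuous φ) (hc : HasCompactSupport φ) (h0 : ∀ t, 0 ≤ φ t)
    (h1 : ∫ t, φ t = 1) {G : Rm m → W} [CompleteSpace W] {B : ℝ}
    (hi : Integrable fun t => φ t • G (x - t))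
    (hB : ∀ t ∈ tsupport φ, ‖G (x - t) - G x‖ ≤ B) : ‖(∫ t, φ t • G (x - t)) - G x‖ ≤ B := by
  have e : (∫ t, φ t • G (x - t)) - G x = ∫ t, φ t • (G (x - t) - G x) := by
    simp only [smul_sub]
    rw [integral_sub hi ((hφ.integrable_of_hasCompactSupport hc).smul_const _),
      integral_smul_const, h1, one_smul]
  rw [e]
  refine (norm_integral_smul_le hφ hc hB).trans ?_
  simp only [abs_of_nonneg (h0 _), h1, one_mul, le_refl]

/-- Expand the product of differences on the right; the term with the constant `c x • b x` vanishes
because a derivative of a test function has integral zero. -/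
lemma commutator_eq [CompleteSpace W] (hφ : ContDiff ℝ ∞ φ) (hc : HasCompactSupport φ)
    (hs : tsupport φ ⊆ Metric.closedBall 0 ε) (hx : Metric.closedBall x ε ⊆ D)
    {c : Rm m → ℂ} (hcc : Continuous c) {b : Rm m → W} (hb : ContinuousOn b D) (w : Rm m) :
    fderiv ℝ (mollify φ c) x w • b x - (∫ t, (fderiv ℝ φ t w) • (c (x - t) • b (x - t))) =
      (∫ t, (fderiv ℝ φ t w) • (c (x - t) - c x) • (b x - b (x - t))) -
        c x • ∫ t, (fderiv ℝ φ t w) • b (x - t) := by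
  have k1 := continuous_fderiv_apply hφ w
  have k2 : HasCompactSupport fun t => fderiv ℝ φ t w := hc.fderiv_apply ℝ w
  have k3 : (tsupport fun t => fderiv ℝ φ t w) ⊆ Metric.closedBall 0 ε :=
    (tsupport_fderiv_apply_subset ℝ w).trans hs
  have i1 : Integrable fun t => (fderiv ℝ φ t w) • (c (x - t) • b (x - t)) :=
    integrable_smul_reflect k1 k2 k3 hx (h := fun y => c y • b y) (hcc.continuousOn.smul hb)
  have i2 : Integrable fun t => (fderiv ℝ φ t w) • b (x - t) :=
    integrable_smul_reflect k1 k2 k3 hx hb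
  have i3 : Integrable fun t => (fderiv ℝ φ t w) • c (x - t) :=
    integrable_smul_reflect k1 k2 k3 hx hcc.continuousOn
  have i4 : Integrable fun t => fderiv ℝ φ t w := k1.integrable_of_hasCompactSupport k2
  have e : (fun t => (fderiv ℝ φ t w) • (c (x - t) - c x) • (b x - b (x - t))) = fun t =>
      ((((fderiv ℝ φ t w) • c (x - t)) • b x - (fderiv ℝ φ t w) • (c (x - t) • b (x - t))) -
        (fderiv ℝ φ t w) • (c x • b x)) + c x • ((fderiv ℝ φ t w) • b (x - t)) := by
    funext t
    simp only [smul_sub, sub_smul, smul_assoc, smul_comm (c x)]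
    abel
  have i5 : Integrable fun t => ((fderiv ℝ φ t w) • c (x - t)) • b x := i3.smul_const _
  have i6 : Integrable fun t => (fderiv ℝ φ t w) • (c x • b x) := i4.smul_const _
  have i7 : Integrable fun t => c x • ((fderiv ℝ φ t w) • b (x - t)) := i2.smul (c x)
  have i8 : Integrable fun t => ((fderiv ℝ φ t w) • c (x - t)) • b x -
      (fderiv ℝ φ t w) • (c (x - t) • b (x - t)) := i5.sub i1
  have i9 : Integrable fun t => (((fderiv ℝ φ t w) • c (x - t)) • b x -
      (fderiv ℝ φ t w) • (c (x - t) • b (x - t))) - (fderiv ℝ φ t w) • (c x • b x) := i8.sub i6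
  rw [e, integral_add i9 i7, integral_sub i8 i6, integral_sub i5 i1,
    integral_smul_const, integral_smul_const, integral_fderiv_eq_zero hφ hc, integral_smul,
    hasFDerivAt_mollify hφ hc hcc]
  simp

/-- Summing `commutator_eq`, the terms with the factor `c i x` add up to a mollification of `d (β i)
= 0`. What remains is a product of two differences: one is small by continuity of `c i`, the other
is of order ε by smoothness of `β i`. -/
lemma sum_wedge_mollify_sub [CompleteSpace W] {κ : Type*} [Fintype κ] (hφ : ContDiff ℝ ∞ φ)
    (hc : HasCompactSupport φ) (hs : tsupport φ ⊆ Metric.closedBall 0 ε)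
    (hx : Metric.closedBall x ε ⊆ D) {c : κ → Rm m → ℂ} (hcc : ∀ i, Continuous (c i))
    {β : κ → Rm m → Rm m [⋀^Fin N]→ₗ[ℝ] W} (hβ : ∀ i, CtsOn D (β i))
    (hβ0 : ∀ i, WkD D (β i) 0) {g : Rm m → Rm m [⋀^Fin (N + 1)]→ₗ[ℝ] W}
    (h : WkD D (fun y => ∑ i, c i y • β i y) g) (v : Fin (N + 1) → Rm m) :
    (∑ i, wedge (fderiv ℝ (mollify φ (c i)) x : Rm m →ₗ[ℝ] ℂ) (β i x)) v -
      ∫ t, φ t • g (x - t) v = ∑ i, ∑ k : Fin (N + 1), (-1 : ℝ) ^ (k : ℕ) •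
        ∫ t, (fderiv ℝ φ t (v k)) • (c i (x - t) - c i x) •
          (β i x (fun a => v (k.succAbove a)) - β i (x - t) (fun a => v (k.succAbove a))) := by
  have e1 : ∫ t, φ t • g (x - t) v = ∑ i, ∑ k : Fin (N + 1), (-1 : ℝ) ^ (k : ℕ) •
      ∫ t, (fderiv ℝ φ t (v k)) • (c i (x - t) • β i (x - t) (fun a => v (k.succAbove a))) := by
    rw [h.reflect hφ hc hs hx v, Finset.sum_comm]
    refine Finset.sum_congr rfl fun k _ => ?_
    rw [← Finset.smul_sum, ← integral_finsetSum]
    · congr 2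
      funext t
      rw [alternatingMap_sum_apply, Finset.smul_sum]
      rfl
    · intro i _
      exact integrable_smul_reflect (continuous_fderiv_apply hφ _) (hc.fderiv_apply ℝ _)
        ((tsupport_fderiv_apply_subset ℝ _).trans hs) hx
        (h := fun y => c i y • β i y (fun a => v (k.succAbove a)))
        ((hcc i).continuousOn.smul (hβ i _))
  have e2 : ∀ i, ∑ k : Fin (N + 1), (-1 : ℝ) ^ (k : ℕ) •
      c i x • ∫ t, (fderiv ℝ φ t (v k)) • β i (x - t) (fun a => v (k.succAbove a)) = 0 := by
    intro i
    have h1 := (hβ0 i).reflect hφ hc hs hx v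
    simp only [Pi.zero_apply, AlternatingMap.zero_apply, smul_zero, integral_zero] at h1
    simp only [smul_comm _ (c i x)]
    rw [← Finset.smul_sum, ← h1, smul_zero]
  rw [e1, alternatingMap_sum_apply, ← Finset.sum_sub_distrib]
  refine Finset.sum_congr rfl fun i _ => ?_
  rw [wedge_apply, ← Finset.sum_sub_distrib]
  have e3 := e2 i
  rw [← sub_zero (∑ k : Fin (N + 1), (-1 : ℝ) ^ (k : ℕ) • ∫ t, _), ← e3,
    ← Finset.sum_sub_distrib]
  refine Finset.sum_congr rfl fun k _ => ?_
  rw [← smul_sub, ← smul_sub, ← commutator_eq hφ hc hs hx (hcc i) (hβ i _) (v k)]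
  rfl

lemma exists_uniform_modulus {κ V G : Type*} [Finite κ] [SeminormedAddCommGroup V]
    [SeminormedAddCommGroup G] {f : κ → V → G} (hf : ∀ i, UniformContinuous (f i)) {η : ℝ}
    (hη : 0 < η) : ∃ δ : ℝ, 0 < δ ∧ ∀ i x t, ‖t‖ ≤ δ → ‖f i (x - t) - f i x‖ ≤ η := by
  have := Fintype.ofFinite κ
  choose δ hδ h using fun i => Metric.uniformContinuous_iff.1 (hf i) η hη
  obtain ⟨d, hd, hdi⟩ : ∃ d : ℝ, 0 < d ∧ ∀ i, d ≤ δ i := by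
    by_cases hκ : Nonempty κ
    · obtain ⟨i, hi⟩ := Finite.exists_min δ
      exact ⟨δ i, hδ i, hi⟩
    · exact ⟨1, one_pos, fun i => (hκ ⟨i⟩).elim⟩
  refine ⟨d / 2, half_pos hd, fun i x t ht => ?_⟩
  have h1 : dist (x - t) x < δ i := by
    rw [dist_eq_norm, sub_sub_cancel_left, norm_neg]
    linarith [hdi i]
  have h2 := h i h1
  rw [dist_eq_norm] at h2
  exact h2.le

lemma continuous_extend {G : Type*} [TopologicalSpace G] [Zero G] {K : Set (Rm m)}
    (hK : IsClosed K) (hD : IsOpen D) (hKD : K ⊆ D) {f : Rm m → G} (hf : ContinuousOn f D)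
    (h0 : ∀ y ∈ D \ K, f y = 0) : Continuous (D.indicator f) := by
  refine continuous_iff_continuousAt.2 fun y => ?_
  by_cases hy : y ∈ D
  · refine (hf.continuousAt (hD.mem_nhds hy)).congr ?_
    filter_upwards [hD.mem_nhds hy] with z hz
    rw [Set.indicator_of_mem hz]
  · refine (continuousAt_const (y := (0 : G))).congr ?_
    filter_upwards [hK.isOpen_compl.mem_nhds fun h => hy (hKD h)] with z hz
    by_cases hzD : z ∈ D
    · rw [Set.indicator_of_mem hzD, h0 z ⟨hzD, hz⟩]
    · rw [Set.indicator_of_notMem hzD]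

/-- Friedrichs' lemma: a form with continuous coefficients in a smooth closed frame can be
approximated uniformly, together with its exterior derivative, by smooth forms. -/
theorem exists_mollify_approx [CompleteSpace W] {κ τ : Type*} [Fintype κ] [Finite τ]
    {K : Set (Rm m)} (hK : IsCompact K) (hD : IsOpen D) (hKD : K ⊆ D)
    {c : κ → Rm m → ℂ} (hc : ∀ i, Continuous (c i)) (hcK : ∀ i, ∀ y ∉ K, c i y = 0)
    {β : κ → Rm m → Rm m [⋀^Fin N]→ₗ[ℝ] W} (hβ : ∀ i w, ContDiffOn ℝ 1 (fun y => β i y w) D)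
    (hβ0 : ∀ i, WkD D (β i) 0) {g : Rm m → Rm m [⋀^Fin (N + 1)]→ₗ[ℝ] W} (hg : CtsOn D g)
    (hgK : ∀ y ∈ D \ K, g y = 0) (h : WkD D (fun y => ∑ i, c i y • β i y) g)
    (v : τ → Fin (N + 1) → Rm m) :
    ∃ K₁ : Set (Rm m), IsCompact K₁ ∧ K₁ ⊆ D ∧ K ⊆ K₁ ∧ ∀ η : ℝ, 0 < η →
      ∃ C : κ → Rm m → ℂ, (∀ i, ContDiff ℝ ∞ (C i)) ∧ (∀ i, tsupport (C i) ⊆ K₁) ∧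
        (∀ i y, ‖C i y - c i y‖ ≤ η) ∧ ∀ j, ∀ y ∈ K₁,
          ‖(∑ i, wedge (fderiv ℝ (C i) y : Rm m →ₗ[ℝ] ℂ) (β i y)) (v j) - g y (v j)‖ ≤ η := by
  have := Fintype.ofFinite τ
  -- `K₁` is the closed δ/2-neighbourhood of `K`. Mollifying at a scale of at most δ/2 keeps the
  -- supports in `K₁`, and at points of `K₁` it uses only values in the δ-neighbourhood, which lies
  -- in `D`.
  obtain ⟨δ, hδ, hδD⟩ := hK.exists_cthickening_subset_open hD hKD
  have hK₂ : IsCompact (Metric.cthickening δ K) := hK.cthickening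
  have hK₁₂ : ∀ x ∈ Metric.cthickening (δ / 2) K, ∀ ε ≤ δ / 2,
      Metric.closedBall x ε ⊆ Metric.cthickening δ K := by
    intro x hx ε hε y hy
    have h1 : y ∈ Metric.cthickening (δ / 2) (Metric.cthickening (δ / 2) K) :=
      Metric.mem_cthickening_of_dist_le y x _ _ hx ((Metric.mem_closedBall.1 hy).trans hε)
    have h2 := Metric.cthickening_cthickening_subset (half_pos hδ).le (half_pos hδ).le K h1
    rwa [add_halves] at h2
  refine ⟨Metric.cthickening (δ / 2) K, hK.cthickening,
    (Metric.cthickening_mono (half_le_self hδ.le) K).trans hδD, Metric.self_subset_cthickening K,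
    fun η hη => ?_⟩
  obtain ⟨A, hA0, hA⟩ := exists_mollifier m
  have hbd : ∀ q : κ × τ × Fin (N + 1), ∃ L : ℝ, ∀ y ∈ Metric.cthickening δ K,
      ‖fderiv ℝ (fun y => β q.1 y fun a => v q.2.1 (q.2.2.succAbove a)) y‖ ≤ L := fun q =>
    (hK₂.image_of_continuousOn (((hβ q.1 _).continuousOn_fderiv_of_isOpen hD
      le_rfl).mono hδD)).isBounded.exists_norm_le.imp fun L hL y hy => hL _ ⟨y, hy, rfl⟩
  choose L' hL' using hbd
  obtain ⟨L, hL0, hL⟩ : ∃ L : ℝ, 0 ≤ L ∧ ∀ q, L' q ≤ L :=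
    ⟨∑ q, |L' q|, Finset.sum_nonneg fun q _ => abs_nonneg _, fun q => (le_abs_self _).trans
      (Finset.single_le_sum (f := fun q => |L' q|) (fun q _ => abs_nonneg _) (Finset.mem_univ q))⟩
  set T : ℝ := ∑ j, ∑ _i : κ, ∑ k, A (v j k) * L with hT
  have hT0 : 0 ≤ T := Finset.sum_nonneg fun j _ => Finset.sum_nonneg fun i _ =>
    Finset.sum_nonneg fun k _ => mul_nonneg (hA0 _) hL0
  -- The commutator will be bounded by `η' * T` and the error of mollifying `g` by `η'`; each is at
  -- most half of `η`.
  set η' : ℝ := η / 2 / (1 + T) with hη'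
  have hη'0 : 0 < η' := by positivity
  have hη'1 : η' * T ≤ η / 2 := by
    rw [hη', div_mul_eq_mul_div, div_le_iff₀ (by positivity)]
    nlinarith
  have hη'2 : η' ≤ η / 2 := div_le_self (by positivity) (by linarith)
  have hcu : ∀ i, UniformContinuous (c i) := fun i =>
    (HasCompactSupport.intro hK (hcK i)).uniformContinuous_of_continuous (hc i)
  have hgc : ∀ j, Continuous (D.indicator fun y => g y (v j)) := fun j =>
    continuous_extend hK.isClosed hD hKD (hg _) fun y hy => by rw [hgK y hy]; rfl
  have hgu : ∀ j, UniformContinuous (D.indicator fun y => g y (v j)) := fun j =>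
    (HasCompactSupport.intro hK fun y hy => by
      by_cases hyD : y ∈ D
      · rw [Set.indicator_of_mem hyD, hgK y ⟨hyD, hy⟩]; rfl
      · rw [Set.indicator_of_notMem hyD]).uniformContinuous_of_continuous (hgc j)
  obtain ⟨δ₁, hδ₁, hm₁⟩ := exists_uniform_modulus hcu hη'0
  obtain ⟨δ₂, hδ₂, hm₂⟩ := exists_uniform_modulus hgu hη'0
  obtain ⟨ε, hε, hε0, hε1, hε2⟩ : ∃ ε : ℝ, 0 < ε ∧ ε ≤ δ / 2 ∧ ε ≤ δ₁ ∧ ε ≤ δ₂ :=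
    ⟨min (δ / 2) (min δ₁ δ₂), by positivity, min_le_left _ _,
      (min_le_right _ _).trans (min_le_left _ _), (min_le_right _ _).trans (min_le_right _ _)⟩
  obtain ⟨φ, hφ, hφc, hφs, hφ0, hφ1, hφA⟩ := hA ε hε
  have hnt : ∀ t ∈ tsupport φ, ‖t‖ ≤ ε := fun t ht => mem_closedBall_zero_iff.1 (hφs ht)
  refine ⟨fun i => mollify φ (c i), fun i => contDiff_mollify hφ hφc (hc i), fun i => ?_,
    fun i y => ?_, fun j y hy => ?_⟩
  · refine closure_minimal (fun y hy => ?_) Metric.isClosed_cthickening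
    by_contra hyK
    refine hy (integral_eq_zero_of_ae (Filter.Eventually.of_forall fun t => ?_))
    by_cases ht : t ∈ tsupport φ
    · have h1 : y - t ∉ K := fun h2 => hyK (Metric.mem_cthickening_of_dist_le y (y - t) _ _ h2 (by
        rw [dist_eq_norm, sub_sub_cancel]; exact (hnt t ht).trans hε0))
      simp [hcK i _ h1]
    · simp [image_eq_zero_of_notMem_tsupport ht]
  · refine (norm_mollify_sub_le hφ.continuous hφc hφ0 hφ1 ?_ (B := η') fun t ht =>
      hm₁ i y t ((hnt t ht).trans hε1)).trans (by linarith)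
    exact integrable_smul_reflect hφ.continuous hφc hφs (Set.subset_univ _) (hc i).continuousOn
  · have hyb := hK₁₂ y hy ε hε0
    have hyD : y ∈ D := hδD (hyb (Metric.mem_closedBall_self hε.le))
    have e1 := sum_wedge_mollify_sub hφ hφc hφs (hyb.trans hδD) hc
      (fun i w => (hβ i w).continuousOn) hβ0 h (v j)
    have b1 : ‖(∑ i, wedge (fderiv ℝ (mollify φ (c i)) y : Rm m →ₗ[ℝ] ℂ) (β i y)) (v j) -
        ∫ t, φ t • g (y - t) (v j)‖ ≤ η / 2 := by
      rw [e1]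
      refine le_trans ?_ hη'1
      have hTj : ∑ _i : κ, ∑ k, A (v j k) * L ≤ T :=
        Finset.single_le_sum (f := fun j => ∑ _i : κ, ∑ k, A (v j k) * L)
          (fun j _ => Finset.sum_nonneg fun i _ => Finset.sum_nonneg fun k _ =>
            mul_nonneg (hA0 _) hL0) (Finset.mem_univ j)
      refine le_trans ?_ (mul_le_mul_of_nonneg_left hTj hη'0.le)
      rw [Finset.mul_sum]
      refine (norm_sum_le _ _).trans (Finset.sum_le_sum fun i _ => ?_)
      rw [Finset.mul_sum]
      refine (norm_sum_le _ _).trans (Finset.sum_le_sum fun k _ => ?_)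
      rw [norm_smul, norm_pow, norm_neg, norm_one, one_pow, one_mul]
      -- Here `η'` bounds the oscillation of `c i` and `L * ε` that of `β i` at scale ε; the 1/ε
      -- from the derivative of the mollifier cancels ε.
      refine (norm_integral_smul_le (B := η' * (L * ε)) (continuous_fderiv_apply hφ _)
        (hφc.fderiv_apply ℝ _) fun t ht => ?_).trans ?_
      · have ht' := hnt t (tsupport_fderiv_apply_subset ℝ _ ht)
        rw [norm_smul]
        refine mul_le_mul (hm₁ i y t (ht'.trans hε1)) ?_ (norm_nonneg _) hη'0.le
        have hyt : y - t ∈ Metric.closedBall y ε := by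
          rw [Metric.mem_closedBall, dist_eq_norm]; simpa using ht'
        have h2 := (convex_closedBall y ε).norm_image_sub_le_of_norm_fderiv_le (𝕜 := ℝ)
          (f := fun y => β i y fun a => v j (k.succAbove a)) (C := L)
          (fun z hz => ((hβ i _).contDiffAt (hD.mem_nhds (hδD (hyb hz)))).differentiableAt (by simp))
          (fun z hz => (hL' (i, j, k) z (hyb hz)).trans (hL _)) hyt
          (Metric.mem_closedBall_self hε.le)
        refine h2.trans (mul_le_mul_of_nonneg_left ?_ hL0)
        simpa using ht'
      · refine (mul_le_mul_of_nonneg_right (hφA (v j k)) (by positivity)).trans (le_of_eq ?_)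
        field_simp
    have hI : ∀ t, t ∈ tsupport φ → (D.indicator fun y => g y (v j)) (y - t) = g (y - t) (v j) :=
      fun t ht => Set.indicator_of_mem
        (sub_mem_of_mem_tsupport (hyb.trans hδD) hφs ht) _
    have b2 : ‖(∫ t, φ t • g (y - t) (v j)) - g y (v j)‖ ≤ η' := by
      have h3 := norm_mollify_sub_le (x := y) (G := D.indicator fun y => g y (v j)) hφ.continuous hφc
        hφ0 hφ1 (integrable_smul_reflect hφ.continuous hφc hφs (Set.subset_univ _)
          (hgc j).continuousOn) (B := η') fun t ht => hm₂ j y t ((hnt t ht).trans hε2)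
      rw [Set.indicator_of_mem hyD] at h3
      have h4 : (fun t => φ t • (D.indicator fun y => g y (v j)) (y - t)) =
          fun t => φ t • g (y - t) (v j) := by
        funext t
        by_cases ht : t ∈ tsupport φ
        · rw [hI t ht]
        · simp [image_eq_zero_of_notMem_tsupport ht]
      rwa [h4] at h3
    have h5 := norm_add_le _ _ |>.trans (add_le_add b1 b2)
    rw [sub_add_sub_cancel] at h5
    linarith

end Mollifier

end
end CRForms

namespace CRForms
noncomputable section

/-! ### Weak derivatives of E-valued forms, and the closed graph of d. -/

section Dual

open MeasureTheory

variable {m : ℕ} {W : Type*} [NormedAddCommGroup W] [NormedSpace ℂ W] {N : ℕ} {D : Set (Rm m)}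

lemma WkD.ext_dual [CompleteSpace W] {u : Rm m → Rm m [⋀^Fin N]→ₗ[ℝ] W}
    {g : Rm m → Rm m [⋀^Fin (N + 1)]→ₗ[ℝ] W} (hu : CtsOn D u) (hg : CtsOn D g)
    (h : ∀ L : W →L[ℂ] ℂ, WkD D (fun y => ((L : W →ₗ[ℂ] ℂ).restrictScalars ℝ).compAlternatingMap (u y))
      (fun y => ((L : W →ₗ[ℂ] ℂ).restrictScalars ℝ).compAlternatingMap (g y))) : WkD D u g := by
  intro φ h1 h2 h3 v
  have e : ∀ (L : W →L[ℂ] ℂ) {ψ : Rm m → ℝ} {w : Rm m → W}, Continuous ψ → HasCompactSupport ψ →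
      tsupport ψ ⊆ D → ContinuousOn w D → L (∫ y, ψ y • w y) = ∫ y, ψ y • L (w y) := by
    intro L ψ w k1 k2 k3 k4
    rw [← ContinuousLinearMap.integral_comp_comm L (integrable_smul_of_tsupport k1 k2 k3 k4)]
    exact integral_congr_ae (Filter.Eventually.of_forall fun y =>
      ((L.restrictScalars ℝ).map_smul (ψ y) (w y)))
  refine (SeparatingDual.eq_iff_forall_dual_eq (R := ℂ)).2 fun L => ?_
  rw [e L h1.continuous h2 h3 (hg v), map_neg, map_sum]
  refine (h L φ h1 h2 h3 v).trans (congrArg Neg.neg (Finset.sum_congr rfl fun i _ => ?_))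
  refine Eq.trans (congrArg ((-1 : ℝ) ^ (i : ℕ) • ·) ?_) ((L.restrictScalars ℝ).map_smul _ _).symm
  exact (e L (continuous_fderiv_apply h1 _) (h2.fderiv_apply ℝ _)
    ((tsupport_fderiv_apply_subset ℝ (v i)).trans h3) (hu _)).symm

end Dual

section Limits

open MeasureTheory

variable {n m : ℕ} {X : Type*} [TopologicalSpace X] [ChartedSpace (Cn n) X]
  [IsManifold 𝓘(ℂ, Cn n) ω X]
  {M : Type*} [TopologicalSpace M] [ChartedSpace (Rm m) M] [IsManifold (𝓡 m) ∞ M]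
  {S : GenericCR n m X M}
  {F : Type*} [NormedAddCommGroup F] [NormedSpace ℂ F]
  {E : X → Type*} [∀ x, AddCommGroup (E x)] [∀ x, Module ℂ (E x)]
  [TopologicalSpace (Bundle.TotalSpace F E)] [∀ x, TopologicalSpace (E x)]
  [FiberBundle F E] [VectorBundle ℂ F E] [ContMDiffVectorBundle ω F E 𝓘(ℂ, Cn n)]
  {x p : M} {U : Opens M} {r l N : ℕ}

/-- In another trivialization the constant section `e` becomes the restriction to M of a holomorphic
function `γ`. Composed with a functional, it yields a function `c` whose differential is
complex-linear, so dc ∧ u = 0 for the (n,r)-form `u`, and the Leibniz rule reduces to `d (c u) = c d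
u`. This is what makes d well defined on E-valued (n,r)-forms. -/
lemma isWeakD_pack [FiniteDimensional ℂ F] {u : Form S (Bundle.Trivial X ℂ) (n + r)}
    {g : Form S (Bundle.Trivial X ℂ) (n + r + 1)}
    (hn : ∀ p ∈ U, IsNRAt S (Bundle.Trivial X ℂ) r p (u p))
    (hu : ∀ x, CtsOn (dom S ℂ (Bundle.Trivial X ℂ) x U) (coeffAlt S ℂ (Bundle.Trivial X ℂ) x u))
    (hg : ∀ x, CtsOn (dom S ℂ (Bundle.Trivial X ℂ) x U) (coeffAlt S ℂ (Bundle.Trivial X ℂ) x g))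
    (h : IsWeakD S ℂ (Bundle.Trivial X ℂ) U u g) (hU : (U : Set M) ⊆ patch S F E x) (e : F) :
    IsWeakD S F E U (pack x e u) (pack x e g) := by
  have : CompleteSpace F := FiniteDimensional.complete ℂ F
  refine isWeakD_iff.2 fun x' => ?_
  have hsub : dom S F E x' U ⊆ dom S ℂ (Bundle.Trivial X ℂ) x' U := fun y hy =>
    ⟨hy.1, hy.2.1, trivial⟩
  let γ : M → F := fun q => (trivializationAt F E (S.ι x)).coordChangeL ℂ
    (trivializationAt F E (S.ι x')) (S.ι q) e
  have hγ : ∀ y ∈ dom S F E x' U, ContMDiffAt (𝓡 m) 𝓘(ℝ, F) ∞ γ ((chartAt (Rm m) x').symm y) := by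
    intro y hy
    have h1 := contMDiffAt_coordChangeL_ι (S := S) (F := F) (E := E) (x := x) (x' := x')
      (hU hy.2.1) (symm_mem_patch hy)
    exact h1.clm_apply contMDiffAt_const
  have hco : ∀ {K : ℕ} (w : Form S (Bundle.Trivial X ℂ) K) (v : Fin K → Rm m),
      ∀ y ∈ dom S F E x' U, coeff S F E x' v (pack x e w) y =
        coeff S ℂ (Bundle.Trivial X ℂ) x' v w y • γ ((chartAt (Rm m) x').symm y) := by
    intro K w v y hy
    rw [coeff_trivial]
    have h1 := (hU hy.2.1).2
    have h2 := (symm_mem_patch hy).2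
    simp only [γ]
    rw [← map_smul, Bundle.Trivialization.coordChangeL_apply _ _ ⟨h1, h2⟩]
    simp only [coeff]
    rw [Bundle.Trivialization.coe_linearMapAt_of_mem _ h2]
    exact congrArg (fun z => ((trivializationAt F E (S.ι x')) ⟨_, z⟩).2)
      (Bundle.Trivialization.symmₗ_apply (R := ℂ) (trivializationAt F E (S.ι x)) h1 _)
  have hcts : ∀ {K : ℕ} {w : Form S (Bundle.Trivial X ℂ) K},
      CtsOn (dom S ℂ (Bundle.Trivial X ℂ) x' U) (coeffAlt S ℂ (Bundle.Trivial X ℂ) x' w) →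
      CtsOn (dom S F E x' U) (coeffAlt S F E x' (pack x e w)) := by
    intro K w hw v
    refine (((hw v).mono hsub).smul (f := fun y => coeffAlt S ℂ (Bundle.Trivial X ℂ) x' w y v)
      (g := fun y => γ ((chartAt (Rm m) x').symm y)) fun y hy => ?_).congr
      fun y hy => hco w v y hy
    exact ((hγ y hy).continuousAt.comp ((chartAt (Rm m) x').continuousAt_symm
      hy.1)).continuousWithinAt
  refine WkD.ext_dual (hcts (hu x')) (hcts (hg x')) fun L => ?_
  let c : M → ℂ := fun q => L (γ q)
  have hc : ∀ y ∈ dom S F E x' U, ContMDiffAt (𝓡 m) 𝓘(ℝ, ℂ) ∞ c ((chartAt (Rm m) x').symm y) :=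
    fun y hy => (L.restrictScalars ℝ).contDiff.contMDiff.contMDiffAt.comp _ (hγ y hy)
  have hc' : ContDiffOn ℝ ∞ (fun y => c ((chartAt (Rm m) x').symm y)) (dom S F E x' U) := by
    intro y hy
    have h := contDiffAt_comp_chart_symm ((chartAt (Rm m) x').map_target hy.1) (hc y hy)
    rw [(chartAt (Rm m) x').right_inv hy.1] at h
    exact h.contDiffWithinAt
  have key := ((isWeakD_iff.1 h x').mono hsub).smul ((hu x').mono hsub) ((hg x').mono hsub)
    (isOpen_dom S F E x' U) hc' Set.inter_subset_left
  refine key.congr (fun y hy => ?_) fun y hy => ?_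
  · ext v
    change L (coeff S F E x' v (pack x e u) y) = _
    rw [hco u v y hy, map_smul, smul_eq_mul, mul_comm]
    rfl
  · have hz : wedge (fderiv ℝ (fun y => c ((chartAt (Rm m) x').symm y)) y : Rm m →ₗ[ℝ] ℂ)
        (coeffAlt S ℂ (Bundle.Trivial X ℂ) x' u y) = 0 := by
      rw [← coeffAlt_dwedge (S := S) (E := Bundle.Trivial X ℂ) (F := ℂ) (x := x')
        ((hc y hy).mdifferentiableAt (by simp)) u hy.1]
      have h1 : dwedge c u ((chartAt (Rm m) x').symm y) = 0 := by
        let h : X → ℂ := fun q => L ((trivializationAt F E (S.ι x)).coordChangeL ℂ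
          (trivializationAt F E (S.ι x')) q e)
        have hh : MDifferentiableAt 𝓘(ℂ, Cn n) 𝓘(ℂ, ℂ) h (S.ι ((chartAt (Rm m) x').symm y)) := by
          have h2 := contMDiffAt_coordChangeL (n := ω) (IB := 𝓘(ℂ, Cn n))
            (e := trivializationAt F E (S.ι x)) (e' := trivializationAt F E (S.ι x'))
            (hU hy.2.1).2 (symm_mem_patch hy).2
          have h3 : ContMDiffAt 𝓘(ℂ, Cn n) 𝓘(ℂ, F) ω (fun q =>
            (trivializationAt F E (S.ι x)).coordChangeL ℂ (trivializationAt F E (S.ι x')) q e)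
            (S.ι ((chartAt (Rm m) x').symm y)) := h2.clm_apply contMDiffAt_const
          exact (L.contDiff.contMDiff.contMDiffAt.comp _ h3).mdifferentiableAt (by simp)
        exact (hn _ hy.2.1).wedge_eq_zero
          (mfderiv 𝓘(ℂ, Cn n) 𝓘(ℂ, ℂ) h (S.ι ((chartAt (Rm m) x').symm y)) : Cn n →L[ℂ] ℂ).toLinearMap
          fun v => dfun_comp_ι hh v
      ext v
      change coeff S ℂ (Bundle.Trivial X ℂ) x' v (dwedge c u) y = 0
      rw [coeff_trivial, h1]
      rfl
    rw [hz, zero_add]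
    ext v
    change L (coeff S F E x' v (pack x e g) y) = _
    rw [hco g v y hy, map_smul, smul_eq_mul, mul_comm]
    rfl

variable [CompactSpace M] [T2Space M]

lemma continuous_integral_coeff {ψ : Rm m → ℝ} (hψ : Continuous ψ) (hc : HasCompactSupport ψ)
    (hs : tsupport ψ ⊆ dom S F E x ⊤) (v : Fin (n + r) → Rm m) :
    Continuous fun f : XC S F E r l => ∫ y, ψ y • coeff S F E x v f.form y := by
  have hi : ∀ f : XC S F E r l, Integrable fun y => ψ y • coeff S F E x v f.form y := fun f =>
    integrable_smul_of_tsupport hψ hc hs (f.form_mem.2.2 x v).continuousOn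
  let I : XC S F E r l →ₗ[ℂ] F :=
    { toFun := fun f => ∫ y, ψ y • coeff S F E x v f.form y
      map_add' := fun f g => by
        rw [← integral_add (hi f) (hi g)]
        simp only [map_add, coeff_add, smul_add]
      map_smul' := fun c f => by
        simp only [map_smul, coeff_smul, RingHom.id_apply]
        rw [← integral_smul]
        simp only [smul_comm c] }
  obtain ⟨C, hC0, hC⟩ := exists_coeff_le_norm (S := S) (E := E) (F := F) hc hs v
  refine AddMonoidHomClass.continuous_of_bound I ((∫ y, |ψ y|) * C) fun f => ?_
  rw [mul_assoc]
  exact norm_integral_smul_le hψ hc fun y hy => hC l f y hy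

/-- Each identity defining the weak derivative compares functionals that are continuous already for
the uniform norm of the coefficients. -/
lemma isClosed_isWeakD {l' : ℕ} : IsClosed {q : XC S F E r l × XC S F E (r + 1) l' |
    IsWeakD S F E ⊤ q.1.form q.2.form} := by
  have e : {q : XC S F E r l × XC S F E (r + 1) l' | IsWeakD S F E ⊤ q.1.form q.2.form} =
      ⋂ (x : M) (φ : Rm m → ℝ) (_ : ContDiff ℝ ∞ φ) (_ : HasCompactSupport φ)
        (_ : tsupport φ ⊆ dom S F E x ⊤) (v : Fin (n + r + 1) → Rm m),
        {q : XC S F E r l × XC S F E (r + 1) l' | ∫ y, φ y • coeff S F E x v q.2.form y =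
          -∑ i : Fin (n + r + 1), (-1 : ℝ) ^ (i : ℕ) •
          ∫ y, (fderiv ℝ φ y (v i)) • coeff S F E x (fun j => v (i.succAbove j)) q.1.form y} := by
    ext q
    simp only [Set.mem_iInter, Set.mem_ofPred_eq]
    rfl
  rw [e]
  refine isClosed_iInter fun x => isClosed_iInter fun φ => isClosed_iInter fun h1 =>
    isClosed_iInter fun h2 => isClosed_iInter fun h3 => isClosed_iInter fun v => ?_
  refine isClosed_eq ((continuous_integral_coeff (r := r + 1) h1.continuous h2 h3 v).comp
    continuous_snd) (continuous_finsetSum _ fun i _ => Continuous.const_smul ?_ _).neg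
  exact (continuous_integral_coeff (continuous_fderiv_apply h1 _) (h2.fderiv_apply ℝ _)
    ((tsupport_fderiv_apply_subset ℝ (v i)).trans h3) _).comp continuous_fst

/-- The norm involves all the covering balls. For a form vanishing outside a compact part of one
patch, the coefficients in that patch control it by `exists_coeff_bound`. -/
lemma exists_norm_le_of_chart {K : Set (Rm m)} (hK : IsCompact K) (hKd : K ⊆ dom S F E x ⊤) (r : ℕ) :
    ∃ C : ℝ, 0 ≤ C ∧ ∀ (h : XC S F E r 0) (η : ℝ), 0 ≤ η →
      (∀ p ∉ (chartAt (Rm m) x).symm '' K, h.form p = 0) →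
      (∀ I, ∀ y ∈ K, ‖coeff S F E x (basisVec I) h.form y‖ ≤ η) → ‖h‖ ≤ C * η := by
  have hcomp : ∀ (x : M) (K : Set (Rm m)), IsCompact K → K ⊆ dom S F E x ⊤ →
      IsCompact ((chartAt (Rm m) x).symm '' K) := fun x K hK hKd =>
    hK.image_of_continuousOn ((chartAt (Rm m) x).continuousOn_symm.mono fun y hy => (hKd hy).1)
  have hb : ∀ q : M × (Fin (n + r) → Fin m), ∃ C : ℝ, 0 ≤ C ∧ ∀ (f : Form S E (n + r)),
      ∀ p ∈ (chartAt (Rm m) x).symm '' K ∩ (chartAt (Rm m) q.1).symm '' cball S F E q.1,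
      ‖coeff S F E q.1 (basisVec q.2) f (chartAt (Rm m) q.1 p)‖ ≤
        C * ∑ I, ‖coeff S F E x (basisVec I) f (chartAt (Rm m) x p)‖ := fun q =>
    exists_coeff_bound ((hcomp x K hK hKd).inter (hcomp q.1 _ (isCompact_cball S F E q.1)
        (cball_subset_dom S F E q.1)))
      (fun p hp => by
        obtain ⟨y, hy, rfl⟩ := hp.1
        exact symm_mem_patch (hKd hy))
      (fun p hp => by
        obtain ⟨y, hy, rfl⟩ := hp.2
        exact symm_mem_patch (cball_subset_dom S F E q.1 hy)) _
  choose C hC hCf using hb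
  refine ⟨(∑ c ∈ centers S F E, ∑ I, C (c, I)) * Fintype.card (Fin (n + r) → Fin m),
    mul_nonneg (Finset.sum_nonneg fun c _ => Finset.sum_nonneg fun I _ => hC _)
      (Nat.cast_nonneg _), fun h η hη h0 hc => ?_⟩
  have hS : 0 ≤ ∑ c ∈ centers S F E, ∑ I, C (c, I) :=
    Finset.sum_nonneg fun c _ => Finset.sum_nonneg fun I _ => hC _
  refine XC.norm_le_zero (by positivity) fun c hcc I y hy => ?_
  have hyd := cball_subset_dom S F E c hy
  by_cases hp : (chartAt (Rm m) c).symm y ∈ (chartAt (Rm m) x).symm '' K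
  · have h1 := hCf (c, I) h.form _ ⟨hp, ⟨y, hy, rfl⟩⟩
    rw [chart_symm_of_mem_dom hyd] at h1
    refine h1.trans ?_
    rw [mul_assoc]
    refine mul_le_mul ?_ ?_ (Finset.sum_nonneg fun _ _ => norm_nonneg _) hS
    · exact (Finset.single_le_sum (f := fun I => C (c, I)) (fun I _ => hC _)
        (Finset.mem_univ I)).trans (Finset.single_le_sum (f := fun c => ∑ I, C (c, I))
          (fun c _ => Finset.sum_nonneg fun I _ => hC _) hcc)
    · obtain ⟨z, hz, hzp⟩ := hp
      rw [← hzp, chart_symm_of_mem_dom (hKd hz)]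
      refine (Finset.sum_le_sum fun J _ => hc J z hz).trans ?_
      simp
  · have h1 : coeff S F E c (basisVec I) h.form y = 0 := by
      simp only [coeff, h0 _ hp]
      exact map_zero _
    rw [h1, norm_zero]
    positivity

end Limits

end
end CRForms

namespace CRForms
noncomputable section

/-! ### Smooth cutoffs and partitions of unity with complex values. -/

section Cutoff

variable {m : ℕ} {M : Type*} [TopologicalSpace M] [ChartedSpace (Rm m) M] [IsManifold (𝓡 m) ∞ M]
  [CompactSpace M] [T2Space M]

lemma exists_cutoff {K : Set M} (hK : IsClosed K) (U : Opens M) (hKU : K ⊆ U) :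
    ∃ ψ : M → ℂ, ContMDiff (𝓡 m) 𝓘(ℝ, ℂ) ∞ ψ ∧ tsupport ψ ⊆ U ∧ ∀ᶠ p in 𝓝ˢ K, ψ p = 1 := by
  obtain ⟨f, h0, h1, -⟩ := exists_contMDiffMap_zero_one_nhds_of_isClosed (n := ⊤) (𝓡 m)
    U.isOpen.isClosed_compl hK (Set.disjoint_left.2 fun p hp hpK => hp (hKU hpK))
  refine ⟨fun p => (f p : ℂ), Complex.ofRealCLM.contDiff.contMDiff.comp f.contMDiff, ?_, ?_⟩
  · intro p hp
    by_contra hpU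
    refine (notMem_tsupport_iff_eventuallyEq.2 ?_) hp
    filter_upwards [(mem_nhdsSet_iff_forall.1 h0 p hpU : ∀ᶠ q in 𝓝 p, f q = 0)] with q hq
    simp [hq]
  · filter_upwards [h1] with p hp
    simp [hp]

lemma exists_partition (V : M → Opens M) (hV : ∀ x, x ∈ V x) :
    ∃ (t : Finset M) (χ : M → M → ℂ), (∀ x, ContMDiff (𝓡 m) 𝓘(ℝ, ℂ) ∞ (χ x)) ∧
      (∀ x ∈ t, tsupport (χ x) ⊆ V x) ∧ ∀ p, ∑ x ∈ t, χ x p = 1 := by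
  classical
  obtain ⟨t, -, ht⟩ := isCompact_univ.elim_nhds_subcover (fun x => (V x : Set M))
    fun x _ => (V x).isOpen.mem_nhds (hV x)
  obtain ⟨f, hf⟩ := SmoothPartitionOfUnity.exists_isSubordinate (𝓡 m) (s := (Set.univ : Set M))
    isClosed_univ (fun x : t => (V x.1 : Set M)) (fun x => (V x.1).isOpen) (fun p hp => by
      have h := ht hp
      simp only [Set.mem_iUnion] at h ⊢
      obtain ⟨x, hx, hpx⟩ := h
      exact ⟨⟨x, hx⟩, hpx⟩)
  refine ⟨t, fun x p => if hx : x ∈ t then ((f ⟨x, hx⟩ p : ℝ) : ℂ) else 0, fun x => ?_,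
    fun x hx => ?_, fun p => ?_⟩
  · by_cases hx : x ∈ t
    · simp only [dif_pos hx]
      exact Complex.ofRealCLM.contDiff.contMDiff.comp (f ⟨x, hx⟩).contMDiff
    · simp only [dif_neg hx]
      exact contMDiff_const
  · simp only [dif_pos hx]
    exact (tsupport_comp_subset (g := fun a : ℝ => (a : ℂ)) (by simp) (f ⟨x, hx⟩)).trans (hf ⟨x, hx⟩)
  · rw [← Finset.sum_attach]
    simp only [Finset.coe_mem, dif_pos]
    have h1 := f.sum_eq_one (Set.mem_univ p)
    rw [finsum_eq_sum_of_fintype] at h1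
    rw [← Complex.ofReal_one, ← h1, Complex.ofReal_sum]
    rfl

end Cutoff

/-! ### Cutting off forms, and E-valued frames. -/

section Local

variable {n m : ℕ} {X : Type*} [TopologicalSpace X] [ChartedSpace (Cn n) X]
  [IsManifold 𝓘(ℂ, Cn n) ω X]
  {M : Type*} [TopologicalSpace M] [ChartedSpace (Rm m) M] [IsManifold (𝓡 m) ∞ M]
  {S : GenericCR n m X M}
  {F : Type*} [NormedAddCommGroup F] [NormedSpace ℂ F]
  {E : X → Type*} [∀ x, AddCommGroup (E x)] [∀ x, Module ℂ (E x)]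
  [TopologicalSpace (Bundle.TotalSpace F E)] [∀ x, TopologicalSpace (E x)]
  [FiberBundle F E] [VectorBundle ℂ F E] [ContMDiffVectorBundle ω F E 𝓘(ℂ, Cn n)]
  {x p : M} {U : Opens M} {r N : ℕ} {l : ℕ∞} {c : M → ℂ}

lemma isNRAt_zero : IsNRAt S E r p 0 := (nrSubmodule S E r p).zero_mem

lemma smulForm_mem_CForms_of_tsupport (hc : ContMDiff (𝓡 m) 𝓘(ℝ, ℂ) ∞ c)
    {f : Form S E (n + r)} (h : ∀ p ∈ tsupport c, IsNRAt S E r p (f p) ∧ Reg S F E l 0 f p) :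
    smulForm c f ∈ CForms S F E ⊤ r l := by
  refine mem_CForms_iff.2 ⟨fun p => ?_, fun p hp => (hp trivial).elim, fun p _ =>
    Reg.smulForm_of_tsupport le_rfl zero_le_one hc fun hp => (h p hp).2⟩
  by_cases hp : p ∈ tsupport c
  · exact (nrSubmodule S E r p).smul_mem (c p) (h p hp).1
  · have h1 : smulForm c f p = 0 := by
      simp [smulForm, image_eq_zero_of_notMem_tsupport hp]
    rw [h1]
    exact isNRAt_zero

lemma dwedge_mem_CForms_of_tsupport (hc : ContMDiff (𝓡 m) 𝓘(ℝ, ℂ) ∞ c)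
    {f : Form S E (n + r)} (h : ∀ p ∈ tsupport c, IsNRAt S E r p (f p) ∧ Reg S F E l 0 f p) :
    dwedge c f ∈ CForms S F E ⊤ (r + 1) l := by
  refine mem_CForms_iff.2 ⟨fun p => ?_, fun p hp => (hp trivial).elim, fun p _ =>
    Reg.dwedge_of_tsupport le_rfl zero_le_one hc fun hp => (h p hp).2⟩
  by_cases hp : p ∈ tsupport c
  · exact (h p hp).1.wedge _
  · have h1 : dwedge c f p = 0 := by
      simp [dwedge, dfun_eq_zero_of_notMem_tsupport hp, wedge_zero_left]
    rw [h1]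
    exact isNRAt_zero

lemma isWeakD_smulForm (hc : ContMDiff (𝓡 m) 𝓘(ℝ, ℂ) ∞ c) (hU : tsupport c ⊆ U)
    {f : Form S E N} {g : Form S E (N + 1)} (hf : ∀ x, CtsOn (dom S F E x U) (coeffAlt S F E x f))
    (hg : ∀ x, CtsOn (dom S F E x U) (coeffAlt S F E x g)) (h : IsWeakD S F E U f g) :
    IsWeakD S F E ⊤ (smulForm c f) (dwedge c f + smulForm c g) :=
  isWeakD_iff.2 fun x => (isWeakD_iff.1 h x).smulForm (hf x) (hg x) hc hU

lemma dwedge_sum_eq_zero {κ : Type*} (t : Finset κ) {χ : κ → M → ℂ}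
    (hχ : ∀ i, ContMDiff (𝓡 m) 𝓘(ℝ, ℂ) ∞ (χ i)) (h1 : ∀ p, ∑ i ∈ t, χ i p = 1)
    (f : Form S E N) : ∑ i ∈ t, dwedge (χ i) f = 0 := by
  funext p
  obtain ⟨D, hD, hDv⟩ : ∃ D : TangentSpace (𝓡 m) p →L[ℝ] ℂ,
      HasMFDerivAt (𝓡 m) 𝓘(ℝ, ℂ) (∑ i ∈ t, χ i) p D ∧ ∀ v, D v = ∑ i ∈ t, dfun (χ i) p v := by
    classical
    clear h1
    induction t using Finset.induction_on with
    | empty => exact ⟨0, by simpa using! hasMFDerivAt_const (I := 𝓡 m) (I' := 𝓘(ℝ, ℂ)) (0 : ℂ) p,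
        fun v => rfl⟩
    | insert i t hi ih =>
      obtain ⟨D, hD, hDv⟩ := ih
      let A : TangentSpace (𝓡 m) p →L[ℝ] ℂ := mfderiv (𝓡 m) 𝓘(ℝ, ℂ) (χ i) p
      refine ⟨A + D, ?_, fun v => ?_⟩
      · rw [Finset.sum_insert hi]
        exact (((hχ i p).mdifferentiableAt (by simp)).hasMFDerivAt).add hD
      · rw [Finset.sum_insert hi, ← hDv]
        rfl
  have h3 : (∑ i ∈ t, χ i) = fun _ => (1 : ℂ) := by
    funext q; rw [Finset.sum_apply, h1]
  rw [h3] at hD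
  have h4 : ∑ i ∈ t, dfun (m := m) (χ i) p = 0 := by
    refine LinearMap.ext fun v => ?_
    have h5 := DFunLike.congr_fun (hasMFDerivAt_unique hD
      (hasMFDerivAt_const (I := 𝓡 m) (I' := 𝓘(ℝ, ℂ)) (1 : ℂ) p)) v
    rw [LinearMap.sum_apply, ← hDv]
    exact h5
  rw [Finset.sum_apply]
  simp only [dwedge]
  rw [← wedge_sum_left, h4, wedge_zero_left]
  rfl

lemma sum_smulForm {κ : Type*} (t : Finset κ) {χ : κ → M → ℂ} (h1 : ∀ p, ∑ i ∈ t, χ i p = 1)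
    (f : Form S E N) : ∑ i ∈ t, smulForm (χ i) f = f := by
  funext p
  rw [Finset.sum_apply]
  simp only [smulForm]
  rw [← Finset.sum_smul, h1, one_smul]

lemma reg_of_eq_zero {f : Form S E N} {K : Set M} (hK : IsClosed K) (h0 : ∀ p ∉ K, f p = 0)
    {α : ℝ} (hp : p ∉ K) : Reg S F E l α f p :=
  reg_zero.congr (by
    filter_upwards [hK.isOpen_compl.mem_nhds hp] with q hq
    exact h0 q hq)

lemma unpack_mem_CForms {f : Form S E (n + r)} (hf : f ∈ CForms S F E ⊤ r l) {K : Set M}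
    (hK : IsClosed K) (hKx : K ⊆ patch S F E x) (h0 : ∀ p ∉ K, f p = 0) (L : F →L[ℂ] ℂ) :
    unpack x L f ∈ CForms S ℂ (Bundle.Trivial X ℂ) ⊤ r l := by
  have h := mem_CForms_iff.1 hf
  refine mem_CForms_iff.2 ⟨h.1.unpack x L, fun p hp => (hp trivial).elim, fun p _ => ?_⟩
  by_cases hp : p ∈ K
  · exact (h.2.2 p trivial).unpack le_rfl zero_le_one (hKx hp) L
  · refine reg_of_eq_zero hK (fun q hq => ?_) hp
    ext v
    simp only [unpack, LinearMap.coe_mk, AddHom.coe_mk, h0 q hq]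
    simp

/-- The function on `M` given by `C` in the coordinates at `x`. -/
def chartFun (x : M) (C : Rm m → ℂ) : M → ℂ := (chartAt (Rm m) x).source.indicator
  fun p => C (chartAt (Rm m) x p)

lemma chartFun_symm {C : Rm m → ℂ} {y : Rm m} (hy : y ∈ (chartAt (Rm m) x).target) :
    chartFun x C ((chartAt (Rm m) x).symm y) = C y := by
  rw [chartFun, Set.indicator_of_mem ((chartAt (Rm m) x).map_target hy),
    (chartAt (Rm m) x).right_inv hy]

lemma isCompact_symm_image {K : Set (Rm m)} (hK : IsCompact K)
    (hKt : K ⊆ (chartAt (Rm m) x).target) : IsCompact ((chartAt (Rm m) x).symm '' K) :=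
  hK.image_of_continuousOn ((chartAt (Rm m) x).continuousOn_symm.mono hKt)

lemma tsupport_chartFun [T2Space M] {C : Rm m → ℂ} {K : Set (Rm m)} (hK : IsCompact K)
    (hKt : K ⊆ (chartAt (Rm m) x).target) (hC : tsupport C ⊆ K) :
    tsupport (chartFun x C) ⊆ (chartAt (Rm m) x).symm '' K := by
  refine closure_minimal (fun p hp => ?_) (isCompact_symm_image hK hKt).isClosed
  have hps : p ∈ (chartAt (Rm m) x).source := by
    by_contra h
    exact hp (Set.indicator_of_notMem h _)
  refine ⟨chartAt (Rm m) x p, hC (subset_tsupport _ fun h => hp ?_), (chartAt (Rm m) x).left_inv hps⟩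
  rw [chartFun, Set.indicator_of_mem hps, h]

lemma contMDiff_chartFun [T2Space M] {C : Rm m → ℂ} {K : Set (Rm m)} (hK : IsCompact K)
    (hKt : K ⊆ (chartAt (Rm m) x).target) (hC : tsupport C ⊆ K) (hs : ContDiff ℝ ∞ C) :
    ContMDiff (𝓡 m) 𝓘(ℝ, ℂ) ∞ (chartFun x C) := by
  refine contMDiff_of_tsupport fun p hp => ?_
  obtain ⟨y, hy, rfl⟩ := tsupport_chartFun hK hKt hC hp
  have hps := (chartAt (Rm m) x).map_target (hKt hy)
  refine (hs.contMDiff.contMDiffAt.comp _ (contMDiffAt_chart hps)).congr_of_eventuallyEq ?_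
  filter_upwards [(chartAt (Rm m) x).open_source.mem_nhds hps] with q hq
  rw [chartFun, Set.indicator_of_mem hq]
  rfl

section Frames

variable [T2Space M]

variable (S) in
/-- A frame neighbourhood of `x`. -/
def frameNhd (x : M) : Opens M := (exists_frame S x).choose_spec.choose_spec.choose

variable (S) in
/-- Closed forms that span the `(n, s)`-forms on the frame neighbourhood of `x`. -/
def frame (x : M) (s : ℕ) (J : Fin s → Fin m) : Form S (Bundle.Trivial X ℂ) (n + s) :=
  frameForm S (exists_frame S x).choose (exists_frame S x).choose_spec.choose s J

lemma frame_spec (S : GenericCR n m X M) (x : M) :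
    x ∈ frameNhd S x ∧ (frameNhd S x : Set M) ⊆ (chartAt (Rm m) x).source ∧
    (∀ j, ContMDiff (𝓡 m) 𝓘(ℝ, ℂ) ∞ ((exists_frame S x).choose j)) ∧
    (∀ k, ContMDiff (𝓡 m) 𝓘(ℝ, ℂ) ∞ ((exists_frame S x).choose_spec.choose k)) ∧
    (∀ p ∈ frameNhd S x, ∀ s J, IsNRAt S (Bundle.Trivial X ℂ) s p (frame S x s J p)) ∧
      ∀ (s : ℕ) (u : Form S (Bundle.Trivial X ℂ) (n + s)),
        (∀ p ∈ frameNhd S x, IsNRAt S (Bundle.Trivial X ℂ) s p (u p)) →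
        CtsOn (dom S ℂ (Bundle.Trivial X ℂ) x (frameNhd S x))
          (coeffAlt S ℂ (Bundle.Trivial X ℂ) x u) →
        ∃ C : (Fin s → Fin m) → Rm m → ℂ,
          (∀ J, ContinuousOn (C J) (dom S ℂ (Bundle.Trivial X ℂ) x (frameNhd S x))) ∧
          (∀ y ∈ dom S ℂ (Bundle.Trivial X ℂ) x (frameNhd S x),
            coeffAlt S ℂ (Bundle.Trivial X ℂ) x u y =
            ∑ J, C J y • coeffAlt S ℂ (Bundle.Trivial X ℂ) x (frame S x s J) y) ∧
          ∀ J y, coeffAlt S ℂ (Bundle.Trivial X ℂ) x u y = 0 → C J y = 0 :=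
  (exists_frame S x).choose_spec.choose_spec.choose_spec

lemma reg_frame (s : ℕ) (J : Fin s → Fin m) (p : M) :
    Reg S ℂ (Bundle.Trivial X ℂ) ⊤ 0 (frame S x s J) p :=
  reg_frameForm (frame_spec S x).2.2.1 (frame_spec S x).2.2.2.1 s J p

lemma isWeakD_frame (s : ℕ) (J : Fin s → Fin m) :
    IsWeakD S ℂ (Bundle.Trivial X ℂ) ⊤ (frame S x s J) 0 :=
  isWeakD_frameForm (frame_spec S x).2.2.1 (frame_spec S x).2.2.2.1 s J

variable (S F E) in
/-- A neighbourhood of `x` on which there is a frame and a trivialization. -/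
def locNhd (x : M) : Opens M := frameNhd S x ⊓ ⟨patch S F E x, isOpen_patch S F E x⟩

lemma mem_locNhd (x : M) : x ∈ locNhd S F E x := ⟨(frame_spec S x).1, mem_patch_self S F E x⟩

lemma locNhd_subset_patch (x : M) : (locNhd S F E x : Set M) ⊆ patch S F E x := fun _ h => h.2

variable [FiniteDimensional ℂ F]

variable (S F E) in
/-- The frame of `(n, s)`-forms with values in the bundle. -/
def eframe (x : M) (s : ℕ) (i : Fin (Module.finrank ℂ F) × (Fin s → Fin m)) : Form S E (n + s) :=
  pack x (Module.finBasis ℂ F i.1) (frame S x s i.2)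

lemma eframe_spec {s : ℕ} (i : Fin (Module.finrank ℂ F) × (Fin s → Fin m))
    (hp : p ∈ locNhd S F E x) :
    IsNRAt S E s p (eframe S F E x s i p) ∧ Reg S F E ⊤ 0 (eframe S F E x s i) p := by
  refine ⟨?_, (reg_frame s i.2 p).pack le_rfl zero_le_one hp.2 _⟩
  obtain ⟨g, hg, hgf⟩ := (frame_spec S x).2.2.2.2.1 p hp.1 s i.2
  let L : ℂ →ₗ[ℂ] E (S.ι p) := ((trivializationAt F E (S.ι x)).symmₗ ℂ (S.ι p)) ∘ₗ
    LinearMap.toSpanSingleton ℂ F (Module.finBasis ℂ F i.1)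
  exact ⟨(L.restrictScalars ℝ).compAlternatingMap g,
    fun c w => (congrArg L (hg c w)).trans (map_smul _ _ _), fun v => congrArg L (hgf v)⟩

lemma ctsOn_zero {D : Set (Rm m)} : CtsOn D (0 : Rm m → Rm m [⋀^Fin N]→ₗ[ℝ] F) :=
  fun _ => continuousOn_const

lemma isWeakD_eframe {s : ℕ} (i : Fin (Module.finrank ℂ F) × (Fin s → Fin m)) :
    IsWeakD S F E (locNhd S F E x) (eframe S F E x s i) 0 := by
  have h := isWeakD_pack (E := E) (u := frame S x s i.2) (g := 0) (U := locNhd S F E x) (x := x)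
    (fun p hp => (frame_spec S x).2.2.2.2.1 p hp.1 s i.2)
    (fun x' => ctsOn_of_reg (l := ⊤) (fun p _ => reg_frame s i.2 p) x')
    (fun x' => by rw [coeffAlt_zero]; exact ctsOn_zero)
    (isWeakD_iff.2 fun x' => (isWeakD_iff.1 (isWeakD_frame s i.2) x').mono (dom_mono x' le_top))
    (locNhd_subset_patch x) (Module.finBasis ℂ F i.1)
  rwa [map_zero] at h

lemma ctsOn_eframe {s : ℕ} (i : Fin (Module.finrank ℂ F) × (Fin s → Fin m)) (x' : M) :
    CtsOn (dom S F E x' (locNhd S F E x)) (coeffAlt S F E x' (eframe S F E x s i)) :=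
  ctsOn_of_reg (fun _ hp => (eframe_spec i hp).2) x'

lemma smulForm_eframe_mem {s : ℕ} (i : Fin (Module.finrank ℂ F) × (Fin s → Fin m))
    (hc : ContMDiff (𝓡 m) 𝓘(ℝ, ℂ) ∞ c) (hs : tsupport c ⊆ locNhd S F E x) :
    smulForm c (eframe S F E x s i) ∈ CForms S F E ⊤ s ⊤ :=
  smulForm_mem_CForms_of_tsupport hc fun _ hp => eframe_spec i (hs hp)

lemma dwedge_eframe_mem {s : ℕ} (i : Fin (Module.finrank ℂ F) × (Fin s → Fin m))
    (hc : ContMDiff (𝓡 m) 𝓘(ℝ, ℂ) ∞ c) (hs : tsupport c ⊆ locNhd S F E x) :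
    dwedge c (eframe S F E x s i) ∈ CForms S F E ⊤ (s + 1) ⊤ :=
  dwedge_mem_CForms_of_tsupport hc fun _ hp => eframe_spec i (hs hp)

lemma isWeakD_smulForm_eframe {s : ℕ} (i : Fin (Module.finrank ℂ F) × (Fin s → Fin m))
    (hc : ContMDiff (𝓡 m) 𝓘(ℝ, ℂ) ∞ c) (hs : tsupport c ⊆ locNhd S F E x) :
    IsWeakD S F E ⊤ (smulForm c (eframe S F E x s i)) (dwedge c (eframe S F E x s i)) := by
  have h := isWeakD_smulForm hc hs (ctsOn_eframe i)
    (fun x' => by rw [coeffAlt_zero]; exact ctsOn_zero) (isWeakD_eframe (E := E) i)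
  have e : smulForm c (0 : Form S E (n + s + 1)) = 0 := by
    funext p; simp [smulForm]
  rwa [e, add_zero] at h

/-- Each scalar component is expanded by `exists_frame`. The coefficients vanish wherever the form
does, so their extension by zero from the coordinate domain is continuous. -/
lemma exists_eframe_expansion {s : ℕ} {f : Form S E (n + s)} (hf : f ∈ CForms S F E ⊤ s 0)
    {K : Set M} (hK : IsCompact K) (hKx : K ⊆ locNhd S F E x) (h0 : ∀ p ∉ K, f p = 0) :
    ∃ C : Fin (Module.finrank ℂ F) × (Fin s → Fin m) → Rm m → ℂ, (∀ i, Continuous (C i)) ∧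
      (∀ i, ∀ y ∉ chartAt (Rm m) x '' K, C i y = 0) ∧
      ∀ y ∈ dom S F E x (locNhd S F E x), coeffAlt S F E x f y =
        ∑ i, C i y • coeffAlt S F E x (eframe S F E x s i) y := by
  let b := Module.finBasis ℂ F
  let L : Fin (Module.finrank ℂ F) → F →L[ℂ] ℂ := fun a => LinearMap.toContinuousLinearMap (b.coord a)
  have hu : ∀ a, unpack x (L a) f ∈ CForms S ℂ (Bundle.Trivial X ℂ) ⊤ s 0 := fun a =>
    unpack_mem_CForms hf hK.isClosed (hKx.trans (locNhd_subset_patch x)) h0 (L a)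
  choose C hC hCe hC0 using fun a => (frame_spec S x).2.2.2.2.2 s (unpack x (L a) f)
    (fun p _ => (hu a).1 p) ((ctsOn_coeffAlt (hu a) x).mono (dom_mono x le_top))
  set D := dom S ℂ (Bundle.Trivial X ℂ) x (frameNhd S x) with hD
  have hKs : K ⊆ (chartAt (Rm m) x).source := fun p hp => (hKx hp).2.1
  have hK' : IsCompact (chartAt (Rm m) x '' K) :=
    hK.image_of_continuousOn ((chartAt (Rm m) x).continuousOn.mono hKs)
  have hz : ∀ y ∈ (chartAt (Rm m) x).target, y ∉ chartAt (Rm m) x '' K →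
      f ((chartAt (Rm m) x).symm y) = 0 := fun y hy hyK => h0 _ fun h =>
    hyK ⟨_, h, (chartAt (Rm m) x).right_inv hy⟩
  have hCz : ∀ a J, ∀ y ∈ D \ (chartAt (Rm m) x '' K), C a J y = 0 := by
    rintro a J y ⟨hyD, hyK⟩
    refine hC0 a J y ?_
    ext v
    change coeff S ℂ (Bundle.Trivial X ℂ) x v (unpack x (L a) f) y = 0
    rw [coeff_unpack, coeff, hz y hyD.1 hyK]
    simp
  have hKD : chartAt (Rm m) x '' K ⊆ D := by
    rintro _ ⟨p, hp, rfl⟩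
    exact chart_mem_dom (patch_subset_trivial x (hKx hp).2) (hKx hp).1
  refine ⟨fun i => D.indicator (C i.1 i.2), fun i => continuous_extend hK'.isClosed
    (isOpen_dom _ _ _ _ _) hKD (hC i.1 i.2) (hCz i.1 i.2), fun i y hy => ?_, fun y hy => ?_⟩
  · by_cases hyD : y ∈ D
    · exact (Set.indicator_of_mem hyD _).trans (hCz _ _ y ⟨hyD, hy⟩)
    · exact Set.indicator_of_notMem hyD _
  · have hyD : y ∈ D := ⟨hy.1, hy.2.1.1, trivial⟩
    ext v
    rw [alternatingMap_sum_apply, Fintype.sum_prod_type]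
    change coeff S F E x v f y = _
    rw [← b.sum_repr (coeff S F E x v f y)]
    refine Finset.sum_congr rfl fun a _ => ?_
    have h1 := DFunLike.congr_fun (hCe a y hyD) v
    rw [alternatingMap_sum_apply] at h1
    have h2 : b.repr (coeff S F E x v f y) a =
        coeffAlt S ℂ (Bundle.Trivial X ℂ) x (unpack x (L a) f) y v :=
      (coeff_unpack x (L a) v f y).symm
    rw [h2, h1, Finset.sum_smul]
    refine Finset.sum_congr rfl fun J _ => ?_
    simp only [Set.indicator_of_mem hyD]
    rw [AlternatingMap.smul_apply, AlternatingMap.smul_apply, smul_assoc]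
    congr 1
    exact (coeff_pack (b a) v (frame S x s J) hy).symm

end Frames

end Local

end
end CRForms

namespace CRForms
noncomputable section

/-! ### Approximation of forms and of their derivatives by smooth forms on M. -/

section Friedrichs

variable {n m : ℕ} {X : Type*} [TopologicalSpace X] [ChartedSpace (Cn n) X]
  [IsManifold 𝓘(ℂ, Cn n) ω X]
  {M : Type*} [TopologicalSpace M] [ChartedSpace (Rm m) M] [IsManifold (𝓡 m) ∞ M]
  {S : GenericCR n m X M}
  {F : Type*} [NormedAddCommGroup F] [NormedSpace ℂ F]
  {E : X → Type*} [∀ x, AddCommGroup (E x)] [∀ x, Module ℂ (E x)]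
  [TopologicalSpace (Bundle.TotalSpace F E)] [∀ x, TopologicalSpace (E x)]
  [FiberBundle F E] [VectorBundle ℂ F E] [ContMDiffVectorBundle ω F E 𝓘(ℂ, Cn n)]
  [CompactSpace M]
  {x p : M} {U : Opens M} {r s : ℕ}

/-- The inclusion of the smooth forms into the Banach space of forms of class `C^l`. -/
def smoothXC (l : ℕ) : CForms S F E ⊤ r ⊤ →ₗ[ℂ] XC S F E r l :=
  Submodule.inclusion (CForms_mono S F E ⊤ r le_top)

@[simp] lemma form_smoothXC (l : ℕ) (u : CForms S F E ⊤ r ⊤) : (smoothXC l u).form = u.1 := rfl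

variable [T2Space M] [FiniteDimensional ℂ F]

lemma smulForm_eq_zero {N : ℕ} {c : M → ℂ} (f : Form S E N) (hp : p ∉ tsupport c) :
    smulForm c f p = 0 := by
  simp [smulForm, image_eq_zero_of_notMem_tsupport hp]

lemma dwedge_eq_zero {N : ℕ} {c : M → ℂ} (f : Form S E N) (hp : p ∉ tsupport c) :
    dwedge c f p = 0 := by
  simp [dwedge, dfun_eq_zero_of_notMem_tsupport hp, wedge_zero_left]

lemma coeff_sum {N : ℕ} {κ : Type*} (t : Finset κ) (v : Fin N → Rm m) (f : κ → Form S E N)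
    (y : Rm m) : coeff S F E x v (∑ i ∈ t, f i) y = ∑ i ∈ t, coeff S F E x v (f i) y := by
  classical
  induction t using Finset.induction_on with
  | empty => simp [coeff_zero]
  | insert i t hi ih => rw [Finset.sum_insert hi, Finset.sum_insert hi, coeff_add, ← ih]

section Combination

variable {K₁ : Set (Rm m)} {C : Fin (Module.finrank ℂ F) × (Fin s → Fin m) → Rm m → ℂ}

lemma tsupport_chartFun_subset_locNhd (hK : IsCompact K₁) (hKd : K₁ ⊆ dom S F E x (locNhd S F E x))
    {C : Rm m → ℂ} (hC : tsupport C ⊆ K₁) : tsupport (chartFun x C) ⊆ locNhd S F E x := by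
  refine (tsupport_chartFun hK (fun _ hy => (hKd hy).1) hC).trans ?_
  rintro _ ⟨y, hy, rfl⟩
  exact (hKd hy).2.1

/-- The smooth form with the coefficients `C` in the frame. -/
def comb (hK : IsCompact K₁) (hKd : K₁ ⊆ dom S F E x (locNhd S F E x))
    (hC : ∀ i, ContDiff ℝ ∞ (C i)) (hCs : ∀ i, tsupport (C i) ⊆ K₁) : CForms S F E ⊤ s ⊤ :=
  ⟨∑ i, smulForm (chartFun x (C i)) (eframe S F E x s i), sum_mem fun i _ =>
    smulForm_eframe_mem i (contMDiff_chartFun hK (fun _ hy => (hKd hy).1) (hCs i) (hC i))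
      (tsupport_chartFun_subset_locNhd hK hKd (hCs i))⟩

/-- The exterior derivative of the smooth form with the coefficients `C` in the frame. -/
def dcomb (hK : IsCompact K₁) (hKd : K₁ ⊆ dom S F E x (locNhd S F E x))
    (hC : ∀ i, ContDiff ℝ ∞ (C i)) (hCs : ∀ i, tsupport (C i) ⊆ K₁) : CForms S F E ⊤ (s + 1) ⊤ :=
  ⟨∑ i, dwedge (chartFun x (C i)) (eframe S F E x s i), sum_mem fun i _ =>
    dwedge_eframe_mem i (contMDiff_chartFun hK (fun _ hy => (hKd hy).1) (hCs i) (hC i))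
      (tsupport_chartFun_subset_locNhd hK hKd (hCs i))⟩

variable (hK : IsCompact K₁) (hKd : K₁ ⊆ dom S F E x (locNhd S F E x))
    (hC : ∀ i, ContDiff ℝ ∞ (C i)) (hCs : ∀ i, tsupport (C i) ⊆ K₁)

lemma isWeakD_comb :
    IsWeakD S F E ⊤ (comb (S := S) (E := E) hK hKd hC hCs).1 (dcomb hK hKd hC hCs).1 := by
  have hΓ : ∀ i, ContMDiff (𝓡 m) 𝓘(ℝ, ℂ) ∞ (chartFun x (C i)) := fun i =>
    contMDiff_chartFun hK (fun _ hy => (hKd hy).1) (hCs i) (hC i)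
  have hs : ∀ i, tsupport (chartFun x (C i)) ⊆ locNhd S F E x := fun i =>
    tsupport_chartFun_subset_locNhd hK hKd (hCs i)
  exact IsWeakD.sum Finset.univ
    (fun i => CForms_mono S F E ⊤ s le_top (smulForm_eframe_mem i (hΓ i) (hs i)))
    (fun i => CForms_mono S F E ⊤ (s + 1) le_top (dwedge_eframe_mem i (hΓ i) (hs i)))
    fun i => isWeakD_smulForm_eframe i (hΓ i) (hs i)

lemma comb_eq_zero (hp : p ∉ (chartAt (Rm m) x).symm '' K₁) :
    (comb (S := S) (E := E) hK hKd hC hCs).1 p = 0 := by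
  refine (Finset.sum_apply p _ _).trans (Finset.sum_eq_zero fun i _ => smulForm_eq_zero _ fun h => ?_)
  exact hp (tsupport_chartFun hK (fun _ hy => (hKd hy).1) (hCs i) h)

lemma dcomb_eq_zero (hp : p ∉ (chartAt (Rm m) x).symm '' K₁) :
    (dcomb (S := S) (E := E) hK hKd hC hCs).1 p = 0 := by
  refine (Finset.sum_apply p _ _).trans (Finset.sum_eq_zero fun i _ => dwedge_eq_zero _ fun h => ?_)
  exact hp (tsupport_chartFun hK (fun _ hy => (hKd hy).1) (hCs i) h)

lemma coeff_comb (v : Fin (n + s) → Rm m) {y : Rm m} (hy : y ∈ (chartAt (Rm m) x).target) :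
    coeff S F E x v (comb (S := S) (E := E) hK hKd hC hCs).1 y =
      ∑ i, C i y • coeff S F E x v (eframe S F E x s i) y := by
  refine (coeff_sum _ v _ y).trans (Finset.sum_congr rfl fun i _ => ?_)
  rw [coeff_smulForm, chartFun_symm hy]

lemma coeff_dcomb (v : Fin (n + s + 1) → Rm m) {y : Rm m} (hy : y ∈ (chartAt (Rm m) x).target) :
    coeff S F E x v (dcomb (S := S) (E := E) hK hKd hC hCs).1 y =
      (∑ i, wedge (fderiv ℝ (C i) y : Rm m →ₗ[ℝ] ℂ)
        (coeffAlt S F E x (eframe S F E x s i) y)) v := by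
  rw [alternatingMap_sum_apply]
  refine (coeff_sum (N := n + s + 1) _ v _ y).trans (Finset.sum_congr rfl fun i _ => ?_)
  have hΓ : ContMDiff (𝓡 m) 𝓘(ℝ, ℂ) ∞ (chartFun x (C i)) :=
    contMDiff_chartFun hK (fun _ hy => (hKd hy).1) (hCs i) (hC i)
  have h1 := coeffAlt_dwedge (S := S) (E := E) (F := F) (x := x)
    ((hΓ _).mdifferentiableAt (by simp)) (eframe S F E x s i) hy
  have h2 : (fun z => chartFun x (C i) ((chartAt (Rm m) x).symm z)) =ᶠ[𝓝 y] C i := by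
    filter_upwards [(chartAt (Rm m) x).open_target.mem_nhds hy] with z hz
    exact chartFun_symm hz
  rw [h2.fderiv_eq] at h1
  exact DFunLike.congr_fun h1 v

end Combination

lemma exists_comb_bound {K₁ : Set (Rm m)} (hK : IsCompact K₁)
    (hKd : K₁ ⊆ dom S F E x (locNhd S F E x)) (s : ℕ) :
    ∃ A : ℝ, 0 ≤ A ∧ ∀ (f : XC S F E s 0)
      (c C : Fin (Module.finrank ℂ F) × (Fin s → Fin m) → Rm m → ℂ)
      (hC : ∀ i, ContDiff ℝ ∞ (C i)) (hCs : ∀ i, tsupport (C i) ⊆ K₁) (η : ℝ), 0 ≤ η →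
      (∀ i y, ‖C i y - c i y‖ ≤ η) → (∀ p ∉ (chartAt (Rm m) x).symm '' K₁, f.form p = 0) →
      (∀ y ∈ dom S F E x (locNhd S F E x), coeffAlt S F E x f.form y =
        ∑ i, c i y • coeffAlt S F E x (eframe S F E x s i) y) →
      ‖f - smoothXC 0 (comb hK hKd hC hCs)‖ ≤ A * η := by
  obtain ⟨A, hA0, hA⟩ := exists_norm_le_of_chart (S := S) (E := E) (F := F) hK
    (hKd.trans (dom_mono x le_top)) s
  have hb : ∀ q : (Fin (Module.finrank ℂ F) × (Fin s → Fin m)) × (Fin (n + s) → Fin m),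
      ∃ B : ℝ, ∀ y ∈ K₁, ‖coeff S F E x (basisVec q.2) (eframe S F E x s q.1) y‖ ≤ B := fun q =>
    (hK.image_of_continuousOn ((ctsOn_eframe q.1 x (basisVec q.2)).mono hKd)).isBounded.exists_norm_le.imp
      fun B hB y hy => hB _ ⟨y, hy, rfl⟩
  choose B hB using hb
  have hB1 : 0 ≤ ∑ q, |B q| := Finset.sum_nonneg fun q _ => abs_nonneg _
  refine ⟨A * (Fintype.card (Fin (Module.finrank ℂ F) × (Fin s → Fin m)) * ∑ q, |B q|),
    by positivity, fun f c C hC hCs η hη hcC hf0 hf => ?_⟩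
  rw [mul_assoc]
  refine hA _ _ (by positivity) (fun p hp => ?_) fun I y hy => ?_
  · rw [map_sub]
    refine (congrArg₂ (· - ·) (hf0 p hp) (comb_eq_zero hK hKd hC hCs hp)).trans (sub_zero _)
  · have e1 : coeff S F E x (basisVec I) (f - smoothXC 0 (comb hK hKd hC hCs)).form y =
        ∑ i, (c i y - C i y) • coeff S F E x (basisVec I) (eframe S F E x s i) y := by
      have h1 : f = (f - smoothXC 0 (comb hK hKd hC hCs)) + smoothXC 0 (comb hK hKd hC hCs) := by simp
      have h2 := congrArg (fun f => coeff S F E x (basisVec I) (XC.form f) y) h1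
      simp only [map_add, coeff_add, form_smoothXC] at h2
      rw [coeff_comb hK hKd hC hCs _ (hKd hy).1] at h2
      have h3 := DFunLike.congr_fun (hf y (hKd hy)) (basisVec I)
      rw [alternatingMap_sum_apply] at h3
      simp only [sub_smul, Finset.sum_sub_distrib]
      rw [eq_sub_iff_add_eq, ← h2]
      exact h3
    rw [e1]
    refine (norm_sum_le _ _).trans ?_
    refine (Finset.sum_le_card_nsmul Finset.univ _ (η * ∑ q, |B q|) fun i _ => ?_).trans
      (le_of_eq ?_)
    · rw [norm_smul, norm_sub_rev]
      refine mul_le_mul (hcC i y) ?_ (norm_nonneg _) hη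
      exact ((hB (i, I) y hy).trans (le_abs_self _)).trans
        (Finset.single_le_sum (f := fun q => |B q|) (fun q _ => abs_nonneg _) (Finset.mem_univ (i, I)))
    · rw [nsmul_eq_mul, Finset.card_univ]
      ring

lemma isCompact_chart_image {K : Set M} (hK : IsCompact K) (hKx : K ⊆ locNhd S F E x) :
    IsCompact (chartAt (Rm m) x '' K) ∧
      chartAt (Rm m) x '' K ⊆ dom S F E x (locNhd S F E x) := by
  refine ⟨hK.image_of_continuousOn ((chartAt (Rm m) x).continuousOn.mono fun p hp => (hKx hp).2.1),
    ?_⟩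
  rintro _ ⟨p, hp, rfl⟩
  exact chart_mem_dom (hKx hp).2 (hKx hp)

lemma notMem_of_notMem_symm_image {K : Set M} (hKx : K ⊆ locNhd S F E x) {K₁ : Set (Rm m)}
    (h : chartAt (Rm m) x '' K ⊆ K₁) (hp : p ∉ (chartAt (Rm m) x).symm '' K₁) : p ∉ K := fun hpK =>
  hp ⟨_, h ⟨p, hpK, rfl⟩, (chartAt (Rm m) x).left_inv (hKx hpK).2.1⟩

theorem exists_smooth_approx_local {K : Set M} (hK : IsCompact K) (hKx : K ⊆ locNhd S F E x)
    {f : XC S F E s 0} (hf : ∀ p ∉ K, f.form p = 0) {ε : ℝ} (hε : 0 < ε) :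
    ∃ u : CForms S F E ⊤ s ⊤, ‖f - smoothXC 0 u‖ ≤ ε := by
  have : CompleteSpace F := FiniteDimensional.complete ℂ F
  obtain ⟨c, hc, hc0, hfc⟩ := exists_eframe_expansion f.form_mem hK hKx hf
  obtain ⟨hK', hK'd⟩ := isCompact_chart_image hK hKx
  -- Only the mollified coefficients are wanted here; `β = 0`, `g = 0` and the empty family of
  -- vectors make the conditions on the derivative void.
  obtain ⟨K₁, hK₁, hK₁d, hKK₁, h⟩ := exists_mollify_approx (W := F) (N := 0) (τ := Empty) hK'
    (isOpen_dom S F E x _) hK'd hc hc0 (β := fun _ _ => 0) (fun i w => contDiffOn_const)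
    (fun i φ h1 h2 h3 v => by simp) (g := 0) ctsOn_zero (fun y hy => rfl)
    (fun φ h1 h2 h3 v => by simp) fun j => j.elim
  obtain ⟨A, hA0, hA⟩ := exists_comb_bound (E := E) hK₁ hK₁d s
  obtain ⟨C, hC, hCs, hCc, -⟩ := h (ε / (A + 1)) (by positivity)
  refine ⟨comb hK₁ hK₁d hC hCs, (hA f c C hC hCs _ (by positivity) hCc (fun p hp => hf p
    (notMem_of_notMem_symm_image hKx hKK₁ hp)) hfc).trans ?_⟩
  rw [mul_div_assoc', div_le_iff₀ (by positivity)]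
  nlinarith

/-- Mollify the coefficients of `f` in the closed frame. Because the frame is closed, the derivative
of the resulting smooth form is the sum of the products dC_i ∧ e_i, which `exists_mollify_approx`
compares with `g`. -/
theorem exists_friedrichs_local {K : Set M} (hK : IsCompact K) (hKx : K ⊆ locNhd S F E x)
    {f : XC S F E s 0} {g : XC S F E (s + 1) 0} (hf : ∀ p ∉ K, f.form p = 0)
    (hg : ∀ p ∉ K, g.form p = 0) (h : WkD (dom S F E x (locNhd S F E x))
      (coeffAlt S F E x f.form) (coeffAlt S F E x (N := n + s + 1) g.form)) {ε : ℝ} (hε : 0 < ε) :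
    ∃ (u : CForms S F E ⊤ s ⊤) (w : CForms S F E ⊤ (s + 1) ⊤), IsWeakD S F E ⊤ u.1 w.1 ∧
      ‖f - smoothXC 0 u‖ ≤ ε ∧ ‖g - smoothXC 0 w‖ ≤ ε := by
  have : CompleteSpace F := FiniteDimensional.complete ℂ F
  obtain ⟨c, hc, hc0, hfc⟩ := exists_eframe_expansion f.form_mem hK hKx hf
  obtain ⟨hK', hK'd⟩ := isCompact_chart_image hK hKx
  obtain ⟨K₁, hK₁, hK₁d, hKK₁, hap⟩ := exists_mollify_approx hK'
    (isOpen_dom S F E x _) hK'd hc hc0 (β := fun i => coeffAlt S F E x (eframe S F E x s i))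
    (fun i w y hy => by
      have h1 := (eframe_spec i hy.2.1).2.regAt le_rfl zero_le_one (symm_mem_patch hy) w
      rw [chart_symm_of_mem_dom hy] at h1
      exact (h1.1.of_le (by simp)).contDiffWithinAt)
    (fun i => by
      have h1 := isWeakD_iff.1 (isWeakD_eframe (S := S) (E := E) (x := x) i) x
      rwa [coeffAlt_zero] at h1)
    (g := coeffAlt S F E x (N := n + s + 1) g.form)
    ((ctsOn_coeffAlt (r := s + 1) g.form_mem x).mono (dom_mono x le_top))
    (fun y hy => by
      have h1 : g.form ((chartAt (Rm m) x).symm y) = 0 := hg _ fun h2 =>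
        hy.2 ⟨_, h2, (chartAt (Rm m) x).right_inv hy.1.1⟩
      ext v
      change coeff S F E x v g.form y = 0
      rw [coeff, h1]
      exact map_zero _)
    (h.congr (fun y hy => (hfc y hy).symm) fun y _ => rfl) (basisVec (N := n + s + 1))
  obtain ⟨A, hA0, hA⟩ := exists_comb_bound (E := E) hK₁ hK₁d s
  obtain ⟨A', hA0', hA'⟩ := exists_norm_le_of_chart (S := S) (E := E) (F := F) hK₁
    (hK₁d.trans (dom_mono x le_top)) (s + 1)
  -- One choice that suffices for both norm estimates; the summand 1 keeps the denominator positive.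
  obtain ⟨C, hC, hCs, hCc, hCd⟩ := hap (ε / (A + A' + 1)) (by positivity)
  refine ⟨comb hK₁ hK₁d hC hCs, dcomb hK₁ hK₁d hC hCs, isWeakD_comb hK₁ hK₁d hC hCs,
    (hA f c C hC hCs _ (by positivity) hCc (fun p hp => hf p
    (notMem_of_notMem_symm_image hKx hKK₁ hp)) hfc).trans ?_,
    (hA' _ (ε / (A + A' + 1)) (by positivity) (fun p hp => ?_) fun I y hy => ?_).trans ?_⟩
  · rw [mul_div_assoc', div_le_iff₀ (by positivity)]
    nlinarith
  · rw [map_sub]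
    exact (congrArg₂ (· - ·) (hg p (notMem_of_notMem_symm_image hKx hKK₁ hp))
      (dcomb_eq_zero hK₁ hK₁d hC hCs hp)).trans (sub_zero _)
  · have h1 := hCd I y hy
    rw [norm_sub_rev, ← coeff_dcomb hK₁ hK₁d hC hCs _ (hK₁d hy).1] at h1
    have e1 : coeff S F E x (basisVec I) (g - smoothXC 0 (dcomb hK₁ hK₁d hC hCs)).form y =
        coeff S F E x (basisVec I) g.form y -
          coeff S F E x (basisVec I) (dcomb hK₁ hK₁d hC hCs).1 y := by
      rw [map_sub, form_smoothXC, sub_eq_add_neg, coeff_add, ← neg_one_smul ℂ, coeff_smul]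
      simp [sub_eq_add_neg]
    rw [e1]
    exact h1
  · rw [mul_div_assoc', div_le_iff₀ (by positivity)]
    nlinarith

/-- The equation is assumed in one patch only. The smooth approximations satisfy it in every patch,
and the graph of d is closed, so the equation passes to all patches without a change of variables in
the integrals. -/
theorem isWeakD_of_chart {K : Set M} (hK : IsCompact K) (hKx : K ⊆ locNhd S F E x)
    {f : Form S E (n + s)} {g : Form S E (n + (s + 1))} (hfc : f ∈ CForms S F E ⊤ s 0)
    (hgc : g ∈ CForms S F E ⊤ (s + 1) 0) (hf : ∀ p ∉ K, f p = 0)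
    (hg : ∀ p ∉ K, g p = 0) (h : WkD (dom S F E x (locNhd S F E x))
      (coeffAlt S F E x f) (coeffAlt S F E x (N := n + s + 1) g)) : IsWeakD S F E ⊤ f g := by
  have hcl := isClosed_isWeakD (S := S) (F := F) (E := E) (r := s) (l := 0) (l' := 0)
  refine hcl.closure_subset (a := (XC.mk f hfc, XC.mk g hgc)) (Metric.mem_closure_iff.2 fun ε hε => ?_)
  obtain ⟨u, w, huw, hu, hw⟩ := exists_friedrichs_local hK hKx (f := XC.mk f hfc)
    (g := XC.mk g hgc) hf hg h (half_pos hε)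
  refine ⟨(smoothXC 0 u, smoothXC 0 w), huw, ?_⟩
  rw [Prod.dist_eq, dist_eq_norm, dist_eq_norm]
  exact (max_le hu hw).trans_lt (half_lt_self hε)

lemma XC.form_sum {κ : Type*} {r l : ℕ} (t : Finset κ) (f : κ → XC S F E r l) :
    (∑ i ∈ t, f i).form = ∑ i ∈ t, (f i).form := map_sum _ _ _

lemma norm_sum_sub_sum_le {κ V : Type*} [SeminormedAddCommGroup V] (t : Finset κ) {f u : κ → V}
    {ε : ℝ} (hε : 0 ≤ ε) (h : ∀ x ∈ t, ‖f x - u x‖ ≤ ε / (t.card + 1)) :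
    ‖∑ x ∈ t, f x - ∑ x ∈ t, u x‖ ≤ ε := by
  rw [← Finset.sum_sub_distrib]
  refine (norm_sum_le _ _).trans ((Finset.sum_le_card_nsmul t _ _ h).trans ?_)
  rw [nsmul_eq_mul, mul_div_assoc', div_le_iff₀ (by positivity)]
  nlinarith

theorem exists_smooth_approx (f : XC S F E s 0) {ε : ℝ} (hε : 0 < ε) :
    ∃ u : CForms S F E ⊤ s ⊤, ‖f - smoothXC 0 u‖ ≤ ε := by
  obtain ⟨t, χ, hχ, hχs, hχ1⟩ := exists_partition (m := m) (M := M) (locNhd S F E) fun x => mem_locNhd x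
  let f' : M → XC S F E s 0 := fun x => XC.mk (smulForm (χ x) f.form)
    (smulForm_mem_CForms f.form_mem (hχ x))
  have hf' : f = ∑ x ∈ t, f' x := by
    refine XC.form_injective ?_
    rw [XC.form_sum]
    exact (sum_smulForm t hχ1 f.form).symm
  have h1 : ∀ x ∈ t, ∃ u : CForms S F E ⊤ s ⊤, ‖f' x - smoothXC 0 u‖ ≤ ε / (t.card + 1) :=
    fun x hx => exists_smooth_approx_local (isClosed_tsupport (χ x)).isCompact (hχs x hx)
      (fun p hp => smulForm_eq_zero _ hp) (by positivity)
  clear_value f'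
  choose! u hu using h1
  refine ⟨∑ x ∈ t, u x, ?_⟩
  rw [map_sum, hf']
  exact norm_sum_sub_sum_le t hε.le hu

lemma denseRange_smoothXC : DenseRange (smoothXC 0 : CForms S F E ⊤ s ⊤ → XC S F E s 0) := by
  intro f
  refine Metric.mem_closure_iff.2 fun ε hε => ?_
  obtain ⟨u, hu⟩ := exists_smooth_approx f (half_pos hε)
  exact ⟨_, ⟨u, rfl⟩, by rw [dist_eq_norm]; exact hu.trans_lt (half_lt_self hε)⟩

lemma isWeakD_smulForm_top {c : M → ℂ} (hc : ContMDiff (𝓡 m) 𝓘(ℝ, ℂ) ∞ c)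
    {f : Form S E (n + s)} {g : Form S E (n + s + 1)} (hf : f ∈ CForms S F E ⊤ s 0)
    (hg : g ∈ CForms S F E ⊤ (s + 1) 0) (h : IsWeakD S F E ⊤ f g) :
    IsWeakD S F E ⊤ (smulForm c f) (dwedge c f + smulForm c g) :=
  isWeakD_smulForm hc (Set.subset_univ _) (fun x => ctsOn_coeffAlt hf x)
    (fun x => ctsOn_coeffAlt (r := s + 1) hg x) h

lemma sum_dwedge_add_smulForm {N : ℕ} {κ : Type*} (t : Finset κ) {χ : κ → M → ℂ}
    (hχ : ∀ i, ContMDiff (𝓡 m) 𝓘(ℝ, ℂ) ∞ (χ i)) (h1 : ∀ p, ∑ i ∈ t, χ i p = 1)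
    (f : Form S E N) (g : Form S E (N + 1)) :
    ∑ i ∈ t, (dwedge (χ i) f + smulForm (χ i) g) = g := by
  rw [Finset.sum_add_distrib, dwedge_sum_eq_zero t hχ h1, sum_smulForm t h1, zero_add]

lemma exists_friedrichs_smulForm {c : M → ℂ} (hc : ContMDiff (𝓡 m) 𝓘(ℝ, ℂ) ∞ c)
    (hs : tsupport c ⊆ locNhd S F E x) {f : Form S E (n + s)} {g : Form S E (n + s + 1)}
    (hf : f ∈ CForms S F E ⊤ s 0) (hg : g ∈ CForms S F E ⊤ (s + 1) 0)
    (h : IsWeakD S F E ⊤ f g) {ε : ℝ} (hε : 0 < ε) {f' : XC S F E s 0} {g' : XC S F E (s + 1) 0}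
    (hf' : f'.form = smulForm c f) (hg' : g'.form = dwedge c f + smulForm c g) :
    ∃ (u : CForms S F E ⊤ s ⊤) (w : CForms S F E ⊤ (s + 1) ⊤), IsWeakD S F E ⊤ u.1 w.1 ∧
      ‖f' - smoothXC 0 u‖ ≤ ε ∧ ‖g' - smoothXC 0 w‖ ≤ ε := by
  have h1 : ∀ p ∉ tsupport c, f'.form p = 0 := fun p hp => by
    rw [hf', smulForm_eq_zero f hp]
  have h2 : ∀ p ∉ tsupport c, g'.form p = 0 := fun p hp => by
    have h3 : dwedge c f p + smulForm c g p = 0 := by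
      rw [dwedge_eq_zero f hp, smulForm_eq_zero g hp, add_zero]
    rw [hg']
    exact h3
  have h3 := (isWeakD_iff.1 (isWeakD_smulForm_top hc hf hg h) x).mono
    (dom_mono x (U := locNhd S F E x) le_top)
  rw [← hf', ← hg'] at h3
  exact exists_friedrichs_local (isClosed_tsupport c).isCompact hs h1 h2 h3 hε

lemma XC.exists_form_eq {r l : ℕ} {κ : Type*} {f : κ → Form S E (n + r)}
    (h : ∀ i, f i ∈ CForms S F E ⊤ r l) : ∃ g : κ → XC S F E r l, ∀ i, (g i).form = f i :=
  ⟨fun i => XC.mk (f i) (h i), fun _ => rfl⟩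

/-- Localize: the derivative of χ f is dχ ∧ f + χ g, and over a partition of unity these sum to `g`,
because the differentials dχ sum to zero. -/
theorem exists_friedrichs {f : XC S F E s 0} {g : XC S F E (s + 1) 0}
    (h : IsWeakD S F E ⊤ f.form g.form) {ε : ℝ} (hε : 0 < ε) :
    ∃ (u : CForms S F E ⊤ s ⊤) (w : CForms S F E ⊤ (s + 1) ⊤), IsWeakD S F E ⊤ u.1 w.1 ∧
      ‖f - smoothXC 0 u‖ ≤ ε ∧ ‖g - smoothXC 0 w‖ ≤ ε := by
  obtain ⟨t, χ, hχ, hχs, hχ1⟩ := exists_partition (m := m) (M := M) (locNhd S F E) fun x => mem_locNhd x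
  obtain ⟨f', hf⟩ := XC.exists_form_eq (l := 0) fun x => smulForm_mem_CForms f.form_mem (hχ x)
  obtain ⟨g', hg⟩ := XC.exists_form_eq (r := s + 1) (l := 0) fun x => add_mem
    (dwedge_mem_CForms f.form_mem (hχ x)) (smulForm_mem_CForms g.form_mem (hχ x))
  have hf' : ∑ x ∈ t, f' x = f := by
    refine XC.form_injective ?_
    rw [XC.form_sum, Finset.sum_congr rfl fun x _ => hf x]
    exact sum_smulForm t hχ1 f.form
  have hg' : ∑ x ∈ t, g' x = g := by
    refine XC.form_injective ?_
    rw [XC.form_sum, Finset.sum_congr rfl fun x _ => hg x]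
    exact sum_dwedge_add_smulForm t hχ hχ1 f.form g.form
  have h2 := fun x (hx : x ∈ t) => exists_friedrichs_smulForm (hχ x) (hχs x hx) f.form_mem
    g.form_mem h (ε := ε / (t.card + 1)) (div_pos hε (by positivity)) (hf x) (hg x)
  choose! u w huw hu hw using h2
  refine ⟨∑ x ∈ t, u x, ∑ x ∈ t, w x, ?_, ?_, ?_⟩
  · rw [Submodule.coe_sum, Submodule.coe_sum, ← Finset.sum_attach, ← Finset.sum_attach t]
    exact IsWeakD.sum t.attach (fun i => CForms_mono S F E ⊤ s le_top (u i).2)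
      (fun i => CForms_mono S F E ⊤ (s + 1) le_top (w i).2) fun i => huw i i.2
  · rw [map_sum, ← hf']
    exact norm_sum_sub_sum_le t hε.le hu
  · rw [map_sum, ← hg']
    exact norm_sum_sub_sum_le t hε.le hw

end Friedrichs

end
end CRForms

namespace CRForms
noncomputable section

/-! ### Compactness of bounded sets of Hölder functions. -/

section Ascoli

/-- Arzelà–Ascoli. Since `α` is positive, the modulus `C t ^ α` tends to 0, which gives
equicontinuity; the defining inequalities are closed under pointwise limits. -/
lemma isCompact_setOf_holder {Y V : Type*} [MetricSpace Y] [NormedAddCommGroup V]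
    [ProperSpace V] (C : ℝ) {α : ℝ} (hα : 0 < α) :
    IsCompact {g : C(Y, V) | ∀ y, ‖g y‖ ≤ C ∧ ∀ z, ‖g y - g z‖ ≤ C * dist y z ^ α} := by
  have hlim : Filter.Tendsto (fun t : ℝ => C * t ^ α) (𝓝 0) (𝓝 0) := by
    have h := (Real.continuousAt_rpow_const 0 α (Or.inr hα.le)).tendsto.const_mul C
    rwa [Real.zero_rpow hα.ne', mul_zero] at h
  have heq : ∀ (T : Set (Y → V)), (∀ g ∈ T, ∀ y z, ‖g y - g z‖ ≤ C * dist y z ^ α) →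
      Equicontinuous ((↑) : T → Y → V) := fun T hT =>
    Metric.equicontinuous_of_continuity_modulus _ hlim _ fun y z g => by
      rw [dist_eq_norm]; exact hT g.1 g.2 y z
  refine ArzelaAscoli.isCompact_of_equicontinuous _ ?_ ?_
  · have h1 : ContinuousMap.toFun '' {g : C(Y, V) | ∀ y, ‖g y‖ ≤ C ∧
        ∀ z, ‖g y - g z‖ ≤ C * dist y z ^ α} = (Set.univ.pi fun _ => Metric.closedBall 0 C) ∩
        ⋂ y, ⋂ z, {g : Y → V | ‖g y - g z‖ ≤ C * dist y z ^ α} := by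
      ext g
      simp only [Set.mem_image, Set.mem_ofPred_eq, Set.mem_inter_iff, Set.mem_pi, Set.mem_univ,
        forall_true_left, mem_closedBall_zero_iff, Set.mem_iInter]
      constructor
      · rintro ⟨g, hg, rfl⟩
        exact ⟨fun y => (hg y).1, fun y => (hg y).2⟩
      · rintro ⟨h2, h3⟩
        have h4 := (heq {g} (by rintro _ rfl; exact h3)).continuous ⟨g, rfl⟩
        exact ⟨⟨g, h4⟩, fun y => ⟨h2 y, h3 y⟩, rfl⟩
    rw [h1]
    refine (isCompact_univ_pi fun _ => isCompact_closedBall _ _).inter_right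
      (isClosed_iInter fun y => isClosed_iInter fun z => ?_)
    exact isClosed_le (((continuous_apply y).sub (continuous_apply z)).norm) continuous_const
  · refine Metric.equicontinuous_of_continuity_modulus _ hlim _ fun y z g => ?_
    rw [dist_eq_norm]
    exact (g.2 y).2 z

instance {m i : ℕ} {F : Type*} [NormedAddCommGroup F] [NormedSpace ℝ F] [FiniteDimensional ℝ F] :
    FiniteDimensional ℝ (Rm m [×i]→L[ℝ] F) :=
  FiniteDimensional.of_injective (ContinuousMultilinearMap.toMultilinearMapLinear :
    (Rm m [×i]→L[ℝ] F) →ₗ[ℝ] MultilinearMap ℝ (fun _ : Fin i => Rm m) F)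
    ContinuousMultilinearMap.toMultilinearMap_injective

end Ascoli

/-! ### Pointwise convergence, and compactness of operators that gain Hölder regularity. -/

section Pointwise

variable {n m : ℕ} {X : Type*} [TopologicalSpace X] [ChartedSpace (Cn n) X]
  [IsManifold 𝓘(ℂ, Cn n) ω X]
  {M : Type*} [TopologicalSpace M] [ChartedSpace (Rm m) M] [IsManifold (𝓡 m) ∞ M]
  {S : GenericCR n m X M}
  {F : Type*} [NormedAddCommGroup F] [NormedSpace ℂ F]
  {E : X → Type*} [∀ x, AddCommGroup (E x)] [∀ x, Module ℂ (E x)]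
  {F' : Type*} [NormedAddCommGroup F'] [NormedSpace ℂ F']
  {E' : X → Type*} [∀ x, AddCommGroup (E' x)] [∀ x, Module ℂ (E' x)]
  {r s r' l l' N N' : ℕ}

/-- Pointwise convergence of forms. -/
def PtTendsto (u : ℕ → Form S E N) (f : Form S E N) : Prop :=
  ∀ p (Λ : ((TangentSpace (𝓡 m) p) [⋀^Fin N]→ₗ[ℝ] (E (S.ι p))) →ₗ[ℂ] ℂ),
    Filter.Tendsto (fun k => Λ (u k p)) Filter.atTop (𝓝 (Λ (f p)))

lemma PtTendsto.map {u : ℕ → Form S E N} {f : Form S E N} (h : PtTendsto u f)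
    (L : ∀ p : M, ((TangentSpace (𝓡 m) p) [⋀^Fin N]→ₗ[ℝ] (E (S.ι p))) →ₗ[ℂ]
      ((TangentSpace (𝓡 m) p) [⋀^Fin N']→ₗ[ℝ] (E' (S.ι p)))) :
    PtTendsto (fun k p => L p (u k p)) (fun p => L p (f p)) := fun p Λ => h p (Λ ∘ₗ L p)

lemma PtTendsto.eq {u : ℕ → Form S E N} {f g : Form S E N} (hf : PtTendsto u f)
    (hg : PtTendsto u g) : f = g := by
  funext p
  rw [← sub_eq_zero, ← Module.forall_dual_apply_eq_zero_iff ℂ]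
  intro Λ
  rw [map_sub, tendsto_nhds_unique (hf p Λ) (hg p Λ), sub_self]

lemma PtTendsto.add {u v : ℕ → Form S E N} {f g : Form S E N} (hf : PtTendsto u f)
    (hg : PtTendsto v g) : PtTendsto (fun k => u k + v k) (f + g) := fun p Λ => by
  refine ((hf p Λ).add (hg p Λ)).congr' ?_ |>.trans (le_of_eq (congrArg 𝓝 ?_))
  · exact Filter.Eventually.of_forall fun k => (map_add Λ _ _).symm
  · exact (map_add Λ _ _).symm

lemma ptTendsto_const (f : Form S E N) : PtTendsto (fun _ => f) f := fun _ _ => tendsto_const_nhds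

lemma PtTendsto.neg {u : ℕ → Form S E N} {f : Form S E N} (hf : PtTendsto u f) :
    PtTendsto (fun k => -u k) (-f) := hf.map fun _ => -LinearMap.id

variable [TopologicalSpace (Bundle.TotalSpace F E)] [∀ x, TopologicalSpace (E x)]
  [FiberBundle F E] [VectorBundle ℂ F E] [ContMDiffVectorBundle ω F E 𝓘(ℂ, Cn n)]
  [FiniteDimensional ℂ F]
  [TopologicalSpace (Bundle.TotalSpace F' E')] [∀ x, TopologicalSpace (E' x)]
  [FiberBundle F' E'] [VectorBundle ℂ F' E'] [ContMDiffVectorBundle ω F' E' 𝓘(ℂ, Cn n)]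
  [FiniteDimensional ℂ F']

lemma tendsto_of_tendsto_evAt {p : M}
    {u : ℕ → (TangentSpace (𝓡 m) p) [⋀^Fin N]→ₗ[ℝ] (E (S.ι p))}
    {f : (TangentSpace (𝓡 m) p) [⋀^Fin N]→ₗ[ℝ] (E (S.ι p))}
    (h : ∀ I, Filter.Tendsto (fun k => evAt S F E p p (u k) I) Filter.atTop
      (𝓝 (evAt S F E p p f I)))
    (Λ : ((TangentSpace (𝓡 m) p) [⋀^Fin N]→ₗ[ℝ] (E (S.ι p))) →ₗ[ℂ] ℂ) :
    Filter.Tendsto (fun k => Λ (u k)) Filter.atTop (𝓝 (Λ f)) := by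
  obtain ⟨L, hL⟩ := LinearMap.exists_leftInverse_of_injective (evAt (N := N) S F E p p)
    (LinearMap.ker_eq_bot.2 (evAt_injective (mem_patch_self S F E p)))
  have h1 := ((Λ ∘ₗ L).continuous_of_finiteDimensional.tendsto _).comp (tendsto_pi_nhds.2 h)
  have h2 : ∀ a, (Λ ∘ₗ L) (evAt S F E p p a) = Λ a := fun a =>
    congrArg Λ (LinearMap.congr_fun hL a)
  rw [h2] at h1
  exact h1.congr fun k => h2 _

lemma ptTendsto_of_coeff {u : ℕ → Form S E N} {f : Form S E N}
    (h : ∀ (p : M) (I : Fin N → Fin m), Filter.Tendsto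
      (fun k => coeff S F E p (basisVec I) (u k) (chartAt (Rm m) p p)) Filter.atTop
      (𝓝 (coeff S F E p (basisVec I) f (chartAt (Rm m) p p)))) : PtTendsto u f := by
  intro p Λ
  refine tendsto_of_tendsto_evAt (F := F) (E := E) (fun I => ?_) Λ
  have h1 := h p I
  simp only [coeff_eq_evAt (mem_chart_source (Rm m) p)] at h1
  exact h1

variable [CompactSpace M] [T2Space M]

lemma XC.ptTendsto {u : ℕ → XC S F E r l} {f : XC S F E r l}
    (h : Filter.Tendsto u Filter.atTop (𝓝 f)) : PtTendsto (fun k => (u k).form) f.form := by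
  refine ptTendsto_of_coeff (F := F) fun p I => ?_
  obtain ⟨C, hC, hb⟩ := exists_coeff_le_norm (S := S) (E := E) (F := F) (r := r)
    (isCompact_singleton (x := chartAt (Rm m) p p))
    (Set.singleton_subset_iff.2 (chart_mem_dom (mem_patch_self S F E p) trivial)) (basisVec I)
  rw [tendsto_iff_norm_sub_tendsto_zero] at h ⊢
  refine squeeze_zero (fun k => norm_nonneg _) (fun k => ?_) (by simpa using h.const_mul C)
  have h1 := hb l (u k - f) _ rfl
  rw [map_sub, sub_eq_add_neg, coeff_add, ← neg_one_smul ℂ, coeff_smul] at h1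
  simpa only [neg_one_smul, ← sub_eq_add_neg] using h1

/-- By the closed graph theorem, since a limit in norm is also a pointwise limit and the latter is
unique. Continuity on every C^l thus follows from the mapping property and a weak convergence
statement. -/
lemma XC.continuous_of_ptTendsto (A : XC S F E s l →ₗ[ℂ] XC S F' E' r l')
    (h : ∀ u f, Filter.Tendsto u Filter.atTop (𝓝 f) →
      PtTendsto (fun k => (A (u k)).form) (A f).form) : Continuous A :=
  A.continuous_of_seq_closed_graph fun u f _ hu hg =>
    XC.form_injective ((XC.ptTendsto hg).eq (h u f hu))

/-- The `i`-th derivative of a coefficient at a point, as a continuous linear functional. -/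
def XC.jetAt (x : centers S F E) (I : Fin (n + r) → Fin m) (i : Fin (l + 1))
    (y : cball S F E x.1) : XC S F E r l →L[ℂ] (Rm m [×(i : ℕ)]→L[ℝ] F) :=
  LinearMap.mkContinuous
    { toFun := fun f => f.jet x I i y
      map_add' := fun f g => by rw [map_add]; rfl
      map_smul' := fun c f => by rw [map_smul]; rfl } 1 fun f => by
    rw [one_mul]
    exact (((f.jet x I i).norm_coe_le_norm y).trans (norm_le_pi_norm (f.jet x I) i)).trans
      ((norm_le_pi_norm (f.jet x) I).trans (norm_le_pi_norm f.jet x))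

lemma XC.norm_jet_le (f : XC S F E r l) (x : centers S F E) (I : Fin (n + r) → Fin m)
    (i : Fin (l + 1)) (y : cball S F E x.1) : ‖f.jet x I i y‖ ≤ ‖f‖ :=
  (((f.jet x I i).norm_coe_le_norm y).trans (norm_le_pi_norm (f.jet x I) i)).trans
    ((norm_le_pi_norm (f.jet x) I).trans (norm_le_pi_norm f.jet x))

/-- Banach–Steinhaus for the Hölder quotients of the jets of `A f`, indexed by pairs of points: they
are bounded for each `f` because `A f` is Hölder, hence they are bounded uniformly on the unit ball.
-/
lemma XC.exists_holder_bound {α : ℝ} (A : XC S F E s l →L[ℂ] XC S F' E' r l')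
    (h : ∀ f, (A f).form ∈ HForms S F' E' ⊤ r l' α) (x : centers S F' E')
    (I : Fin (n + r) → Fin m) (i : Fin (l' + 1)) :
    ∃ C : ℝ, ∀ (f : XC S F E s l) (y z : cball S F' E' x.1),
      ‖(A f).jet x I i y - (A f).jet x I i z‖ ≤ C * ‖f‖ * dist y z ^ α := by
  let ev : cball S F' E' x.1 → XC S F E s l →L[ℂ] (Rm m [×(i : ℕ)]→L[ℝ] F') := fun y =>
    (XC.jetAt x I i y).comp A
  have hev : ∀ y f, ev y f = (A f).jet x I i y := fun y f => rfl
  obtain ⟨C, hC⟩ := banach_steinhaus (g := fun yz : cball S F' E' x.1 × cball S F' E' x.1 =>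
    (((dist yz.1 yz.2 ^ α)⁻¹ : ℝ) : ℂ) • (ev yz.1 - ev yz.2)) (fun f => by
      obtain ⟨C, hC⟩ := (h f).2 x.1 (basisVec I) i (by exact_mod_cast Nat.lt_succ_iff.1 i.2)
        (cball S F' E' x.1) (isCompact_cball S F' E' x.1) (cball_subset_dom S F' E' x.1)
      refine ⟨max C 0, fun yz => ?_⟩
      have h0 : 0 ≤ dist yz.1 yz.2 ^ α := by positivity
      have h1 := hC yz.1 ⟨yz.1.2, cball_subset_dom S F' E' x.1 yz.1.2⟩ yz.2
        ⟨yz.2.2, cball_subset_dom S F' E' x.1 yz.2.2⟩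
      rw [smul_apply, norm_smul, sub_apply, hev, hev,
        XC.jet_apply, XC.jet_apply, Complex.norm_real, Real.norm_of_nonneg (inv_nonneg.2 h0)]
      refine inv_mul_le_of_le_mul₀ h0 (le_max_right _ _) ?_
      rw [mul_comm]
      exact h1.trans (mul_le_mul_of_nonneg_right (le_max_left _ _) h0))
  refine ⟨C, fun f y z => ?_⟩
  by_cases hyz : y = z
  · subst hyz
    have hC0 := (norm_nonneg _).trans (hC (y, y))
    rw [sub_self, norm_zero]
    positivity
  · have hd : 0 < dist y z ^ α := Real.rpow_pos_of_pos (dist_pos.2 hyz) α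
    have h1 := ((((dist y z ^ α)⁻¹ : ℝ) : ℂ) • (ev y - ev z)).le_of_opNorm_le (hC (y, z)) f
    rw [smul_apply, norm_smul, sub_apply, hev, hev,
      Complex.norm_real, Real.norm_of_nonneg (inv_nonneg.2 hd.le), inv_mul_le_iff₀ hd] at h1
    rwa [mul_comm]

variable (S F E r l) in
/-- The jets that are bounded and Hölder continuous with given constants. -/
def holderJets (D : centers S F E → (Fin (n + r) → Fin m) → Fin (l + 1) → ℝ) (α : ℝ) :
    Set (JetSpace S F E r l) :=
  Set.univ.pi fun x => Set.univ.pi fun I => Set.univ.pi fun i =>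
    {g | ∀ y, ‖g y‖ ≤ D x I i ∧ ∀ z, ‖g y - g z‖ ≤ D x I i * dist y z ^ α}

lemma isCompact_holderJets (D : centers S F E → (Fin (n + r) → Fin m) → Fin (l + 1) → ℝ)
    {α : ℝ} (hα : 0 < α) : IsCompact (holderJets S F E r l D α) := by
  have : FiniteDimensional ℝ F := FiniteDimensional.complexToReal F
  have hproper : ∀ i : ℕ, ProperSpace (Rm m [×i]→L[ℝ] F) := fun i =>
    FiniteDimensional.proper ℝ _
  exact isCompact_univ_pi fun x => isCompact_univ_pi fun I => isCompact_univ_pi fun i =>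
    isCompact_setOf_holder _ hα

lemma mem_holderJets {D : centers S F E → (Fin (n + r) → Fin m) → Fin (l + 1) → ℝ} {α : ℝ}
    {g : JetSpace S F E r l} (h : ∀ x I i y, ‖g x I i y‖ ≤ D x I i ∧
      ∀ z, ‖g x I i y - g x I i z‖ ≤ D x I i * dist y z ^ α) : g ∈ holderJets S F E r l D α :=
  fun x _ I _ i _ => h x I i

lemma XC.exists_mem_holderJets {α : ℝ} (A : XC S F E s l →L[ℂ] XC S F' E' r l')
    (h : ∀ f, (A f).form ∈ HForms S F' E' ⊤ r l' α) :
    ∃ D, ∀ f : XC S F E s l, ‖f‖ ≤ 1 → (A f).jet ∈ holderJets S F' E' r l' D α := by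
  choose C hC using XC.exists_holder_bound A h
  refine ⟨fun x I i => max (C x I i) ‖A‖, fun f hf => mem_holderJets fun x I i y =>
    ⟨?_, fun z => ?_⟩⟩
  · refine ((A f).norm_jet_le x I i y).trans ((A.le_opNorm f).trans ?_)
    exact (mul_le_of_le_one_right (norm_nonneg _) hf).trans (le_max_right _ _)
  · refine (hC x I i f y z).trans ?_
    have h0 : 0 ≤ dist y z ^ α := by positivity
    refine mul_le_mul_of_nonneg_right ?_ h0
    rcases le_total 0 (C x I i) with h2 | h2
    · exact (mul_le_of_le_one_right h2 hf).trans (le_max_left _ _)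
    · exact (mul_nonpos_of_nonpos_of_nonneg h2 (norm_nonneg _)).trans
        ((norm_nonneg _).trans (le_max_right _ _))

lemma XC.isClosedEmbedding_jet :
    Topology.IsClosedEmbedding (XC.jet : XC S F E r l → JetSpace S F E r l) := by
  have h : IsUniformInducing (XC.jet : XC S F E r l → JetSpace S F E r l) :=
    XC.isometry_jet.isUniformInducing
  exact h.isUniformEmbedding.isClosedEmbedding

/-- The jets of the image of the unit ball lie in a compact set of Hölder jets, and the jet map is a
closed embedding, so the preimage of that set is compact. -/
theorem XC.isCompactOperator_of_holder {α : ℝ} (hα : 0 < α)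
    (A : XC S F E s l →L[ℂ] XC S F' E' r l')
    (h : ∀ f, (A f).form ∈ HForms S F' E' ⊤ r l' α) : IsCompactOperator A := by
  obtain ⟨D, hD⟩ := XC.exists_mem_holderJets A h
  refine ⟨_, XC.isClosedEmbedding_jet.isCompact_preimage (isCompact_holderJets D hα), ?_⟩
  filter_upwards [Metric.closedBall_mem_nhds (0 : XC S F E s l) one_pos] with f hf
  exact hD f (mem_closedBall_zero_iff.1 hf)

end Pointwise

end
end CRForms

namespace CRForms
noncomputable section

/-! ### Smoothing operators and their localization. -/

section Operators

variable {n m : ℕ} {X : Type*} [TopologicalSpace X] [ChartedSpace (Cn n) X]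
  [IsManifold 𝓘(ℂ, Cn n) ω X]
  {M : Type*} [TopologicalSpace M] [ChartedSpace (Rm m) M] [IsManifold (𝓡 m) ∞ M]
  {S : GenericCR n m X M}
  {F : Type*} [NormedAddCommGroup F] [NormedSpace ℂ F]
  {E : X → Type*} [∀ x, AddCommGroup (E x)] [∀ x, Module ℂ (E x)]
  [TopologicalSpace (Bundle.TotalSpace F E)] [∀ x, TopologicalSpace (E x)]
  [FiberBundle F E] [VectorBundle ℂ F E] [ContMDiffVectorBundle ω F E 𝓘(ℂ, Cn n)]
  [FiniteDimensional ℂ F]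
  {F' : Type*} [NormedAddCommGroup F'] [NormedSpace ℂ F']
  {E' : X → Type*} [∀ x, AddCommGroup (E' x)] [∀ x, Module ℂ (E' x)]
  [TopologicalSpace (Bundle.TotalSpace F' E')] [∀ x, TopologicalSpace (E' x)]
  [FiberBundle F' E'] [VectorBundle ℂ F' E'] [ContMDiffVectorBundle ω F' E' 𝓘(ℂ, Cn n)]
  [FiniteDimensional ℂ F']
  [CompactSpace M] [T2Space M]
  {x p : M} {U : Opens M} {r s N : ℕ} {α : ℝ} {c : M → ℂ}

/-- The coordinates of a vector in a basis. -/
def coordL (a : Fin (Module.finrank ℂ F)) : F →L[ℂ] ℂ :=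
  LinearMap.toContinuousLinearMap ((Module.finBasis ℂ F).coord a)

lemma sum_pack_unpack (hp : p ∈ patch S F E x) (f : Form S E N) :
    ∑ a, pack x (Module.finBasis ℂ F a) (unpack x (coordL a) f) p = f p := by
  refine AlternatingMap.ext fun v => ?_
  rw [alternatingMap_sum_apply]
  let e := trivializationAt F E (S.ι x)
  have h1 : ∀ a, pack (E := E) x (Module.finBasis ℂ F a) (unpack x (coordL a) f) p v =
      e.symmₗ ℂ (S.ι p) ((Module.finBasis ℂ F).repr (e.linearMapAt ℂ (S.ι p) (f p v)) a •
        Module.finBasis ℂ F a) := fun a => rfl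
  simp only [h1]
  rw [← map_sum, Module.Basis.sum_repr]
  exact Bundle.Trivialization.symmₗ_linearMapAt e hp.2 _

/-- Multiplication by a function, as a linear map. -/
def smulFormL (c : M → ℂ) : Form S E N →ₗ[ℂ] Form S E N where
  toFun := smulForm c
  map_add' _ _ := funext fun _ => smul_add _ _ _
  map_smul' b f := funext fun p => smul_comm (c p) b (f p)

/-- The exterior product with the differential of a function, as a linear map. -/
def dwedgeL (c : M → ℂ) : Form S E N →ₗ[ℂ] Form S E (N + 1) where
  toFun := dwedge c
  map_add' _ _ := funext fun _ => wedge_add_right _ _ _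
  map_smul' _ _ := funext fun _ => wedge_smul_right _ _ _

lemma smulFormL_apply (c : M → ℂ) (f : Form S E N) : smulFormL c f = smulForm c f := rfl

lemma isNRAt_unpack {f : Form S E (n + s)} {l : ℕ∞} (hf : f ∈ CForms S F E ⊤ s l)
    (hp : p ∈ patch S F E x) (L : F →L[ℂ] ℂ) :
    IsNRAt S (Bundle.Trivial X ℂ) s p (unpack x L f p) ∧
      Reg S ℂ (Bundle.Trivial X ℂ) l 0 (unpack x L f) p :=
  ⟨hf.1.unpack x L p, ((mem_CForms_iff.1 hf).2.2 p trivial).unpack le_rfl zero_le_one hp L⟩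

lemma smulForm_unpack_mem {f : Form S E (n + s)} {l : ℕ∞} (hf : f ∈ CForms S F E ⊤ s l)
    (hc : ContMDiff (𝓡 m) 𝓘(ℝ, ℂ) ∞ c) (hs : tsupport c ⊆ patch S F E x) (L : F →L[ℂ] ℂ) :
    smulForm c (unpack x L f) ∈ CForms S ℂ (Bundle.Trivial X ℂ) ⊤ s l :=
  smulForm_mem_CForms_of_tsupport hc fun _ hp => isNRAt_unpack hf (hs hp) L

lemma dwedge_unpack_mem {f : Form S E (n + s)} {l : ℕ∞} (hf : f ∈ CForms S F E ⊤ s l)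
    (hc : ContMDiff (𝓡 m) 𝓘(ℝ, ℂ) ∞ c) (hs : tsupport c ⊆ patch S F E x) (L : F →L[ℂ] ℂ) :
    dwedge c (unpack x L f) ∈ CForms S ℂ (Bundle.Trivial X ℂ) ⊤ (s + 1) l :=
  dwedge_mem_CForms_of_tsupport hc fun _ hp => isNRAt_unpack hf (hs hp) L

/-- A linear map with values in a space of forms, followed by the inclusion into the Banach
space. -/
def XC.lift {r l : ℕ} {B : Type*} [AddCommGroup B] [Module ℂ B] (A : B →ₗ[ℂ] Form S E (n + r))
    (h : ∀ f, A f ∈ CForms S F E ⊤ r (l : ℕ∞)) : B →ₗ[ℂ] XC S F E r l where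
  toFun f := XC.mk (A f) (h f)
  map_add' f g := XC.form_injective (map_add A f g)
  map_smul' c f := XC.form_injective (map_smul A c f)

/-- The localized scalar component of a form. -/
def locIn (hc : ContMDiff (𝓡 m) 𝓘(ℝ, ℂ) ∞ c) (hs : tsupport c ⊆ patch S F E x)
    (L : F →L[ℂ] ℂ) : XC S F E s 0 →ₗ[ℂ] XC S ℂ (Bundle.Trivial X ℂ) s 0 :=
  XC.lift (smulFormL c ∘ₗ unpack x L ∘ₗ XC.form)
    fun f => smulForm_unpack_mem f.form_mem hc hs L

/-- The scalar component of a form multiplied by the differential of a cutoff function. -/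
def locInD (hc : ContMDiff (𝓡 m) 𝓘(ℝ, ℂ) ∞ c) (hs : tsupport c ⊆ patch S F E x)
    (L : F →L[ℂ] ℂ) : XC S F E s 0 →ₗ[ℂ] XC S ℂ (Bundle.Trivial X ℂ) (s + 1) 0 :=
  XC.lift (r := s + 1) (dwedgeL c ∘ₗ unpack x L ∘ₗ XC.form)
    fun f => dwedge_unpack_mem f.form_mem hc hs L

/-- `Λ` applied to the values of an alternating map. -/
def compAltL {V W W' : Type*} [AddCommGroup V] [Module ℝ V] [AddCommGroup W] [Module ℂ W]
    [AddCommGroup W'] [Module ℂ W'] (Λ : W →ₗ[ℂ] W') :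
    (V [⋀^Fin N]→ₗ[ℝ] W) →ₗ[ℂ] (V [⋀^Fin N]→ₗ[ℝ] W') where
  toFun a := (Λ.restrictScalars ℝ).compAlternatingMap a
  map_add' _ _ := AlternatingMap.ext fun _ => map_add Λ _ _
  map_smul' _ _ := AlternatingMap.ext fun _ => map_smul Λ _ _

lemma PtTendsto.smulForm {u : ℕ → Form S E N} {f : Form S E N} (h : PtTendsto u f) (c : M → ℂ) :
    PtTendsto (fun k => smulForm c (u k)) (CRForms.smulForm c f) :=
  fun p Λ => by
    have e : ∀ a : (TangentSpace (𝓡 m) p) [⋀^Fin N]→ₗ[ℝ] (E (S.ι p)), Λ (c p • a) = c p * Λ a :=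
      fun a => map_smul Λ _ _
    refine Filter.Tendsto.congr (fun k => (e (u k p)).symm) ?_
    change Filter.Tendsto _ _ (𝓝 (Λ (c p • f p)))
    rw [e]
    exact (h p Λ).const_mul (c p)

/-- The exterior product with a covector, as a linear map. -/
def wedgeL {V W : Type*} [AddCommGroup V] [Module ℝ V] [AddCommGroup W] [Module ℂ W]
    (τ : V →ₗ[ℝ] ℂ) : (V [⋀^Fin N]→ₗ[ℝ] W) →ₗ[ℂ] (V [⋀^Fin (N + 1)]→ₗ[ℝ] W) where
  toFun := wedge τ
  map_add' _ _ := wedge_add_right _ _ _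
  map_smul' _ _ := wedge_smul_right _ _ _

lemma PtTendsto.dwedge {u : ℕ → Form S E N} {f : Form S E N} (h : PtTendsto u f) (c : M → ℂ) :
    PtTendsto (fun k => dwedge c (u k)) (CRForms.dwedge c f) :=
  h.map fun p => wedgeL (dfun c p)

lemma PtTendsto.unpack {u : ℕ → Form S E N} {f : Form S E N} (h : PtTendsto u f)
    (L : F →L[ℂ] ℂ) : PtTendsto (fun k => unpack x L (u k)) (CRForms.unpack x L f) :=
  h.map (E' := Bundle.Trivial X ℂ) fun p => compAltL ((L : F →ₗ[ℂ] ℂ) ∘ₗ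
    (trivializationAt F E (S.ι x)).linearMapAt ℂ (S.ι p))

lemma PtTendsto.pack {u : ℕ → Form S (Bundle.Trivial X ℂ) N} {f : Form S (Bundle.Trivial X ℂ) N}
    (h : PtTendsto u f) (e : F) :
    PtTendsto (fun k => pack (E := E) x e (u k)) (CRForms.pack x e f) :=
  h.map (E' := E) fun p => compAltL ((trivializationAt F E (S.ι x)).symmₗ ℂ (S.ι p) ∘ₗ
    LinearMap.toSpanSingleton ℂ F e)

lemma continuous_locIn (hc : ContMDiff (𝓡 m) 𝓘(ℝ, ℂ) ∞ c) (hs : tsupport c ⊆ patch S F E x)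
    (L : F →L[ℂ] ℂ) : Continuous (locIn (s := s) hc hs L) :=
  XC.continuous_of_ptTendsto _ fun _ _ h => ((XC.ptTendsto h).unpack L).smulForm c

lemma continuous_locInD (hc : ContMDiff (𝓡 m) 𝓘(ℝ, ℂ) ∞ c) (hs : tsupport c ⊆ patch S F E x)
    (L : F →L[ℂ] ℂ) : Continuous (locInD (s := s) hc hs L) :=
  XC.continuous_of_ptTendsto _ fun _ _ h => ((XC.ptTendsto h).unpack L).dwedge c

variable (F F' α U) in
/-- A linear operator that maps `C^l` to `C^{l+α}` for all `l`, and is continuous from uniform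
convergence to pointwise convergence. -/
def IsSmoothing (A : XC S F E s 0 →ₗ[ℂ] Form S E' (n + r)) : Prop :=
  (∀ (l : ℕ) (f : XC S F E s 0), f.form ∈ CForms S F E ⊤ s l → A f ∈ HForms S F' E' U r l α) ∧
    ∀ u f, Filter.Tendsto u Filter.atTop (𝓝 f) → PtTendsto (fun k => A (u k)) (A f)

lemma IsSmoothing.comp {F'' : Type*} [NormedAddCommGroup F''] [NormedSpace ℂ F'']
    {E'' : X → Type*} [∀ x, AddCommGroup (E'' x)] [∀ x, Module ℂ (E'' x)]
    [TopologicalSpace (Bundle.TotalSpace F'' E'')] [∀ x, TopologicalSpace (E'' x)]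
    [FiberBundle F'' E''] [VectorBundle ℂ F'' E''] [ContMDiffVectorBundle ω F'' E'' 𝓘(ℂ, Cn n)]
    [FiniteDimensional ℂ F''] {s' : ℕ}
    {A : XC S F E s 0 →ₗ[ℂ] Form S E' (n + r)} (hA : IsSmoothing F F' U α A)
    {B : XC S F'' E'' s' 0 →ₗ[ℂ] XC S F E s 0} (hB : Continuous B)
    (hl : ∀ (l : ℕ) f, f.form ∈ CForms S F'' E'' ⊤ s' l → (B f).form ∈ CForms S F E ⊤ s l) :
    IsSmoothing F'' F' U α (A ∘ₗ B) :=
  ⟨fun l f hf => hA.1 l _ (hl l f hf), fun _ f h => hA.2 _ _ ((hB.tendsto f).comp h)⟩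

lemma IsSmoothing.add {A B : XC S F E s 0 →ₗ[ℂ] Form S E' (n + r)} (hA : IsSmoothing F F' U α A)
    (hB : IsSmoothing F F' U α B) : IsSmoothing F F' U α (A + B) :=
  ⟨fun l f hf => add_mem (hA.1 l f hf) (hB.1 l f hf), fun u f h => (hA.2 u f h).add (hB.2 u f h)⟩

lemma IsSmoothing.neg {A : XC S F E s 0 →ₗ[ℂ] Form S E' (n + r)} (hA : IsSmoothing F F' U α A) :
    IsSmoothing F F' U α (-A) :=
  ⟨fun l f hf => neg_mem (hA.1 l f hf), fun u f h => (hA.2 u f h).neg⟩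

lemma isSmoothing_zero : IsSmoothing F F' U α (0 : XC S F E s 0 →ₗ[ℂ] Form S E' (n + r)) :=
  ⟨fun _ _ _ => zero_mem _, fun _ _ _ => ptTendsto_const 0⟩

lemma IsSmoothing.sum {κ : Type*} (t : Finset κ) {A : κ → XC S F E s 0 →ₗ[ℂ] Form S E' (n + r)}
    (hA : ∀ i ∈ t, IsSmoothing F F' U α (A i)) : IsSmoothing F F' U α (∑ i ∈ t, A i) := by
  classical
  induction t using Finset.induction_on with
  | empty => exact isSmoothing_zero
  | insert i t hi ih =>
    rw [Finset.sum_insert hi]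
    exact (hA i (Finset.mem_insert_self i t)).add
      (ih fun j hj => hA j (Finset.mem_insert_of_mem hj))

lemma IsSmoothing.smulForm_pack (hα0 : 0 ≤ α) (hα1 : α ≤ 1)
    {A : XC S F' E' s 0 →ₗ[ℂ] Form S (Bundle.Trivial X ℂ) (n + r)} (hA : IsSmoothing F' ℂ U α A)
    (hc : ContMDiff (𝓡 m) 𝓘(ℝ, ℂ) ∞ c) (hs : tsupport c ⊆ patch S F E x) (hU : tsupport c ⊆ U)
    (e : F) : IsSmoothing F' F ⊤ α (smulFormL c ∘ₗ pack (E := E) x e ∘ₗ A) := by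
  refine ⟨fun l f hf => mem_HForms_of_reg hα0 hα1 (((hA.1 l f hf).1.1.pack x e).smulForm c)
    fun p => ?_, fun u f h => ((hA.2 u f h).pack e).smulForm c⟩
  exact Reg.smulForm_of_tsupport hα0 hα1 hc fun hp =>
    (reg_of_mem_HForms (hA.1 l f hf) (hU hp)).pack hα0 hα1 (hs hp) e

lemma IsSmoothing.dwedge_pack (hα0 : 0 ≤ α) (hα1 : α ≤ 1)
    {A : XC S F' E' s 0 →ₗ[ℂ] Form S (Bundle.Trivial X ℂ) (n + r)} (hA : IsSmoothing F' ℂ U α A)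
    (hc : ContMDiff (𝓡 m) 𝓘(ℝ, ℂ) ∞ c) (hs : tsupport c ⊆ patch S F E x) (hU : tsupport c ⊆ U)
    (e : F) : IsSmoothing (r := r + 1) F' F ⊤ α (dwedgeL c ∘ₗ pack (E := E) x e ∘ₗ A) := by
  refine ⟨fun l f hf => mem_HForms_of_reg (r := r + 1) hα0 hα1
    (((hA.1 l f hf).1.1.pack x e).dwedge c) fun p => ?_, fun u f h => ((hA.2 u f h).pack e).dwedge c⟩
  exact Reg.dwedge_of_tsupport hα0 hα1 hc fun hp =>
    (reg_of_mem_HForms (hA.1 l f hf) (hU hp)).pack hα0 hα1 (hs hp) e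

lemma IsSmoothing.comp_locIn {A : XC S ℂ (Bundle.Trivial X ℂ) s 0 →ₗ[ℂ] Form S E' (n + r)}
    (hA : IsSmoothing ℂ F' U α A) (hc : ContMDiff (𝓡 m) 𝓘(ℝ, ℂ) ∞ c)
    (hs : tsupport c ⊆ patch S F E x) (L : F →L[ℂ] ℂ) :
    IsSmoothing F F' U α (A ∘ₗ locIn hc hs L) :=
  hA.comp (continuous_locIn hc hs L) fun _ _ hf => smulForm_unpack_mem hf hc hs L

lemma IsSmoothing.comp_locInD {A : XC S ℂ (Bundle.Trivial X ℂ) (s + 1) 0 →ₗ[ℂ] Form S E' (n + r)}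
    (hA : IsSmoothing ℂ F' U α A) (hc : ContMDiff (𝓡 m) 𝓘(ℝ, ℂ) ∞ c)
    (hs : tsupport c ⊆ patch S F E x) (L : F →L[ℂ] ℂ) :
    IsSmoothing F F' U α (A ∘ₗ locInD hc hs L) :=
  hA.comp (continuous_locInD hc hs L) fun _ _ hf => dwedge_unpack_mem hf hc hs L

/-- In the patch at `x` this is the Leibniz rule for a scalar component. The product has support
compactly inside the patch, so `isWeakD_of_chart` extends the identity to all patches. -/
lemma isWeakD_locIn (hc : ContMDiff (𝓡 m) 𝓘(ℝ, ℂ) ∞ c) (hU : tsupport c ⊆ locNhd S F E x)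
    (L : F →L[ℂ] ℂ) {f : XC S F E s 0} {g : XC S F E (s + 1) 0}
    (h : IsWeakD S F E ⊤ f.form g.form) :
    IsWeakD S ℂ (Bundle.Trivial X ℂ) ⊤ (locIn hc (hU.trans (locNhd_subset_patch x)) L f).form
      (locInD hc (hU.trans (locNhd_subset_patch x)) L f +
        locIn hc (hU.trans (locNhd_subset_patch x)) L g).form := by
  have : CompleteSpace F := FiniteDimensional.complete ℂ F
  have hs := hU.trans (locNhd_subset_patch x)
  have hsub : dom S ℂ (Bundle.Trivial X ℂ) x (locNhd S F E x) ⊆ dom S F E x (locNhd S F E x) :=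
    fun y hy => ⟨hy.1, hy.2.1, (locNhd_subset_patch x hy.2.1).2⟩
  have hct : ∀ {r : ℕ} (f : XC S F E r 0), CtsOn (dom S ℂ (Bundle.Trivial X ℂ) x (locNhd S F E x))
      (coeffAlt S ℂ (Bundle.Trivial X ℂ) x (unpack x L f.form)) := fun f v => by
    have h1 := (L.continuous.comp_continuousOn ((ctsOn_coeffAlt f.form_mem x) v)).mono
      (hsub.trans (dom_mono x le_top))
    exact h1.congr fun y _ => coeff_unpack x L v f.form y
  have h1 := ((isWeakD_iff.1 h x).unpack (ctsOn_coeffAlt f.form_mem x)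
    (ctsOn_coeffAlt (r := s + 1) g.form_mem x) L).mono (hsub.trans (dom_mono x le_top))
  have h2 := h1.smulForm (hct f) (hct (r := s + 1) g) hc hU
  refine isWeakD_of_chart (x := x) (isClosed_tsupport c).isCompact (fun p hp =>
    ⟨(hU hp).1, patch_subset_trivial x (hs hp)⟩) (XC.form_mem _) (XC.form_mem (r := s + 1) _)
    (fun p hp => smulForm_eq_zero _ hp) (fun p hp => ?_) (h2.mono (dom_mono x le_top))
  have h3 : dwedge c (unpack x L f.form) p + smulForm c (unpack x L g.form) p = 0 := by
    rw [dwedge_eq_zero _ hp, smulForm_eq_zero _ hp, add_zero]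
  exact h3

end Operators

end
end CRForms

namespace CRForms
noncomputable section

/-! ### Condition H in terms of the Banach spaces. -/

section Scalar

variable {n m : ℕ} {X : Type*} [TopologicalSpace X] [ChartedSpace (Cn n) X]
  [IsManifold 𝓘(ℂ, Cn n) ω X]
  {M : Type*} [TopologicalSpace M] [ChartedSpace (Rm m) M] [IsManifold (𝓡 m) ∞ M]
  {S : GenericCR n m X M}
  {F : Type*} [NormedAddCommGroup F] [NormedSpace ℂ F]
  {E : X → Type*} [∀ x, AddCommGroup (E x)] [∀ x, Module ℂ (E x)]
  [TopologicalSpace (Bundle.TotalSpace F E)] [∀ x, TopologicalSpace (E x)]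
  [FiberBundle F E] [VectorBundle ℂ F E] [ContMDiffVectorBundle ω F E 𝓘(ℂ, Cn n)]
  [FiniteDimensional ℂ F] [CompactSpace M] [T2Space M]
  {x p : M} {U : Opens M} {r s N : ℕ} {α : ℝ} {c : M → ℂ}

lemma form_eq_zero_of_lt (h : m < N) (f : Form S E N) : f = 0 := by
  funext p
  refine AlternatingMap.ext fun v => (f p).map_linearDependent v fun hv => ?_
  let w : Fin N → EuclideanSpace ℝ (Fin m) := v
  have hw : LinearIndependent ℝ w := hv
  have h1 := hw.fintype_card_le_finrank
  simp only [Fintype.card_fin, finrank_euclideanSpace] at h1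
  omega

lemma XC.tendsto_topCForms {u : ℕ → XC S F E r 0} {f : XC S F E r 0}
    (h : Filter.Tendsto u Filter.atTop (𝓝 f)) :
    Filter.Tendsto (fun k => (⟨(u k).form, (u k).form_mem⟩ : CForms S F E ⊤ r 0)) Filter.atTop
      (@nhds _ (topCForms S F E r 0) ⟨f.form, f.form_mem⟩) := by
  rw [@nhds_induced _ _ (topC S F E (n + r) 0), Filter.tendsto_comap_iff]
  simp only [nhds_iInf, Filter.tendsto_iInf]
  intro x v i hi
  obtain rfl : i = 0 := by simpa using hi
  rw [nhds_induced, Filter.tendsto_comap_iff, UniformOnFun.tendsto_iff_tendstoUniformlyOn]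
  rintro K ⟨hK, hKd⟩
  obtain ⟨C, hC, hb⟩ := exists_coeff_le_norm (S := S) (E := E) (F := F) (r := r) hK hKd v
  rw [Metric.tendstoUniformlyOn_iff]
  intro ε hε
  rw [Metric.tendsto_nhds] at h
  filter_upwards [h (ε / (C + 1)) (by positivity)] with k hk y hy
  have h1 := hb 0 (f - u k) y hy
  rw [map_sub, sub_eq_add_neg, coeff_add, ← neg_one_smul ℂ, coeff_smul] at h1
  simp only [neg_one_smul, ← sub_eq_add_neg] at h1
  rw [dist_comm, dist_eq_norm, lt_div_iff₀ (by positivity)] at hk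
  have h2 : dist (iteratedFDeriv ℝ 0 (coeff S F E x v f.form) y)
      (iteratedFDeriv ℝ 0 (coeff S F E x v (u k).form) y) =
      ‖coeff S F E x v f.form y - coeff S F E x v (u k).form y‖ := by
    rw [iteratedFDeriv_zero_eq_comp, iteratedFDeriv_zero_eq_comp, Function.comp_apply,
      Function.comp_apply, LinearIsometryEquiv.dist_map, dist_eq_norm]
  refine h2.trans_lt (h1.trans_lt (lt_of_le_of_lt ?_ hk))
  nlinarith [norm_nonneg (f - u k)]

lemma ptTendsto_of_topHForms {u : ℕ → HForms S F E U r 0 α} {f : HForms S F E U r 0 α}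
    (h : Filter.Tendsto u Filter.atTop (@nhds _ (topHForms S F E U r 0 α) f)) :
    PtTendsto (fun k => (u k).1) f.1 := by
  intro p
  by_cases hp : p ∈ U
  · refine tendsto_of_tendsto_evAt (F := F) (E := E) fun I => ?_
    rw [@nhds_induced _ _ (topH S F E U (n + r) 0 α), Filter.tendsto_comap_iff] at h
    simp only [nhds_iInf, Filter.tendsto_iInf] at h
    have h1 := h p (basisVec I) 0 le_rfl
    rw [nhds_inf, Filter.tendsto_inf, nhds_induced, Filter.tendsto_comap_iff,
      UniformOnFun.tendsto_iff_tendstoUniformlyOn] at h1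
    have hd := chart_mem_dom (mem_patch_self S F E p) hp
    have h2 := (h1.1 _ ⟨_, isCompact_singleton (x := chartAt (Rm m) p p),
      Set.singleton_subset_iff.2 (dom_mono p le_top hd), rfl⟩).tendsto_at (x := chartAt (Rm m) p p)
      ⟨rfl, hd⟩
    have h3 := ((continuousMultilinearCurryFin0 ℝ (Rm m) F).continuous.tendsto _).comp h2
    have h4 : ∀ g : Form S E (n + r), continuousMultilinearCurryFin0 ℝ (Rm m) F
        (iteratedFDeriv ℝ 0 (coeff S F E p (basisVec I) g) (chartAt (Rm m) p p)) =
        evAt S F E p p (g p) I := fun g => by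
      rw [← coeff_eq_evAt (mem_chart_source (Rm m) p)]; rfl
    exact ((Filter.tendsto_congr fun k => (h4 (u k).1).symm).2 h3).trans (le_of_eq (congrArg 𝓝 (h4 f.1)))
  · intro Λ
    have h1 : ∀ g : HForms S F E U r 0 α, g.1 p = 0 := fun g => g.2.1.2.1 p hp
    simp only [h1]
    exact tendsto_const_nhds

/-- The homotopy operators provided by condition `H`, in terms of the Banach spaces. -/
theorem ConditionH.exists_local {k q : ℕ} (hm : m + k = 2 * n) (hH : ConditionH S k α q) (p : M) :
    ∃ U : Opens M, p ∈ U ∧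
      ∃ T : ∀ r : ℕ, XC S ℂ (Bundle.Trivial X ℂ) (r + 1) 0 →ₗ[ℂ]
        Form S (Bundle.Trivial X ℂ) (n + r),
      (∀ r, (r + 1 ≤ q ∨ IsLargeDegree n k q (r + 1) ∨ n ≤ r + k) →
        IsSmoothing ℂ ℂ U α (T r)) ∧
      (∀ (f : XC S ℂ (Bundle.Trivial X ℂ) 0 0) (g : XC S ℂ (Bundle.Trivial X ℂ) 1 0),
        IsWeakD S ℂ (Bundle.Trivial X ℂ) ⊤ f.form g.form → closure {p | f.form p ≠ 0} ⊆ U →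
          ∀ p ∈ U, f.form p = T 0 g p) ∧
      (∀ r : ℕ, (r + 1 ≤ q - 1 ∨ IsLargeDegree n k q (r + 1)) →
        ∀ (f : XC S ℂ (Bundle.Trivial X ℂ) (r + 1) 0) (g : XC S ℂ (Bundle.Trivial X ℂ) (r + 2) 0),
        IsWeakD S ℂ (Bundle.Trivial X ℂ) ⊤ f.form g.form → closure {p | f.form p ≠ 0} ⊆ U →
          IsWeakD S ℂ (Bundle.Trivial X ℂ) U (T r f) (f.form - T (r + 1) g)) := by
  obtain ⟨U, hp, T, h1, h2, h3⟩ := hH p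
  refine ⟨U, hp, fun r => (CForms S ℂ (Bundle.Trivial X ℂ) U r 0).subtype ∘ₗ T r, fun r hr => ?_,
    h2, h3⟩
  rw [← or_assoc] at hr
  rcases hr with hr | hr
  · refine ⟨fun l f hf => ?_, fun u f hu => ?_⟩
    · obtain ⟨hT, -⟩ := h1 l r hr
      exact hT ⟨f.form, hf⟩
    · obtain ⟨hT, hc⟩ := h1 0 r hr
      have h4 := (@Continuous.tendsto _ _ (topCForms S ℂ (Bundle.Trivial X ℂ) (r + 1) 0)
        (topHForms S ℂ (Bundle.Trivial X ℂ) U r 0 α) _ hc f).comp (XC.tendsto_topCForms hu)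
      exact ptTendsto_of_topHForms h4
  -- If `n ≤ r + k`, the degree `n + r + 1` exceeds `m = 2 n - k`, so all forms vanish and any
  -- operator is smoothing.
  · have h5 : ∀ f : XC S ℂ (Bundle.Trivial X ℂ) (r + 1) 0, f = 0 := fun f =>
      XC.form_injective ((form_eq_zero_of_lt (by omega) f.form).trans (map_zero _).symm)
    refine ⟨fun l f hf => ?_, fun u f hu => ?_⟩
    · rw [h5 f, map_zero]
      exact zero_mem _
    · simp only [h5]
      exact ptTendsto_const _

end Scalar

end
end CRForms

namespace CRForms
noncomputable section

/-! ### The global homotopy formula. -/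

section Homotopy

variable {n m : ℕ} {X : Type*} [TopologicalSpace X] [ChartedSpace (Cn n) X]
  [IsManifold 𝓘(ℂ, Cn n) ω X]
  {M : Type*} [TopologicalSpace M] [ChartedSpace (Rm m) M] [IsManifold (𝓡 m) ∞ M]
  {S : GenericCR n m X M}
  {F : Type*} [NormedAddCommGroup F] [NormedSpace ℂ F]
  {E : X → Type*} [∀ x, AddCommGroup (E x)] [∀ x, Module ℂ (E x)]
  [TopologicalSpace (Bundle.TotalSpace F E)] [∀ x, TopologicalSpace (E x)]
  [FiberBundle F E] [VectorBundle ℂ F E] [ContMDiffVectorBundle ω F E 𝓘(ℂ, Cn n)]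
  [FiniteDimensional ℂ F] [CompactSpace M] [T2Space M]
  {x p : M} {U : Opens M} {r s N : ℕ} {α : ℝ} {χ ψ : M → ℂ}

lemma reg_sub_of_mem {f g : Form S E (n + s)} (hf : f ∈ CForms S F E ⊤ s 0)
    (hg : g ∈ CForms S F E U s 0) (hp : p ∈ U) : Reg S F E 0 0 (f - g) p := by
  rw [sub_eq_add_neg]
  exact ((mem_CForms_iff.1 hf).2.2 p trivial).add ((mem_CForms_iff.1 (neg_mem hg)).2.2 p hp)

lemma closure_support_smulForm_subset {f : Form S E N} :
    closure {p | smulForm ψ f p ≠ 0} ⊆ tsupport ψ := by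
  refine closure_minimal (fun p hp => ?_) (isClosed_tsupport ψ)
  by_contra h
  exact hp (smulForm_eq_zero f h)

/-- The local formula is applied to ψ times a scalar component of `f`, whose derivative also
contains a dψ term. After the passage to E-valued forms, multiplication by χ adds a dχ term. These
two kinds of terms make up the error operator. -/
lemma isWeakD_smulForm_pack_locIn
    {T₀ : XC S ℂ (Bundle.Trivial X ℂ) (r + 1) 0 →ₗ[ℂ] Form S (Bundle.Trivial X ℂ) (n + r)}
    {T₁ : XC S ℂ (Bundle.Trivial X ℂ) (r + 1 + 1) 0 →ₗ[ℂ]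
      Form S (Bundle.Trivial X ℂ) (n + (r + 1))}
    (h₀ : IsSmoothing ℂ ℂ U α T₀) (h₁ : IsSmoothing ℂ ℂ U α T₁)
    (hT : ∀ (f : XC S ℂ (Bundle.Trivial X ℂ) (r + 1) 0)
      (g : XC S ℂ (Bundle.Trivial X ℂ) (r + 1 + 1) 0),
      IsWeakD S ℂ (Bundle.Trivial X ℂ) ⊤ f.form g.form → closure {p | f.form p ≠ 0} ⊆ U →
        IsWeakD S ℂ (Bundle.Trivial X ℂ) U (T₀ f) (f.form - T₁ g))
    (hψ : ContMDiff (𝓡 m) 𝓘(ℝ, ℂ) ∞ ψ) (hψx : tsupport ψ ⊆ locNhd S F E x)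
    (hψU : tsupport ψ ⊆ U) (hχ : ContMDiff (𝓡 m) 𝓘(ℝ, ℂ) ∞ χ) (hχψ : tsupport χ ⊆ tsupport ψ)
    {f : XC S F E (r + 1) 0} {g : XC S F E (r + 1 + 1) 0} (h : IsWeakD S F E ⊤ f.form g.form)
    (L : F →L[ℂ] ℂ) (e : F) :
    IsWeakD S F E ⊤
      (smulForm χ (pack x e (T₀ (locIn hψ (hψx.trans (locNhd_subset_patch x)) L f))))
      (dwedge χ (pack x e (T₀ (locIn hψ (hψx.trans (locNhd_subset_patch x)) L f))) +
        smulForm χ (pack (N := n + r + 1) x e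
          ((locIn hψ (hψx.trans (locNhd_subset_patch x)) L f).form -
          T₁ (locInD hψ (hψx.trans (locNhd_subset_patch x)) L f +
            locIn hψ (hψx.trans (locNhd_subset_patch x)) L g)))) := by
  have hs := hψx.trans (locNhd_subset_patch x)
  set w := locIn hψ hs L f
  set w' := locInD hψ hs L f + locIn hψ hs L g
  have hw : IsWeakD S ℂ (Bundle.Trivial X ℂ) ⊤ w.form w'.form := isWeakD_locIn hψ hψx L h
  let V : Opens M := U ⊓ locNhd S F E x
  have hV : (V : Set M) ⊆ patch S F E x := fun p hp => locNhd_subset_patch x hp.2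
  have hd := hT w w' hw (closure_support_smulForm_subset.trans hψU)
  have hm0 := (h₀.1 0 w w.form_mem).1
  have hm1 := (h₁.1 0 w' w'.form_mem).1
  have hr0 : ∀ p ∈ U, Reg S ℂ (Bundle.Trivial X ℂ) 0 0 (T₀ w) p := (mem_CForms_iff.1 hm0).2.2
  have hr1 : ∀ p ∈ U, Reg S ℂ (Bundle.Trivial X ℂ) 0 0 (w.form - T₁ w') p := fun p hp =>
    reg_sub_of_mem w.form_mem hm1 hp
  have hd' : IsWeakD S ℂ (Bundle.Trivial X ℂ) V (T₀ w) (w.form - T₁ w') := isWeakD_iff.2 fun y =>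
    (isWeakD_iff.1 hd y).mono (dom_mono y inf_le_left)
  have hp := isWeakD_pack (U := V) (x := x) (fun p _ => hm0.1 p)
    (fun y => ctsOn_of_reg (U := V) (fun p hp => hr0 p hp.1) y)
    (fun y => ctsOn_of_reg (U := V) (N := n + r + 1) (fun p hp => hr1 p hp.1) y) hd' hV e
  refine isWeakD_smulForm hχ (U := V) (fun p hp => ⟨hψU (hχψ hp), hψx (hχψ hp)⟩)
    (fun y => ctsOn_of_reg (U := V) (fun p hp => (hr0 p hp.1).pack le_rfl zero_le_one (hV hp) e) y)
    (fun y => ctsOn_of_reg (U := V) (N := n + r + 1)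
      (fun p hp => Reg.pack (N := n + r + 1) le_rfl zero_le_one (hr1 p hp.1) (hV hp) e) y) hp

lemma sum_smulForm_pack_smulForm_unpack (hs : tsupport χ ⊆ patch S F E x)
    (h1 : ∀ p ∈ tsupport χ, ψ p = 1) (f : Form S E N) :
    ∑ a, smulForm χ (pack x (Module.finBasis ℂ F a) (smulForm ψ (unpack x (coordL a) f))) =
      smulForm χ f := by
  funext p
  rw [Finset.sum_apply]
  by_cases hp : p ∈ tsupport χ
  · have h2 : ∀ a, pack (E := E) x (Module.finBasis ℂ F a)
        (smulForm ψ (unpack x (coordL a) f)) p =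
        pack x (Module.finBasis ℂ F a) (unpack x (coordL a) f) p := fun a => by
      have h3 : smulForm ψ (unpack x (coordL a) f) p = unpack x (coordL a) f p := by
        rw [smulForm, h1 p hp, one_smul]
      simp only [pack, LinearMap.coe_mk, AddHom.coe_mk, h3]
    simp only [smulForm] at h2 ⊢
    simp only [h2]
    rw [← Finset.smul_sum, sum_pack_unpack (hs hp)]
  · rw [smulForm_eq_zero f hp]
    exact Finset.sum_eq_zero fun a _ => smulForm_eq_zero _ hp

lemma smulForm_pack_congr {u v : Form S (Bundle.Trivial X ℂ) N}
    (h : ∀ p ∈ tsupport χ, u p = v p) (e : F) :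
    smulForm χ (pack (E := E) x e u) = smulForm χ (pack x e v) := by
  funext p
  by_cases hp : p ∈ tsupport χ
  · simp only [smulForm, pack, LinearMap.coe_mk, AddHom.coe_mk, h p hp]
  · exact (smulForm_eq_zero _ hp).trans (smulForm_eq_zero _ hp).symm

lemma smulForm_pack_mem {u : Form S (Bundle.Trivial X ℂ) (n + s)} {l : ℕ∞}
    (hu : u ∈ CForms S ℂ (Bundle.Trivial X ℂ) ⊤ s l) (hχ : ContMDiff (𝓡 m) 𝓘(ℝ, ℂ) ∞ χ)
    (hs : tsupport χ ⊆ patch S F E x) (e : F) :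
    smulForm χ (pack (E := E) x e u) ∈ CForms S F E ⊤ s l :=
  smulForm_mem_CForms_of_tsupport hχ fun p hp => ⟨hu.1.pack x e p,
    ((mem_CForms_iff.1 hu).2.2 p trivial).pack le_rfl zero_le_one (hs hp) e⟩

variable (F E) in
/-- Global homotopy operators, for forms with values in the bundle. -/
theorem ConditionH.exists_homotopy {k q : ℕ} (hα0 : 0 ≤ α) (hα1 : α ≤ 1) (hm : m + k = 2 * n)
    (hH : ConditionH S k α q) :
    ∃ (A : ∀ r, XC S F E (r + 1) 0 →ₗ[ℂ] Form S E (n + r))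
      (K : ∀ s, XC S F E s 0 →ₗ[ℂ] Form S E (n + s)),
      (∀ r, (r + 1 ≤ q ∨ IsLargeDegree n k q (r + 1) ∨ n ≤ r + k) →
        IsSmoothing F F ⊤ α (A r)) ∧
      (1 ≤ q → IsSmoothing F F ⊤ α (K 0)) ∧
      (∀ r, (r + 1 ≤ q - 1 ∨ IsLargeDegree n k q (r + 1)) → IsSmoothing F F ⊤ α (K (r + 1))) ∧
      (∀ (f : XC S F E 0 0) (g : XC S F E 1 0), IsWeakD S F E ⊤ f.form g.form →
        f.form = K 0 f + A 0 g) ∧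
      (∀ r, (r + 1 ≤ q - 1 ∨ IsLargeDegree n k q (r + 1)) →
        ∀ (f : XC S F E (r + 1) 0) (g : XC S F E (r + 1 + 1) 0), IsWeakD S F E ⊤ f.form g.form →
          IsWeakD S F E ⊤ (A r f) (f.form - K (r + 1) f - A (r + 1) g)) := by
  choose U hU T hT hT0 hT1 using hH.exists_local hm
  obtain ⟨t, χ₀, hχ₀, hχs₀, hχ1₀⟩ := exists_partition (m := m) (M := M)
    (fun x => U x ⊓ locNhd S F E x) fun x => ⟨hU x, mem_locNhd x⟩
  classical
  -- Setting χ to 0 off the finite set `t` makes the support condition hold for every index, which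
  -- spares membership hypotheses below.
  obtain ⟨χ, hχ, hχs, hχ1⟩ : ∃ χ : M → M → ℂ, (∀ x, ContMDiff (𝓡 m) 𝓘(ℝ, ℂ) ∞ (χ x)) ∧
      (∀ x, tsupport (χ x) ⊆ (U x ⊓ locNhd S F E x : Opens M)) ∧ ∀ p, ∑ x ∈ t, χ x p = 1 := by
    refine ⟨fun x => if x ∈ t then χ₀ x else 0, fun x => ?_, fun x => ?_, fun p => ?_⟩
    · beta_reduce
      split_ifs
      · exact hχ₀ x
      · exact contMDiff_const
    · beta_reduce
      split_ifs with h
      · exact hχs₀ x h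
      · simp [tsupport]
    · rw [← hχ1₀ p]
      exact Finset.sum_congr rfl fun x hx => by beta_reduce; rw [if_pos hx]
  have hcut : ∀ x, ∃ ψ : M → ℂ, ContMDiff (𝓡 m) 𝓘(ℝ, ℂ) ∞ ψ ∧
      tsupport ψ ⊆ (U x ⊓ locNhd S F E x : Opens M) ∧ ∀ p ∈ tsupport (χ x), ψ p = 1 := fun x => by
    obtain ⟨ψ, h1, h2, h3⟩ := exists_cutoff (m := m) (isClosed_tsupport (χ x)) _ (hχs x)
    exact ⟨ψ, h1, h2, fun p hp => mem_of_mem_nhds (s := {p | ψ p = 1}) (mem_nhdsSet_iff_forall.1 h3 p hp)⟩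
  choose ψ hψ hψs hψ1 using hcut
  have hψU : ∀ x, tsupport (ψ x) ⊆ U x := fun x p hp => (hψs x hp).1
  have hψl : ∀ x, tsupport (ψ x) ⊆ locNhd S F E x := fun x p hp => (hψs x hp).2
  have hψp : ∀ x, tsupport (ψ x) ⊆ patch S F E x := fun x =>
    (hψl x).trans (locNhd_subset_patch x)
  have hχψ : ∀ x, tsupport (χ x) ⊆ tsupport (ψ x) := fun x p hp => subset_tsupport _ (by
    rw [Function.mem_support, hψ1 x p hp]; exact one_ne_zero)
  have hχp : ∀ x, tsupport (χ x) ⊆ patch S F E x := fun x => (hχψ x).trans (hψp x)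
  let b := Module.finBasis ℂ F
  -- `A` glues the operators T. `K₀` collects the terms with dψ inside T and `K₁` those with dχ
  -- outside T. Differentiating A f and using that ψ = 1 on the support of χ yields d A f = f - (K₀
  -- - K₁) f - A d f.
  let A : ∀ r, XC S F E (r + 1) 0 →ₗ[ℂ] Form S E (n + r) := fun r => ∑ x ∈ t, ∑ a,
    smulFormL (χ x) ∘ₗ pack x (b a) ∘ₗ T x r ∘ₗ locIn (hψ x) (hψp x) (coordL a)
  let K₀ : ∀ s, XC S F E s 0 →ₗ[ℂ] Form S E (n + s) := fun s => ∑ x ∈ t, ∑ a,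
    smulFormL (χ x) ∘ₗ pack x (b a) ∘ₗ T x s ∘ₗ locInD (hψ x) (hψp x) (coordL a)
  let K₁ : ∀ r, XC S F E (r + 1) 0 →ₗ[ℂ] Form S E (n + (r + 1)) := fun r => ∑ x ∈ t, ∑ a,
    dwedgeL (χ x) ∘ₗ pack x (b a) ∘ₗ T x r ∘ₗ locIn (hψ x) (hψp x) (coordL a)
  have hAg : ∀ r, (r + 1 ≤ q ∨ IsLargeDegree n k q (r + 1) ∨ n ≤ r + k) →
      IsSmoothing F F ⊤ α (A r) := fun r hr => IsSmoothing.sum t fun x _ =>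
    IsSmoothing.sum _ fun a _ => ((hT x r hr).comp_locIn (hψ x) (hψp x) (coordL a)).smulForm_pack
      hα0 hα1 (hχ x) (hχp x) ((hχψ x).trans (hψU x)) (b a)
  have hK₀g : ∀ r, (r + 1 ≤ q ∨ IsLargeDegree n k q (r + 1) ∨ n ≤ r + k) →
      IsSmoothing F F ⊤ α (K₀ r) := fun r hr => IsSmoothing.sum t fun x _ =>
    IsSmoothing.sum _ fun a _ => ((hT x r hr).comp_locInD (hψ x) (hψp x) (coordL a)).smulForm_pack
      hα0 hα1 (hχ x) (hχp x) ((hχψ x).trans (hψU x)) (b a)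
  have hK₁g : ∀ r, (r + 1 ≤ q ∨ IsLargeDegree n k q (r + 1) ∨ n ≤ r + k) →
      IsSmoothing F F ⊤ α (K₁ r) := fun r hr => IsSmoothing.sum t fun x _ =>
    IsSmoothing.sum _ fun a _ => ((hT x r hr).comp_locIn (hψ x) (hψp x) (coordL a)).dwedge_pack
      hα0 hα1 (hχ x) (hχp x) ((hχψ x).trans (hψU x)) (b a)
  have hrec : ∀ {N : ℕ} (f : Form S E N), ∑ x ∈ t, ∑ a, smulForm (χ x) (pack x (b a)
      (smulForm (ψ x) (unpack x (coordL a) f))) = f := fun f => by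
    rw [← sum_smulForm t hχ1 f]
    exact Finset.sum_congr rfl fun x _ => by
      rw [sum_smulForm t hχ1 f]
      exact sum_smulForm_pack_smulForm_unpack (hχp x) (hψ1 x) f
  have hgood : ∀ r, (r + 1 ≤ q - 1 ∨ IsLargeDegree n k q (r + 1)) →
      (r + 1 ≤ q ∨ IsLargeDegree n k q (r + 1) ∨ n ≤ r + k) := fun r hr => by
    rcases hr with hr | hr
    · exact Or.inl (hr.trans (Nat.sub_le _ _))
    · exact Or.inr (Or.inl hr)
  -- The formula in one degree also involves the operator of the next. Above the top degree that
  -- operator acts on the zero space, which is the third alternative.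
  have hgood' : ∀ r, (r + 1 ≤ q - 1 ∨ IsLargeDegree n k q (r + 1)) →
      (r + 1 + 1 ≤ q ∨ IsLargeDegree n k q (r + 1 + 1) ∨ n ≤ r + 1 + k) := fun r hr => by
    unfold IsLargeDegree at *
    omega
  -- The local formula in degree 0 has no term d T, hence no dχ term, and the error there is `K₀`
  -- alone.
  refine ⟨A, fun s => match s with
    | 0 => K₀ 0
    | r + 1 => K₀ (r + 1) + -K₁ r, hAg, fun hq => hK₀g 0 (Or.inl (by omega)), fun r hr =>
      (hK₀g (r + 1) (hgood' r hr)).add (hK₁g r (hgood r hr)).neg, fun f g h => ?_,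
      fun r hr f g h => ?_⟩
  · have h1 : ∀ x a, smulForm (χ x) (pack x (b a) (smulForm (ψ x) (unpack x (coordL a) f.form))) =
        smulFormL (χ x) (pack x (b a) (T x 0 (locInD (hψ x) (hψp x) (coordL a) f))) +
          smulFormL (χ x) (pack x (b a) (T x 0 (locIn (hψ x) (hψp x) (coordL a) g))) := fun x a => by
      rw [← map_add, ← map_add, ← map_add]
      have h2 := hT0 x _ _ (isWeakD_locIn (hψ x) (hψl x) (coordL a) h)
        (closure_support_smulForm_subset.trans (hψU x))
      exact smulForm_pack_congr (E := E) (F := F) (fun p hp => h2 p (hψU x (hχψ x hp))) (b a)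
    refine (hrec f.form).symm.trans ((Finset.sum_congr rfl fun x _ =>
      Finset.sum_congr rfl fun a _ => h1 x a).trans ?_)
    simp only [Finset.sum_add_distrib, K₀, A, LinearMap.sum_apply, LinearMap.comp_apply]
  · have h1 : ∀ x a, IsWeakD S F E ⊤
        ((smulFormL (χ x) ∘ₗ pack x (b a) ∘ₗ T x r ∘ₗ locIn (hψ x) (hψp x) (coordL a)) f)
        ((dwedgeL (χ x) ∘ₗ pack x (b a) ∘ₗ T x r ∘ₗ locIn (hψ x) (hψp x) (coordL a)) f +
          (smulForm (χ x) (pack x (b a) (smulForm (ψ x) (unpack x (coordL a) f.form))) -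
            ((smulFormL (χ x) ∘ₗ pack x (b a) ∘ₗ T x (r + 1) ∘ₗ
                locInD (hψ x) (hψp x) (coordL a)) f +
              (smulFormL (χ x) ∘ₗ pack x (b a) ∘ₗ T x (r + 1) ∘ₗ
                locIn (hψ x) (hψp x) (coordL a)) g))) := fun x a => by
      have h2 := isWeakD_smulForm_pack_locIn (hT x r (hgood r hr)) (hT x (r + 1) (hgood' r hr))
        (hT1 x r hr) (hψ x) (hψl x) (hψU x) (hχ x) (hχψ x) h (coordL a) (b a)
      rw [← smulFormL_apply (χ x) (pack (N := n + r + 1) x (b a) _), map_sub, map_sub, map_add,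
        map_add, map_add] at h2
      exact h2
    have hm1 : ∀ x a, (smulFormL (χ x) ∘ₗ pack x (b a) ∘ₗ T x r ∘ₗ
        locIn (hψ x) (hψp x) (coordL a)) f ∈ CForms S F E ⊤ r 0 := fun x a =>
      ((((hT x r (hgood r hr)).comp_locIn (hψ x) (hψp x) (coordL a)).smulForm_pack
        hα0 hα1 (hχ x) (hχp x) ((hχψ x).trans (hψU x)) (b a)).1 0 f f.form_mem).1
    have hm2 : ∀ x a, (dwedgeL (χ x) ∘ₗ pack x (b a) ∘ₗ T x r ∘ₗ
        locIn (hψ x) (hψp x) (coordL a)) f ∈ CForms S F E ⊤ (r + 1) 0 := fun x a =>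
      ((((hT x r (hgood r hr)).comp_locIn (hψ x) (hψp x) (coordL a)).dwedge_pack
        hα0 hα1 (hχ x) (hχp x) ((hχψ x).trans (hψU x)) (b a)).1 0 f f.form_mem).1
    have hm3 : ∀ x a, smulForm (χ x) (pack x (b a)
        (smulForm (ψ x) (unpack x (coordL a) f.form))) ∈ CForms S F E ⊤ (r + 1) 0 := fun x a =>
      smulForm_pack_mem (smulForm_unpack_mem f.form_mem (hψ x) (hψp x) _) (hχ x) (hχp x) (b a)
    have hm4 : ∀ x a, (smulFormL (χ x) ∘ₗ pack x (b a) ∘ₗ T x (r + 1) ∘ₗ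
        locInD (hψ x) (hψp x) (coordL a)) f ∈ CForms S F E ⊤ (r + 1) 0 := fun x a =>
      ((((hT x (r + 1) (hgood' r hr)).comp_locInD (hψ x) (hψp x) (coordL a)).smulForm_pack
        hα0 hα1 (hχ x) (hχp x) ((hχψ x).trans (hψU x)) (b a)).1 0 f f.form_mem).1
    have hm5 : ∀ x a, (smulFormL (χ x) ∘ₗ pack x (b a) ∘ₗ T x (r + 1) ∘ₗ
        locIn (hψ x) (hψp x) (coordL a)) g ∈ CForms S F E ⊤ (r + 1) 0 := fun x a =>
      ((((hT x (r + 1) (hgood' r hr)).comp_locIn (hψ x) (hψp x) (coordL a)).smulForm_pack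
        hα0 hα1 (hχ x) (hχp x) ((hχψ x).trans (hψU x)) (b a)).1 0 g g.form_mem).1
    have hm6 := fun x a => add_mem (hm2 x a) (sub_mem (hm3 x a) (add_mem (hm4 x a) (hm5 x a)))
    have h2 := IsWeakD.sum t (fun x => sum_mem fun a _ => hm1 x a)
      (fun x => sum_mem fun a _ => hm6 x a) fun x =>
        IsWeakD.sum Finset.univ (hm1 x) (hm6 x) (h1 x)
    have h3 : A r f = ∑ x ∈ t, ∑ a, (smulFormL (χ x) ∘ₗ pack x (b a) ∘ₗ T x r ∘ₗ
        locIn (hψ x) (hψp x) (coordL a)) f := by simp only [A, LinearMap.sum_apply]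
    have h4 : f.form - (K₀ (r + 1) + -K₁ r) f - A (r + 1) g = ∑ x ∈ t, ∑ a,
        ((dwedgeL (χ x) ∘ₗ pack x (b a) ∘ₗ T x r ∘ₗ locIn (hψ x) (hψp x) (coordL a)) f +
          (smulForm (χ x) (pack x (b a) (smulForm (ψ x) (unpack x (coordL a) f.form))) -
            ((smulFormL (χ x) ∘ₗ pack x (b a) ∘ₗ T x (r + 1) ∘ₗ
                locInD (hψ x) (hψp x) (coordL a)) f +
              (smulFormL (χ x) ∘ₗ pack x (b a) ∘ₗ T x (r + 1) ∘ₗ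
                locIn (hψ x) (hψp x) (coordL a)) g))) := by
      simp only [Finset.sum_add_distrib, Finset.sum_sub_distrib, hrec, K₀, K₁, A,
        LinearMap.sum_apply, LinearMap.add_apply, LinearMap.neg_apply]
      abel
    rw [h3]
    exact h4 ▸ h2

end Homotopy

end
end CRForms

namespace CRForms
noncomputable section

/-! ### Inverting 1 - K modulo finite rank, compatibly with regularity and closedness. -/

section Parametrix

variable {n m : ℕ} {X : Type*} [TopologicalSpace X] [ChartedSpace (Cn n) X]
  [IsManifold 𝓘(ℂ, Cn n) ω X]
  {M : Type*} [TopologicalSpace M] [ChartedSpace (Rm m) M] [IsManifold (𝓡 m) ∞ M]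
  {S : GenericCR n m X M}
  {F : Type*} [NormedAddCommGroup F] [NormedSpace ℂ F]
  {E : X → Type*} [∀ x, AddCommGroup (E x)] [∀ x, Module ℂ (E x)]
  [TopologicalSpace (Bundle.TotalSpace F E)] [∀ x, TopologicalSpace (E x)]
  [FiberBundle F E] [VectorBundle ℂ F E] [ContMDiffVectorBundle ω F E 𝓘(ℂ, Cn n)]
  [FiniteDimensional ℂ F] [CompactSpace M] [T2Space M]
  {r s l : ℕ} {α : ℝ}

variable (S F E) in
/-- The inclusion of the forms of class `C^l` into the continuous forms. -/
def inclXC (s l : ℕ) : XC S F E s l →L[ℂ] XC S F E s 0 where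
  toLinearMap := XC.lift XC.form fun f => CForms_mono S F E ⊤ s zero_le f.form_mem
  cont := XC.continuous_of_ptTendsto _ fun _ f h =>
    show PtTendsto _ f.form from XC.ptTendsto h

lemma denseRange_inclXC : DenseRange (inclXC S F E s l : XC S F E s l →ₗ[ℂ] XC S F E s 0) :=
  denseRange_smoothXC.mono (by
    rintro _ ⟨u, rfl⟩
    exact ⟨smoothXC l u, XC.form_injective rfl⟩)

/-- The action of a smoothing operator on the forms of class `C^l`. -/
def IsSmoothing.op {K : XC S F E s 0 →ₗ[ℂ] Form S E (n + s)} (hK : IsSmoothing F F ⊤ α K)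
    (l : ℕ) : XC S F E s l →L[ℂ] XC S F E s l where
  toLinearMap := XC.lift (K ∘ₗ (inclXC S F E s l : XC S F E s l →ₗ[ℂ] XC S F E s 0))
    fun f => (hK.1 l _ f.form_mem).1
  cont := XC.continuous_of_ptTendsto _ fun _ f h =>
    hK.2 _ _ (((inclXC S F E s l).continuous.tendsto f).comp h)

lemma IsSmoothing.isCompactOperator_op (hα : 0 < α) {K : XC S F E s 0 →ₗ[ℂ] Form S E (n + s)}
    (hK : IsSmoothing F F ⊤ α K) (l : ℕ) : IsCompactOperator (hK.op l) :=
  XC.isCompactOperator_of_holder hα _ fun f => hK.1 l _ f.form_mem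

lemma inclXC_one_sub_op {K : XC S F E s 0 →ₗ[ℂ] Form S E (n + s)}
    (hK : IsSmoothing F F ⊤ α K) (f : XC S F E s l) :
    inclXC S F E s l ((1 - hK.op l) f) = (1 - hK.op 0) (inclXC S F E s l f) :=
  XC.form_injective rfl

lemma mem_CForms_top {f : Form S E (n + s)} (h : ∀ l : ℕ, f ∈ CForms S F E ⊤ s l) :
    f ∈ CForms S F E ⊤ s ⊤ :=
  ⟨(h 0).1, (h 0).2.1, fun x v => contDiffOn_infty.2 fun k => (h k).2.2 x v⟩

variable (S F E) in
/-- The closed continuous forms. -/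
def closedXC (s : ℕ) : Submodule ℂ (XC S F E s 0) := (ZForms S F E s 0).comap XC.form

lemma mem_closedXC {f : XC S F E s 0} : f ∈ closedXC S F E s ↔ IsWeakD S F E ⊤ f.form 0 :=
  ⟨fun h => h.2, fun h => ⟨f.form_mem, h⟩⟩

lemma isClosed_closedXC : IsClosed (closedXC S F E s : Set (XC S F E s 0)) := by
  have h : Continuous fun f : XC S F E s 0 => (f, (0 : XC S F E (s + 1) 0)) := by fun_prop
  have h1 := (isClosed_isWeakD (S := S) (F := F) (E := E) (r := s) (l := 0) (l' := 0)).preimage h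
  convert h1 using 1
  ext f
  exact mem_closedXC

/-- `K` maps the closed subspace of closed forms to itself and is compact there. The Riesz pair of
this restriction must be the restriction of `P` and `G`, by `proj_intertwine` and `inv_intertwine`.
-/
lemma IsSmoothing.riesz_closed (hα : 0 < α) {K : XC S F E s 0 →ₗ[ℂ] Form S E (n + s)}
    (hK : IsSmoothing F F ⊤ α K)
    (h : ∀ f : XC S F E s 0, IsWeakD S F E ⊤ f.form 0 → IsWeakD S F E ⊤ (K f) 0)
    {P G : XC S F E s 0 →L[ℂ] XC S F E s 0}
    (hR : IsRieszPair ((1 - hK.op 0 : XC S F E s 0 →L[ℂ] XC S F E s 0) :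
      Module.End ℂ (XC S F E s 0)) P G) {f : XC S F E s 0} (hf : f ∈ closedXC S F E s) :
    P f ∈ closedXC S F E s ∧ G f ∈ closedXC S F E s := by
  have hV : ∀ v ∈ closedXC S F E s, hK.op 0 v ∈ closedXC S F E s := fun v hv =>
    mem_closedXC.2 (h v (mem_closedXC.1 hv))
  have hcl := isClosed_closedXC (S := S) (F := F) (E := E) (s := s)
  have : CompleteSpace (closedXC S F E s) := hcl.completeSpace_coe
  let K' : closedXC S F E s →L[ℂ] closedXC S F E s :=
    ((hK.op 0).comp (closedXC S F E s).subtypeL).codRestrict _ fun v => hV v v.2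
  have hK' : IsCompactOperator K' :=
    IsCompactOperator.codRestrict ((hK.isCompactOperator_op hα 0).comp_clm _) _ hcl
  obtain ⟨P', G', hR', -⟩ := exists_isRieszPair hK'
  have hj : ∀ b : closedXC S F E s, (closedXC S F E s).subtype
      (((1 - K' : closedXC S F E s →L[ℂ] closedXC S F E s) : Module.End ℂ _) b) =
      ((1 - hK.op 0 : XC S F E s 0 →L[ℂ] XC S F E s 0) : Module.End ℂ _)
        ((closedXC S F E s).subtype b) := fun b => rfl
  have h1 := hR.proj_intertwine hR' hj ⟨f, hf⟩
  have h2 := hR.inv_intertwine hR' hj ⟨f, hf⟩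
  refine ⟨?_, ?_⟩
  · rw [show P f = _ from h1]
    exact Subtype.coe_prop _
  · rw [show G f = _ from h2]
    exact Subtype.coe_prop _

/-- The same comparison for the inclusion of C^l into C^0 shows that `G` preserves C^l. For `P` more
is true: the inclusion has dense range and `P` has finite rank, so `range_proj_le_range` places its
entire range in C^l, for every `l`. -/
lemma IsSmoothing.riesz_regular (hα : 0 < α) {K : XC S F E s 0 →ₗ[ℂ] Form S E (n + s)}
    (hK : IsSmoothing F F ⊤ α K) {P G : XC S F E s 0 →L[ℂ] XC S F E s 0}
    (hR : IsRieszPair ((1 - hK.op 0 : XC S F E s 0 →L[ℂ] XC S F E s 0) :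
      Module.End ℂ (XC S F E s 0)) P G)
    [FiniteDimensional ℂ (LinearMap.range (P : XC S F E s 0 →ₗ[ℂ] XC S F E s 0))] (l : ℕ)
    (f : XC S F E s 0) : (P f).form ∈ CForms S F E ⊤ s l ∧
      (f.form ∈ CForms S F E ⊤ s l → (G f).form ∈ CForms S F E ⊤ s l) := by
  obtain ⟨P', G', hR', -⟩ := exists_isRieszPair (hK.isCompactOperator_op hα l)
  have hj := fun b => inclXC_one_sub_op hK (l := l) b
  refine ⟨?_, fun hf => ?_⟩
  · obtain ⟨b, hb⟩ := range_proj_le_range hR hR' P.continuous hj denseRange_inclXC f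
    rw [show P f = _ from hb]
    exact b.form_mem
  · obtain ⟨b, hb⟩ : ∃ b : XC S F E s l, b.form = f.form := ⟨XC.mk f.form hf, rfl⟩
    have e : f = inclXC S F E s l b := XC.form_injective hb.symm
    have h2 := hR.inv_intertwine hR' hj b
    rw [e, show G (inclXC S F E s l b) = _ from h2]
    exact XC.form_mem (G' b)

theorem IsSmoothing.exists_parametrix (hα : 0 < α) {K : XC S F E s 0 →ₗ[ℂ] Form S E (n + s)}
    (hK : IsSmoothing F F ⊤ α K) : ∃ P G : XC S F E s 0 →L[ℂ] XC S F E s 0,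
      (∀ f, (G f).form - K (G f) = f.form - (P f).form) ∧
      (∀ f g, g.form = f.form - K f → (G g).form = f.form - (P f).form) ∧
      FiniteDimensional ℂ (LinearMap.range (P : XC S F E s 0 →ₗ[ℂ] XC S F E s 0)) ∧
      (∀ f, (P f).form ∈ CForms S F E ⊤ s ⊤) ∧
      (∀ (l : ℕ) (f : XC S F E s 0), f.form ∈ CForms S F E ⊤ s l →
        (G f).form ∈ CForms S F E ⊤ s l) ∧
      ((∀ f : XC S F E s 0, IsWeakD S F E ⊤ f.form 0 → IsWeakD S F E ⊤ (K f) 0) →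
        ∀ f : XC S F E s 0, IsWeakD S F E ⊤ f.form 0 →
          IsWeakD S F E ⊤ (P f).form 0 ∧ IsWeakD S F E ⊤ (G f).form 0) := by
  obtain ⟨P, G, hR, hfd⟩ := exists_isRieszPair (hK.isCompactOperator_op hα 0)
  refine ⟨P, G, fun f => ?_, fun f g hg => ?_, hfd, fun f => ?_, fun l f => ?_, fun h f hf => ?_⟩
  · exact congrArg XC.form (hR.map_inv f)
  · have e : g = (1 - hK.op 0) f := XC.form_injective hg
    rw [e]
    exact congrArg XC.form (hR.inv_map f)
  · exact mem_CForms_top fun l => (hK.riesz_regular hα hR l f).1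
  · exact (hK.riesz_regular hα hR l f).2
  · have h1 := hK.riesz_closed hα h hR (mem_closedXC.2 hf)
    exact ⟨mem_closedXC.1 h1.1, mem_closedXC.1 h1.2⟩

end Parametrix

end
end CRForms

namespace CRForms
noncomputable section

/-! ### Regular primitives and closedness of the space of exact forms. -/

section Solve

variable {n m : ℕ} {X : Type*} [TopologicalSpace X] [ChartedSpace (Cn n) X]
  [IsManifold 𝓘(ℂ, Cn n) ω X]
  {M : Type*} [TopologicalSpace M] [ChartedSpace (Rm m) M] [IsManifold (𝓡 m) ∞ M]
  {S : GenericCR n m X M}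
  {F : Type*} [NormedAddCommGroup F] [NormedSpace ℂ F]
  {E : X → Type*} [∀ x, AddCommGroup (E x)] [∀ x, Module ℂ (E x)]
  [TopologicalSpace (Bundle.TotalSpace F E)] [∀ x, TopologicalSpace (E x)]
  [FiberBundle F E] [VectorBundle ℂ F E] [ContMDiffVectorBundle ω F E 𝓘(ℂ, Cn n)]
  [FiniteDimensional ℂ F] [CompactSpace M] [T2Space M]
  {r s : ℕ} {l : ℕ∞} {α : ℝ}

lemma mem_CForms_of_forall_nat {f : Form S E (n + s)}
    (h : ∀ i : ℕ, (i : ℕ∞) ≤ l → f ∈ CForms S F E ⊤ s i) : f ∈ CForms S F E ⊤ s l := by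
  induction l using ENat.recTopCoe with
  | top => exact mem_CForms_top fun i => h i le_top
  | coe i => exact h i le_rfl

lemma mem_HForms_of_forall_nat {f : Form S E (n + s)}
    (h : ∀ i : ℕ, (i : ℕ∞) ≤ l → f ∈ HForms S F E ⊤ s i α) : f ∈ HForms S F E ⊤ s l α :=
  ⟨mem_CForms_of_forall_nat fun i hi => (h i hi).1, fun x v i hi => (h i hi).2 x v i le_rfl⟩

lemma mem_HForms_of_smooth (hα0 : 0 ≤ α) (hα1 : α ≤ 1) {f : Form S E (n + s)}
    (hf : f ∈ CForms S F E ⊤ s ⊤) : f ∈ HForms S F E ⊤ s l α :=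
  mem_HForms_of_reg hα0 hα1 hf.1 fun p v => regAt_of_contDiffAt_infty hα0 hα1
    ((mem_CForms_iff.1 hf).2.2 p trivial v).1 l

variable (S F E) in
/-- The continuous forms that are exact, with a continuous primitive. -/
def exactXC (r : ℕ) : Submodule ℂ (XC S F E (r + 1) 0) := (BForms S F E r 0 0).comap XC.form

lemma mem_exactXC {f : XC S F E (r + 1) 0} :
    f ∈ exactXC S F E r ↔ ∃ u : XC S F E r 0, IsWeakD S F E ⊤ u.form f.form :=
  ⟨fun h => ⟨XC.mk h.2.choose h.2.choose_spec.1, h.2.choose_spec.2⟩,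
    fun ⟨u, h⟩ => ⟨f.form_mem, u.form, u.form_mem, h⟩⟩

variable (S F E) in
/-- Exact forms of class `C^l` have primitives of class `C^{l+α}`, for all `l` at once. -/
def HasRegularPrimitives (r : ℕ) (α : ℝ) : Prop :=
  ∀ f ∈ exactXC S F E r, ∃ w, IsWeakD S F E ⊤ w f.form ∧
    ∀ l : ℕ, f.form ∈ CForms S F E ⊤ (r + 1) l → w ∈ HForms S F E ⊤ r l α

/-! ### Exactness from the homotopy formula one degree lower. -/

section Small

variable {K : XC S F E r 0 →ₗ[ℂ] Form S E (n + r)}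
  {A : XC S F E (r + 1) 0 →ₗ[ℂ] Form S E (n + r)}

/-- A smoothing operator on continuous forms. -/
def IsSmoothing.toXC {A : XC S F E s 0 →ₗ[ℂ] Form S E (n + r)} (hA : IsSmoothing F F ⊤ α A) :
    XC S F E s 0 →L[ℂ] XC S F E r 0 where
  toLinearMap := XC.lift A fun f => (hA.1 0 f f.form_mem).1
  cont := XC.continuous_of_ptTendsto _ fun _ f h => hA.2 _ f h

lemma XC.isWeakD_sub {u u' : XC S F E r 0} {f f' : XC S F E (r + 1) 0}
    (h : IsWeakD S F E ⊤ u.form f.form) (h' : IsWeakD S F E ⊤ u'.form f'.form) :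
    IsWeakD S F E ⊤ (u - u').form (f - f').form :=
  h.sub u.form_mem u'.form_mem f.form_mem f'.form_mem h'

lemma XC.isWeakD_add {u u' : XC S F E r 0} {f f' : XC S F E (r + 1) 0}
    (h : IsWeakD S F E ⊤ u.form f.form) (h' : IsWeakD S F E ⊤ u'.form f'.form) :
    IsWeakD S F E ⊤ (u + u').form (f + f').form :=
  h.add u.form_mem u'.form_mem f.form_mem f'.form_mem h'

lemma isWeakD_eq {u u' : Form S E (n + r)} {f f' : Form S E (n + (r + 1))}
    (h : IsWeakD S F E ⊤ u f) (hu : u' = u) (hf : f' = f) : IsWeakD S F E ⊤ u' f' :=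
  hu ▸ hf ▸ h

/-- The form `e = u - K u - A f` is closed, and `G (A f + e) = G (u - K u) = u - P u`. Hence `P u +
G (A f) = u - G e` differs from the primitive `u` by the closed form `G e`. The gain is that `P u`
is smooth and `G (A f)` is as regular as `A f`, while `u` is only continuous. -/
lemma solve_small_primitive (hK : IsSmoothing F F ⊤ α K) (hA : IsSmoothing F F ⊤ α A)
    (h : ∀ (u : XC S F E r 0) (f : XC S F E (r + 1) 0), IsWeakD S F E ⊤ u.form f.form →
      IsWeakD S F E ⊤ (u.form - K u - A f) 0)
    {P G : XC S F E r 0 →L[ℂ] XC S F E r 0}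
    (hG : ∀ f g, g.form = f.form - K f → (G g).form = f.form - (P f).form)
    (hc : ∀ f : XC S F E r 0, IsWeakD S F E ⊤ f.form 0 → IsWeakD S F E ⊤ (G f).form 0)
    {u : XC S F E r 0} {f : XC S F E (r + 1) 0} (hu : IsWeakD S F E ⊤ u.form f.form) :
    IsWeakD S F E ⊤ (P u + G (hA.toXC f)).form f.form := by
  obtain ⟨e, he⟩ : ∃ e : XC S F E r 0, e = u - hK.toXC u - hA.toXC f := ⟨_, rfl⟩
  have he0 : IsWeakD S F E ⊤ e.form 0 := by
    rw [he]
    exact h u f hu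
  have h1 := XC.isWeakD_sub (f' := 0) hu (hc e he0)
  have h2 : G (hA.toXC f + e) = u - P u := XC.form_injective (hG u _ (by
    rw [he]
    change (hA.toXC f + (u - hK.toXC u - hA.toXC f)).form = (u - hK.toXC u).form
    rw [add_sub_cancel]))
  have h3 : P u + G (hA.toXC f) = u - G e := by
    rw [map_add] at h2
    rw [eq_sub_iff_add_eq, add_assoc, h2, add_sub_cancel]
  rw [h3]
  exact isWeakD_eq h1 rfl (congrArg XC.form (sub_zero f)).symm

/-- Any primitive `u` may be replaced by `K u + A f`, since the two differ by a closed form. This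
recovers the α derivatives, as `K` and `A` gain them while `G` is only known to preserve C^l. -/
lemma isWeakD_small_of_closed (hK : IsSmoothing F F ⊤ α K) (hA : IsSmoothing F F ⊤ α A)
    (h : ∀ (u : XC S F E r 0) (f : XC S F E (r + 1) 0), IsWeakD S F E ⊤ u.form f.form →
      IsWeakD S F E ⊤ (u.form - K u - A f) 0)
    {u : XC S F E r 0} {f : XC S F E (r + 1) 0} (hu : IsWeakD S F E ⊤ u.form f.form) :
    IsWeakD S F E ⊤ (hK.toXC u + hA.toXC f).form f.form := by
  have h1 : IsWeakD S F E ⊤ (u - hK.toXC u - hA.toXC f).form (0 : XC S F E (r + 1) 0).form :=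
    h u f hu
  have h2 := XC.isWeakD_sub hu h1
  refine isWeakD_eq h2 (congrArg XC.form ?_) (congrArg XC.form (sub_zero f)).symm
  abel

lemma small_closed (hK : IsSmoothing F F ⊤ α K)
    (h : ∀ (u : XC S F E r 0) (f : XC S F E (r + 1) 0), IsWeakD S F E ⊤ u.form f.form →
      IsWeakD S F E ⊤ (u.form - K u - A f) 0)
    (f : XC S F E r 0) (hf : IsWeakD S F E ⊤ f.form 0) : IsWeakD S F E ⊤ (K f) 0 := by
  have h1 := h f 0 hf
  rw [map_zero, sub_zero] at h1
  have h2 : IsWeakD S F E ⊤ (f - (f - hK.toXC f)).form ((0 : XC S F E (r + 1) 0) - 0).form :=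
    XC.isWeakD_sub hf h1
  refine isWeakD_eq h2 ?_ (congrArg XC.form (sub_zero (0 : XC S F E (r + 1) 0))).symm
  rw [sub_sub_cancel]
  rfl

/-- Two passes: `P u + G (A f)` is a primitive `w` of class C^l, and then `K w + A f` is one of
class C^{l+α}. Neither construction depends on `l`. -/
theorem hasRegularPrimitives_small (hα : 0 < α) (hK : IsSmoothing F F ⊤ α K)
    (hA : IsSmoothing F F ⊤ α A)
    (h : ∀ (u : XC S F E r 0) (f : XC S F E (r + 1) 0), IsWeakD S F E ⊤ u.form f.form →
      IsWeakD S F E ⊤ (u.form - K u - A f) 0) : HasRegularPrimitives S F E r α := by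
  obtain ⟨P, G, -, hG, -, hP, hGl, hc⟩ := hK.exists_parametrix hα
  intro f hf
  obtain ⟨u, hu⟩ := mem_exactXC.1 hf
  have h1 := solve_small_primitive hK hA h hG (fun g hg => (hc (small_closed hK h) g hg).2) hu
  refine ⟨_, isWeakD_small_of_closed hK hA h h1, fun l hl => ?_⟩
  have h2 := hA.1 l f hl
  exact add_mem (hK.1 l _ (add_mem (CForms_mono S F E ⊤ r le_top (hP u)) (hGl l _ h2.1))) h2

/-- The set is the sum of the closed graph of d and the finite-dimensional space `N × 0`, and such a
sum is closed. -/
lemma isClosed_graph_sup (N : Submodule ℂ (XC S F E r 0)) [FiniteDimensional ℂ N] :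
    IsClosed {q : XC S F E r 0 × XC S F E (r + 1) 0 |
      ∃ v ∈ N, IsWeakD S F E ⊤ (q.1 + v).form q.2.form} := by
  let Γ : Submodule ℂ (XC S F E r 0 × XC S F E (r + 1) 0) :=
    { carrier := {q | IsWeakD S F E ⊤ q.1.form q.2.form}
      add_mem' := fun h h' => XC.isWeakD_add h h'
      zero_mem' := IsWeakD.zero S F E
      smul_mem' := fun c _ h => h.smul c }
  have h1 := Submodule.isClosed_sup_finiteDimensional Γ
    (N.map (LinearMap.inl ℂ (XC S F E r 0) (XC S F E (r + 1) 0))) isClosed_isWeakD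
  convert h1 using 1
  ext q
  simp only [SetLike.mem_coe, Submodule.mem_sup, Submodule.mem_map]
  constructor
  · rintro ⟨v, hv, h⟩
    refine ⟨(q.1 + v, q.2), h, LinearMap.inl ℂ _ _ (-v), ⟨-v, neg_mem hv, rfl⟩, ?_⟩
    exact Prod.ext (add_neg_cancel_right _ _) (add_zero _)
  · rintro ⟨a, ha, _, ⟨v, hv, rfl⟩, rfl⟩
    refine ⟨-v, neg_mem hv, ?_⟩
    exact isWeakD_eq ha (congrArg XC.form (add_neg_cancel_right _ _))
      (congrArg XC.form (add_zero _))

/-- By `solve_small_primitive`, `f` is exact if and only if `G (A f) + v` is a primitive of it for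
some `v` in the finite-dimensional range of `P`. That set is the preimage of a closed set under a
continuous map. -/
theorem isClosed_exactXC_small (hα : 0 < α) (hK : IsSmoothing F F ⊤ α K)
    (hA : IsSmoothing F F ⊤ α A)
    (h : ∀ (u : XC S F E r 0) (f : XC S F E (r + 1) 0), IsWeakD S F E ⊤ u.form f.form →
      IsWeakD S F E ⊤ (u.form - K u - A f) 0) :
    IsClosed (exactXC S F E r : Set (XC S F E (r + 1) 0)) := by
  obtain ⟨P, G, -, hG, hfd, -, -, hc⟩ := hK.exists_parametrix hα
  have h1 := isClosed_graph_sup (LinearMap.range (P : XC S F E r 0 →ₗ[ℂ] XC S F E r 0))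
  have h2 : Continuous fun f : XC S F E (r + 1) 0 => (G (hA.toXC f), f) :=
    (G.continuous.comp hA.toXC.continuous).prodMk continuous_id
  convert h1.preimage h2 using 1
  ext f
  refine mem_exactXC.trans ⟨fun ⟨u, hu⟩ => ?_, fun ⟨v, _, hv⟩ => ⟨_, hv⟩⟩
  have h1 := solve_small_primitive hK hA h hG (fun g hg => (hc (small_closed hK h) g hg).2) hu
  rw [add_comm (P u)] at h1
  exact ⟨P u, ⟨u, rfl⟩, h1⟩

end Small

/-! ### Exactness and cohomology in degrees where the homotopy formula holds. -/

section Large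

variable {K : XC S F E (r + 1) 0 →ₗ[ℂ] Form S E (n + (r + 1))}
  {A : XC S F E (r + 1) 0 →ₗ[ℂ] Form S E (n + r)}

lemma large_closed (hK : IsSmoothing F F ⊤ α K) (hA : IsSmoothing F F ⊤ α A)
    (h : ∀ f : XC S F E (r + 1) 0, IsWeakD S F E ⊤ f.form 0 →
      IsWeakD S F E ⊤ (A f) (f.form - K f))
    (f : XC S F E (r + 1) 0) (hf : IsWeakD S F E ⊤ f.form 0) : IsWeakD S F E ⊤ (K f) 0 := by
  have h1 : IsWeakD S F E ⊤ (f - hK.toXC f).form (0 : XC S F E (r + 1 + 1) 0).form :=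
    (h f hf).closed (hA.1 0 f f.form_mem).1
  have h2 := XC.isWeakD_sub (r := r + 1) (f := 0) hf h1
  refine isWeakD_eq (r := r + 1) h2 ?_ (congrArg XC.form (sub_zero (0 : XC S F E (r + 2) 0))).symm
  rw [sub_sub_cancel]
  rfl

/-- The homotopy formula is applied to the closed form `G f` in place of `f`, because `(1 - K) G f =
f - P f`. -/
lemma large_decomp (h : ∀ f : XC S F E (r + 1) 0, IsWeakD S F E ⊤ f.form 0 →
      IsWeakD S F E ⊤ (A f) (f.form - K f))
    {P G : XC S F E (r + 1) 0 →L[ℂ] XC S F E (r + 1) 0}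
    (hG : ∀ f, (G f).form - K (G f) = f.form - (P f).form)
    (hc : ∀ f : XC S F E (r + 1) 0, IsWeakD S F E ⊤ f.form 0 → IsWeakD S F E ⊤ (G f).form 0)
    {f : XC S F E (r + 1) 0} (hf : IsWeakD S F E ⊤ f.form 0) :
    IsWeakD S F E ⊤ (A (G f)) (f - P f).form :=
  isWeakD_eq (h (G f) (hc f hf)) rfl (hG f).symm

/-- By Friedrichs' lemma, an exact form with a merely continuous primitive is a uniform limit of
derivatives of smooth forms. -/
lemma mem_of_forall_approx {B : Submodule ℂ (XC S F E (r + 1) 0)}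
    (hB : IsClosed (B : Set (XC S F E (r + 1) 0)))
    (h : ∀ (u : CForms S F E ⊤ r ⊤) (w : CForms S F E ⊤ (r + 1) ⊤),
      IsWeakD S F E ⊤ u.1 w.1 → smoothXC 0 w ∈ B) {f : XC S F E (r + 1) 0}
    (hf : f ∈ exactXC S F E r) : f ∈ B := by
  obtain ⟨u, hu⟩ := mem_exactXC.1 hf
  have h1 : f ∈ closure (B : Set (XC S F E (r + 1) 0)) := by
    refine Metric.mem_closure_iff.2 fun ε hε => ?_
    obtain ⟨u', w, huw, -, hw⟩ := exists_friedrichs hu (half_pos hε)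
    refine ⟨smoothXC 0 w, h u' w huw, ?_⟩
    rw [dist_eq_norm]
    exact hw.trans_lt (half_lt_self hε)
  rwa [hB.closure_eq] at h1

/-- If `w = d u` with `u` and `w` smooth, then `P w = w - (w - P w)` has the smooth primitive `u - A
(G w)`. The elements of the range of `P` with smooth primitives form a finite-dimensional, hence
closed, subspace `D`, so the property extends to uniform limits of such `w`. -/
lemma proj_mem_BForms (hA : IsSmoothing F F ⊤ α A)
    (h : ∀ f : XC S F E (r + 1) 0, IsWeakD S F E ⊤ f.form 0 →
      IsWeakD S F E ⊤ (A f) (f.form - K f))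
    {P G : XC S F E (r + 1) 0 →L[ℂ] XC S F E (r + 1) 0}
    (hG : ∀ f, (G f).form - K (G f) = f.form - (P f).form)
    (hfd : FiniteDimensional ℂ (LinearMap.range (P : XC S F E (r + 1) 0 →ₗ[ℂ] XC S F E (r + 1) 0)))
    (hP : ∀ f, (P f).form ∈ CForms S F E ⊤ (r + 1) ⊤)
    (hGl : ∀ (l : ℕ) (f : XC S F E (r + 1) 0), f.form ∈ CForms S F E ⊤ (r + 1) l →
      (G f).form ∈ CForms S F E ⊤ (r + 1) l)
    (hc : ∀ f : XC S F E (r + 1) 0, IsWeakD S F E ⊤ f.form 0 → IsWeakD S F E ⊤ (G f).form 0)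
    {f : XC S F E (r + 1) 0} (hf : f ∈ exactXC S F E r) : (P f).form ∈ BForms S F E r ⊤ ⊤ := by
  let D : Submodule ℂ (XC S F E (r + 1) 0) :=
    LinearMap.range (P : XC S F E (r + 1) 0 →ₗ[ℂ] XC S F E (r + 1) 0) ⊓
      (BForms S F E r ⊤ ⊤).comap XC.form
  have hD : FiniteDimensional ℂ D := Submodule.finiteDimensional_of_le inf_le_left
  have hDc : IsClosed (D : Set (XC S F E (r + 1) 0)) := D.closed_of_finiteDimensional
  have hB : IsClosed
      (D.comap (P : XC S F E (r + 1) 0 →ₗ[ℂ] XC S F E (r + 1) 0) : Set (XC S F E (r + 1) 0)) :=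
    hDc.preimage P.continuous
  refine (mem_of_forall_approx hB (fun u w huw => ?_) hf : f ∈ D.comap _).2
  have hw : IsWeakD S F E ⊤ (smoothXC 0 w).form 0 := huw.closed u.2
  have h1 := large_decomp h hG hc hw
  have h2 : IsWeakD S F E ⊤ (smoothXC 0 u).form (smoothXC 0 w).form := huw
  have h3 := XC.isWeakD_sub (u' := hA.toXC (G (smoothXC 0 w))) h2 h1
  refine ⟨⟨_, rfl⟩, hP _, _, ?_, isWeakD_eq h3 rfl (congrArg XC.form (sub_sub_cancel _ _)).symm⟩
  exact sub_mem u.2 (mem_CForms_top fun l => (hA.1 l _ (hGl l _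
    (CForms_mono S F E ⊤ (r + 1) le_top w.2))).1)

/-- Everything is read off from `f = d A G f + P f` for closed `f`. If `f` is exact, then `P f = d
v` with `v` smooth, and `v + A (G f)` is a regular primitive. The exact forms are therefore the
closed forms whose image under `P` has a smooth primitive. Finally, the forms `P f` with `f` closed
represent all cohomology classes. -/
theorem solve_large (hα0 : 0 < α) (hα1 : α ≤ 1) (hK : IsSmoothing F F ⊤ α K)
    (hA : IsSmoothing F F ⊤ α A)
    (h : ∀ f : XC S F E (r + 1) 0, IsWeakD S F E ⊤ f.form 0 →
      IsWeakD S F E ⊤ (A f) (f.form - K f)) :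
    HasRegularPrimitives S F E r α ∧ IsClosed (exactXC S F E r : Set (XC S F E (r + 1) 0)) ∧
      ∃ N : Submodule ℂ (Form S E (n + (r + 1))), FiniteDimensional ℂ N ∧
        N ≤ ZForms S F E (r + 1) ⊤ ∧
        ∀ f ∈ ZForms S F E (r + 1) 0, ∃ g ∈ N, f - g ∈ BForms S F E r 0 0 := by
  obtain ⟨P, G, hG, -, hfd, hP, hGl, hc⟩ := hK.exists_parametrix hα0
  have hc' := hc (large_closed hK hA h)
  have hG' := fun f hf => (hc' f hf).2
  have hPB : ∀ f ∈ exactXC S F E r, (P f).form ∈ BForms S F E r ⊤ ⊤ := fun f hf =>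
    proj_mem_BForms hA h hG hfd hP hGl hG' hf
  have key : ∀ f : XC S F E (r + 1) 0, IsWeakD S F E ⊤ f.form 0 → ∀ v ∈ CForms S F E ⊤ r ⊤,
      IsWeakD S F E ⊤ v (P f).form → IsWeakD S F E ⊤ (v + A (G f)) f.form := by
    intro f hf v hv hvP
    have h1 := XC.isWeakD_add (u := XC.mk v (CForms_mono S F E ⊤ r le_top hv))
      (u' := hA.toXC (G f)) hvP (large_decomp h hG hG' hf)
    exact isWeakD_eq h1 rfl (congrArg XC.form (add_sub_cancel _ _)).symm
  have hex : ∀ f ∈ exactXC S F E r, IsWeakD S F E ⊤ f.form 0 := fun f hf => by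
    obtain ⟨u, hu⟩ := mem_exactXC.1 hf
    exact hu.closed u.form_mem
  refine ⟨fun f hf => ?_, ?_, ?_⟩
  · obtain ⟨-, v, hv, hvP⟩ := hPB f hf
    exact ⟨_, key f (hex f hf) v hv hvP, fun l hl =>
      add_mem (mem_HForms_of_smooth hα0.le hα1 hv) (hA.1 l _ (hGl l f hl))⟩
  · let D : Submodule ℂ (XC S F E (r + 1) 0) :=
      LinearMap.range (P : XC S F E (r + 1) 0 →ₗ[ℂ] XC S F E (r + 1) 0) ⊓
        (BForms S F E r ⊤ ⊤).comap XC.form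
    have hD : FiniteDimensional ℂ D := Submodule.finiteDimensional_of_le inf_le_left
    have hDc : IsClosed (D : Set (XC S F E (r + 1) 0)) := D.closed_of_finiteDimensional
    convert (isClosed_closedXC (S := S) (F := F) (E := E) (s := r + 1)).inter
      (hDc.preimage P.continuous) using 1
    ext f
    refine ⟨fun hf => ⟨mem_closedXC.2 (hex f hf), ⟨f, rfl⟩, hPB f hf⟩, ?_⟩
    rintro ⟨hf, -, -, v, hv, hvP⟩
    refine mem_exactXC.2 ⟨XC.mk v (CForms_mono S F E ⊤ r le_top hv) + hA.toXC (G f), ?_⟩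
    exact key f (mem_closedXC.1 hf) v hv hvP
  · refine ⟨(closedXC S F E (r + 1)).map
      (XC.form ∘ₗ (P : XC S F E (r + 1) 0 →ₗ[ℂ] XC S F E (r + 1) 0)), ?_, ?_, fun f hf => ?_⟩
    · have h1 : FiniteDimensional ℂ ((LinearMap.range
        (P : XC S F E (r + 1) 0 →ₗ[ℂ] XC S F E (r + 1) 0)).map XC.form) := inferInstance
      refine Submodule.finiteDimensional_of_le (S₂ := (LinearMap.range
        (P : XC S F E (r + 1) 0 →ₗ[ℂ] XC S F E (r + 1) 0)).map XC.form) ?_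
      rintro _ ⟨f, -, rfl⟩
      exact ⟨P f, ⟨f, rfl⟩, rfl⟩
    · rintro _ ⟨f, hf, rfl⟩
      exact ⟨hP f, (hc' f (mem_closedXC.1 hf)).1⟩
    · obtain ⟨f', hf'⟩ : ∃ f' : XC S F E (r + 1) 0, f'.form = f := ⟨XC.mk f hf.1, rfl⟩
      have hf0 : IsWeakD S F E ⊤ f'.form 0 := hf' ▸ hf.2
      refine ⟨(P f').form, ⟨f', mem_closedXC.2 hf0, rfl⟩, ?_⟩
      rw [← hf']
      exact ⟨XC.form_mem (f' - P f'), _, (hA.1 0 _ (XC.form_mem _)).1, large_decomp h hG hG' hf0⟩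

end Large

end Solve

end
end CRForms

namespace CRForms
noncomputable section

/-! ### From order zero to every order of differentiability. -/

section Conclusion

variable {n m : ℕ} {X : Type*} [TopologicalSpace X] [ChartedSpace (Cn n) X]
  [IsManifold 𝓘(ℂ, Cn n) ω X]
  {M : Type*} [TopologicalSpace M] [ChartedSpace (Rm m) M] [IsManifold (𝓡 m) ∞ M]
  {S : GenericCR n m X M}
  {F : Type*} [NormedAddCommGroup F] [NormedSpace ℂ F]
  {E : X → Type*} [∀ x, AddCommGroup (E x)] [∀ x, Module ℂ (E x)]
  [TopologicalSpace (Bundle.TotalSpace F E)] [∀ x, TopologicalSpace (E x)]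
  [FiberBundle F E] [VectorBundle ℂ F E] [ContMDiffVectorBundle ω F E 𝓘(ℂ, Cn n)]
  [FiniteDimensional ℂ F] [CompactSpace M] [T2Space M]
  {r s : ℕ} {l : ℕ∞} {α : ℝ}

lemma tendstoUniformlyOn_coeff (f : CForms S F E ⊤ s l) {x : M} (v : Fin (n + s) → Rm m)
    {K : Set (Rm m)} (hK : IsCompact K) (hKd : K ⊆ dom S F E x ⊤) :
    TendstoUniformlyOn (fun (g : CForms S F E ⊤ s l) y => iteratedFDeriv ℝ 0 (coeff S F E x v g.1) y)
      (fun y => iteratedFDeriv ℝ 0 (coeff S F E x v f.1) y)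
      (@nhds _ (topCForms S F E s l) f) K := by
  have h : Filter.Tendsto (fun g : CForms S F E ⊤ s l =>
      UniformOnFun.ofFun {K : Set (Rm m) | IsCompact K ∧ K ⊆ dom S F E x ⊤}
        fun y => iteratedFDeriv ℝ 0 (coeff S F E x v g.1) y) (@nhds _ (topCForms S F E s l) f)
      (𝓝 (UniformOnFun.ofFun {K : Set (Rm m) | IsCompact K ∧ K ⊆ dom S F E x ⊤}
        fun y => iteratedFDeriv ℝ 0 (coeff S F E x v f.1) y)) := by
    rw [@nhds_induced _ _ (topC S F E (n + s) l)]
    simp only [nhds_iInf, Filter.comap_iInf]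
    refine Filter.tendsto_iInf' x (Filter.tendsto_iInf' v (Filter.tendsto_iInf' 0
      (Filter.tendsto_iInf' (by simp) ?_)))
    rw [nhds_induced, Filter.comap_comap]
    exact Filter.tendsto_comap
  exact UniformOnFun.tendsto_iff_tendstoUniformlyOn.1 h K ⟨hK, hKd⟩

lemma continuous_topCForms_XC :
    Continuous[topCForms S F E s l, inferInstance] fun f : CForms S F E ⊤ s l =>
      XC.mk (l := 0) f.1 (CForms_mono S F E ⊤ s zero_le f.2) := by
  let _ := topCForms S F E s l
  refine continuous_iff_continuousAt.2 fun f => Metric.tendsto_nhds.2 fun ε hε => ?_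
  have h : ∀ᶠ g in 𝓝 f, ∀ x : centers S F E, ∀ I : Fin (n + s) → Fin m, ∀ y ∈ cball S F E x.1,
      dist (iteratedFDeriv ℝ 0 (coeff S F E x.1 (basisVec I) f.1) y)
        (iteratedFDeriv ℝ 0 (coeff S F E x.1 (basisVec I) g.1) y) < ε / 2 :=
    Filter.eventually_all.2 fun x => Filter.eventually_all.2 fun I =>
      Metric.tendstoUniformlyOn_iff.1 (tendstoUniformlyOn_coeff f (basisVec I)
        (isCompact_cball S F E x.1) (cball_subset_dom S F E x.1)) _ (half_pos hε)
  filter_upwards [h] with g hg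
  rw [dist_comm, dist_eq_norm]
  refine (XC.norm_le_zero (half_pos hε).le fun x hx I y hy => ?_).trans_lt (half_lt_self hε)
  have h1 := (hg ⟨x, hx⟩ I y hy).le
  rw [iteratedFDeriv_zero_eq_comp, iteratedFDeriv_zero_eq_comp, Function.comp_apply,
    Function.comp_apply, LinearIsometryEquiv.dist_map, dist_eq_norm] at h1
  rw [map_sub, sub_eq_add_neg, coeff_add, ← neg_one_smul ℂ, coeff_smul]
  simp only [neg_one_smul, ← sub_eq_add_neg]
  exact h1

lemma HasRegularPrimitives.mem_BHForms (h : HasRegularPrimitives S F E r α)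
    {f : Form S E (n + (r + 1))} (hf : f ∈ CForms S F E ⊤ (r + 1) l)
    (hf0 : f ∈ BForms S F E r 0 0) : f ∈ BHForms S F E r l α := by
  obtain ⟨w, hw, hl⟩ := h (XC.mk f hf0.1) hf0
  exact ⟨hf, w, mem_HForms_of_forall_nat fun i hi => hl i (CForms_mono S F E ⊤ (r + 1) hi hf), hw⟩

lemma BHForms_le_BForms : BHForms S F E r l α ≤ BForms S F E r l l :=
  fun _ ⟨hf, u, hu, h⟩ => ⟨hf, u, hu.1, h⟩

lemma BForms_mono_left {j j' l : ℕ∞} (h : j' ≤ j) : BForms S F E r j l ≤ BForms S F E r j' l :=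
  fun _ ⟨hf, u, hu, hd⟩ => ⟨hf, u, CForms_mono S F E ⊤ r h hu, hd⟩

lemma BForms_mono_right {j l l' : ℕ∞} (h : l' ≤ l) : BForms S F E r j l ≤ BForms S F E r j l' :=
  fun _ ⟨hf, u, hu, hd⟩ => ⟨CForms_mono S F E ⊤ (r + 1) h hf, u, hu, hd⟩

lemma BForms_le_ZForms {j : ℕ∞} : BForms S F E r j l ≤ ZForms S F E (r + 1) l :=
  fun _ ⟨hf, _, hu, hd⟩ => ⟨hf, hd.closed hu⟩

lemma HasRegularPrimitives.BHForms_eq (h : HasRegularPrimitives S F E r α) :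
    BHForms S F E r l α = BForms S F E r 0 l :=
  le_antisymm (BHForms_le_BForms.trans (BForms_mono_left zero_le))
    fun _ hf => h.mem_BHForms hf.1 (BForms_mono_right zero_le hf)

/-- A C^l form lies in this space as soon as it has a continuous primitive. The set is thus the
preimage of the closed set of exact continuous forms under the inclusion of C^l into C^0. -/
lemma HasRegularPrimitives.isClosed_BHForms (h : HasRegularPrimitives S F E r α)
    (hc : IsClosed (exactXC S F E r : Set (XC S F E (r + 1) 0))) :
    IsClosed[topCForms S F E (r + 1) l]
      {f : CForms S F E ⊤ (r + 1) l | f.1 ∈ BHForms S F E r l α} := by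
  let _ := topCForms S F E (r + 1) l
  convert hc.preimage (continuous_topCForms_XC (S := S) (F := F) (E := E) (s := r + 1) (l := l))
    using 1
  ext f
  refine ⟨fun hf => ?_, fun hf => h.mem_BHForms f.2 hf⟩
  exact BForms_mono_right zero_le (BForms_mono_left zero_le (BHForms_le_BForms hf))

/-- A smooth form with a continuous primitive has a smooth one, by regular primitives at `l = ∞`. -/
lemma HasRegularPrimitives.injective_natMap (h : HasRegularPrimitives S F E r α) :
    Function.Injective (natMap S F E r l) := by
  refine (injective_iff_map_eq_zero _).2 fun a => ?_
  induction a using Submodule.Quotient.induction_on with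
  | H f =>
    intro hf
    have h0 : (Submodule.Quotient.mk (Submodule.inclusion (ZForms_le S F E (r + 1) l) f) :
      Cohomology S F E r 0 l) = 0 := hf
    have h1 := (Submodule.Quotient.mk_eq_zero _).1 h0
    exact (Submodule.Quotient.mk_eq_zero _).2
      (BHForms_le_BForms (h.mem_BHForms (l := ⊤) f.2.1
        (BForms_mono_right zero_le (show f.1 ∈ BForms S F E r 0 l from h1))))

lemma exists_add_of_mem_ZForms {N : Submodule ℂ (Form S E (n + (r + 1)))}
    (hN : N ≤ ZForms S F E (r + 1) ⊤)
    (h : ∀ f ∈ ZForms S F E (r + 1) 0, ∃ g ∈ N, f - g ∈ BForms S F E r 0 0)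
    {f : Form S E (n + (r + 1))} (hf : f ∈ ZForms S F E (r + 1) l) :
    ∃ g ∈ N, f - g ∈ BForms S F E r 0 l := by
  obtain ⟨g, hg, hb⟩ := h f ⟨CForms_mono S F E ⊤ (r + 1) zero_le hf.1, hf.2⟩
  exact ⟨g, hg, sub_mem hf.1 (CForms_mono S F E ⊤ (r + 1) le_top (hN hg).1), hb.2⟩

/-- `N` represents every class but may itself contain exact forms; an algebraic complement in `N` of
its exact elements is the required summand. -/
lemma exists_isCompl_ZForms (hB : HasRegularPrimitives S F E r α)
    {N : Submodule ℂ (Form S E (n + (r + 1)))} [FiniteDimensional ℂ N]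
    (hN : N ≤ ZForms S F E (r + 1) ⊤)
    (h : ∀ f ∈ ZForms S F E (r + 1) 0, ∃ g ∈ N, f - g ∈ BForms S F E r 0 0) :
    ∃ H : Submodule ℂ (Form S E (n + (r + 1))), FiniteDimensional ℂ H ∧
      H ≤ ZForms S F E (r + 1) ⊤ ∧ ZForms S F E (r + 1) l = BHForms S F E r l α ⊔ H ∧
      Disjoint (BHForms S F E r l α) H := by
  rw [hB.BHForms_eq]
  obtain ⟨C, hC⟩ := ((BForms S F E r 0 l).submoduleOf N).exists_isCompl
  have hCN : C.map N.subtype ≤ N := Submodule.map_subtype_le N C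
  refine ⟨C.map N.subtype, inferInstance, hCN.trans hN, le_antisymm (fun f hf => ?_) ?_, ?_⟩
  · obtain ⟨g, hg, hb⟩ := exists_add_of_mem_ZForms hN h hf
    have h1 : (⟨g, hg⟩ : N) ∈ (BForms S F E r 0 l).submoduleOf N ⊔ C :=
      hC.sup_eq_top ▸ Submodule.mem_top
    obtain ⟨a, ha, c, hc, hac⟩ := Submodule.mem_sup.1 h1
    have h2 : g = a.1 + c.1 := congrArg Subtype.val hac.symm
    refine Submodule.mem_sup.2 ⟨f - g + a.1, add_mem hb ha, c.1, ⟨c, hc, rfl⟩, ?_⟩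
    rw [add_assoc, ← h2, sub_add_cancel]
  · exact sup_le BForms_le_ZForms ((hCN.trans hN).trans (ZForms_le S F E (r + 1) l))
  · refine Submodule.disjoint_def.2 ?_
    rintro _ hb ⟨c, hc, rfl⟩
    exact congrArg Subtype.val (Submodule.disjoint_def.1 hC.disjoint c hb hc)

lemma finiteDimensional_cohomology {N : Submodule ℂ (Form S E (n + (r + 1)))}
    [FiniteDimensional ℂ N] (hN : N ≤ ZForms S F E (r + 1) ⊤)
    (h : ∀ f ∈ ZForms S F E (r + 1) 0, ∃ g ∈ N, f - g ∈ BForms S F E r 0 0) :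
    FiniteDimensional ℂ (Cohomology S F E r 0 l) := by
  refine Module.Finite.of_surjective (((BForms S F E r 0 l).submoduleOf
    (ZForms S F E (r + 1) l)).mkQ ∘ₗ
      Submodule.inclusion (hN.trans (ZForms_le S F E (r + 1) l))) fun a => ?_
  induction a using Submodule.Quotient.induction_on with
  | H f =>
    obtain ⟨g, hg, hb⟩ := exists_add_of_mem_ZForms hN h f.2
    refine ⟨⟨g, hg⟩, ((Submodule.Quotient.eq _).2 ?_).symm⟩
    exact hb

/-- Every class of order `l` has a representative in `N`, and `N` consists of smooth closed forms.
-/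
lemma surjective_natMap {N : Submodule ℂ (Form S E (n + (r + 1)))}
    (hN : N ≤ ZForms S F E (r + 1) ⊤)
    (h : ∀ f ∈ ZForms S F E (r + 1) 0, ∃ g ∈ N, f - g ∈ BForms S F E r 0 0) :
    Function.Surjective (natMap S F E r l) := by
  intro a
  induction a using Submodule.Quotient.induction_on with
  | H f =>
    obtain ⟨g, hg, hb⟩ := exists_add_of_mem_ZForms hN h f.2
    refine ⟨Submodule.Quotient.mk ⟨g, hN hg⟩, ((Submodule.Quotient.eq _).2 ?_).symm⟩
    exact hb

variable (F E) in
-- Wherever the homotopy formula holds, `solve_large` applies. The only degree left is `r + 1 = q`,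
-- where the formula in degree `q - 1` is used instead.
theorem ConditionH.solve {k q : ℕ} (hα0 : 0 < α) (hα1 : α ≤ 1) (hm : m + k = 2 * n)
    (hq : 1 ≤ q) (hH : ConditionH S k α q) :
    (∀ r, (r + 1 ≤ q ∨ IsLargeDegree n k q (r + 1)) → HasRegularPrimitives S F E r α ∧
      IsClosed (exactXC S F E r : Set (XC S F E (r + 1) 0))) ∧
    ∀ r, (r + 1 ≤ q - 1 ∨ IsLargeDegree n k q (r + 1)) →
      ∃ N : Submodule ℂ (Form S E (n + (r + 1))), FiniteDimensional ℂ N ∧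
        N ≤ ZForms S F E (r + 1) ⊤ ∧
        ∀ f ∈ ZForms S F E (r + 1) 0, ∃ g ∈ N, f - g ∈ BForms S F E r 0 0 := by
  obtain ⟨A, K, hA, hK0, hK, h0, h1⟩ := hH.exists_homotopy F E hα0.le hα1 hm
  have hl : ∀ r, (r + 1 ≤ q - 1 ∨ IsLargeDegree n k q (r + 1)) → _ := fun r hr =>
    solve_large (r := r) hα0 hα1 (hK r hr)
      (hA r (hr.imp (fun h => h.trans (Nat.sub_le q 1)) Or.inl)) fun f hf => by
        have h2 := h1 r hr f 0 hf
        rwa [map_zero, sub_zero] at h2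
  refine ⟨fun r hr => ?_, fun r hr => (hl r hr).2.2⟩
  by_cases hr' : r + 1 ≤ q - 1 ∨ IsLargeDegree n k q (r + 1)
  · exact ⟨(hl r hr').1, (hl r hr').2.1⟩
  have hrq : r + 1 ≤ q := hr.resolve_right fun h => hr' (Or.inr h)
  have hA' := hA r (Or.inl hrq)
  -- Here `r + 1 = q`. For `q = 1` the formula in degree 0 reads `u = K u + A d u`, so `u - K u - A
  -- f` even vanishes. For larger `q` this difference is `d A u`, hence closed.
  cases r with
  | zero =>
    have key : ∀ (u : XC S F E 0 0) (f : XC S F E 1 0), IsWeakD S F E ⊤ u.form f.form →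
        IsWeakD S F E ⊤ (u.form - K 0 u - A 0 f) 0 := fun u f hu => by
      have h2 : u.form - K 0 u - A 0 f = 0 := by
        rw [sub_sub, ← h0 u f hu, sub_self]
      rw [h2]
      exact IsWeakD.zero S F E
    exact ⟨hasRegularPrimitives_small hα0 (hK0 hq) hA' key,
      isClosed_exactXC_small hα0 (hK0 hq) hA' key⟩
  | succ r =>
    have hr2 : r + 1 ≤ q - 1 ∨ IsLargeDegree n k q (r + 1) := Or.inl (by omega)
    have hA2 := hA r (Or.inl (by omega))
    have key : ∀ (u : XC S F E (r + 1) 0) (f : XC S F E (r + 1 + 1) 0),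
        IsWeakD S F E ⊤ u.form f.form →
        IsWeakD S F E ⊤ (u.form - K (r + 1) u - A (r + 1) f) 0 := fun u f hu =>
      (h1 r hr2 u f hu).closed (hA2.1 0 u u.form_mem).1
    exact ⟨hasRegularPrimitives_small hα0 (hK r hr2) hA' key,
      isClosed_exactXC_small hα0 (hK r hr2) hA' key⟩

end Conclusion

end
end CRForms

theorem mainTheorem2 {n m k : ℕ} (hm : m + k = 2 * n)
    {X : Type*} [TopologicalSpace X] [T2Space X] [ChartedSpace (Cn n) X]
    [IsManifold 𝓘(ℂ, Cn n) ω X]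
    {M : Type*} [TopologicalSpace M] [CompactSpace M] [ChartedSpace (Rm m) M]
    [IsManifold (𝓡 m) ∞ M]
    (S : GenericCR n m X M)
    (F : Type*) [NormedAddCommGroup F] [NormedSpace ℂ F] [FiniteDimensional ℂ F]
    (E : X → Type*) [∀ x, AddCommGroup (E x)] [∀ x, Module ℂ (E x)]
    [TopologicalSpace (Bundle.TotalSpace F E)] [∀ x, TopologicalSpace (E x)]
    [FiberBundle F E] [VectorBundle ℂ F E] [ContMDiffVectorBundle ω F E 𝓘(ℂ, Cn n)]
    (α : ℝ) (hα0 : 0 < α) (hα1 : α < 1) (q : ℕ) (hq1 : 1 ≤ q) (hq : q + k ≤ n)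
    (hH : ConditionH S k α q) :
    (∀ r : ℕ, (r + 1 ≤ q ∨ IsLargeDegree n k q (r + 1)) → ∀ l : ℕ∞,
      IsClosed[topCForms S F E (r + 1) l]
        {f : CForms S F E ⊤ (r + 1) l | f.1 ∈ BHForms S F E r l α} ∧
      BHForms S F E r l α = BForms S F E r 0 l ∧
      Function.Injective (natMap S F E r l)) ∧
    (∀ r : ℕ, (r + 1 ≤ q - 1 ∨ IsLargeDegree n k q (r + 1)) → ∀ l : ℕ∞,
      (∃ H : Submodule ℂ (Form S E (n + (r + 1))),
        FiniteDimensional ℂ H ∧ H ≤ ZForms S F E (r + 1) ⊤ ∧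
        ZForms S F E (r + 1) l = BHForms S F E r l α ⊔ H ∧
        Disjoint (BHForms S F E r l α) H) ∧
      Function.Bijective (natMap S F E r l) ∧
      FiniteDimensional ℂ (Cohomology S F E r ⊤ ⊤) ∧
      FiniteDimensional ℂ (Cohomology S F E r 0 l)) := by
  have : T2Space M := t2Space_of_genericCR S
  obtain ⟨h1, h2⟩ := hH.solve F E hα0 hα1.le hm hq1
  refine ⟨fun r hr l => ⟨(h1 r hr).1.isClosed_BHForms (h1 r hr).2, (h1 r hr).1.BHForms_eq,
    (h1 r hr).1.injective_natMap⟩, fun r hr l => ?_⟩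
  have hB := (h1 r (hr.imp (fun h => h.trans (Nat.sub_le q 1)) id)).1
  obtain ⟨N, hfd, hN, h⟩ := h2 r hr
  have hfin := finiteDimensional_cohomology (l := l) hN h
  exact ⟨exists_isCompl_ZForms hB hN h, ⟨hB.injective_natMap, surjective_natMap hN h⟩,
    Module.Finite.of_injective (natMap S F E r l) hB.injective_natMap, hfin⟩
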